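/- **Definitions.** Let $G=(V,E)$ be a simple undirected graph with $n\ge 1$ vertices, $m$ edges and integer edge weights $c_e\in\{1,\dots,C\}$. For $U\subseteq V$, a multiway cut of the induced subgraph $G[U]$ is a partition $\mathcal P$ of $U$ into $|\mathcal P|\ge 2$ nonempty sides. Let $\partial\mathcal P$ be the set of edges of $G[U]$ with endpoints in different sides, and let $d(\mathcal P)=\sum_{e\in\partial\mathcal P}c_e$. The cut ratio of $\mathcal P$ is $d(\mathcal P)/(|\mathcal P|-1)$. The maximal min-ratio cut of $G[U]$ is the multiway cut with the most sides among those of minimum cut ratio. The canonical cut hierarchy of $G$ is the smallest family of vertex sets that contains $V$ and, with every member $U$ having $|U|\ge2$, contains all sides of the maximal min-ratio cut of $G[U]$. It is laminar and is represented by a rooted tree with leaves $\{v\}$, $v\in V$. The ideal load of an edge $e$ is $x_e=(|\mathcal P|-1)/d(\mathcal P)$, where $\mathcal P$ is the multiway cut of the hierarchy with $e\in\partial\mathcal P$; in the weighted normalization it is $\ell(e)=c_e\,x_e$. **Theorem.** For every constant $c$ there is a randomized algorithm (a program for a word RAM with $\Theta(\log(n+C))$-bit words that can draw random words and can call a subroutine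 returning an integral maximum flow of a directed graph with integer capacities) with the following properties on every such $G$ and with every correct maximum flow subroutine. With probability at least $1-n^{-c}$ it outputs the tree of the canonical cut hierarchy of $G$ together with the ideal loads $x_e$ and $\ell(e)$ of all edges (as fractions of integers). It always halts, in time $\widetilde O\big(n(m+1)(1+\log C)\big)$ plus $\widetilde O\big(n(1+\log C)\big)$ calls to the maximum flow subroutine, each on a directed graph with $O(m+1)$ vertices, $O(m+1)$ edges and integer capacities at most $\operatorname{poly}(n,C)$. Here $\widetilde O(\cdot)$ hides factors polylogarithmic in $n$ (bounded below by a positive constant), and all constants and exponents depend only on $c$. For a graph with at least one edge and $C\ge 2$ the bounds are $\widetilde O(nm\log C)$ time and $\widetilde O(n\log C)$ calls on directed graphs with $O(m)$ vertices and edges. -/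

import Mathlib

/-! # Weighted graphs, minimum ratio multiway cuts and the canonical cut hierarchy -/

/-- A simple undirected graph with vertex set `Fin n` and `m` edges with natural weights, presented
by its list of edges. -/
structure WGraph (n m : ℕ) where
  src : Fin m → Fin n
  dst : Fin m → Fin n
  weight : Fin m → ℕ
  loopless : ∀ e, src e ≠ dst e
  simple : Function.Injective fun e => s(src e, dst e)

namespace WGraph

variable {n m : ℕ}

/-- The edges of the induced subgraph `G[U]` with endpoints in different sides of the partition
`P` of `U`. -/
def cutEdges (G : WGraph n m) {U : Finset (Fin n)} (P : Finpartition U) : Finset (Fin m) :=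
  Finset.univ.filter fun e =>
    G.src e ∈ U ∧ G.dst e ∈ U ∧ P.part (G.src e) ≠ P.part (G.dst e)

/-- `d(P)`, the total weight of the edges cut by `P`. -/
def cutValue (G : WGraph n m) {U : Finset (Fin n)} (P : Finpartition U) : ℕ :=
  ∑ e ∈ G.cutEdges P, G.weight e

/-- The cut ratio `d(P) / (|P| - 1)`; it is only used for partitions with at least two sides. -/
def cutRatio (G : WGraph n m) {U : Finset (Fin n)} (P : Finpartition U) : ℚ :=
  (G.cutValue P : ℚ) / ((P.parts.card : ℚ) - 1)

/-- `P` is a minimum ratio (multiway) cut of `G[U]`. -/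
def IsMinRatioCut (G : WGraph n m) {U : Finset (Fin n)} (P : Finpartition U) : Prop :=
  2 ≤ P.parts.card ∧
    ∀ Q : Finpartition U, 2 ≤ Q.parts.card → G.cutRatio P ≤ G.cutRatio Q

/-- `P` is the maximal minimum ratio cut of `G[U]`: the one with the most sides. -/
def IsMaximalMinRatioCut (G : WGraph n m) {U : Finset (Fin n)} (P : Finpartition U) : Prop :=
  G.IsMinRatioCut P ∧
    ∀ Q : Finpartition U, G.IsMinRatioCut Q → Q.parts.card ≤ P.parts.card

/-- The canonical cut hierarchy of `G`, as a family of vertex sets: it contains the whole vertex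
set, and with every set `U` of at least two vertices all sides of the maximal minimum ratio cut of
`G[U]`. (A singleton has no multiway cut, so there the recursion ends.) -/
inductive InHierarchy (G : WGraph n m) : Finset (Fin n) → Prop
  | root : InHierarchy G Finset.univ
  | side {U : Finset (Fin n)} (P : Finpartition U) (S : Finset (Fin n)) :
      InHierarchy G U → G.IsMaximalMinRatioCut P → S ∈ P.parts → InHierarchy G S

/-- `x` is the ideal load `(|P| - 1) / d(P)` of the edge `e`, where `P` is the multiway cut of the
hierarchy that cuts `e`. -/
def IsIdealLoad (G : WGraph n m) (e : Fin m) (x : ℚ) : Prop :=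
  ∃ (U : Finset (Fin n)) (P : Finpartition U),
    G.InHierarchy U ∧ G.IsMaximalMinRatioCut P ∧ e ∈ G.cutEdges P ∧
      x = ((P.parts.card : ℚ) - 1) / (G.cutValue P : ℚ)

end WGraph

/-! # Maximum flow -/

/-- A directed graph with integer capacities (given by its list of arcs), a source and a sink. -/
structure FlowInstance where
  nodes : ℕ
  arcs : ℕ
  source : Fin nodes
  sink : Fin nodes
  source_ne_sink : source ≠ sink
  tail : Fin arcs → Fin nodes
  head : Fin arcs → Fin nodes
  cap : Fin arcs → ℕ

namespace FlowInstance

def outFlow (I : FlowInstance) (f : Fin I.arcs → ℕ) (v : Fin I.nodes) : ℕ :=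
  ∑ a ∈ Finset.univ.filter (fun a => I.tail a = v), f a

def inFlow (I : FlowInstance) (f : Fin I.arcs → ℕ) (v : Fin I.nodes) : ℕ :=
  ∑ a ∈ Finset.univ.filter (fun a => I.head a = v), f a

/-- Integral source-sink flows. -/
def IsFlow (I : FlowInstance) (f : Fin I.arcs → ℕ) : Prop :=
  (∀ a, f a ≤ I.cap a) ∧ ∀ v, v ≠ I.source → v ≠ I.sink → I.inFlow f v = I.outFlow f v

def value (I : FlowInstance) (f : Fin I.arcs → ℕ) : ℤ :=
  (I.outFlow f I.source : ℤ) - (I.inFlow f I.source : ℤ)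

/-- Integral maximum flows (capacities are integral, so they are also maximum among real flows). -/
def IsMaxFlow (I : FlowInstance) (f : Fin I.arcs → ℕ) : Prop :=
  I.IsFlow f ∧ ∀ g, I.IsFlow g → I.value g ≤ I.value f

/-- The instance is stored in the memory `mem` (of `2 ^ w` cells) from address `p` on: number of
nodes, number of arcs, source, sink, and then tail, head and capacity of every arc. -/
def StoredAt (I : FlowInstance) (w : ℕ) (mem : ℕ → ℕ) (p : ℕ) : Prop :=
  p + 4 + 3 * I.arcs ≤ 2 ^ w ∧
    mem p = I.nodes ∧ mem (p + 1) = I.arcs ∧ mem (p + 2) = I.source ∧ mem (p + 3) = I.sink ∧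
      ∀ a : Fin I.arcs, mem (p + 4 + 3 * a) = I.tail a ∧ mem (p + 5 + 3 * a) = I.head a ∧
        mem (p + 6 + 3 * a) = I.cap a

end FlowInstance

/-- A candidate maximum flow subroutine: it returns a value on every arc of every instance. -/
def FlowSubroutine : Type := (I : FlowInstance) → Fin I.arcs → ℕ

/-- The subroutine returns a maximum flow of every instance. -/
def FlowSubroutine.Correct (O : FlowSubroutine) : Prop :=
  ∀ I : FlowInstance, I.IsMaxFlow (O I)

/-! # A randomized word RAM with a maximum flow subroutine -/

namespace WordRAM

inductive Op
  | add | sub | mul | div | mod | lt | eq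

/-- Arithmetic on `w`-bit words, modulo `2 ^ w`; comparisons return `1` or `0`. -/
def Op.eval (w : ℕ) : Op → ℕ → ℕ → ℕ
  | add, a, b => (a + b) % 2 ^ w
  | sub, a, b => (a + (2 ^ w - b)) % 2 ^ w
  | mul, a, b => (a * b) % 2 ^ w
  | div, a, b => (a / b) % 2 ^ w
  | mod, a, b => (a % b) % 2 ^ w
  | lt, a, b => (if a < b then 1 else 0) % 2 ^ w
  | eq, a, b => (if a = b then 1 else 0) % 2 ^ w

/-- Programs; registers are numbered by `ℕ`, and a program mentions finitely many of them. -/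
inductive Cmd
  /-- do nothing -/
  | skip
  /-- `x := k` -/
  | const (x k : ℕ)
  /-- `x := y ∘ z` -/
  | op (o : Op) (x y z : ℕ)
  /-- `x := memory[y]` -/
  | load (x y : ℕ)
  /-- `memory[x] := y` -/
  | store (x y : ℕ)
  /-- `x :=` a uniformly random word -/
  | rand (x : ℕ)
  /-- call the maximum flow subroutine on the instance stored at address `x`; the flow values are
  written to the memory from address `y` on -/
  | maxFlow (x y : ℕ)
  | seq (c d : Cmd)
  /-- if `x ≠ 0` then `c` else `d` -/
  | ite (x : ℕ) (c d : Cmd)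
  /-- while `x ≠ 0` do `c` -/
  | while (x : ℕ) (c : Cmd)

/-- Registers and memory, with the elapsed time, the number of random words drawn, and the list of
instances passed to the maximum flow subroutine so far. -/
structure Config where
  reg : ℕ → ℕ
  mem : ℕ → ℕ
  time : ℕ
  drawn : ℕ
  calls : List FlowInstance

/-- One time unit elapses. -/
def Config.tick (s : Config) : Config := { s with time := s.time + 1 }

def Config.setReg (s : Config) (x v : ℕ) : Config :=
  { s with reg := Function.update s.reg x v }

def Config.setMem (s : Config) (p v : ℕ) : Config :=
  { s with mem := Function.update s.mem p v }

/-- Writing the list `v` of `k` words to the memory from address `p` on. -/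
def Config.setBlock (s : Config) (p k : ℕ) (v : Fin k → ℕ) : Config :=
  { s with mem := fun q => if h : p ≤ q ∧ q - p < k then v ⟨q - p, h.2⟩ else s.mem q }

/-- `Exec w O ρ c s t`: on words of `w` bits, with the maximum flow subroutine `O` and with `ρ` as
the sequence of random words, program `c` started in `s` halts in `t`. Every instruction and every
test takes one time unit; calls of the subroutine are moreover recorded. A call with a malformed
instance has no outcome. -/
inductive Exec (w : ℕ) (O : FlowSubroutine) (ρ : ℕ → ℕ) : Cmd → Config → Config → Prop
  | skip (s : Config) : Exec w O ρ .skip s s.tick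
  | const (s : Config) (x k : ℕ) :
      Exec w O ρ (.const x k) s (s.setReg x (k % 2 ^ w)).tick
  | op (s : Config) (o : Op) (x y z : ℕ) :
      Exec w O ρ (.op o x y z) s (s.setReg x (o.eval w (s.reg y) (s.reg z))).tick
  | load (s : Config) (x y : ℕ) :
      Exec w O ρ (.load x y) s (s.setReg x (s.mem (s.reg y))).tick
  | store (s : Config) (x y : ℕ) :
      Exec w O ρ (.store x y) s (s.setMem (s.reg x) (s.reg y)).tick
  | rand (s : Config) (x : ℕ) :
      Exec w O ρ (.rand x) s { (s.setReg x (ρ s.drawn)).tick with drawn := s.drawn + 1 }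
  | maxFlow (s : Config) (x y : ℕ) (I : FlowInstance) :
      I.StoredAt w s.mem (s.reg x) → s.reg y + I.arcs ≤ 2 ^ w →
      Exec w O ρ (.maxFlow x y) s
        { (s.setBlock (s.reg y) I.arcs (O I)).tick with calls := I :: s.calls }
  | seq {c d : Cmd} {s t u : Config} :
      Exec w O ρ c s t → Exec w O ρ d t u → Exec w O ρ (.seq c d) s u
  | ite_true {x : ℕ} {c d : Cmd} {s t : Config} :
      s.reg x ≠ 0 → Exec w O ρ c s.tick t → Exec w O ρ (.ite x c d) s t
  | ite_false {x : ℕ} {c d : Cmd} {s t : Config} :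
      s.reg x = 0 → Exec w O ρ d s.tick t → Exec w O ρ (.ite x c d) s t
  | while_true {x : ℕ} {c : Cmd} {s t u : Config} :
      s.reg x ≠ 0 → Exec w O ρ c s.tick t → Exec w O ρ (.while x c) t u →
      Exec w O ρ (.while x c) s u
  | while_false {x : ℕ} {c : Cmd} {s : Config} :
      s.reg x = 0 → Exec w O ρ (.while x c) s s.tick

/-- The sequence of random words that starts with `ρ` (the words after it do not matter for a
computation of at most `T` steps). -/
def tape {T w : ℕ} (ρ : Fin T → Fin (2 ^ w)) (i : ℕ) : ℕ :=
  if h : i < T then (ρ ⟨i, h⟩ : ℕ) else 0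

/-- Initial configuration on input `G`: the memory holds `n`, `m`, and then the two endpoints and
the weight of every edge; everything else is `0`. -/
def initial {n m : ℕ} (G : WGraph n m) : Config where
  reg := fun _ => 0
  mem := fun p =>
    if p = 0 then n
    else if p = 1 then m
    else if h : (p - 2) / 3 < m then
      if (p - 2) % 3 = 0 then (G.src ⟨(p - 2) / 3, h⟩ : ℕ)
      else if (p - 2) % 3 = 1 then (G.dst ⟨(p - 2) / 3, h⟩ : ℕ)
      else G.weight ⟨(p - 2) / 3, h⟩
    else 0
  time := 0
  drawn := 0
  calls := []

end WordRAM

/-! # The output -/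

/-- The set of vertices `v` (leaves of a forest given by parent pointers) that have the node `i`
as an ancestor, a node being an ancestor of itself. -/
noncomputable def leavesBelow (n : ℕ) (parent : ℕ → ℕ) (i : ℕ) : Finset (Fin n) :=
  open Classical in Finset.univ.filter fun v => ∃ k : ℕ, parent^[k] (v : ℕ) = i

/-- The tree with nodes `0, …, N - 1` given by parent pointers (the root points to itself) is the
tree of the canonical cut hierarchy: node `v < n` stands for the leaf `{v}`, and the sets of
leaves below the nodes are the members of the hierarchy, each occurring exactly once. -/
def RepresentsHierarchy {n m : ℕ} (G : WGraph n m) (N : ℕ) (parent : ℕ → ℕ) : Prop :=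
  n ≤ N ∧ (∀ i < N, parent i < N) ∧
    (∀ v : Fin n, leavesBelow n parent v = {v}) ∧
    Set.BijOn (leavesBelow n parent) (Set.Iio N) {S | G.InHierarchy S}

/-- The output of a halted computation is correct. It is stored at the address `p` held by
register `0`: first the number `N` of nodes of the hierarchy and the `N` parent pointers, then for
every edge `e` three words `a`, `b`, `d` such that `a / d` is the ideal load of `e` (per unit of
weight) and `b / d` is the ideal load multiplied by the weight of `e`. -/
def CorrectOutput {n m : ℕ} (G : WGraph n m) (w : ℕ) (t : WordRAM.Config) : Prop :=
  ∃ p N : ℕ, t.reg 0 = p ∧ t.mem p = N ∧ p + 1 + N + 3 * m ≤ 2 ^ w ∧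
    RepresentsHierarchy G N (fun i => t.mem (p + 1 + i)) ∧
    ∀ e : Fin m, ∃ x : ℚ, G.IsIdealLoad e x ∧
      t.mem (p + 1 + N + 3 * e + 2) ≠ 0 ∧
      (t.mem (p + 1 + N + 3 * e) : ℚ) / (t.mem (p + 1 + N + 3 * e + 2) : ℚ) = x ∧
      (t.mem (p + 1 + N + 3 * e + 1) : ℚ) / (t.mem (p + 1 + N + 3 * e + 2) : ℚ) =
        (G.weight e : ℚ) * x

/-!
# A deterministic computation of the canonical cut hierarchy

Call a vertex set `U` *strong* at `μ` if every multiway cut of `G[U]` has ratio larger than `μ`.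
Strong sets that meet have a strong union (`WGraph.Strong.union`), so the maximal strong sets at `μ`
partition the vertices, and these partitions get finer as `μ` grows. The sides of the maximal
minimum ratio cut of `G[U]` are the maximal sets inside `U` that are strong at the minimum ratio
(`WGraph.IsMaximalMinRatioCut.isCol`). Therefore the hierarchy is determined by the strengths of the
edges, the strength of `e` being the supremum of all `μ` at which some set containing both ends of
`e` is strong. All ratios are fractions with denominators below `n`, so distinct ratios differ by at
least `1 / n ^ 2`. It is thus enough to know every strength up to `1 / D` with `D = n ^ 2`, that is,
an integral level `κ e` with `WGraph.EdgeApprox D 1 (κ e) e`: the maximal minimum ratio cut of a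
component of the graph of the edges of level at least `k` is its partition into components at level
`k + 1` (`WGraph.isCol_of_level`).

The levels are computed bit by bit. If they are known up to `2 * h`, then each edge of level `k` has
to be tested for a strong set at `(k + h) / D`. The components are treated in the order of
decreasing levels, with everything of higher level already merged into single labels
(`WGraph.TopComponent`). In one component the labels are inserted one at a time. The invariant is
that no set `S` of inserted labels spans edges of scaled weight more than `L * (|S| - 1)`, with
`L = k + h` (`WGraph.Sparse`). After the insertion of `v`, the least set `S` around `v` that maximizes
the scaled weight of its edges minus `L * |S|` is strong (`WGraph.Best.strong`), and contracting it
restores the invariant (`WGraph.Best.sparse`). This set is the source side of the least minimum cut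
in a network with source `v` in which a cut pays `L` for every label on the source side, and the
scaled weight of every edge that does not have both ends there; so it is found by one maximum flow
call followed by a search in the residual graph (`StructRAM.LabelInstance.best`). At the end,
sparsity shows that no further strong set exists (`WGraph.edgeApprox_refine`). A sweep over all
components makes at most `2 * n` flow calls (`StructRAM.refineSweep_spec`), and there are
`O(log (n * C))` sweeps. A last sweep records the components as nodes of the tree, together with the number of
parts and the weight of every cut (`StructRAM.treeSweep_spec`), and joins the connected components
of a disconnected graph under a root (`StructRAM.finish_spec`).

The algorithm uses no random words, so it is correct with probability `1`. It is written in a small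
structured language with scalar variables and arrays, reasoned about with weakest preconditions, and
compiled to the word RAM: the compiled code simulates the program at a constant cost for each step
(`StructRAM.Stm.code_exec`). The whole input is contained in the first array, and all intermediate
numbers are polynomial in `n` and `C`, so that words of `10 * (log (n + C) + 1)` bits suffice. -/

set_option linter.constructorNameAsVariable false
set_option linter.unusedSimpArgs false

/-! ### A structured language with arrays on top of the word RAM -/

namespace StructRAM

open WordRAM (Op Cmd Config)

/-- The scalar variables of the program. -/
inductive Var
  | n | m | tot | dd | step | k | go | r | x | fnd | cnt | v | e | f | lam | chg | num | wt
  | a | b | cap | root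
  deriving DecidableEq

/-- The arrays of the program, which lie one after another in the memory. The first one, `inp`,
overlays the input of the machine; `inst` and `flo` hold the argument and the result of the flow
subroutine, and `out` holds the output. For edges, `lA` and `lB` are the current labels of the ends,
`cA` and `cB` working copies of them, `kap` the levels, and `oc` and `ow` numerator and denominator
of the ideal loads. For labels, `reach` and `touch` are marks and `node` is the tree node. For
vertices, `fst` is the initial label. -/
inductive Arr
  | inp | inst | flo | out | lA | lB | kap | cA | cB | reach | touch | fst | node | oc | ow
  deriving DecidableEq

theorem Var.ctorIdx_inj {x y : Var} (h : x.ctorIdx = y.ctorIdx) : x = y := by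
  cases x <;> cases y <;> first | rfl | cases h

theorem Arr.ctorIdx_inj {x y : Arr} (h : x.ctorIdx = y.ctorIdx) : x = y := by
  cases x <;> cases y <;> first | rfl | cases h

theorem Arr.ctorIdx_lt (x : Arr) : x.ctorIdx + 1 ≤ 16 := by
  cases x <;> decide

/-- Arithmetic expressions over variables and array entries. -/
inductive Ex
  | lit (k : ℕ)
  | var (x : Var)
  | bin (o : Op) (a b : Ex)
  | rd (j : Arr) (i : Ex)

instance : Coe Var Ex := ⟨Ex.var⟩
instance (k : ℕ) : OfNat Ex k := ⟨Ex.lit k⟩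
instance : Add Ex := ⟨Ex.bin .add⟩
instance : Mul Ex := ⟨Ex.bin .mul⟩
instance : Div Ex := ⟨Ex.bin .div⟩

/-- Statements; `flow` calls the flow subroutine on the instance stored in `inst`. -/
inductive Stm
  | skip
  | set (x : Var) (e : Ex)
  | put (j : Arr) (i e : Ex)
  | seq (c d : Stm)
  | ite (e : Ex) (c d : Stm)
  | loop (e : Ex) (c : Stm)
  | flow

infixr:60 " ;; " => Stm.seq
infix:62 " ≔ " => Stm.set

/-- States of the structured language. The field `time` counts elementary statements and tests. -/
structure St where
  v : Var → ℕ
  a : Arr → ℕ → ℕ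
  time : ℕ
  calls : List FlowInstance

namespace St

/-- One elementary step elapses. -/
def tick (σ : St) : St := { σ with time := σ.time + 1 }

/-- Assignment to a variable. -/
def set (σ : St) (x : Var) (k : ℕ) : St := ⟨Function.update σ.v x k, σ.a, σ.time, σ.calls⟩

/-- Assignment to an array entry. -/
def put (σ : St) (j : Arr) (i k : ℕ) : St :=
  ⟨σ.v, Function.update σ.a j (Function.update (σ.a j) i k), σ.time, σ.calls⟩

variable (σ : St) (x y : Var) (j j' : Arr) (i i' k : ℕ)

@[simp] theorem tick_v : σ.tick.v = σ.v := rfl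
@[simp] theorem tick_a : σ.tick.a = σ.a := rfl
@[simp] theorem tick_calls : σ.tick.calls = σ.calls := rfl
@[simp] theorem tick_time : σ.tick.time = σ.time + 1 := rfl
@[simp] theorem set_v : (σ.set x k).v y = if y = x then k else σ.v y :=
  Function.update_apply ..
@[simp] theorem set_a : (σ.set x k).a = σ.a := rfl
@[simp] theorem set_calls : (σ.set x k).calls = σ.calls := rfl
@[simp] theorem set_time : (σ.set x k).time = σ.time := rfl
@[simp] theorem put_v : (σ.put j i k).v = σ.v := rfl
@[simp] theorem put_a :
    (σ.put j i k).a j' i' = if j' = j then (if i' = i then k else σ.a j i') else σ.a j' i' := by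
  unfold put
  by_cases h : j' = j
  · subst h; simp [Function.update_apply]
  · simp [h]
@[simp] theorem put_calls : (σ.put j i k).calls = σ.calls := rfl
@[simp] theorem put_time : (σ.put j i k).time = σ.time := rfl

end St

/-- The operations of the machine on unbounded naturals. -/
def natOp : Op → ℕ → ℕ → ℕ
  | .add, a, b => a + b
  | .sub, a, b => a - b
  | .mul, a, b => a * b
  | .div, a, b => a / b
  | .mod, a, b => a % b
  | .lt, a, b => if a < b then 1 else 0
  | .eq, a, b => if a = b then 1 else 0

/-- The operation neither overflows nor underflows. -/
def opOk (W : ℕ) : Op → ℕ → ℕ → Prop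
  | .add, a, b => a + b < W
  | .sub, a, b => b ≤ a
  | .mul, a, b => a * b < W
  | _, _, _ => True

theorem eval_eq_natOp {w : ℕ} (hw : 2 ≤ 2 ^ w) {o : Op} {a b : ℕ} (ha : a < 2 ^ w)
    (h : opOk (2 ^ w) o a b) : o.eval w a b = natOp o a b ∧ natOp o a b < 2 ^ w := by
  have hd : a / b ≤ a := Nat.div_le_self a b
  have hm : a % b ≤ a := Nat.mod_le a b
  cases o
  case add => exact ⟨Nat.mod_eq_of_lt h, h⟩
  case sub =>
    simp only [opOk] at h
    have : a + (2 ^ w - b) = (a - b) + 2 ^ w := by omega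
    refine ⟨?_, show a - b < _ by omega⟩
    change (a + (2 ^ w - b)) % 2 ^ w = a - b
    rw [this, Nat.add_mod_right, Nat.mod_eq_of_lt (by omega)]
  case mul => exact ⟨Nat.mod_eq_of_lt h, h⟩
  case div => exact ⟨Nat.mod_eq_of_lt (by omega), show a / b < _ by omega⟩
  case mod => exact ⟨Nat.mod_eq_of_lt (by omega), show a % b < _ by omega⟩
  case lt =>
    have : (if a < b then 1 else 0) < 2 ^ w := by split_ifs <;> omega
    exact ⟨Nat.mod_eq_of_lt this, this⟩
  case eq =>
    have : (if a = b then 1 else 0) < 2 ^ w := by split_ifs <;> omega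
    exact ⟨Nat.mod_eq_of_lt this, this⟩

namespace Ex

/-- The value of an expression. -/
def eval (σ : St) : Ex → ℕ
  | lit k => k
  | var x => σ.v x
  | bin o a b => natOp o (a.eval σ) (b.eval σ)
  | rd j i => σ.a j (i.eval σ)

/-- The expression evaluates without overflow on words below `W` and with array indices below `M`.
-/
def ok (W M : ℕ) (σ : St) : Ex → Prop
  | lit k => k < 16
  | var _ => True
  | bin o a b => a.ok W M σ ∧ b.ok W M σ ∧ opOk W o (a.eval σ) (b.eval σ)
  | rd _ i => i.ok W M σ ∧ i.eval σ < M

variable (W M : ℕ) (σ : St) (a b i : Ex) (x : Var) (j : Arr) (k : ℕ)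

@[simp] theorem eval_lit : (lit k).eval σ = k := rfl
@[simp] theorem eval_ofNat : Ex.eval σ ofNat(k) = OfNat.ofNat k := rfl
@[simp] theorem eval_var : (var x).eval σ = σ.v x := rfl
@[simp] theorem eval_rd : (rd j i).eval σ = σ.a j (i.eval σ) := rfl
@[simp] theorem eval_add : (a + b).eval σ = a.eval σ + b.eval σ := rfl
@[simp] theorem eval_mul : (a * b).eval σ = a.eval σ * b.eval σ := rfl
@[simp] theorem eval_div : (a / b).eval σ = a.eval σ / b.eval σ := rfl
@[simp] theorem eval_lt :
    (bin .lt a b).eval σ = if a.eval σ < b.eval σ then 1 else 0 := rfl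
@[simp] theorem eval_eq :
    (bin .eq a b).eval σ = if a.eval σ = b.eval σ then 1 else 0 := rfl
@[simp] theorem ok_lit : (lit k).ok W M σ ↔ k < 16 := Iff.rfl
@[simp] theorem ok_ofNat : Ex.ok W M σ ofNat(k) ↔ OfNat.ofNat k < 16 := Iff.rfl
@[simp] theorem ok_var : (var x).ok W M σ ↔ True := Iff.rfl
@[simp] theorem ok_rd : (rd j i).ok W M σ ↔ i.ok W M σ ∧ i.eval σ < M := Iff.rfl
@[simp] theorem ok_add :
    (a + b).ok W M σ ↔ a.ok W M σ ∧ b.ok W M σ ∧ a.eval σ + b.eval σ < W := Iff.rfl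
@[simp] theorem ok_mul :
    (a * b).ok W M σ ↔ a.ok W M σ ∧ b.ok W M σ ∧ a.eval σ * b.eval σ < W := Iff.rfl
@[simp] theorem ok_div : (a / b).ok W M σ ↔ a.ok W M σ ∧ b.ok W M σ := by
  change _ ∧ _ ∧ True ↔ _; simp
@[simp] theorem ok_lt : (bin .lt a b).ok W M σ ↔ a.ok W M σ ∧ b.ok W M σ := by
  change _ ∧ _ ∧ True ↔ _; simp
@[simp] theorem ok_eq : (bin .eq a b).ok W M σ ↔ a.ok W M σ ∧ b.ok W M σ := by
  change _ ∧ _ ∧ True ↔ _; simp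

end Ex

/-- The instance is stored in the array `f` from index `0` on. -/
def StoredIn (I : FlowInstance) (f : ℕ → ℕ) : Prop :=
  f 0 = I.nodes ∧ f 1 = I.arcs ∧ f 2 = I.source ∧ f 3 = I.sink ∧
    ∀ a : Fin I.arcs, f (4 + 3 * a) = I.tail a ∧ f (5 + 3 * a) = I.head a ∧ f (6 + 3 * a) = I.cap a

/-- Big-step semantics, with words below `W` and arrays of length `M`. -/
inductive Run (W M : ℕ) (O : FlowSubroutine) : Stm → St → St → Prop
  | skip (σ) : Run W M O .skip σ σ.tick
  | set (σ x e) : e.ok W M σ → Run W M O (.set x e) σ (σ.set x (e.eval σ)).tick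
  | put (σ j i e) : i.ok W M σ → e.ok W M σ → i.eval σ < M →
      Run W M O (.put j i e) σ (σ.put j (i.eval σ) (e.eval σ)).tick
  | seq {c d σ τ υ} : Run W M O c σ τ → Run W M O d τ υ → Run W M O (.seq c d) σ υ
  | ite_true {e c d σ τ} : e.ok W M σ → e.eval σ ≠ 0 → Run W M O c σ.tick τ →
      Run W M O (.ite e c d) σ τ
  | ite_false {e c d σ τ} : e.ok W M σ → e.eval σ = 0 → Run W M O d σ.tick τ →
      Run W M O (.ite e c d) σ τ
  | loop_true {e c σ τ υ} : e.ok W M σ → e.eval σ ≠ 0 → Run W M O c σ.tick τ →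
      Run W M O (.loop e c) τ υ → Run W M O (.loop e c) σ υ
  | loop_false {e c σ} : e.ok W M σ → e.eval σ = 0 → Run W M O (.loop e c) σ σ.tick
  | flow (σ) (I : FlowInstance) : StoredIn I (σ.a .inst) → 4 + 3 * I.arcs ≤ M →
      (∀ a, O I a < W) →
      Run W M O .flow σ
        ⟨σ.v, Function.update σ.a .flo
          (fun i => if h : i < I.arcs then O I ⟨i, h⟩ else σ.a .flo i), σ.time + 1, I :: σ.calls⟩

/-! ### Compilation to the word RAM -/

/-- Code that leaves the value of the expression in register `2 * d + 2`; it uses the registers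
with even numbers from there on. Register `0` holds the array length, the variables are kept in
the registers with odd numbers. -/
def Ex.code : Ex → ℕ → Cmd
  | lit k, d => .const (2 * d + 2) k
  | var x, d => .seq (.const (2 * d + 2) 0) (.op .add (2 * d + 2) (2 * x.ctorIdx + 1) (2 * d + 2))
  | bin o a b, d =>
      .seq (a.code d) (.seq (b.code (d + 1)) (.op o (2 * d + 2) (2 * d + 2) (2 * (d + 1) + 2)))
  | rd j i, d => .seq (i.code d) (.seq (.const (2 * d + 4) j.ctorIdx)
      (.seq (.op .mul (2 * d + 4) (2 * d + 4) 0)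
        (.seq (.op .add (2 * d + 2) (2 * d + 2) (2 * d + 4)) (.load (2 * d + 2) (2 * d + 2)))))

/-- The running time of `Ex.code`. -/
def Ex.cost : Ex → ℕ
  | lit _ => 1
  | var _ => 2
  | bin _ a b => a.cost + b.cost + 1
  | rd _ i => i.cost + 4

/-- The word RAM program of a statement. -/
def Stm.code : Stm → Cmd
  | skip => .skip
  | set x e => .seq (e.code 0) (.seq (.const (2 * x.ctorIdx + 1) 0)
      (.op .add (2 * x.ctorIdx + 1) 2 (2 * x.ctorIdx + 1)))
  | put j i e => .seq (i.code 0) (.seq (e.code 1) (.seq (.const 6 j.ctorIdx)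
      (.seq (.op .mul 6 6 0) (.seq (.op .add 2 2 6) (.store 2 4)))))
  | seq c d => .seq c.code d.code
  | ite e c d => .seq (e.code 0) (.ite 2 c.code d.code)
  | loop e c => .seq (e.code 0) (.while 2 (.seq c.code (e.code 0)))
  | flow => .seq (.const 2 (Arr.inst.ctorIdx)) (.seq (.op .mul 2 2 0)
      (.seq (.const 4 (Arr.flo.ctorIdx)) (.seq (.op .mul 4 4 0) (.maxFlow 2 4))))

/-- The largest running time of the code of an elementary statement or test. -/
def Stm.unit : Stm → ℕ
  | skip => 1
  | set _ e => e.cost + 2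
  | put _ i e => i.cost + e.cost + 4
  | seq c d => max c.unit d.unit
  | ite e c d => max (e.cost + 1) (max c.unit d.unit)
  | loop e c => max (e.cost + 1) c.unit
  | flow => 5

/-- The machine configuration `s` represents the state `σ`. -/
structure Sim (w M : ℕ) (σ : St) (s : Config) : Prop where
  len : s.reg 0 = M
  reg : ∀ x : Var, s.reg (2 * x.ctorIdx + 1) = σ.v x
  vlt : ∀ x, σ.v x < 2 ^ w
  mem : ∀ (j : Arr) (i : ℕ), i < M → s.mem (j.ctorIdx * M + i) = σ.a j i
  alt : ∀ (j : Arr) (i : ℕ), i < M → σ.a j i < 2 ^ w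
  calls : s.calls = σ.calls

theorem Sim.of_eq {w M : ℕ} {σ : St} {s t : Config} (h : Sim w M σ s) (h0 : t.reg 0 = s.reg 0)
    (hr : ∀ r, r % 2 = 1 → t.reg r = s.reg r) (hm : t.mem = s.mem) (hc : t.calls = s.calls) :
    Sim w M σ t where
  len := h0.trans h.len
  reg x := (hr _ (by omega)).trans (h.reg x)
  vlt := h.vlt
  mem := by rw [hm]; exact h.mem
  alt := h.alt
  calls := hc.trans h.calls

theorem addr_lt {M W : ℕ} (hM : 16 * M ≤ W) (j : Arr) {i : ℕ} (hi : i < M) :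
    j.ctorIdx * M + i < W ∧ j.ctorIdx * M < W := by
  have h1 : (j.ctorIdx + 1) * M ≤ 16 * M := Nat.mul_le_mul_right M j.ctorIdx_lt
  rw [Nat.add_mul] at h1
  omega

theorem addr_inj {M : ℕ} {j j' : ℕ} {i i' : ℕ} (hi : i < M) (hi' : i' < M)
    (h : j * M + i = j' * M + i') : j = j' ∧ i = i' := by
  have hM : 0 < M := by omega
  have h1 : (j * M + i) / M = j := by
    rw [Nat.mul_comm, Nat.mul_add_div hM, Nat.div_eq_of_lt hi, Nat.add_zero]
  have h2 : (j' * M + i') / M = j' := by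
    rw [Nat.mul_comm, Nat.mul_add_div hM, Nat.div_eq_of_lt hi', Nat.add_zero]
  have h3 : j = j' := by rw [← h1, h, h2]
  subst h3
  exact ⟨rfl, by omega⟩

section Compile

variable {w M : ℕ} {O : FlowSubroutine} {ρ : ℕ → ℕ}

theorem Ex.code_exec (hM : 16 * M ≤ 2 ^ w) (hw : 16 ≤ 2 ^ w) {σ : St} (e : Ex) :
    ∀ (d : ℕ) (s : Config), Sim w M σ s → e.ok (2 ^ w) M σ →
      ∃ t, WordRAM.Exec w O ρ (e.code d) s t ∧ t.reg (2 * d + 2) = e.eval σ ∧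
        t.mem = s.mem ∧ t.calls = s.calls ∧ t.time = s.time + e.cost ∧
        (∀ r, r % 2 = 1 ∨ r < 2 * d + 2 → t.reg r = s.reg r) ∧ e.eval σ < 2 ^ w := by
  induction e with
  | lit k =>
    intro d s hs hk
    simp only [ok_lit] at hk
    refine ⟨_, .const s _ k, ?_, rfl, rfl, rfl, ?_, ?_⟩
    · simp [Config.tick, Config.setReg, Nat.mod_eq_of_lt (hk.trans_le hw)]
    · intro r hr
      have : r ≠ 2 * d + 2 := by omega
      simp [Config.tick, Config.setReg, this]
    · exact hk.trans_le hw
  | var x =>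
    intro d s hs _
    refine ⟨_, .seq (.const s _ 0) (.op _ .add _ _ _), ?_, rfl, rfl, rfl, ?_, hs.vlt x⟩
    · have : 2 * x.ctorIdx + 1 ≠ 2 * d + 2 := by omega
      simp only [Config.tick, Config.setReg, Op.eval, Function.update_self,
        Function.update_of_ne this, hs.reg x, Nat.add_zero, Nat.mod_eq_of_lt (hs.vlt x),
        Ex.eval_var, Nat.zero_mod]
    · intro r hr
      have : r ≠ 2 * d + 2 := by omega
      simp [Config.tick, Config.setReg, this]
  | bin o a b iha ihb =>
    intro d s hs hok
    obtain ⟨oka, okb, oko⟩ := hok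
    obtain ⟨t, ht, h1, h2, h3, h4, h5, h6⟩ := iha d s hs oka
    have hs' : Sim w M σ t :=
      hs.of_eq (h5 0 (by omega)) (fun r hr => h5 r (.inl hr)) h2 h3
    obtain ⟨u, hu, g1, g2, g3, g4, g5, g6⟩ := ihb (d + 1) t hs' okb
    obtain ⟨e1, e2⟩ := eval_eq_natOp (w := w) (by omega) h6 oko
    refine ⟨_, .seq ht (.seq hu (.op _ o _ _ _)), ?_, ?_, ?_, ?_, ?_, e2⟩
    · simp only [Config.tick, Config.setReg, Function.update_self]
      rw [g5 (2 * d + 2) (by omega), h1, g1, e1]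
      rfl
    · simp [Config.tick, Config.setReg, g2, h2]
    · simp [Config.tick, Config.setReg, g3, h3]
    · simp only [Config.tick, Config.setReg, g4, h4, Ex.cost]; omega
    · intro r hr
      have : r ≠ 2 * d + 2 := by omega
      simp only [Config.tick, Config.setReg, Function.update_of_ne this]
      rw [g5 r (by omega), h5 r hr]
  | rd j i ih =>
    intro d s hs hok
    obtain ⟨oki, hi⟩ := hok
    obtain ⟨t, ht, h1, h2, h3, h4, h5, h6⟩ := ih d s hs oki
    obtain ⟨a1, a2⟩ := addr_lt hM j hi
    have hj := j.ctorIdx_lt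
    have h0 : t.reg 0 = M := (h5 0 (by omega)).trans hs.len
    refine ⟨_, .seq ht (.seq (.const _ _ _) (.seq (.op _ .mul _ _ _) (.seq (.op _ .add _ _ _)
      (.load _ _ _)))), ?_, ?_, ?_, ?_, ?_, hs.alt j _ hi⟩
    · simp [Config.tick, Config.setReg, Op.eval, h0, h1, h2,
        Nat.mod_eq_of_lt (show j.ctorIdx < 2 ^ w by omega), Nat.mod_eq_of_lt a2]
      rw [Nat.add_comm, Nat.mod_eq_of_lt a1, hs.mem j _ hi]
    · simp [Config.tick, Config.setReg, h2]
    · simp [Config.tick, Config.setReg, h3]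
    · simp only [Config.tick, Config.setReg, h4, Ex.cost, Nat.add_assoc]
    · intro r hr
      by_cases hr4 : r = 2 * d + 4
      · omega
      · have : r ≠ 2 * d + 2 := by omega
        simp [Config.tick, Config.setReg, this, hr4, h5 r hr]

theorem Ex.code_sim (hM : 16 * M ≤ 2 ^ w) (hw : 16 ≤ 2 ^ w) {σ : St} {e : Ex} {s : Config}
    (hs : Sim w M σ s) (hok : e.ok (2 ^ w) M σ) :
    ∃ t, WordRAM.Exec w O ρ (e.code 0) s t ∧ t.reg 2 = e.eval σ ∧ Sim w M σ t ∧
      t.time = s.time + e.cost ∧ e.eval σ < 2 ^ w := by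
  obtain ⟨t, ht, h1, h2, h3, h4, h5, h6⟩ := e.code_exec (O := O) (ρ := ρ) hM hw 0 s hs hok
  exact ⟨t, ht, h1, hs.of_eq (h5 0 (by omega)) (fun r hr => h5 r (.inl hr)) h2 h3, h4, h6⟩

theorem Sim.tick {σ : St} {s : Config} (h : Sim w M σ s) : Sim w M σ.tick s :=
  ⟨h.len, h.reg, h.vlt, h.mem, h.alt, h.calls⟩

theorem Sim.ctick {σ : St} {s : Config} (h : Sim w M σ s) : Sim w M σ s.tick :=
  ⟨h.len, h.reg, h.vlt, h.mem, h.alt, h.calls⟩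

/-- The body of a compiled loop, started after the test has been evaluated into register `2`. -/
theorem loop_exec_aux {e : Ex} {c : Stm} {s t u : Config} (h2 : s.reg 2 ≠ 0)
    (h : WordRAM.Exec w O ρ c.code s.tick t)
    (h' : WordRAM.Exec w O ρ (Stm.loop e c).code t u) :
    WordRAM.Exec w O ρ (.while 2 (.seq c.code (e.code 0))) s u := by
  cases h' with
  | seq h3 h4 => exact .while_true h2 (.seq h h3) h4

theorem addr_exec (j : Arr) (r : ℕ) (hr : r ≠ 0) {s : Config} (h0 : s.reg 0 = M)
    (ha : j.ctorIdx * M < 2 ^ w) (hw : 16 ≤ 2 ^ w) :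
    ∃ t, WordRAM.Exec w O ρ (.seq (.const r j.ctorIdx) (.op .mul r r 0)) s t ∧
      t.reg r = j.ctorIdx * M ∧ (∀ q, q ≠ r → t.reg q = s.reg q) ∧ t.mem = s.mem ∧
      t.calls = s.calls ∧ t.time = s.time + 2 := by
  have hj := j.ctorIdx_lt
  refine ⟨_, .seq (.const _ _ _) (.op _ .mul _ _ _), ?_, ?_, rfl, rfl, rfl⟩
  · simp only [Config.tick, Config.setReg, Function.update_self, Op.eval,
      Function.update_of_ne hr.symm, h0, Nat.mod_eq_of_lt (show j.ctorIdx < 2 ^ w by omega),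
      Nat.mod_eq_of_lt ha]
  · intro q hq
    simp only [Config.tick, Config.setReg, Function.update_of_ne hq]

theorem flow_exec (hM : 16 * M ≤ 2 ^ w) (hw : 16 ≤ 2 ^ w) {K : ℕ} {σ : St} {I : FlowInstance}
    (hI : StoredIn I (σ.a .inst)) (hlen : 4 + 3 * I.arcs ≤ M) (hO : ∀ a, O I a < 2 ^ w)
    (hK : Stm.flow.unit ≤ K) {s : Config} (hs : Sim w M σ s) :
    ∃ t, WordRAM.Exec w O ρ Stm.flow.code s t ∧
      Sim w M ⟨σ.v, Function.update σ.a .flo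
          (fun i => if h : i < I.arcs then O I ⟨i, h⟩ else σ.a .flo i), σ.time + 1,
          I :: σ.calls⟩ t ∧
      t.time + K * σ.time ≤ s.time + K * (σ.time + 1) := by
  have hMpos : 0 < M := by omega
  obtain ⟨t, ht, h1, h2, h3, h4, h5⟩ := addr_exec (O := O) (ρ := ρ) .inst 2 (by omega) hs.len
    (addr_lt hM .inst hMpos).2 hw
  obtain ⟨u, hu, g1, g2, g3, g4, g5⟩ := addr_exec (O := O) (ρ := ρ) .flo 4 (by omega)
    ((h2 0 (by omega)).trans hs.len) (addr_lt hM .flo hMpos).2 hw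
  simp only [show Arr.inst.ctorIdx = 1 from rfl, show Arr.flo.ctorIdx = 2 from rfl] at *
  have hm : ∀ i < M, s.mem (1 * M + i) = σ.a .inst i := fun i hi => hs.mem .inst i hi
  have r2 : u.reg 2 = 1 * M := (g2 2 (by omega)).trans h1
  have hmem : u.mem = s.mem := g3.trans h3
  have hreg : ∀ q, q ≠ 2 → q ≠ 4 → u.reg q = s.reg q := fun q hq hq' =>
    (g2 q hq').trans (h2 q hq)
  cases ht with
  | seq ht1 ht2 =>
  cases hu with
  | seq hu1 hu2 =>
  refine ⟨_, .seq ht1 (.seq ht2 (.seq hu1 (.seq hu2 (.maxFlow _ _ _ I ?_ ?_)))),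
    ⟨?_, ?_, ?_, ?_, ?_, ?_⟩, ?_⟩
  · rw [r2, hmem]
    refine ⟨by omega, ?_, ?_, ?_, ?_, ?_⟩
    · rw [← hI.1, ← hm 0 (by omega), Nat.add_zero]
    · rw [← hI.2.1, ← hm 1 (by omega)]
    · rw [← hI.2.2.1, ← hm 2 (by omega)]
    · rw [← hI.2.2.2.1, ← hm 3 (by omega)]
    · intro a
      have ha := a.2
      obtain ⟨b1, b2, b3⟩ := hI.2.2.2.2 a
      rw [← b1, ← b2, ← b3, ← hm _ (by omega), ← hm _ (by omega), ← hm _ (by omega)]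
      simp only [Nat.add_assoc, and_self]
  · rw [g1]; omega
  · exact (hreg 0 (by omega) (by omega)).trans hs.len
  · exact fun y => (hreg _ (by omega) (by omega)).trans (hs.reg y)
  · exact hs.vlt
  · intro j i hi
    simp only [Config.tick, Config.setBlock, g1, hmem]
    by_cases hj : j = .flo
    · subst hj
      simp only [Function.update_self, show Arr.flo.ctorIdx = 2 from rfl]
      by_cases hi' : i < I.arcs
      · have : 2 * M ≤ 2 * M + i ∧ 2 * M + i - 2 * M < I.arcs := by omega
        rw [dif_pos this, dif_pos hi']
        congr 2
        omega
      · have : ¬ (2 * M ≤ 2 * M + i ∧ 2 * M + i - 2 * M < I.arcs) := by omega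
        rw [dif_neg this, dif_neg hi']
        exact hs.mem .flo i hi
    · rw [Function.update_of_ne hj, dif_neg, hs.mem j i hi]
      rintro ⟨h1, h2⟩
      have := addr_inj (M := M) (j := j.ctorIdx) (i := i) (j' := 2)
        (i' := j.ctorIdx * M + i - 2 * M) hi (by omega) (by omega)
      exact hj (Arr.ctorIdx_inj this.1)
  · intro j i hi
    by_cases hj : j = .flo
    · subst hj
      simp only [Function.update_self]
      split_ifs with h
      · exact hO _
      · exact hs.alt _ i hi
    · simp only [Function.update_of_ne hj]
      exact hs.alt j i hi
  · simp only [Config.tick, Config.setBlock, g4, h4, hs.calls]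
  · simp only [Stm.unit] at hK
    simp only [Config.tick, Config.setBlock, Nat.mul_add, g5, h5]
    omega

/-- The compiled program simulates the statement, each step of which takes at most `K` units of
time. -/
theorem Stm.code_exec (hM : 16 * M ≤ 2 ^ w) (hw : 16 ≤ 2 ^ w) {K : ℕ} {c : Stm} {σ τ : St}
    (h : Run (2 ^ w) M O c σ τ) : c.unit ≤ K → ∀ s, Sim w M σ s →
      ∃ t, WordRAM.Exec w O ρ c.code s t ∧ Sim w M τ t ∧
        t.time + K * σ.time ≤ s.time + K * τ.time := by
  induction h with
  | skip σ =>
    intro hK s hs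
    refine ⟨_, .skip s, hs.tick.ctick, ?_⟩
    simp only [Stm.unit] at hK
    simp only [Config.tick, St.tick, Nat.mul_add]
    omega
  | set σ x e hok =>
    intro hK s hs
    obtain ⟨t, ht, h1, h2, h3, h4⟩ := Ex.code_sim (O := O) (ρ := ρ) hM hw hs hok
    refine ⟨_, .seq ht (.seq (.const _ _ _) (.op _ .add _ _ _)), ⟨?_, ?_, ?_, ?_, ?_, ?_⟩, ?_⟩
    · simp [Config.tick, Config.setReg, h2.len]
    · intro y
      by_cases hy : y = x
      · subst hy
        have : (2 : ℕ) ≠ 2 * y.ctorIdx + 1 := by omega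
        simp [Config.tick, Config.setReg, this, Op.eval, h1, Nat.mod_eq_of_lt h4]
      · have h5 : y.ctorIdx ≠ x.ctorIdx := fun h => hy (Var.ctorIdx_inj h)
        have : 2 * y.ctorIdx + 1 ≠ 2 * x.ctorIdx + 1 := by omega
        simp [Config.tick, Config.setReg, h5, hy, h2.reg y]
    · intro y
      by_cases hy : y = x
      · simp [hy, h4]
      · simp [hy, h2.vlt y]
    · intro j i hi
      simpa [Config.tick, Config.setReg] using h2.mem j i hi
    · intro j i hi
      simpa using h2.alt j i hi
    · simpa [Config.tick, Config.setReg] using h2.calls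
    · simp only [Stm.unit] at hK
      simp only [Config.tick, Config.setReg, St.tick, St.set, Nat.mul_add, h3]
      omega
  | put σ j i e oki oke hi =>
    intro hK s hs
    obtain ⟨t, ht, h1, h2, h3, h4, h5, h6⟩ := i.code_exec (O := O) (ρ := ρ) hM hw 0 s hs oki
    have hs' : Sim w M σ t :=
      hs.of_eq (h5 0 (by omega)) (fun r hr => h5 r (.inl hr)) h2 h3
    obtain ⟨u, hu, g1, g2, g3, g4, g5, g6⟩ := e.code_exec (O := O) (ρ := ρ) hM hw 1 t hs' oke
    have hs'' : Sim w M σ u :=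
      hs'.of_eq (g5 0 (by omega)) (fun r hr => g5 r (.inl hr)) g2 g3
    have e2 : u.reg 2 = i.eval σ := (g5 2 (by omega)).trans h1
    have e4 : u.reg 4 = e.eval σ := g1
    have e0 : u.reg 0 = M := hs''.len
    obtain ⟨a1, a2⟩ := addr_lt hM j hi
    have hj := j.ctorIdx_lt
    refine ⟨_, .seq ht (.seq hu (.seq (.const _ _ _) (.seq (.op _ .mul _ _ _)
      (.seq (.op _ .add _ _ _) (.store _ _ _))))), ⟨?_, ?_, ?_, ?_, ?_, ?_⟩, ?_⟩
    · simp [Config.tick, Config.setReg, Config.setMem, e0]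
    · intro y
      have h7 : 2 * y.ctorIdx + 1 ≠ 6 := by omega
      have h8 : 2 * y.ctorIdx + 1 ≠ 2 := by omega
      simp [Config.tick, Config.setReg, Config.setMem, h7, h8, hs''.reg y]
    · exact hs''.vlt
    · intro j' i' hi'
      have hadr : (i.eval σ + j.ctorIdx * M) % 2 ^ w = j.ctorIdx * M + i.eval σ := by
        rw [Nat.add_comm, Nat.mod_eq_of_lt a1]
      simp only [Config.tick, Config.setReg, Config.setMem, Op.eval, Function.update_apply, e0, e2,
        e4, Nat.mod_eq_of_lt (show j.ctorIdx < 2 ^ w by omega), St.tick_a, St.put_a]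
      simp only [if_true, show (2 : ℕ) = 6 ↔ False by decide, show (0 : ℕ) = 6 ↔ False by decide,
        show (4 : ℕ) = 6 ↔ False by decide, show (4 : ℕ) = 2 ↔ False by decide, if_false,
        show (6 : ℕ) = 2 ↔ False by decide, e2, e0, e4, Nat.mod_eq_of_lt a2, hadr]
      by_cases hjj : j' = j
      · subst hjj
        by_cases hii : i' = i.eval σ
        · simp [hii]
        · simp [hii, hs''.mem _ _ hi']
      · have : ¬ j'.ctorIdx * M + i' = j.ctorIdx * M + i.eval σ :=
          fun h => hjj (Arr.ctorIdx_inj (addr_inj hi' hi h).1)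
        simp [hjj, this, hs''.mem _ _ hi']
    · intro j' i' hi'
      have := hs.alt j' i' hi'
      have := hs.alt j i' hi'
      simp only [St.tick_a, St.put_a]
      split_ifs <;> assumption
    · simpa [Config.tick, Config.setReg, Config.setMem] using hs''.calls
    · simp only [Stm.unit] at hK
      simp only [Config.tick, Config.setReg, Config.setMem, St.tick, St.put, Nat.mul_add, h4, g4]
      omega
  | seq _ _ ih1 ih2 =>
    intro hK s hs
    simp only [Stm.unit, max_le_iff] at hK
    obtain ⟨t, ht, h1, h2⟩ := ih1 hK.1 s hs
    obtain ⟨u, hu, g1, g2⟩ := ih2 hK.2 t h1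
    exact ⟨u, .seq ht hu, g1, by omega⟩
  | ite_true hok hne _ ih =>
    intro hK s hs
    simp only [Stm.unit, max_le_iff] at hK
    obtain ⟨t, ht, h1, h2, h3, h4⟩ := Ex.code_sim (O := O) (ρ := ρ) hM hw hs hok
    obtain ⟨u, hu, g1, g2⟩ := ih hK.2.1 t.tick h2.tick.ctick
    refine ⟨u, .seq ht (.ite_true (by rwa [h1]) hu), g1, ?_⟩
    simp only [Config.tick, St.tick, Nat.mul_add, h3] at g2
    omega
  | ite_false hok hne _ ih =>
    intro hK s hs
    simp only [Stm.unit, max_le_iff] at hK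
    obtain ⟨t, ht, h1, h2, h3, h4⟩ := Ex.code_sim (O := O) (ρ := ρ) hM hw hs hok
    obtain ⟨u, hu, g1, g2⟩ := ih hK.2.2 t.tick h2.tick.ctick
    refine ⟨u, .seq ht (.ite_false (by rwa [h1]) hu), g1, ?_⟩
    simp only [Config.tick, St.tick, Nat.mul_add, h3] at g2
    omega
  | loop_true hok hne _ _ ih1 ih2 =>
    intro hK s hs
    have hK' := hK
    simp only [Stm.unit, max_le_iff] at hK'
    obtain ⟨t, ht, h1, h2, h3, h4⟩ := Ex.code_sim (O := O) (ρ := ρ) hM hw hs hok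
    obtain ⟨u, hu, g1, g2⟩ := ih1 hK'.2 t.tick h2.tick.ctick
    obtain ⟨v, hv, f1, f2⟩ := ih2 hK u g1
    refine ⟨v, .seq ht (loop_exec_aux (by rwa [h1]) hu hv), f1, ?_⟩
    simp only [Config.tick, St.tick, Nat.mul_add, h3] at g2
    omega
  | loop_false hok hne =>
    intro hK s hs
    simp only [Stm.unit, max_le_iff] at hK
    obtain ⟨t, ht, h1, h2, h3, h4⟩ := Ex.code_sim (O := O) (ρ := ρ) hM hw hs hok
    refine ⟨_, .seq ht (.while_false (by rwa [h1])), h2.tick.ctick, ?_⟩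
    simp only [Config.tick, St.tick, Nat.mul_add, h3]
    omega
  | flow σ I hI hlen hO => exact fun hK s hs => flow_exec hM hw hI hlen hO hK hs

end Compile

/-! ### Frame rules and rules for loops -/

/-- Whether the statement assigns to the variable. -/
def Stm.modV (x : Var) : Stm → Bool
  | skip => false
  | set y _ => decide (y = x)
  | put _ _ _ => false
  | seq c d => c.modV x || d.modV x
  | ite _ c d => c.modV x || d.modV x
  | loop _ c => c.modV x
  | flow => false

/-- Whether the statement writes to the array. -/
def Stm.modA (j : Arr) : Stm → Bool
  | skip => false
  | set _ _ => false
  | put j' _ _ => decide (j' = j)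
  | seq c d => c.modA j || d.modA j
  | ite _ c d => c.modA j || d.modA j
  | loop _ c => c.modA j
  | flow => decide (j = .flo)

/-- Whether the statement may call the flow subroutine. -/
def Stm.flows : Stm → Bool
  | skip => false
  | set _ _ => false
  | put _ _ _ => false
  | seq c d => c.flows || d.flows
  | ite _ c d => c.flows || d.flows
  | loop _ c => c.flows
  | flow => true

/-- The state `τ` agrees with `σ` on everything that the statement does not modify. -/
structure Frame (c : Stm) (σ τ : St) : Prop where
  v : ∀ x, c.modV x = false → τ.v x = σ.v x
  a : ∀ j, c.modA j = false → τ.a j = σ.a j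
  calls : c.flows = false → τ.calls = σ.calls

section Rules

variable {W M : ℕ} {O : FlowSubroutine}

theorem Run.frame {c : Stm} {σ τ : St} (h : Run W M O c σ τ) : Frame c σ τ := by
  induction h with
  | skip σ => exact ⟨fun _ _ => rfl, fun _ _ => rfl, fun _ => rfl⟩
  | set σ x e _ =>
    refine ⟨fun y hy => ?_, fun _ _ => rfl, fun _ => rfl⟩
    simp only [Stm.modV, decide_eq_false_iff_not] at hy
    simp [Ne.symm hy]
  | put σ j i e _ _ _ =>
    refine ⟨fun _ _ => rfl, fun j' hj => ?_, fun _ => rfl⟩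
    simp only [Stm.modA, decide_eq_false_iff_not] at hj
    funext q
    simp [Ne.symm hj]
  | seq _ _ ih1 ih2 =>
    refine ⟨fun x hx => ?_, fun j hj => ?_, fun hc => ?_⟩
    · simp only [Stm.modV, Bool.or_eq_false_iff] at hx
      rw [ih2.v x hx.2, ih1.v x hx.1]
    · simp only [Stm.modA, Bool.or_eq_false_iff] at hj
      rw [ih2.a j hj.2, ih1.a j hj.1]
    · simp only [Stm.flows, Bool.or_eq_false_iff] at hc
      rw [ih2.calls hc.2, ih1.calls hc.1]
  | ite_true _ _ _ ih =>
    refine ⟨fun x hx => ?_, fun j hj => ?_, fun hc => ?_⟩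
    · simp only [Stm.modV, Bool.or_eq_false_iff] at hx
      rw [ih.v x hx.1]; rfl
    · simp only [Stm.modA, Bool.or_eq_false_iff] at hj
      rw [ih.a j hj.1]; rfl
    · simp only [Stm.flows, Bool.or_eq_false_iff] at hc
      rw [ih.calls hc.1]; rfl
  | ite_false _ _ _ ih =>
    refine ⟨fun x hx => ?_, fun j hj => ?_, fun hc => ?_⟩
    · simp only [Stm.modV, Bool.or_eq_false_iff] at hx
      rw [ih.v x hx.2]; rfl
    · simp only [Stm.modA, Bool.or_eq_false_iff] at hj
      rw [ih.a j hj.2]; rfl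
    · simp only [Stm.flows, Bool.or_eq_false_iff] at hc
      rw [ih.calls hc.2]; rfl
  | loop_true _ _ _ _ ih1 ih2 =>
    refine ⟨fun x hx => ?_, fun j hj => ?_, fun hc => ?_⟩
    · rw [ih2.v x hx, ih1.v x hx]; rfl
    · rw [ih2.a j hj, ih1.a j hj]; rfl
    · rw [ih2.calls hc, ih1.calls hc]; rfl
  | loop_false _ _ => exact ⟨fun _ _ => rfl, fun _ _ => rfl, fun _ => rfl⟩
  | flow σ I _ _ _ =>
    refine ⟨fun _ _ => rfl, fun j hj => ?_, fun h => by simp [Stm.flows] at h⟩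
    simp only [Stm.modA, decide_eq_false_iff_not] at hj
    simp [hj]

variable (W M O) in
/-- Weakest precondition: the statement halts in a state that satisfies `Q`. -/
def wp (c : Stm) (Q : St → Prop) (σ : St) : Prop := ∃ τ, Run W M O c σ τ ∧ Q τ

theorem wp_mono {c : Stm} {Q R : St → Prop} {σ : St} (h : wp W M O c Q σ)
    (hQR : ∀ τ, Frame c σ τ → Q τ → R τ) : wp W M O c R σ :=
  let ⟨τ, h1, h2⟩ := h
  ⟨τ, h1, hQR τ h1.frame h2⟩

@[simp] theorem wp_skip {Q : St → Prop} {σ : St} : wp W M O .skip Q σ ↔ Q σ.tick :=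
  ⟨fun ⟨_, h, hq⟩ => by cases h; exact hq, fun h => ⟨_, .skip σ, h⟩⟩

@[simp] theorem wp_set {x : Var} {e : Ex} {Q : St → Prop} {σ : St} :
    wp W M O (.set x e) Q σ ↔ e.ok W M σ ∧ Q (σ.set x (e.eval σ)).tick :=
  ⟨fun ⟨_, h, hq⟩ => by cases h; exact ⟨by assumption, hq⟩, fun h => ⟨_, .set σ x e h.1, h.2⟩⟩

@[simp] theorem wp_put {j : Arr} {i e : Ex} {Q : St → Prop} {σ : St} :
    wp W M O (.put j i e) Q σ ↔ i.ok W M σ ∧ e.ok W M σ ∧ i.eval σ < M ∧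
      Q (σ.put j (i.eval σ) (e.eval σ)).tick :=
  ⟨fun ⟨_, h, hq⟩ => by cases h; exact ⟨by assumption, by assumption, by assumption, hq⟩,
    fun h => ⟨_, .put σ j i e h.1 h.2.1 h.2.2.1, h.2.2.2⟩⟩

@[simp] theorem wp_seq {c d : Stm} {Q : St → Prop} {σ : St} :
    wp W M O (c ;; d) Q σ ↔ wp W M O c (wp W M O d Q) σ :=
  ⟨fun ⟨_, h, hq⟩ => by cases h with | seq h1 h2 => exact ⟨_, h1, _, h2, hq⟩,
    fun ⟨_, h1, _, h2, hq⟩ => ⟨_, .seq h1 h2, hq⟩⟩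

@[simp] theorem wp_ite {e : Ex} {c d : Stm} {Q : St → Prop} {σ : St} :
    wp W M O (.ite e c d) Q σ ↔ e.ok W M σ ∧ (e.eval σ ≠ 0 → wp W M O c Q σ.tick) ∧
      (e.eval σ = 0 → wp W M O d Q σ.tick) := by
  constructor
  · rintro ⟨τ, h, hq⟩
    cases h with
    | ite_true h1 h2 h3 => exact ⟨h1, fun _ => ⟨τ, h3, hq⟩, fun h => absurd h h2⟩
    | ite_false h1 h2 h3 => exact ⟨h1, fun h => absurd h2 h, fun _ => ⟨τ, h3, hq⟩⟩
  · rintro ⟨h1, h2, h3⟩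
    by_cases h : e.eval σ = 0
    · obtain ⟨τ, h4, hq⟩ := h3 h
      exact ⟨τ, .ite_false h1 h h4, hq⟩
    · obtain ⟨τ, h4, hq⟩ := h2 h
      exact ⟨τ, .ite_true h1 h h4, hq⟩

theorem Frame.refl (c : Stm) (σ : St) : Frame c σ σ := ⟨fun _ _ => rfl, fun _ _ => rfl, fun _ => rfl⟩

/-- Loops with an invariant `I` and a variant `V`. -/
theorem wp_loop {e : Ex} {c : Stm} {Q : St → Prop} (I : St → Prop) (V : St → ℕ) {σ : St}
    (h0 : I σ)
    (hs : ∀ τ, Frame (.loop e c) σ τ → I τ → e.ok W M τ ∧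
      (e.eval τ ≠ 0 → wp W M O c (fun υ => I υ ∧ V υ < V τ) τ.tick) ∧
      (e.eval τ = 0 → Q τ.tick)) : wp W M O (.loop e c) Q σ := by
  suffices H : ∀ N, ∀ τ, V τ ≤ N → Frame (.loop e c) σ τ → I τ → wp W M O (.loop e c) Q τ from
    H _ σ le_rfl (Frame.refl _ _) h0
  intro N
  induction N with
  | zero =>
    intro τ hV hf hI
    obtain ⟨h1, h2, h3⟩ := hs τ hf hI
    by_cases h : e.eval τ = 0
    · exact ⟨_, .loop_false h1 h, h3 h⟩
    · obtain ⟨υ, _, _, h4⟩ := h2 h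
      omega
  | succ N ih =>
    intro τ hV hf hI
    obtain ⟨h1, h2, h3⟩ := hs τ hf hI
    by_cases h : e.eval τ = 0
    · exact ⟨_, .loop_false h1 h, h3 h⟩
    · obtain ⟨υ, h4, h5, h6⟩ := h2 h
      have hf' := h4.frame
      obtain ⟨φ, h7, h8⟩ := ih υ (by omega)
        ⟨fun x hx => (hf'.v x hx).trans (hf.v x hx), fun j hj => (hf'.a j hj).trans (hf.a j hj),
          fun hc => (hf'.calls hc).trans (hf.calls hc)⟩ h5
      exact ⟨φ, .loop_true h1 h h4 h7, h8⟩

/-- `for x < bnd do c` -/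
def Stm.for (x : Var) (bnd : Ex) (c : Stm) : Stm :=
  x ≔ 0 ;; .loop (.bin .lt x bnd) (c ;; (x ≔ ((x : Ex) + 1)))

/-- Counting loops with an invariant `I`; the invariant may bound the elapsed time. -/
theorem wp_for {x : Var} {bnd : Ex} {c : Stm} {Q : St → Prop} {σ : St} (N : ℕ)
    (I : ℕ → St → Prop) (hx : c.modV x = false) (hN : N < W)
    (hb : ∀ τ, Frame (.for x bnd c) σ τ → bnd.ok W M τ ∧ bnd.eval τ = N)
    (h0 : I 0 (σ.set x 0).tick)
    (hs : ∀ i < N, ∀ τ, Frame (.for x bnd c) σ τ → τ.v x = i → I i τ →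
      wp W M O c (fun υ => I (i + 1) (υ.set x (i + 1)).tick) τ.tick)
    (hq : ∀ τ, Frame (.for x bnd c) σ τ → I N τ → Q τ.tick) :
    wp W M O (.for x bnd c) Q σ := by
  have hW : 0 < W := by omega
  have fr0 : Frame (.for x bnd c) σ (σ.set x 0).tick := by
    refine ⟨fun y hy => ?_, fun _ _ => rfl, fun _ => rfl⟩
    simp only [Stm.for, Stm.modV, Bool.or_eq_false_iff, decide_eq_false_iff_not] at hy
    simp [Ne.symm hy.1]
  refine wp_seq.2 (wp_set.2 ⟨by simp, ?_⟩)
  rw [Ex.eval_ofNat]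
  refine wp_loop (fun τ => τ.v x ≤ N ∧ I (τ.v x) τ) (fun τ => N - τ.v x)
    ⟨by simp, by simpa using h0⟩ ?_
  rintro τ hf ⟨hle, hI⟩
  have hf' : Frame (.for x bnd c) σ τ := by
    refine ⟨fun y hy => ?_, fun j hj => ?_, fun hc => ?_⟩
    · rw [hf.v y ?_, fr0.v y hy]
      simp only [Stm.for, Stm.modV, Bool.or_eq_false_iff] at hy ⊢
      exact hy.2
    · rw [hf.a j ?_, fr0.a j hj]
      simpa [Stm.for, Stm.modA] using hj
    · rw [hf.calls ?_, fr0.calls hc]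
      simpa [Stm.for, Stm.flows] using hc
  obtain ⟨b1, b2⟩ := hb τ hf'
  refine ⟨by simpa using b1, fun h => ?_, fun h => ?_⟩
  · simp only [Ex.eval_lt, Ex.eval_var, b2, ne_eq, ite_eq_right_iff, one_ne_zero, imp_false,
      not_not] at h
    refine wp_seq.2 (wp_mono (hs _ h τ hf' rfl hI) fun υ fυ hυ => ?_)
    have : υ.v x = τ.v x := fυ.v x hx
    refine wp_set.2 ⟨?_, ⟨?_, ?_⟩, ?_⟩
    · simp [this]; omega
    · simp [this]; omega
    · simpa [this] using hυ
    · simp [this]; omega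
  · simp only [Ex.eval_lt, Ex.eval_var, b2, ite_eq_right_iff, one_ne_zero, imp_false] at h
    have : τ.v x = N := by omega
    exact hq τ hf' (this ▸ hI)

/-- Counting loops whose body takes at most `t` steps in each round. -/
theorem wp_for_time {x : Var} {bnd : Ex} {c : Stm} {Q : St → Prop} {σ : St} (N t : ℕ)
    (I : ℕ → St → Prop) (hx : c.modV x = false) (hN : N < W)
    (hb : ∀ τ, Frame (.for x bnd c) σ τ → bnd.ok W M τ ∧ bnd.eval τ = N)
    (h0 : I 0 (σ.set x 0).tick)
    (hs : ∀ i < N, ∀ τ, Frame (.for x bnd c) σ τ → τ.v x = i → I i τ →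
      wp W M O c (fun υ => υ.time ≤ τ.time + 1 + t ∧ I (i + 1) (υ.set x (i + 1)).tick) τ.tick)
    (hq : ∀ τ, Frame (.for x bnd c) σ τ → I N τ → τ.time ≤ σ.time + 1 + (t + 2) * N → Q τ.tick) :
    wp W M O (.for x bnd c) Q σ := by
  refine wp_for N (fun i τ => I i τ ∧ τ.time ≤ σ.time + 1 + (t + 2) * i) hx hN hb
    ⟨h0, by simp⟩ ?_ fun τ hf h => hq τ hf h.1 h.2
  rintro i hi τ hf hxi ⟨hI, ht⟩
  refine wp_mono (hs i hi τ hf hxi hI) fun υ _ hυ => ⟨hυ.2, ?_⟩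
  simp only [St.tick_time, St.set_time, Nat.mul_add]
  have := hυ.1
  omega

end Rules

end StructRAM

/-! ### Maximum flows and minimum cuts -/

namespace FlowInstance

variable (I : FlowInstance) (f : Fin I.arcs → ℕ)

/-- The set of nodes is closed under residual arcs of the flow `f`. -/
def ResClosed (p : Fin I.nodes → Prop) : Prop :=
  ∀ a, (p (I.tail a) → f a < I.cap a → p (I.head a)) ∧ (p (I.head a) → 0 < f a → p (I.tail a))

open Classical in
/-- The capacity of the arcs that leave the set of nodes `p`. -/
noncomputable def cutCap (p : Fin I.nodes → Prop) : ℕ :=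
  ∑ a, if p (I.tail a) ∧ ¬ p (I.head a) then I.cap a else 0

/-- The net flow out of a node. -/
def net (v : Fin I.nodes) : ℤ := (I.outFlow f v : ℤ) - I.inFlow f v

/-- The nodes that can be reached from the source in the residual graph in `k` steps. -/
def resLevel : ℕ → Fin I.nodes → Prop
  | 0, v => v = I.source
  | k + 1, v => resLevel k v ∨ ∃ a, (resLevel k (I.tail a) ∧ I.head a = v ∧ f a < I.cap a) ∨
      (resLevel k (I.head a) ∧ I.tail a = v ∧ 0 < f a)

variable {I f}

theorem outFlow_update (g : Fin I.arcs → ℕ) (a : Fin I.arcs) (k : ℕ) (v : Fin I.nodes) :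
    (I.outFlow (Function.update g a k) v : ℤ) =
      I.outFlow g v + if I.tail a = v then (k : ℤ) - g a else 0 := by
  simp only [outFlow, Nat.cast_sum, Finset.sum_filter]
  rw [← Finset.add_sum_erase _ _ (Finset.mem_univ a), ← Finset.add_sum_erase (Finset.univ)
    (fun b => ((if I.tail b = v then g b else 0 : ℕ) : ℤ)) (Finset.mem_univ a)]
  rw [Finset.sum_congr rfl (g := fun b => ((if I.tail b = v then g b else 0 : ℕ) : ℤ))]
  · simp only [Function.update_self]; split_ifs <;> push_cast <;> ring
  · intro b hb
    rw [Function.update_of_ne (Finset.ne_of_mem_erase hb)]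

theorem inFlow_update (g : Fin I.arcs → ℕ) (a : Fin I.arcs) (k : ℕ) (v : Fin I.nodes) :
    (I.inFlow (Function.update g a k) v : ℤ) =
      I.inFlow g v + if I.head a = v then (k : ℤ) - g a else 0 := by
  simp only [inFlow, Nat.cast_sum, Finset.sum_filter]
  rw [← Finset.add_sum_erase _ _ (Finset.mem_univ a), ← Finset.add_sum_erase (Finset.univ)
    (fun b => ((if I.head b = v then g b else 0 : ℕ) : ℤ)) (Finset.mem_univ a)]
  rw [Finset.sum_congr rfl (g := fun b => ((if I.head b = v then g b else 0 : ℕ) : ℤ))]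
  · simp only [Function.update_self]; split_ifs <;> push_cast <;> ring
  · intro b hb
    rw [Function.update_of_ne (Finset.ne_of_mem_erase hb)]

theorem net_update (g : Fin I.arcs → ℕ) (a : Fin I.arcs) (k : ℕ) (v : Fin I.nodes) :
    I.net (Function.update g a k) v = I.net g v + (if I.tail a = v then (k : ℤ) - g a else 0) -
      if I.head a = v then (k : ℤ) - g a else 0 := by
  simp only [net, outFlow_update, inFlow_update]; ring

/-- One unit of flow can be sent from the source to a node of residual level `k`, changing the
flow only between nodes of level `k`. -/
theorem exists_push (hf : ∀ a, f a ≤ I.cap a) (k : ℕ) : ∀ v, I.resLevel f k v →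
    ∃ g : Fin I.arcs → ℕ, (∀ a, g a ≤ I.cap a) ∧
      (∀ a, ¬ I.resLevel f k (I.tail a) ∨ ¬ I.resLevel f k (I.head a) → g a = f a) ∧
      ∀ x, I.net g x = I.net f x + (if x = I.source then 1 else 0) - if x = v then 1 else 0 := by
  induction k with
  | zero =>
    rintro v rfl
    exact ⟨f, hf, fun _ _ => rfl, fun x => by ring⟩
  | succ k ih =>
    intro v hv
    by_cases hk : I.resLevel f k v
    · obtain ⟨g, h1, h2, h3⟩ := ih v hk
      refine ⟨g, h1, fun a ha => h2 a ?_, h3⟩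
      exact ha.imp (fun h h' => h (.inl h')) (fun h h' => h (.inl h'))
    obtain hv | ⟨a, ⟨hu, rfl, ha⟩ | ⟨hu, rfl, ha⟩⟩ := hv
    · exact absurd hv hk
    · obtain ⟨g, h1, h2, h3⟩ := ih _ hu
      have hga : g a = f a := h2 a (.inr hk)
      refine ⟨Function.update g a (f a + 1), ?_, ?_, ?_⟩
      · intro b
        by_cases hb : b = a
        · subst hb; simpa using ha
        · simpa [hb] using h1 b
      · intro b hb
        have : b ≠ a := by
          rintro rfl
          rcases hb with hb | hb
          · exact hb (.inl hu)
          · exact hb (.inr ⟨b, .inl ⟨hu, rfl, ha⟩⟩)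
        rw [Function.update_of_ne this]
        exact h2 b (hb.imp (fun h h' => h (.inl h')) (fun h h' => h (.inl h')))
      · intro x
        rw [net_update, h3 x, hga]
        push_cast
        simp only [eq_comm (a := x)]
        split_ifs <;> ring
    · obtain ⟨g, h1, h2, h3⟩ := ih _ hu
      have hga : g a = f a := h2 a (.inl hk)
      refine ⟨Function.update g a (f a - 1), ?_, ?_, ?_⟩
      · intro b
        by_cases hb : b = a
        · subst hb; have := hf b; simp; omega
        · simpa [hb] using h1 b
      · intro b hb
        have : b ≠ a := by
          rintro rfl
          rcases hb with hb | hb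
          · exact hb (.inr ⟨b, .inr ⟨hu, rfl, ha⟩⟩)
          · exact hb (.inl hu)
        rw [Function.update_of_ne this]
        exact h2 b (hb.imp (fun h h' => h (.inl h')) (fun h h' => h (.inl h')))
      · intro x
        rw [net_update, h3 x, hga, Nat.cast_sub ha]
        push_cast
        simp only [eq_comm (a := x)]
        split_ifs <;> ring

theorem resClosed_resLevel : I.ResClosed f fun v => ∃ k, I.resLevel f k v :=
  fun a => ⟨fun ⟨k, hk⟩ h => ⟨k + 1, .inr ⟨a, .inl ⟨hk, rfl, h⟩⟩⟩,
    fun ⟨k, hk⟩ h => ⟨k + 1, .inr ⟨a, .inr ⟨hk, rfl, h⟩⟩⟩⟩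

/-- There is no augmenting path for a maximum flow. -/
theorem IsMaxFlow.not_resLevel_sink (h : I.IsMaxFlow f) (k : ℕ) : ¬ I.resLevel f k I.sink := by
  intro hk
  obtain ⟨g, h1, -, h3⟩ := exists_push h.1.1 k _ hk
  have hg : I.IsFlow g := by
    refine ⟨h1, fun v hs ht => ?_⟩
    have := h3 v
    have hv := h.1.2 v hs ht
    simp only [if_neg hs, if_neg ht, net] at this
    omega
  have := h.2 g hg
  have h4 := h3 I.source
  simp only [if_true, if_neg I.source_ne_sink, net] at h4
  simp only [value] at this
  omega

open Classical in
theorem IsFlow.value_eq (h : I.IsFlow f) {p : Fin I.nodes → Prop} (hs : p I.source)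
    (ht : ¬ p I.sink) : I.value f =
      ∑ a, (f a : ℤ) * ((if p (I.tail a) then 1 else 0) - if p (I.head a) then 1 else 0) := by
  have h1 : I.value f = ∑ v ∈ Finset.univ.filter p, I.net f v := by
    rw [Finset.sum_eq_single I.source]
    · rfl
    · intro v hv hne
      have : v ≠ I.sink := by
        rintro rfl; exact ht (Finset.mem_filter.1 hv).2
      have := h.2 v hne this
      simp only [net]; omega
    · intro h; exact absurd (Finset.mem_filter.2 ⟨Finset.mem_univ _, hs⟩) h
  rw [h1]
  simp only [net, outFlow, inFlow, Finset.sum_sub_distrib, mul_sub, Nat.cast_sum,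
    Finset.sum_filter]
  congr 1
  · have this (v : Fin I.nodes) : (if p v then ∑ a, ((if I.tail a = v then f a else 0 : ℕ) : ℤ) else 0) =
        ∑ a, if I.tail a = v then (if p (I.tail a) then (f a : ℤ) else 0) else 0 := by
      split_ifs with hv
      · refine Finset.sum_congr rfl fun a _ => ?_
        split_ifs with h1 h2 <;> simp_all
      · refine (Finset.sum_eq_zero fun a _ => ?_).symm
        split_ifs with h1 h2 <;> simp_all
    simp only [this]
    rw [Finset.sum_comm]
    simp
  · have this (v : Fin I.nodes) : (if p v then ∑ a, ((if I.head a = v then f a else 0 : ℕ) : ℤ) else 0) =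
        ∑ a, if I.head a = v then (if p (I.head a) then (f a : ℤ) else 0) else 0 := by
      split_ifs with hv
      · refine Finset.sum_congr rfl fun a _ => ?_
        split_ifs with h1 h2 <;> simp_all
      · refine (Finset.sum_eq_zero fun a _ => ?_).symm
        split_ifs with h1 h2 <;> simp_all
    simp only [this]
    rw [Finset.sum_comm]
    simp

theorem IsFlow.value_le_cutCap (h : I.IsFlow f) {p : Fin I.nodes → Prop} (hs : p I.source)
    (ht : ¬ p I.sink) : I.value f ≤ I.cutCap p := by
  classical
  rw [h.value_eq hs ht, cutCap, Nat.cast_sum]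
  refine Finset.sum_le_sum fun a _ => ?_
  have := h.1 a
  split_ifs <;> simp_all

theorem IsFlow.value_eq_cutCap_iff (h : I.IsFlow f) {p : Fin I.nodes → Prop} (hs : p I.source)
    (ht : ¬ p I.sink) : I.value f = I.cutCap p ↔ I.ResClosed f p := by
  classical
  rw [h.value_eq hs ht, cutCap, Nat.cast_sum, Finset.sum_eq_sum_iff_of_le]
  · simp only [Finset.mem_univ, forall_const, ResClosed]
    refine forall_congr' fun a => ?_
    have := h.1 a
    by_cases h1 : p (I.tail a) <;> by_cases h2 : p (I.head a) <;> simp [h1, h2]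
    · omega
  · intro a _
    have := h.1 a
    split_ifs <;> simp_all

/-- The least residually closed set that contains the source is a minimum cut, and it is contained
in every minimum cut. -/
theorem IsMaxFlow.cutCap_le (h : I.IsMaxFlow f) {p : Fin I.nodes → Prop} (hs : p I.source)
    (hp : I.ResClosed f p) (hmin : ∀ q, q I.source → I.ResClosed f q → ∀ v, p v → q v) :
    ¬ p I.sink ∧ ∀ q : Fin I.nodes → Prop, q I.source → ¬ q I.sink →
      I.cutCap p ≤ I.cutCap q ∧ (I.cutCap p = I.cutCap q → ∀ v, p v → q v) := by
  have ht : ¬ p I.sink := fun hps => by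
    obtain ⟨k, hk⟩ := hmin _ ⟨0, rfl⟩ (resClosed_resLevel (I := I) (f := f)) _ hps
    exact h.not_resLevel_sink k hk
  refine ⟨ht, fun q hqs hqt => ?_⟩
  have h1 := (h.1.value_eq_cutCap_iff hs ht).2 hp
  have h2 := h.1.value_le_cutCap hqs hqt
  refine ⟨by omega, fun he => hmin q hqs ?_⟩
  exact (h.1.value_eq_cutCap_iff hqs hqt).1 (by omega)

end FlowInstance

/-! ### Strong vertex sets -/

namespace WGraph

variable {n m : ℕ} (G : WGraph n m)

/-- The total weight of the edges of `G[U]` whose ends have different colours. -/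
def dcut (U : Finset (Fin n)) (g : Fin n → ℕ) : ℕ :=
  ∑ e with G.src e ∈ U ∧ G.dst e ∈ U ∧ g (G.src e) ≠ g (G.dst e), G.weight e

/-- The number of colours on `U`. -/
def ncol (U : Finset (Fin n)) (g : Fin n → ℕ) : ℕ := (U.image g).card

/-- The excess of the multiway cut into colour classes over the ratio `μ`. -/
def excess (μ : ℚ) (U : Finset (Fin n)) (g : Fin n → ℕ) : ℚ :=
  G.dcut U g - μ * ((ncol U g : ℚ) - 1)

/-- All multiway cuts of `G[U]` have ratio larger than `μ`. Multiway cuts are given by colourings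
of the vertices. -/
def Strong (μ : ℚ) (U : Finset (Fin n)) : Prop :=
  U.Nonempty ∧ ∀ g : Fin n → ℕ, 2 ≤ ncol U g → 0 < G.excess μ U g

variable {G} {U W X Y : Finset (Fin n)} {g g' : Fin n → ℕ} {μ ν : ℚ}

theorem dcut_congr (h : ∀ u ∈ U, g u = g' u) : G.dcut U g = G.dcut U g' := by
  refine Finset.sum_congr (Finset.filter_congr fun e _ => ?_) fun _ _ => rfl
  refine and_congr_right fun h1 => and_congr_right fun h2 => ?_
  rw [h _ h1, h _ h2]

theorem ncol_congr (h : ∀ u ∈ U, g u = g' u) : ncol U g = ncol U g' := by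
  unfold ncol; rw [Finset.image_congr (fun u hu => h u hu)]

theorem excess_congr (h : ∀ u ∈ U, g u = g' u) : G.excess μ U g = G.excess μ U g' := by
  simp only [excess, dcut_congr h, ncol_congr h]

theorem dcut_mono (h : U ⊆ W) : G.dcut U g ≤ G.dcut W g := by
  refine Finset.sum_le_sum_of_subset fun e he => ?_
  simp only [Finset.mem_filter, Finset.mem_univ, true_and] at he ⊢
  exact ⟨h he.1, h he.2.1, he.2.2⟩

theorem ncol_pos (h : U.Nonempty) : 1 ≤ ncol U g := Finset.card_pos.2 (h.image g)

theorem two_le_ncol {u v : Fin n} (hu : u ∈ U) (hv : v ∈ U) (h : g u ≠ g v) : 2 ≤ ncol U g :=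
  Finset.one_lt_card.2 ⟨_, Finset.mem_image_of_mem g hu, _, Finset.mem_image_of_mem g hv, h⟩

theorem exists_of_two_le_ncol (h : 2 ≤ ncol U g) : ∃ u ∈ U, ∃ v ∈ U, g u ≠ g v := by
  obtain ⟨c, hc, d, hd, hne⟩ := Finset.one_lt_card.1 h
  obtain ⟨u, hu, rfl⟩ := Finset.mem_image.1 hc
  obtain ⟨v, hv, rfl⟩ := Finset.mem_image.1 hd
  exact ⟨u, hu, v, hv, hne⟩

theorem excess_of_ncol_eq_one (h : ncol U g = 1) : 0 ≤ G.excess μ U g := by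
  simp [excess, h]

theorem Strong.excess_nonneg (h : G.Strong μ U) (g : Fin n → ℕ) : 0 ≤ G.excess μ U g := by
  by_cases h2 : 2 ≤ ncol U g
  · exact (h.2 g h2).le
  · exact excess_of_ncol_eq_one (by have := ncol_pos (g := g) h.1; omega)

theorem Strong.mono (hν : ν ≤ μ) (h : G.Strong μ U) : G.Strong ν U := by
  refine ⟨h.1, fun g hg => (h.2 g hg).trans_le ?_⟩
  have : (2 : ℚ) ≤ ncol U g := by exact_mod_cast hg
  have := mul_le_mul_of_nonneg_right hν (show (0 : ℚ) ≤ (ncol U g : ℚ) - 1 by linarith)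
  simp only [excess]
  linarith

theorem strong_singleton (u : Fin n) : G.Strong μ {u} := by
  refine ⟨Finset.singleton_nonempty u, fun g hg => ?_⟩
  simp [ncol] at hg

/-- The colouring obtained from `g` by merging all colours that occur on `X` into the colour `c`. -/
def mergeCol (g : Fin n → ℕ) (X : Finset (Fin n)) (c : ℕ) (v : Fin n) : ℕ :=
  if g v ∈ X.image g then c else g v

theorem ncol_mergeCol (hX : X ⊆ W) {x : Fin n} (hx : x ∈ X) :
    ncol W (mergeCol g X (g x)) + ncol X g = ncol W g + 1 := by
  have h1 : W.image (mergeCol g X (g x)) = insert (g x) (W.image g \ X.image g) := by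
    ext c
    simp only [mergeCol, Finset.mem_image, Finset.mem_insert, Finset.mem_sdiff]
    constructor
    · rintro ⟨v, hv, rfl⟩
      split_ifs with h
      · exact .inl rfl
      · exact .inr ⟨⟨v, hv, rfl⟩, h⟩
    · rintro (rfl | ⟨⟨v, hv, rfl⟩, h⟩)
      · exact ⟨x, hX hx, if_pos ⟨x, hx, rfl⟩⟩
      · exact ⟨v, hv, if_neg h⟩
  have h2 : g x ∉ W.image g \ X.image g := fun h =>
    (Finset.mem_sdiff.1 h).2 (Finset.mem_image_of_mem g hx)
  unfold ncol
  rw [h1, Finset.card_insert_of_notMem h2, Finset.card_sdiff_of_subset (Finset.image_subset_image hX)]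
  have := Finset.card_le_card (Finset.image_subset_image (f := g) hX)
  omega

theorem dcut_mergeCol (hX : X ⊆ W) (c : ℕ) :
    G.dcut X g + G.dcut W (mergeCol g X c) ≤ G.dcut W g := by
  unfold dcut
  rw [← Finset.sum_union]
  · refine Finset.sum_le_sum_of_subset fun e he => ?_
    simp only [Finset.mem_union, Finset.mem_filter, Finset.mem_univ, true_and] at he ⊢
    rcases he with he | he
    · exact ⟨hX he.1, hX he.2.1, he.2.2⟩
    · exact ⟨he.1, he.2.1, fun h => he.2.2 (by simp only [mergeCol, h])⟩
  · refine Finset.disjoint_left.2 fun e h1 h2 => ?_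
    simp only [Finset.mem_filter, Finset.mem_univ, true_and] at h1 h2
    refine h2.2.2 ?_
    simp only [mergeCol, if_pos (Finset.mem_image_of_mem g h1.1),
      if_pos (Finset.mem_image_of_mem g h1.2.1)]

theorem excess_mergeCol (hX : X ⊆ W) {x : Fin n} (hx : x ∈ X) :
    G.excess μ X g + G.excess μ W (mergeCol g X (g x)) ≤ G.excess μ W g := by
  have h1 : (ncol W (mergeCol g X (g x)) : ℚ) + ncol X g = ncol W g + 1 := by
    exact_mod_cast ncol_mergeCol hX hx
  have h2 : (G.dcut X g : ℚ) + G.dcut W (mergeCol g X (g x)) ≤ G.dcut W g := by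
    exact_mod_cast dcut_mergeCol hX (g x)
  have h3 : (ncol W (mergeCol g X (g x)) : ℚ) = ncol W g + 1 - ncol X g := by linarith
  simp only [excess, h3]
  linarith

/-- Strong sets that meet have a strong union: merging the colours on `X` splits a multiway cut of
`X ∪ Y` into one of `X` and one of `Y`. Hence the maximal strong sets form a partition. -/
theorem Strong.union (hX : G.Strong μ X) (hY : G.Strong μ Y) {x : Fin n} (hxX : x ∈ X)
    (hxY : x ∈ Y) : G.Strong μ (X ∪ Y) := by
  refine ⟨hX.1.mono Finset.subset_union_left, fun g hg => ?_⟩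
  have h1 := excess_mergeCol (G := G) (μ := μ) (g := g) (W := X ∪ Y) Finset.subset_union_left hxX
  have h2 := ncol_mergeCol (g := g) (W := X ∪ Y) Finset.subset_union_left hxX
  have h3 : ncol (X ∪ Y) (mergeCol g X (g x)) = ncol Y (mergeCol g X (g x)) := by
    unfold ncol
    rw [Finset.image_union, Finset.union_eq_right.2]
    intro c hc
    obtain ⟨v, hv, rfl⟩ := Finset.mem_image.1 hc
    refine Finset.mem_image.2 ⟨x, hxY, ?_⟩
    simp only [mergeCol, if_pos (Finset.mem_image_of_mem g hxX),
      if_pos (Finset.mem_image_of_mem g hv)]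
  have h4 : G.excess μ Y (mergeCol g X (g x)) ≤ G.excess μ (X ∪ Y) (mergeCol g X (g x)) := by
    simp only [excess, h3]
    have : (G.dcut Y (mergeCol g X (g x)) : ℚ) ≤ G.dcut (X ∪ Y) (mergeCol g X (g x)) := by
      exact_mod_cast dcut_mono Finset.subset_union_right
    linarith
  have h5 := hX.excess_nonneg g
  have h6 := hY.excess_nonneg (mergeCol g X (g x))
  by_cases hc : 2 ≤ ncol X g
  · have := hX.2 g hc; linarith
  · have := hY.2 (mergeCol g X (g x)) (by omega); linarith

/-- A set is strong if it is partitioned into strong sets and no multiway cut that respects the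
partition violates its strength. -/
theorem strong_of_classes (hW : W.Nonempty) (ℓ : Fin n → ℕ)
    (hcl : ∀ u ∈ W, G.Strong μ (W.filter fun v => ℓ v = ℓ u))
    (hco : ∀ γ : ℕ → ℕ, 2 ≤ ncol W (γ ∘ ℓ) → 0 < G.excess μ W (γ ∘ ℓ)) : G.Strong μ W := by
  refine ⟨hW, fun g => ?_⟩
  induction hN : ncol W g using Nat.strong_induction_on generalizing g with
  | _ N ih =>
  subst hN
  intro hg
  by_cases hs : ∃ u ∈ W, 2 ≤ ncol (W.filter fun v => ℓ v = ℓ u) g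
  · obtain ⟨u, hu, h2⟩ := hs
    have huX : u ∈ W.filter fun v => ℓ v = ℓ u := Finset.mem_filter.2 ⟨hu, rfl⟩
    have h1 := excess_mergeCol (G := G) (μ := μ) (g := g) (Finset.filter_subset _ W) huX
    have h3 := ncol_mergeCol (g := g) (Finset.filter_subset _ W) huX
    have h4 := (hcl u hu).2 g h2
    by_cases h5 : 2 ≤ ncol W (mergeCol g (W.filter fun v => ℓ v = ℓ u) (g u))
    · have := ih _ (by omega) _ rfl h5
      linarith
    · have := excess_of_ncol_eq_one (G := G) (μ := μ) (U := W)
        (g := mergeCol g (W.filter fun v => ℓ v = ℓ u) (g u))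
        (by have := ncol_pos (g := mergeCol g (W.filter fun v => ℓ v = ℓ u) (g u)) hW; omega)
      linarith
  · have hconst : ∀ u ∈ W, ∀ v ∈ W, ℓ u = ℓ v → g u = g v := by
      intro u hu v hv h
      by_contra hne
      refine hs ⟨u, hu, two_le_ncol (u := u) (v := v) ?_ ?_ hne⟩
      · exact Finset.mem_filter.2 ⟨hu, rfl⟩
      · exact Finset.mem_filter.2 ⟨hv, h.symm⟩
    classical
    let γ : ℕ → ℕ := fun c => if h : ∃ u ∈ W, ℓ u = c then g h.choose else 0
    have hγ : ∀ u ∈ W, g u = (γ ∘ ℓ) u := by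
      intro u hu
      have h : ∃ v ∈ W, ℓ v = ℓ u := ⟨u, hu, rfl⟩
      simp only [γ, Function.comp, dif_pos h]
      exact hconst u hu _ h.choose_spec.1 h.choose_spec.2.symm
    rw [excess_congr hγ]
    exact hco γ (by rwa [← ncol_congr hγ])

/-! ### Components of threshold graphs -/

variable (G) in
/-- The set `X` is connected in `G[X]` by edges with the property `F`: there is no nonconstant
colouring for which these edges are monochromatic. -/
def Linked (F : Fin m → Prop) (X : Finset (Fin n)) : Prop :=
  ∀ g : Fin n → ℕ, (∀ e, F e → G.src e ∈ X → G.dst e ∈ X → g (G.src e) = g (G.dst e)) →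
    ∀ u ∈ X, ∀ v ∈ X, g u = g v

variable (G) in
/-- No edge with the property `F` leaves `X`. -/
def Closed (F : Fin m → Prop) (X : Finset (Fin n)) : Prop :=
  ∀ e, F e → (G.src e ∈ X ↔ G.dst e ∈ X)

theorem Strong.linked {F : Fin m → Prop} (h : G.Strong μ X) (hμ : 0 ≤ μ)
    (hF : ∀ e, G.src e ∈ X → G.dst e ∈ X → F e) : G.Linked F X := by
  intro g hg u hu v hv
  by_contra hne
  have h2 := two_le_ncol hu hv hne
  have h3 := h.2 g h2
  have h4 : G.dcut X g = 0 := by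
    refine Finset.sum_eq_zero fun e he => ?_
    simp only [Finset.mem_filter, Finset.mem_univ, true_and] at he
    exact absurd (hg e (hF e he.1 he.2.1) he.1 he.2.1) he.2.2
  have h5 : (2 : ℚ) ≤ ncol X g := by exact_mod_cast h2
  have := mul_nonneg hμ (show (0 : ℚ) ≤ (ncol X g : ℚ) - 1 by linarith)
  simp only [excess, h4, Nat.cast_zero] at h3
  linarith

theorem Linked.mono {F F' : Fin m → Prop} (h : G.Linked F X)
    (hF : ∀ e, F e → G.src e ∈ X → G.dst e ∈ X → F' e) : G.Linked F' X :=
  fun g hg => h g fun e he hs hd => hg e (hF e he hs hd) hs hd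

theorem Linked.subset_of_closed {F : Fin m → Prop} (h : G.Linked F X) (hY : G.Closed F Y)
    {x : Fin n} (hx : x ∈ X) (hxY : x ∈ Y) : X ⊆ Y := by
  intro v hv
  have := h (fun u => if u ∈ Y then 1 else 0) (fun e he _ _ => by simp only [hY e he]) x hx v hv
  simp only [hxY, if_true] at this
  by_contra hv'
  simp [hv'] at this

variable (G) in
/-- `k / D` approximates the strength of the edge `e` from below, with error at most `s / D`: some
set that contains `e` is strong at `k / D`, but none at `(k + s) / D`. -/
def EdgeApprox (D s k : ℕ) (e : Fin m) : Prop :=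
  s ∣ k ∧ (∃ U, G.src e ∈ U ∧ G.dst e ∈ U ∧ G.Strong ((k : ℚ) / D) U) ∧
    ∀ U, G.src e ∈ U → G.dst e ∈ U → ¬ G.Strong (((k + s : ℕ) : ℚ) / D) U

theorem Strong.mono_div {D k k' : ℕ} (hk : k' ≤ k) (h : G.Strong ((k : ℚ) / D) U) :
    G.Strong ((k' : ℚ) / D) U :=
  h.mono (div_le_div_of_nonneg_right (by exact_mod_cast hk) (Nat.cast_nonneg D))

theorem EdgeApprox.le_of_strong {D s k t : ℕ} {e : Fin m} (h : G.EdgeApprox D s k e) (ht : s ∣ t)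
    (hs : G.src e ∈ U) (hd : G.dst e ∈ U) (hU : G.Strong ((t : ℚ) / D) U) : t ≤ k := by
  by_contra hlt
  push Not at hlt
  have h1 : k + s ≤ t := by
    obtain ⟨a, rfl⟩ := h.1
    obtain ⟨b, rfl⟩ := ht
    have : a < b := lt_of_mul_lt_mul_left hlt (Nat.zero_le s)
    calc s * a + s = s * (a + 1) := by ring
      _ ≤ s * b := Nat.mul_le_mul_left s this
  exact h.2.2 U hs hd (hU.mono_div h1)

/-- A component of the graph of the edges with `κ e ≥ t` is strong at `t / D`. -/
theorem strong_of_linked {D s t : ℕ} {κ : Fin m → ℕ} (hκ : ∀ e, G.EdgeApprox D s (κ e) e)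
    (ht : s ∣ t) (hne : X.Nonempty) (hl : G.Linked (fun e => t ≤ κ e) X)
    (hc : G.Closed (fun e => t ≤ κ e) X) : G.Strong ((t : ℚ) / D) X := by
  classical
  obtain ⟨x, hx⟩ := hne
  obtain ⟨Z, hZ, hmax⟩ := Finset.exists_max_image
    (Finset.univ.filter fun Z : Finset (Fin n) => x ∈ Z ∧ G.Strong ((t : ℚ) / D) Z) Finset.card
    ⟨{x}, by simp [strong_singleton]⟩
  simp only [Finset.mem_filter, Finset.mem_univ, true_and] at hZ hmax
  have hZX : Z ⊆ X := (hZ.2.linked (by positivity) fun e hs hd =>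
    (hκ e).le_of_strong ht hs hd hZ.2).subset_of_closed hc hZ.1 hx
  have habs : ∀ Y y, y ∈ Y → y ∈ Z → G.Strong ((t : ℚ) / D) Y → Y ⊆ Z := by
    intro Y y hy hyZ hY
    have h1 := hmax (Z ∪ Y) ⟨Finset.mem_union_left _ hZ.1, hZ.2.union hY hyZ hy⟩
    have h2 := Finset.eq_of_subset_of_card_le Finset.subset_union_left h1
    exact Finset.union_eq_left.1 h2.symm
  have hXZ : X ⊆ Z := by
    refine hl.subset_of_closed (fun e he => ?_) hx hZ.1
    obtain ⟨Y, h1, h2, h3⟩ := (hκ e).2.1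
    exact ⟨fun h => habs Y _ h1 h (h3.mono_div he) h2, fun h => habs Y _ h2 h (h3.mono_div he) h1⟩
  rw [Finset.Subset.antisymm hXZ hZX]
  exact hZ.2

/-- An edge inside a component of the graph of the edges with `κ e ≥ t` has `κ e ≥ t`. -/
theorem le_of_linked {D s t : ℕ} {κ : Fin m → ℕ} (hκ : ∀ e, G.EdgeApprox D s (κ e) e)
    (ht : s ∣ t) (hl : G.Linked (fun e => t ≤ κ e) X) (hc : G.Closed (fun e => t ≤ κ e) X)
    {e : Fin m} (hs : G.src e ∈ X) (hd : G.dst e ∈ X) : t ≤ κ e :=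
  (hκ e).le_of_strong ht hs hd (strong_of_linked hκ ht ⟨_, hs⟩ hl hc)

/-! ### Contraction of best sets of labels -/

variable (G) in
/-- The weight of the edges inside the set of labels `S`, where `a` and `b` are the labels of the
ends of an edge. -/
def cw (a b : Fin m → ℕ) (S : Finset ℕ) : ℕ :=
  ∑ e with a e ≠ b e ∧ a e ∈ S ∧ b e ∈ S, G.weight e

variable (G) in
/-- No set of labels below `v` spans edges of scaled weight more than `L * (|S| - 1)`. -/
def Sparse (D L : ℕ) (a b : Fin m → ℕ) (v : ℕ) : Prop :=
  ∀ S ⊆ Finset.range v, S.Nonempty → D * G.cw a b S + L ≤ L * S.card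

variable (G) in
/-- Among the sets of labels that contain `v` and otherwise labels below `v`, the set `S` is the
least one that maximizes `D * cw S - L * |S|`. -/
structure Best (D L : ℕ) (a b : Fin m → ℕ) (v : ℕ) (S : Finset ℕ) : Prop where
  mem : v ∈ S
  sub : S ⊆ Finset.range (v + 1)
  le : ∀ T ⊆ Finset.range (v + 1), v ∈ T → D * G.cw a b T + L * S.card ≤ D * G.cw a b S + L * T.card
  min : ∀ T ⊆ Finset.range (v + 1), v ∈ T →
    D * G.cw a b T + L * S.card = D * G.cw a b S + L * T.card → S ⊆ T

/-- Renaming all labels in `S` to `v`. -/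
def collapse (S : Finset ℕ) (v c : ℕ) : ℕ := if c ∈ S then v else c

theorem Best.sparse {D L v : ℕ} {a b : Fin m → ℕ} {S : Finset ℕ} (h : G.Best D L a b v S)
    (hsp : G.Sparse D L a b v) :
    G.Sparse D L (fun e => collapse S v (a e)) (fun e => collapse S v (b e)) (v + 1) := by
  intro T hT hne
  by_cases hv : v ∈ T
  · have h1 : G.cw (fun e => collapse S v (a e)) (fun e => collapse S v (b e)) T + G.cw a b S ≤
        G.cw a b (T ∪ S) := by
      unfold cw
      rw [← Finset.sum_union]
      · refine Finset.sum_le_sum_of_subset fun e he => ?_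
        simp only [Finset.mem_union, Finset.mem_filter, Finset.mem_univ, true_and] at he ⊢
        simp only [collapse] at he
        rcases he with ⟨h1, h2, h3⟩ | ⟨h1, h2, h3⟩
        · refine ⟨fun h => h1 (by rw [h]), ?_, ?_⟩
          · by_cases h4 : a e ∈ S
            · exact .inr h4
            · rw [if_neg h4] at h2; exact .inl h2
          · by_cases h4 : b e ∈ S
            · exact .inr h4
            · rw [if_neg h4] at h3; exact .inl h3
        · exact ⟨h1, .inr h2, .inr h3⟩
      · refine Finset.disjoint_left.2 fun e h1 h2 => ?_
        simp only [Finset.mem_filter, Finset.mem_univ, true_and] at h1 h2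
        simp only [collapse] at h1
        exact h1.1 (by rw [if_pos h2.2.1, if_pos h2.2.2])
    have h2 := h.le (T ∪ S) (Finset.union_subset hT h.sub) (Finset.mem_union_left _ hv)
    have h3 : (T ∪ S).card + 1 ≤ T.card + S.card := by
      rw [← Finset.card_union_add_card_inter]
      have : 0 < (T ∩ S).card := Finset.card_pos.2 ⟨v, Finset.mem_inter.2 ⟨hv, h.mem⟩⟩
      omega
    have h4 := Nat.mul_le_mul_left D h1
    have h5 := Nat.mul_le_mul_left L h3
    simp only [Nat.mul_add, Nat.mul_one] at h4 h5
    omega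
  · have hT' : T ⊆ Finset.range v := fun c hc => by
      have h1 := Finset.mem_range.1 (hT hc)
      have h2 : c ≠ v := fun h => hv (h ▸ hc)
      exact Finset.mem_range.2 (by omega)
    have h1 : G.cw (fun e => collapse S v (a e)) (fun e => collapse S v (b e)) T ≤ G.cw a b T := by
      refine Finset.sum_le_sum_of_subset fun e he => ?_
      simp only [Finset.mem_filter, Finset.mem_univ, true_and] at he ⊢
      simp only [collapse] at he
      obtain ⟨h1, h2, h3⟩ := he
      have h4 : a e ∉ S := fun h => hv (by rwa [if_pos h] at h2)
      have h5 : b e ∉ S := fun h => hv (by rwa [if_pos h] at h3)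
      rw [if_neg h4] at h1 h2
      rw [if_neg h5] at h1 h3
      exact ⟨h1, h2, h3⟩
    have := hsp T hT' hne
    have := Nat.mul_le_mul_left D h1
    omega

theorem cw_fiberwise (a b : Fin m → ℕ) (S : Finset ℕ) (γ : ℕ → ℕ) :
    G.cw a b S = (∑ e with (a e ≠ b e ∧ a e ∈ S ∧ b e ∈ S) ∧ γ (a e) ≠ γ (b e), G.weight e) +
      ∑ c ∈ S.image γ, G.cw a b (S.filter fun s => γ s = c) := by
  unfold cw
  rw [← Finset.sum_filter_add_sum_filter_not _ (fun e => γ (a e) ≠ γ (b e)), Finset.filter_filter,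
    Finset.filter_filter]
  congr 1
  rw [← Finset.sum_fiberwise_of_maps_to (t := S.image γ) (g := fun e => γ (a e))]
  · refine Finset.sum_congr rfl fun c _ => ?_
    rw [Finset.filter_filter]
    refine Finset.sum_congr (Finset.filter_congr fun e _ => ?_) fun _ _ => rfl
    simp only [Finset.mem_filter, not_not]
    constructor
    · rintro ⟨⟨⟨h1, h2, h3⟩, h4⟩, rfl⟩
      exact ⟨h1, ⟨h2, rfl⟩, h3, h4.symm⟩
    · rintro ⟨h1, ⟨h2, h3⟩, h4, h5⟩
      exact ⟨⟨⟨h1, h2, h4⟩, h3.trans h5.symm⟩, h3⟩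
  · intro e he
    simp only [Finset.mem_filter, Finset.mem_univ, true_and] at he
    exact Finset.mem_image_of_mem γ he.1.2.1

/-- Cutting a best set into classes costs more than `L` per additional class. -/
theorem Best.lt_cut {D L v : ℕ} {a b : Fin m → ℕ} {S : Finset ℕ} (h : G.Best D L a b v S)
    (hsp : G.Sparse D L a b v) (γ : ℕ → ℕ) (hγ : 2 ≤ (S.image γ).card) :
    L * (S.image γ).card <
      D * (∑ e with (a e ≠ b e ∧ a e ∈ S ∧ b e ∈ S) ∧ γ (a e) ≠ γ (b e), G.weight e) + L := by
  have h1 := cw_fiberwise (G := G) a b S γ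
  have h2 : S.card = ∑ c ∈ S.image γ, (S.filter fun s => γ s = c).card :=
    Finset.card_eq_sum_card_image γ S
  have hmem : γ v ∈ S.image γ := Finset.mem_image_of_mem γ h.mem
  rw [← Finset.add_sum_erase _ _ hmem] at h1 h2
  have h3 : D * G.cw a b (S.filter fun s => γ s = γ v) + L * S.card <
      D * G.cw a b S + L * (S.filter fun s => γ s = γ v).card := by
    have hT : (S.filter fun s => γ s = γ v) ⊆ Finset.range (v + 1) :=
      (Finset.filter_subset _ _).trans h.sub
    have hv : v ∈ S.filter fun s => γ s = γ v := Finset.mem_filter.2 ⟨h.mem, rfl⟩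
    refine lt_of_le_of_ne (h.le _ hT hv) fun heq => ?_
    have hsub := h.min _ hT hv heq
    obtain ⟨c, hc, d, hd, hne⟩ := Finset.one_lt_card.1 hγ
    obtain ⟨s, hs, rfl⟩ := Finset.mem_image.1 hc
    obtain ⟨t, ht, rfl⟩ := Finset.mem_image.1 hd
    exact hne ((Finset.mem_filter.1 (hsub hs)).2.trans (Finset.mem_filter.1 (hsub ht)).2.symm)
  have h4 : D * (∑ c ∈ (S.image γ).erase (γ v), G.cw a b (S.filter fun s => γ s = c)) +
      L * ((S.image γ).erase (γ v)).card ≤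
        L * ∑ c ∈ (S.image γ).erase (γ v), (S.filter fun s => γ s = c).card := by
    rw [Finset.mul_sum, Finset.mul_sum, Nat.mul_comm L (Finset.card _), ← smul_eq_mul,
      ← Finset.sum_const, ← Finset.sum_add_distrib]
    refine Finset.sum_le_sum fun c hc => hsp _ ?_ ?_
    · intro s hs
      obtain ⟨hs1, hs2⟩ := Finset.mem_filter.1 hs
      have h5 := Finset.mem_range.1 (h.sub hs1)
      have h6 : s ≠ v := by
        rintro rfl
        exact Finset.ne_of_mem_erase hc hs2.symm
      exact Finset.mem_range.2 (by omega)
    · obtain ⟨s, hs, hsc⟩ := Finset.mem_image.1 (Finset.mem_of_mem_erase hc)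
      exact ⟨s, Finset.mem_filter.2 ⟨hs, hsc⟩⟩
  rw [Finset.card_erase_of_mem hmem] at h4
  have h7 : L * (S.image γ).card = L * ((S.image γ).card - 1) + L := by
    conv_lhs => rw [show (S.image γ).card = (S.image γ).card - 1 + 1 by omega]
    ring
  rw [h2] at h3
  have h8 := congrArg (D * ·) h1
  simp only [Nat.mul_add] at h8 h3
  omega

/-- The vertices whose labels belong to a best set form a strong set. -/
theorem Best.strong {D L v : ℕ} (hD : 0 < D) {a b : Fin m → ℕ} {S : Finset ℕ}
    (h : G.Best D L a b v S) (hsp : G.Sparse D L a b v) {ℓ : Fin n → ℕ}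
    (hab : ∀ e, a e ≠ b e → G.src e ∈ U ∧ G.dst e ∈ U ∧ a e = ℓ (G.src e) ∧ b e = ℓ (G.dst e))
    (hcl : ∀ u ∈ U, G.Strong ((L : ℚ) / D) (U.filter fun w => ℓ w = ℓ u))
    (hne : (U.filter fun u => ℓ u ∈ S).Nonempty) :
    G.Strong ((L : ℚ) / D) (U.filter fun u => ℓ u ∈ S) := by
  refine strong_of_classes hne ℓ ?_ ?_
  · intro u hu
    obtain ⟨hu1, hu2⟩ := Finset.mem_filter.1 hu
    convert hcl u hu1 using 1
    ext w
    simp only [Finset.mem_filter]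
    exact ⟨fun h => ⟨h.1.1, h.2⟩, fun h => ⟨⟨h.1, h.2 ▸ hu2⟩, h.2⟩⟩
  · intro γ hγ
    have h1 : ncol (U.filter fun u => ℓ u ∈ S) (γ ∘ ℓ) ≤ (S.image γ).card := by
      refine Finset.card_le_card fun c hc => ?_
      obtain ⟨u, hu, rfl⟩ := Finset.mem_image.1 hc
      exact Finset.mem_image_of_mem γ (Finset.mem_filter.1 hu).2
    have h2 := h.lt_cut hsp γ (hγ.trans h1)
    have h3 : (∑ e with (a e ≠ b e ∧ a e ∈ S ∧ b e ∈ S) ∧ γ (a e) ≠ γ (b e), G.weight e) ≤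
        G.dcut (U.filter fun u => ℓ u ∈ S) (γ ∘ ℓ) := by
      refine Finset.sum_le_sum_of_subset fun e he => ?_
      simp only [Finset.mem_filter, Finset.mem_univ, true_and, Function.comp] at he ⊢
      obtain ⟨⟨h1, h2, h3⟩, h4⟩ := he
      obtain ⟨h5, h6, h7, h8⟩ := hab e h1
      rw [h7] at h2 h4
      rw [h8] at h3 h4
      exact ⟨⟨h5, h2⟩, ⟨h6, h3⟩, h4⟩
    have h4 : L * ncol (U.filter fun u => ℓ u ∈ S) (γ ∘ ℓ) <
        D * G.dcut (U.filter fun u => ℓ u ∈ S) (γ ∘ ℓ) + L :=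
      lt_of_le_of_lt (Nat.mul_le_mul_left L h1) (h2.trans_le
        (Nat.add_le_add_right (Nat.mul_le_mul_left D h3) L))
    have h5 : (L : ℚ) * ncol (U.filter fun u => ℓ u ∈ S) (γ ∘ ℓ) <
        D * G.dcut (U.filter fun u => ℓ u ∈ S) (γ ∘ ℓ) + L := by exact_mod_cast h4
    have hD' : (0 : ℚ) < D := by exact_mod_cast hD
    rw [excess, sub_pos, div_mul_eq_mul_div, div_lt_iff₀ hD']
    linarith

/-- Once the labels of a component `U` at level `k` have been contracted to strong sets at level
`k + h` and what remains is sparse, the edges between different labels are known to lie below level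
`k + h`, and the contracted ones above. -/
theorem edgeApprox_refine {D h k : ℕ} {κ : Fin m → ℕ} (hD : 0 < D)
    (hκ : ∀ e, G.EdgeApprox D (2 * h) (κ e) e)
    (hk : 2 * h ∣ k) (hc : G.Closed (fun e => k ≤ κ e) U)
    {lab ℓ : Fin n → ℕ} (hlab : ∀ u v, lab u = lab v → ℓ u = ℓ v)
    (hact : ∀ e, G.src e ∈ U → G.dst e ∈ U → lab (G.src e) ≠ lab (G.dst e) → κ e = k)
    {a b : Fin m → ℕ}
    (hab : ∀ e, G.src e ∈ U → G.dst e ∈ U → lab (G.src e) ≠ lab (G.dst e) →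
      a e = ℓ (G.src e) ∧ b e = ℓ (G.dst e))
    (hcl : ∀ u ∈ U, G.Strong (((k + h : ℕ) : ℚ) / D) (U.filter fun w => ℓ w = ℓ u))
    {N : ℕ} (hN : ∀ u ∈ U, ℓ u < N) (hsp : G.Sparse D (k + h) a b N)
    {e : Fin m} (hs : G.src e ∈ U) (hd : G.dst e ∈ U)
    (he : lab (G.src e) ≠ lab (G.dst e)) :
    G.EdgeApprox D h (if a e = b e then k + h else k) e := by
  have hke := hact e hs hd he
  have hke' := hκ e
  rw [hke] at hke'
  obtain ⟨e1, e2⟩ := hab e hs hd he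
  have hhk : h ∣ k := dvd_trans ⟨2, by ring⟩ hk
  split_ifs with heq
  · refine ⟨(Nat.dvd_add_right hhk).2 dvd_rfl, ⟨_, ?_, ?_, hcl _ hs⟩, ?_⟩
    · exact Finset.mem_filter.2 ⟨hs, rfl⟩
    · exact Finset.mem_filter.2 ⟨hd, by rw [← e1, ← e2, heq]⟩
    · rw [show k + h + h = k + 2 * h by ring]
      exact hke'.2.2
  · refine ⟨hhk, hke'.2.1, fun Y hsY hdY hY => ?_⟩
    have hYe : ∀ f, G.src f ∈ Y → G.dst f ∈ Y → k ≤ κ f := fun f h1 h2 =>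
      (hκ f).le_of_strong hk h1 h2 (hY.mono_div (Nat.le_add_right k h))
    have hYU : Y ⊆ U := (hY.linked (by positivity) hYe).subset_of_closed hc hsY hs
    have h2 : 2 ≤ ncol Y ℓ := two_le_ncol hsY hdY (by rwa [← e1, ← e2])
    have h3 := hY.2 ℓ h2
    have h4 := hsp (Y.image ℓ) (fun c hc => by
      obtain ⟨u, hu, rfl⟩ := Finset.mem_image.1 hc
      exact Finset.mem_range.2 (hN u (hYU hu))) ⟨_, Finset.mem_image_of_mem ℓ hsY⟩
    have h5 : G.dcut Y ℓ ≤ G.cw a b (Y.image ℓ) := by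
      refine Finset.sum_le_sum_of_subset fun f hf => ?_
      simp only [Finset.mem_filter, Finset.mem_univ, true_and] at hf ⊢
      obtain ⟨f1, f2⟩ := hab f (hYU hf.1) (hYU hf.2.1) fun h => hf.2.2 (hlab _ _ h)
      rw [f1, f2]
      exact ⟨hf.2.2, Finset.mem_image_of_mem ℓ hf.1, Finset.mem_image_of_mem ℓ hf.2.1⟩
    have h6 : D * G.dcut Y ℓ + (k + h) ≤ (k + h) * ncol Y ℓ :=
      le_trans (Nat.add_le_add_right (Nat.mul_le_mul_left D h5) _) h4
    have h7 : (D : ℚ) * G.dcut Y ℓ + ((k + h : ℕ) : ℚ) ≤ ((k + h : ℕ) : ℚ) * ncol Y ℓ := by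
      exact_mod_cast h6
    have hD' : (0 : ℚ) < D := by exact_mod_cast hD
    rw [excess, sub_pos, div_mul_eq_mul_div, div_lt_iff₀ hD'] at h3
    linarith

end WGraph

/-! ### Multiway cuts as colourings, and uniqueness of the maximal minimum ratio cut -/

namespace WGraph

variable {n m : ℕ} {G : WGraph n m} {U : Finset (Fin n)} {g : Fin n → ℕ}

theorem card_image_le_of_imp {α β γ : Type*} [DecidableEq β] [DecidableEq γ] {s : Finset α}
    {f : α → β} {g : α → γ} (h : ∀ u ∈ s, ∀ v ∈ s, g u = g v → f u = f v) :
    (s.image f).card ≤ (s.image g).card := by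
  classical
  by_cases hne : s.Nonempty
  · obtain ⟨u0, hu0⟩ := hne
    let φ : γ → β := fun c => if h : ∃ u ∈ s, g u = c then f h.choose else f u0
    refine le_trans (Finset.card_le_card (t := (s.image g).image φ) fun c hc => ?_)
      Finset.card_image_le
    obtain ⟨u, hu, rfl⟩ := Finset.mem_image.1 hc
    refine Finset.mem_image.2 ⟨g u, Finset.mem_image_of_mem g hu, ?_⟩
    have hex : ∃ v ∈ s, g v = g u := ⟨u, hu, rfl⟩
    simp only [φ, dif_pos hex]
    exact h _ hex.choose_spec.1 _ hu hex.choose_spec.2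
  · rw [Finset.not_nonempty_iff_eq_empty.1 hne]; simp

/-- The colour classes of `g` on `U` are the sides of `P`. -/
def IsCol (P : Finpartition U) (g : Fin n → ℕ) : Prop :=
  ∀ u ∈ U, ∀ v ∈ U, g u = g v ↔ P.part u = P.part v

theorem exists_isCol (P : Finpartition U) : ∃ g, IsCol P g :=
  ⟨fun u => Encodable.encode (P.part u), fun _ _ _ _ => Encodable.encode_injective.eq_iff⟩

theorem image_part (P : Finpartition U) : U.image P.part = P.parts := by
  ext X
  rw [Finset.mem_image]
  constructor
  · rintro ⟨u, hu, rfl⟩; exact P.part_mem.2 hu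
  · intro hX
    obtain ⟨u, hu⟩ := P.nonempty_of_mem_parts hX
    exact ⟨u, P.le hX hu, P.part_eq_of_mem hX hu⟩

theorem IsCol.card {P : Finpartition U} (h : IsCol P g) : P.parts.card = ncol U g := by
  rw [← image_part, ncol]
  exact le_antisymm (card_image_le_of_imp fun u hu v hv => (h u hu v hv).1)
    (card_image_le_of_imp fun u hu v hv => (h u hu v hv).2)

theorem IsCol.cutEdges {P : Finpartition U} (h : IsCol P g) : G.cutEdges P =
    Finset.univ.filter fun e => G.src e ∈ U ∧ G.dst e ∈ U ∧ g (G.src e) ≠ g (G.dst e) :=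
  Finset.filter_congr fun _ _ => and_congr_right fun hs => and_congr_right fun hd =>
    not_congr (h _ hs _ hd).symm

theorem IsCol.cutValue {P : Finpartition U} (h : IsCol P g) : G.cutValue P = G.dcut U g := by
  rw [WGraph.cutValue, h.cutEdges, dcut]

theorem IsCol.part {P : Finpartition U} (h : IsCol P g) {u : Fin n} (hu : u ∈ U) :
    P.part u = U.filter fun v => g v = g u := by
  ext v
  rw [Finset.mem_filter]
  constructor
  · intro hv
    have hvU := P.part_subset u hv
    exact ⟨hvU, (h v hvU u hu).2 ((P.mem_part_iff_part_eq_part hvU hu).1 hv)⟩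
  · rintro ⟨hvU, hv⟩
    exact (P.mem_part_iff_part_eq_part hvU hu).2 ((h v hvU u hu).1 hv)

theorem IsCol.parts {P : Finpartition U} (h : IsCol P g) :
    P.parts = U.image fun u => U.filter fun v => g v = g u := by
  rw [← image_part]
  exact Finset.image_congr fun u hu => h.part hu

/-- The partition of `U` into colour classes. -/
def colPart (U : Finset (Fin n)) (g : Fin n → ℕ) : Finpartition U :=
  Finpartition.ofExistsUnique (U.image fun u => U.filter fun v => g v = g u)
    (fun p hp => by
      obtain ⟨u, _, rfl⟩ := Finset.mem_image.1 hp
      exact Finset.filter_subset _ _)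
    (fun u hu => by
      refine ⟨U.filter fun v => g v = g u, ⟨Finset.mem_image.2 ⟨u, hu, rfl⟩,
        Finset.mem_filter.2 ⟨hu, rfl⟩⟩, ?_⟩
      rintro _ ⟨hy, huy⟩
      obtain ⟨v, _, rfl⟩ := Finset.mem_image.1 hy
      rw [(Finset.mem_filter.1 huy).2])
    (fun h => by
      obtain ⟨u, hu, he⟩ := Finset.mem_image.1 h
      have : u ∈ U.filter fun v => g v = g u := Finset.mem_filter.2 ⟨hu, rfl⟩
      rw [he] at this
      exact absurd this (Finset.notMem_empty u))

theorem isCol_colPart (U : Finset (Fin n)) (g : Fin n → ℕ) : IsCol (colPart U g) g := by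
  have key : ∀ u ∈ U, (colPart U g).part u = U.filter fun v => g v = g u := fun u hu =>
    (colPart U g).part_eq_of_mem (Finset.mem_image.2 ⟨u, hu, rfl⟩) (Finset.mem_filter.2 ⟨hu, rfl⟩)
  intro u hu v hv
  rw [key u hu, key v hv]
  constructor
  · intro h; rw [h]
  · intro h
    have : u ∈ U.filter fun w => g w = g v := h ▸ Finset.mem_filter.2 ⟨hu, rfl⟩
    exact (Finset.mem_filter.1 this).2

theorem cutRatio_eq {P : Finpartition U} (h : IsCol P g) :
    G.cutRatio P = G.dcut U g / ((ncol U g : ℚ) - 1) := by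
  rw [cutRatio, h.cutValue, h.card]

theorem exists_maximal (hU : 2 ≤ U.card) : ∃ Q : Finpartition U, G.IsMaximalMinRatioCut Q := by
  classical
  have hne : (Finset.univ.filter fun Q : Finpartition U => 2 ≤ Q.parts.card).Nonempty := by
    refine ⟨⊥, Finset.mem_filter.2 ⟨Finset.mem_univ _, ?_⟩⟩
    rwa [Finpartition.card_bot]
  obtain ⟨Q, hQ, hmin⟩ := Finset.exists_min_image _ G.cutRatio hne
  simp only [Finset.mem_filter, Finset.mem_univ, true_and] at hQ hmin
  have hne' : (Finset.univ.filter fun Q : Finpartition U => G.IsMinRatioCut Q).Nonempty :=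
    ⟨Q, Finset.mem_filter.2 ⟨Finset.mem_univ _, hQ, hmin⟩⟩
  obtain ⟨R, hR, hmax⟩ := Finset.exists_max_image _ (fun Q => Q.parts.card) hne'
  simp only [Finset.mem_filter, Finset.mem_univ, true_and] at hR hmax
  exact ⟨R, hR, hmax⟩

theorem IsMinRatioCut.excess_nonneg {Q : Finpartition U} (hQ : G.IsMinRatioCut Q) {g : Fin n → ℕ}
    (hg : 1 ≤ ncol U g) : 0 ≤ G.excess (G.cutRatio Q) U g := by
  by_cases h2 : 2 ≤ ncol U g
  · have h := hQ.2 (colPart U g) (by rwa [(isCol_colPart U g).card])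
    rw [cutRatio_eq (isCol_colPart U g), le_div_iff₀] at h
    · rw [excess]; linarith
    · have : (2 : ℚ) ≤ ncol U g := by exact_mod_cast h2
      linarith
  · exact excess_of_ncol_eq_one (by omega)

theorem IsMinRatioCut.excess_eq_zero {Q : Finpartition U} (hQ : G.IsMinRatioCut Q)
    (hg : IsCol Q g) : G.excess (G.cutRatio Q) U g = 0 := by
  have h2 : (2 : ℚ) ≤ ncol U g := by rw [← hg.card]; exact_mod_cast hQ.1
  rw [excess, cutRatio_eq hg, div_mul_cancel₀, sub_self]
  linarith

/-- A multiway cut into sets that are strong at the minimum ratio, such that strong sets are not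
cut, is the maximal minimum ratio cut. -/
theorem IsMaximalMinRatioCut.isCol {Q : Finpartition U} (hQ : G.IsMaximalMinRatioCut Q)
    (hcl : ∀ u ∈ U, G.Strong (G.cutRatio Q) (U.filter fun v => g v = g u))
    (hco : ∀ Y ⊆ U, G.Strong (G.cutRatio Q) Y → ∀ u ∈ Y, ∀ v ∈ Y, g u = g v) : IsCol Q g := by
  obtain ⟨q, hq⟩ := exists_isCol Q
  have h0 := hQ.1.excess_eq_zero hq
  have hcoarse : ∀ u ∈ U, ∀ v ∈ U, g u = g v → q u = q v := by
    intro u hu v hv huv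
    by_contra hne
    have huX : u ∈ U.filter fun w => g w = g u := Finset.mem_filter.2 ⟨hu, rfl⟩
    have h1 := excess_mergeCol (G := G) (μ := G.cutRatio Q) (g := q) (Finset.filter_subset _ U) huX
    have h2 := (hcl u hu).2 q (two_le_ncol huX (Finset.mem_filter.2 ⟨hv, huv.symm⟩) hne)
    have h3 := hQ.1.excess_nonneg (g := mergeCol q (U.filter fun w => g w = g u) (q u))
      (ncol_pos ⟨u, hu⟩)
    linarith
  have hfine : ∀ u ∈ U, ∀ v ∈ U, q u = q v → g u = g v := by
    intro u hu v hv huv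
    set Y := U.filter fun w => q w = q u with hY
    have hYU : Y ⊆ U := Finset.filter_subset _ _
    have huY : u ∈ Y := Finset.mem_filter.2 ⟨hu, rfl⟩
    have hvY : v ∈ Y := Finset.mem_filter.2 ⟨hv, huv.symm⟩
    by_contra hne
    have hns : ¬ G.Strong (G.cutRatio Q) Y := fun h => hne (hco Y hYU h u huY v hvY)
    have : ∃ r, 2 ≤ ncol Y r ∧ G.excess (G.cutRatio Q) Y r ≤ 0 := by
      by_contra hr
      push Not at hr
      exact hns ⟨⟨u, huY⟩, hr⟩
    obtain ⟨r, hr2, hr0⟩ := this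
    -- refine the side `Y` of `Q` by its multiway cut `r` of no larger ratio
    let p : Fin n → ℕ := fun w => if w ∈ Y then Nat.pair 1 (r w) else Nat.pair 0 (q w)
    have hpY : ∀ w ∈ Y, p w = Nat.pair 1 (r w) := fun w hw => if_pos hw
    have hpU : ∀ w ∉ Y, p w = Nat.pair 0 (q w) := fun w hw => if_neg hw
    have hcolY : ncol Y p = ncol Y r :=
      le_antisymm (card_image_le_of_imp fun w hw x hx h => by rw [hpY w hw, hpY x hx, h])
        (card_image_le_of_imp fun w hw x hx h => by
          rw [hpY w hw, hpY x hx] at h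
          exact (Nat.pair_eq_pair.1 h).2)
    have hiff : ∀ w ∈ U, w ∈ Y ↔ p w ∈ Y.image p := by
      intro w hw
      refine ⟨Finset.mem_image_of_mem p, fun h => ?_⟩
      obtain ⟨x, hx, hxw⟩ := Finset.mem_image.1 h
      by_contra hwY
      rw [hpY x hx, hpU w hwY] at hxw
      exact absurd (Nat.pair_eq_pair.1 hxw).1 one_ne_zero
    have hmer : ∀ w ∈ U, ∀ x ∈ U, mergeCol p Y (p u) w = mergeCol p Y (p u) x ↔ q w = q x := by
      intro w hw x hx
      have hqY : ∀ z ∈ U, z ∈ Y ↔ q z = q u := fun z hz => by simp [hY, hz]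
      unfold mergeCol
      by_cases h1 : w ∈ Y <;> by_cases h2 : x ∈ Y
      · rw [if_pos ((hiff w hw).1 h1), if_pos ((hiff x hx).1 h2), (hqY w hw).1 h1,
          (hqY x hx).1 h2]
        simp
      · rw [if_pos ((hiff w hw).1 h1), if_neg (fun h => h2 ((hiff x hx).2 h)), hpY u huY,
          hpU x h2]
        refine iff_of_false (fun h => absurd (Nat.pair_eq_pair.1 h).1 one_ne_zero) fun h => ?_
        exact h2 ((hqY x hx).2 (h.symm.trans ((hqY w hw).1 h1)))
      · rw [if_neg (fun h => h1 ((hiff w hw).2 h)), if_pos ((hiff x hx).1 h2), hpY u huY,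
          hpU w h1]
        refine iff_of_false (fun h => absurd (Nat.pair_eq_pair.1 h).1.symm one_ne_zero) fun h => ?_
        exact h1 ((hqY w hw).2 (h.trans ((hqY x hx).1 h2)))
      · rw [if_neg (fun h => h1 ((hiff w hw).2 h)), if_neg (fun h => h2 ((hiff x hx).2 h)),
          hpU w h1, hpU x h2]
        exact ⟨fun h => (Nat.pair_eq_pair.1 h).2, fun h => by rw [h]⟩
    have hcol : ncol U p + 1 = ncol U q + ncol Y r := by
      have h1 := ncol_mergeCol (g := p) hYU huY
      have h2 : ncol U (mergeCol p Y (p u)) = ncol U q :=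
        le_antisymm (card_image_le_of_imp fun w hw x hx => (hmer w hw x hx).2)
          (card_image_le_of_imp fun w hw x hx => (hmer w hw x hx).1)
      omega
    have hcut : G.dcut U p ≤ G.dcut U q + G.dcut Y r := by
      unfold dcut
      rw [← Finset.sum_union_inter]
      refine le_trans (Finset.sum_le_sum_of_subset fun e he => ?_) (Nat.le_add_right _ _)
      simp only [Finset.mem_union, Finset.mem_filter, Finset.mem_univ, true_and] at he ⊢
      obtain ⟨h1, h2, h3⟩ := he
      by_cases h4 : q (G.src e) = q (G.dst e)
      · right
        have hmem : ∀ w ∈ U, w ∈ Y ↔ q w = q u := fun w hw => by simp [hY, hw]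
        by_cases h5 : G.src e ∈ Y
        · have h6 : G.dst e ∈ Y := (hmem _ h2).2 (h4 ▸ (hmem _ h1).1 h5)
          refine ⟨h5, h6, fun h => h3 ?_⟩
          rw [hpY _ h5, hpY _ h6, h]
        · have h6 : G.dst e ∉ Y := fun h => h5 ((hmem _ h1).2 (h4.trans ((hmem _ h2).1 h)))
          exact absurd (by rw [hpU _ h5, hpU _ h6, h4]) h3
      · exact .inl ⟨h1, h2, h4⟩
    have hex : G.excess (G.cutRatio Q) U p ≤ 0 := by
      have h1 : (ncol U p : ℚ) = ncol U q + ncol Y r - 1 := by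
        have : (ncol U p : ℚ) + 1 = ncol U q + ncol Y r := by exact_mod_cast hcol
        linarith
      have h2 : (G.dcut U p : ℚ) ≤ G.dcut U q + G.dcut Y r := by exact_mod_cast hcut
      simp only [excess] at h0 hr0 ⊢
      rw [h1]
      linarith
    have hqc : 2 ≤ ncol U q := by rw [← hq.card]; exact hQ.1.1
    have hp2 : (2 : ℚ) ≤ ncol U p := by
      have : 2 ≤ ncol U p := by omega
      exact_mod_cast this
    have hpmin : G.IsMinRatioCut (colPart U p) := by
      refine ⟨by rw [(isCol_colPart U p).card]; omega, fun R hR => ?_⟩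
      refine le_trans ?_ (hQ.1.2 R hR)
      rw [cutRatio_eq (isCol_colPart U p), div_le_iff₀ (by linarith)]
      rw [excess] at hex
      linarith
    have := hQ.2 _ hpmin
    rw [(isCol_colPart U p).card, hq.card] at this
    omega
  intro u hu v hv
  rw [← hq u hu v hv]
  exact ⟨hcoarse u hu v hv, hfine u hu v hv⟩

theorem cutRatio_nonneg (Q : Finpartition U) (h : 2 ≤ Q.parts.card) : 0 ≤ G.cutRatio Q := by
  have : (2 : ℚ) ≤ Q.parts.card := by exact_mod_cast h
  exact div_nonneg (Nat.cast_nonneg _) (by linarith)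

/-- Fractions with denominators below `n` that differ by less than `1 / n ^ 2` are equal. -/
theorem fraction_gap {D k n d q d' q' : ℕ} (hD : D = n * n) (hq : q < n) (hq' : q' < n)
    (h1 : k * q < D * d) (h2 : D * d' ≤ (k + 1) * q') : d' * q ≤ d * q' := by
  by_contra hlt
  push Not at hlt
  have h3 : D * (d * q' + 1) ≤ D * (d' * q) := Nat.mul_le_mul_left D hlt
  have h4 : (D * d') * q ≤ ((k + 1) * q') * q := Nat.mul_le_mul_right q h2
  have h5 : (k * q) * q' ≤ (D * d) * q' := Nat.mul_le_mul_right q' h1.le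
  have h6 : q' * q < n * n := Nat.mul_lt_mul'' hq' hq
  subst hD
  nlinarith

/-- The maximal minimum ratio cut of a component of the threshold graph at level `k` is its
partition into components at level `k + 1`, if the levels approximate the strengths of all edges up
to `1 / n ^ 2`. -/
theorem isCol_of_level {D k : ℕ} (hD : D = n * n) {κ : Fin m → ℕ}
    (hκ : ∀ e, G.EdgeApprox D 1 (κ e) e) (hl : G.Linked (fun e => k ≤ κ e) U)
    (hc : G.Closed (fun e => k ≤ κ e) U)
    (hgl : ∀ u ∈ U, G.Linked (fun e => k + 1 ≤ κ e) (U.filter fun v => g v = g u))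
    (hgc : ∀ u ∈ U, G.Closed (fun e => k + 1 ≤ κ e) (U.filter fun v => g v = g u))
    (h2 : 2 ≤ ncol U g) {Q : Finpartition U} (hQ : G.IsMaximalMinRatioCut Q) : IsCol Q g := by
  obtain ⟨u, hu, u', hu', hne⟩ := exists_of_two_le_ncol h2
  have hn : 0 < n := u.pos
  have hDpos : (0 : ℚ) < D := by
    have : 0 < D := hD ▸ Nat.mul_pos hn hn
    exact_mod_cast this
  have hstrong : G.Strong ((k : ℚ) / D) U := strong_of_linked hκ (one_dvd k) ⟨u, hu⟩ hl hc
  have hconst : ∀ Y ⊆ U, G.Strong (((k + 1 : ℕ) : ℚ) / D) Y → ∀ w ∈ Y, ∀ x ∈ Y, g w = g x := by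
    intro Y hYU hY w hw x hx
    have h1 := (hY.linked (F := fun e => k + 1 ≤ κ e) (by positivity) fun e hs hd =>
      (hκ e).le_of_strong (one_dvd _) hs hd hY).subset_of_closed (hgc x (hYU hx)) hx
        (Finset.mem_filter.2 ⟨hYU hx, rfl⟩)
    exact (Finset.mem_filter.1 (h1 hw)).2
  have hbad : ∀ Y ⊆ U, (∃ w ∈ Y, ∃ x ∈ Y, g w ≠ g x) →
      ∃ r, 2 ≤ ncol Y r ∧ G.excess (((k + 1 : ℕ) : ℚ) / D) Y r ≤ 0 := by
    rintro Y hYU ⟨w, hw, x, hx, hwx⟩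
    by_contra hr
    push Not at hr
    exact hwx (hconst Y hYU ⟨⟨w, hw⟩, hr⟩ w hw x hx)
  obtain ⟨q, hq⟩ := exists_isCol Q
  have hq2 : 2 ≤ ncol U q := by rw [← hq.card]; exact hQ.1.1
  have hq0 := hQ.1.excess_eq_zero hq
  have hcast : ∀ {Y : Finset (Fin n)} {r : Fin n → ℕ}, 2 ≤ ncol Y r →
      ((ncol Y r - 1 : ℕ) : ℚ) = (ncol Y r : ℚ) - 1 := fun h => by
    rw [Nat.cast_sub (by omega), Nat.cast_one]
  have hcolle : ∀ {Y : Finset (Fin n)} {r : Fin n → ℕ}, 2 ≤ ncol Y r → ncol Y r - 1 < n := by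
    intro Y r h
    have h1 : ncol Y r ≤ Y.card := Finset.card_image_le
    have h2 : Y.card ≤ n := by simpa using Finset.card_le_univ Y
    omega
  have hlow : k * (ncol U q - 1) < D * G.dcut U q := by
    have h := hstrong.2 q hq2
    rw [excess, sub_pos, div_mul_eq_mul_div, div_lt_iff₀ hDpos, ← hcast hq2] at h
    rw [mul_comm D]
    exact_mod_cast h
  have hle : G.cutRatio Q ≤ ((k + 1 : ℕ) : ℚ) / D := by
    obtain ⟨r, hr2, hr0⟩ := hbad U subset_rfl ⟨u, hu, u', hu', hne⟩
    have h1 := hQ.1.excess_nonneg (g := r) (by omega)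
    have h3 : (2 : ℚ) ≤ ncol U r := by exact_mod_cast hr2
    simp only [excess] at h1 hr0
    exact le_of_mul_le_mul_right (by linarith) (show (0 : ℚ) < (ncol U r : ℚ) - 1 by linarith)
  refine hQ.isCol (fun w hw => ?_) fun Y hYU hY => ?_
  · exact (strong_of_linked (X := U.filter fun v => g v = g w) hκ (one_dvd _)
      ⟨w, Finset.mem_filter.2 ⟨hw, rfl⟩⟩ (hgl w hw) (hgc w hw)).mono hle
  · by_contra hnc
    push Not at hnc
    obtain ⟨r, hr2, hr0⟩ := hbad Y hYU hnc
    have h1 : D * G.dcut Y r ≤ (k + 1) * (ncol Y r - 1) := by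
      rw [excess, sub_nonpos, div_mul_eq_mul_div, le_div_iff₀ hDpos, ← hcast hr2] at hr0
      rw [mul_comm D]
      exact_mod_cast hr0
    have h3 := fraction_gap hD (hcolle hq2) (hcolle hr2) hlow h1
    have h4 : (G.dcut Y r : ℚ) * ((ncol U q : ℚ) - 1) ≤ G.dcut U q * ((ncol Y r : ℚ) - 1) := by
      rw [← hcast hq2, ← hcast hr2]; exact_mod_cast h3
    have h5 := hY.2 r hr2
    have h6 : (2 : ℚ) ≤ ncol U q := by exact_mod_cast hq2
    have h7 : (0 : ℚ) < (ncol U q : ℚ) - 1 := by linarith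
    rw [excess, cutRatio_eq hq, sub_pos, div_mul_eq_mul_div, div_lt_iff₀ h7] at h5
    linarith

/-- The maximal minimum ratio cut of a disconnected graph is the partition into components. -/
theorem isCol_of_disconnected {D s : ℕ} {κ : Fin m → ℕ} (hκ : ∀ e, G.EdgeApprox D s (κ e) e)
    (hgl : ∀ u, G.Linked (fun _ => True) (Finset.univ.filter fun v => g v = g u))
    (hgc : ∀ e, g (G.src e) = g (G.dst e)) (h2 : 2 ≤ ncol Finset.univ g)
    {Q : Finpartition (Finset.univ : Finset (Fin n))} (hQ : G.IsMaximalMinRatioCut Q) :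
    IsCol Q g := by
  have hclosed : ∀ u, G.Closed (fun _ => True) (Finset.univ.filter fun v => g v = g u) :=
    fun u e _ => by simp [hgc e]
  have hzero : G.cutRatio Q = 0 := by
    refine le_antisymm ?_ (cutRatio_nonneg Q hQ.1.1)
    refine (hQ.1.2 (colPart _ g) (by rwa [(isCol_colPart _ g).card])).trans ?_
    rw [cutRatio_eq (isCol_colPart _ g)]
    have : G.dcut Finset.univ g = 0 :=
      Finset.sum_eq_zero fun e he => absurd (hgc e) (Finset.mem_filter.1 he).2.2.2
    rw [this]; simp
  refine hQ.isCol (fun u _ => ?_) fun Y _ hY u hu v hv => ?_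
  · rw [hzero]
    have := strong_of_linked (t := 0) (X := Finset.univ.filter fun v => g v = g u) hκ
      (dvd_zero s) ⟨u, Finset.mem_filter.2 ⟨Finset.mem_univ u, rfl⟩⟩
      ((hgl u).mono fun _ _ _ _ => Nat.zero_le _) fun e _ => hclosed u e trivial
    simpa using this
  · rw [hzero] at hY
    have := (hY.linked le_rfl fun _ _ _ => trivial).subset_of_closed (hclosed v) hv
      (Finset.mem_filter.2 ⟨Finset.mem_univ v, rfl⟩)
    exact (Finset.mem_filter.1 (this hu)).2

end WGraph

namespace StructRAM

/-! ### The program -/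

/-- The entry of an array at an index held by a variable. -/
abbrev Arr.at (j : Arr) (x : Var) : Ex := .rd j (.var x)

/-- Source, target and weight of edge `e` in the input. -/
abbrev inSrc : Ex := .rd .inp (2 + 3 * (.var .e))
abbrev inDst : Ex := .rd .inp (3 + 3 * (.var .e))
abbrev inWeight : Ex := .rd .inp (4 + 3 * (.var .e))

/-- Read the numbers of vertices and edges, number the vertices that have edges by edge ends, and
compute a power of two that bounds all scaled edge strengths. -/
def readInput : Stm :=
  .n ≔ .rd .inp 0 ;; .m ≔ .rd .inp 1 ;; .tot ≔ 0 ;;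
  .for .e (.var .m) (.put .fst inSrc (2 * .var .e) ;; .put .fst inDst (2 * .var .e + 1) ;;
    .tot ≔ .var .tot + inWeight) ;;
  .dd ≔ .var .n * .var .n ;; .step ≔ 1 ;;
  .loop (.bin .lt (.var .step) (.var .dd * .var .tot)) (.step ≔ 2 * .var .step)

/-- Give every vertex its own label; `lA` and `lB` hold the labels of the ends of the edges. -/
def setLabels : Stm :=
  .for .e (.var .m) (.put .lA (.var .e) (.rd .fst inSrc) ;; .put .lB (.var .e) (.rd .fst inDst))

/-- Find the largest level `k` of an edge between different labels, and a label `r` it occurs at. -/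
def findMax : Stm :=
  .go ≔ 0 ;; .k ≔ 0 ;;
  .for .e (.var .m) (.ite (.bin .eq (Arr.lA.at .e) (Arr.lB.at .e)) .skip
    (.ite (.bin .lt (Arr.kap.at .e) (.var .k)) .skip
      (.go ≔ 1 ;; .k ≔ Arr.kap.at .e ;; .r ≔ Arr.lA.at .e)))

/-- Copy the current labels to `cA` and `cB`. -/
def copyLabels : Stm :=
  .for .e (.var .m) (.put .cA (.var .e) (Arr.lA.at .e) ;; .put .cB (.var .e) (Arr.lB.at .e))

/-- Look for an edge of level `k` between the label `r` and another label `x`. -/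
def scan : Stm :=
  .fnd ≔ 0 ;;
  .for .e (.var .m) (.ite (.bin .eq (Arr.lA.at .e) (Arr.lB.at .e)) .skip
    (.ite (.bin .eq (Arr.kap.at .e) (.var .k))
      (.ite (.bin .eq (Arr.lA.at .e) (.var .r)) (.fnd ≔ 1 ;; .x ≔ Arr.lB.at .e)
        (.ite (.bin .eq (Arr.lB.at .e) (.var .r)) (.fnd ≔ 1 ;; .x ≔ Arr.lA.at .e) .skip))
      .skip))

/-- Rename the label `x` to `r`. -/
def mergeLabel : Stm :=
  .for .e (.var .m) (.ite (.bin .eq (Arr.lA.at .e) (.var .x)) (.put .lA (.var .e) (.var .r)) .skip ;;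
    .ite (.bin .eq (Arr.lB.at .e) (.var .x)) (.put .lB (.var .e) (.var .r)) .skip)

/-- Merge everything that is connected to the label `r` by edges of level `k`, counting the labels
that are absorbed. -/
def grow : Stm :=
  .cnt ≔ 0 ;; scan ;; .loop (.var .fnd) (mergeLabel ;; .cnt ≔ .var .cnt + 1 ;; scan)

/-- Erase the copied labels of edges that still join different labels. -/
def mask : Stm :=
  .for .e (.var .m) (.ite (.bin .eq (Arr.lA.at .e) (Arr.lB.at .e)) .skip
    (.put .cA (.var .e) 0 ;; .put .cB (.var .e) 0))

/-- Merge one component of the graph of edges of level at least `k`. Afterwards `cA` and `cB` differ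
exactly on the edges that have been merged, where they hold the previous labels. -/
def pick : Stm := copyLabels ;; grow ;; mask

/-- The flow instance for label `v`, in which a minimum cut is a best set of labels. -/
def build : Stm :=
  .put .inst 0 (2 * .var .m + 1) ;; .put .inst 1 (4 * .var .m) ;; .put .inst 2 (.var .v) ;;
  .put .inst 3 (2 * .var .m) ;;
  .for .e (.var .m)
    (.a ≔ Arr.cA.at .e ;; .b ≔ Arr.cB.at .e ;; .cap ≔ 0 ;;
     .ite (.bin .eq (.var .a) (.var .b)) .skip (.ite (.bin .lt (.var .v) (.var .a)) .skip
       (.ite (.bin .lt (.var .v) (.var .b)) .skip (.cap ≔ .var .dd * inWeight))) ;;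
     .put .inst (4 + 3 * .var .e) (.var .v) ;; .put .inst (5 + 3 * .var .e) (.var .a) ;;
     .put .inst (6 + 3 * .var .e) (.var .cap) ;;
     .put .inst (4 + 3 * (.var .m + .var .e)) (.var .a) ;;
     .put .inst (5 + 3 * (.var .m + .var .e)) (.var .b) ;;
     .put .inst (6 + 3 * (.var .m + .var .e)) (.var .cap)) ;;
  .for .e (2 * .var .m)
    (.put .inst (4 + 3 * (2 * .var .m + .var .e)) (.var .e) ;;
     .put .inst (5 + 3 * (2 * .var .m + .var .e)) (2 * .var .m) ;;
     .put .inst (6 + 3 * (2 * .var .m + .var .e)) (.var .lam))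

/-- Tail, head and capacity of arc `e` of the flow instance. -/
abbrev arcTail : Ex := .rd .inst (4 + 3 * .var .e)
abbrev arcHead : Ex := .rd .inst (5 + 3 * .var .e)
abbrev arcCap : Ex := .rd .inst (6 + 3 * .var .e)

/-- One pass over the arcs that extends the set `reach` along residual arcs. -/
def relax : Stm :=
  .for .e (4 * .var .m)
    (.ite (.rd .reach arcTail)
      (.ite (.rd .reach arcHead) .skip
        (.ite (.bin .lt (Arr.flo.at .e) arcCap) (.put .reach arcHead 1 ;; .chg ≔ 1) .skip))
      (.ite (.rd .reach arcHead)
        (.ite (.bin .lt 0 (Arr.flo.at .e)) (.put .reach arcTail 1 ;; .chg ≔ 1) .skip) .skip))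

/-- Compute the nodes that are reachable from `v` along residual arcs. -/
def search : Stm :=
  .for .e (2 * .var .m + 1) (.put .reach (.var .e) 0) ;; .put .reach (.var .v) 1 ;; .chg ≔ 1 ;;
  .loop (.var .chg) (.chg ≔ 0 ;; relax)

/-- Rename all reached labels to `v`. -/
def contract : Stm :=
  .for .e (.var .m) (.ite (.rd .reach (Arr.cA.at .e)) (.put .cA (.var .e) (.var .v)) .skip ;;
    .ite (.rd .reach (Arr.cB.at .e)) (.put .cB (.var .e) (.var .v)) .skip)

/-- Insert the label `v` and contract the strong set of labels that this creates. -/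
def insertLabel : Stm := build ;; .flow ;; search ;; contract

/-- Mark the labels that occur on edges of the component, and raise the levels of these edges. -/
def markTouched : Stm :=
  .for .e (2 * .var .m) (.put .touch (.var .e) 0) ;;
  .for .e (.var .m) (.ite (.bin .eq (Arr.cA.at .e) (Arr.cB.at .e)) .skip
    (.put .touch (Arr.cA.at .e) 1 ;; .put .touch (Arr.cB.at .e) 1 ;;
      .put .kap (.var .e) (.var .k + .var .step)))

/-- Lower the levels of the edges that have not been contracted. -/
def lowerLevels : Stm :=
  .for .e (.var .m) (.ite (.bin .eq (Arr.cA.at .e) (Arr.cB.at .e)) .skip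
    (.put .kap (.var .e) (.var .k)))

/-- Decide for every edge of the component whether its strength exceeds level `k + step`. -/
def greedy : Stm :=
  markTouched ;; .lam ≔ .var .k + .var .step ;;
  .for .v (2 * .var .m) (.ite (Arr.touch.at .v) insertLabel .skip) ;; lowerLevels

/-- Refine the levels of all edges from precision `2 * step` to precision `step`. -/
def refineSweep : Stm := setLabels ;; findMax ;; .loop (.var .go) (pick ;; greedy ;; findMax)

/-- Create the tree node of the component that has just been merged, and record the ideal loads of
its edges. -/
def emit : Stm :=
  .wt ≔ 0 ;;
  .for .e (.var .m) (.ite (.bin .eq (Arr.cA.at .e) (Arr.cB.at .e)) .skip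
    (.put .out (1 + .rd .node (Arr.cA.at .e)) (.var .num) ;;
     .put .out (1 + .rd .node (Arr.cB.at .e)) (.var .num) ;; .wt ≔ .var .wt + inWeight)) ;;
  .for .e (.var .m) (.ite (.bin .eq (Arr.cA.at .e) (Arr.cB.at .e)) .skip
    (.put .oc (.var .e) (.var .cnt) ;; .put .ow (.var .e) (.var .wt))) ;;
  .put .node (.var .r) (.var .num) ;; .num ≔ .var .num + 1

/-- The leaves are the first tree nodes. -/
def initNodes : Stm :=
  .num ≔ .var .n ;;
  .for .e (.var .m) (.put .node (Arr.lA.at .e) inSrc ;; .put .node (Arr.lB.at .e) inDst)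

/-- Build the tree of the components of all threshold graphs. -/
def treeSweep : Stm :=
  setLabels ;; initNodes ;; findMax ;; .loop (.var .go) (pick ;; emit ;; findMax)

/-- Count the tree nodes without parent. -/
def countRoots : Stm :=
  .cnt ≔ 0 ;;
  .for .e (.var .num) (.ite (.rd .out (1 + .var .e)) .skip
    (.cnt ≔ .var .cnt + 1 ;; .root ≔ .var .e))

/-- Join several roots under a new one, and write the output. -/
def finish : Stm :=
  countRoots ;;
  .ite (.bin .lt 1 (.var .cnt))
    (.for .e (.var .num) (.ite (.rd .out (1 + .var .e)) .skip (.put .out (1 + .var .e) (.var .num))) ;;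
      .root ≔ .var .num ;; .num ≔ .var .num + 1) .skip ;;
  .put .out (1 + .var .root) (.var .root) ;; .put .out 0 (.var .num) ;;
  .for .e (.var .m)
    (.put .out (1 + (.var .num + 3 * .var .e)) (Arr.oc.at .e) ;;
     .put .out (2 + (.var .num + 3 * .var .e)) (Arr.oc.at .e * inWeight) ;;
     .put .out (3 + (.var .num + 3 * .var .e)) (Arr.ow.at .e))

/-- The whole program. -/
def mainProg : Stm :=
  readInput ;; .loop (.bin .lt 1 (.var .step)) (.step ≔ .var .step / 2 ;; refineSweep) ;;
  treeSweep ;; finish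

end StructRAM

/-! ### Specifications of the elementary loops -/

namespace StructRAM

section Specs

variable {W M m : ℕ} {O : FlowSubroutine} {σ : St}

theorem mergeLabel_spec (hm : σ.v .m = m) (hmM : m ≤ M) (hmW : m < W) :
    wp W M O mergeLabel (fun τ => τ.time ≤ σ.time + (7 * m + 2) ∧ ∀ e < m,
      τ.a .lA e = (if σ.a .lA e = σ.v .x then σ.v .r else σ.a .lA e) ∧
      τ.a .lB e = (if σ.a .lB e = σ.v .x then σ.v .r else σ.a .lB e)) σ := by
  refine wp_for_time m 5 (fun i τ => ∀ e < m,
      (τ.a .lA e = if e < i then (if σ.a .lA e = σ.v .x then σ.v .r else σ.a .lA e)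
        else σ.a .lA e) ∧
      (τ.a .lB e = if e < i then (if σ.a .lB e = σ.v .x then σ.v .r else σ.a .lB e)
        else σ.a .lB e)) rfl hmW ?_ ?_ ?_ ?_
  · intro τ hf
    simp [hf.v .m rfl, hm]
  · simp
  · intro i hi τ hf hv hI
    have hx := hf.v .x rfl
    have hr := hf.v .r rfl
    have h1 := (hI i hi).1
    have h2 := (hI i hi).2
    simp only [lt_irrefl, if_false] at h1 h2
    have hiM : i < M := by omega
    simp [hv, hiM, hx, hr, h1, h2]
    grind
  · intro τ hf hI ht
    refine ⟨by simp; omega, fun e he => ?_⟩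
    have := hI e he
    simpa [he] using this

theorem copyLabels_spec (hm : σ.v .m = m) (hmM : m ≤ M) (hmW : m < W) :
    wp W M O copyLabels (fun τ => τ.time ≤ σ.time + (4 * m + 2) ∧ ∀ e < m,
      τ.a .cA e = σ.a .lA e ∧ τ.a .cB e = σ.a .lB e) σ := by
  refine wp_for_time m 2 (fun i τ => ∀ e < i, τ.a .cA e = σ.a .lA e ∧ τ.a .cB e = σ.a .lB e)
    rfl hmW ?_ ?_ ?_ ?_
  · intro τ hf
    simp [hf.v .m rfl, hm]
  · simp
  · intro i hi τ hf hv hI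
    have h1 := hf.a .lA rfl
    have h2 := hf.a .lB rfl
    have hiM : i < M := by omega
    simp [hv, hiM, h1, h2]
    grind
  · intro τ hf hI ht
    exact ⟨by simp; omega, hI⟩

theorem mask_spec (hm : σ.v .m = m) (hmM : m ≤ M) (hmW : m < W) :
    wp W M O mask (fun τ => τ.time ≤ σ.time + (5 * m + 2) ∧ ∀ e < m,
      τ.a .cA e = (if σ.a .lA e = σ.a .lB e then σ.a .cA e else 0) ∧
      τ.a .cB e = (if σ.a .lA e = σ.a .lB e then σ.a .cB e else 0)) σ := by
  refine wp_for_time m 3 (fun i τ => ∀ e < m,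
      τ.a .cA e = (if σ.a .lA e = σ.a .lB e ∨ i ≤ e then σ.a .cA e else 0) ∧
      τ.a .cB e = (if σ.a .lA e = σ.a .lB e ∨ i ≤ e then σ.a .cB e else 0))
    rfl hmW ?_ ?_ ?_ ?_
  · intro τ hf
    simp [hf.v .m rfl, hm]
  · simp
  · intro i hi τ hf hv hI
    have h1 := hf.a .lA rfl
    have h2 := hf.a .lB rfl
    have hiM : i < M := by omega
    simp [hv, hiM, h1, h2]
    grind
  · intro τ hf hI ht
    refine ⟨by simp; omega, fun e he => ?_⟩
    have := hI e he
    have h3 : ¬ m ≤ e := by omega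
    simpa [h3] using this

theorem findMax_spec (hm : σ.v .m = m) (hmM : m ≤ M) (hmW : m < W) :
    wp W M O findMax (fun τ => τ.time ≤ σ.time + (7 * m + 4) ∧
      (τ.v .go = 0 → ∀ e < m, σ.a .lA e = σ.a .lB e) ∧
      (τ.v .go ≠ 0 → (∃ e < m, σ.a .lA e ≠ σ.a .lB e ∧ σ.a .kap e = τ.v .k ∧
          σ.a .lA e = τ.v .r) ∧
        ∀ e < m, σ.a .lA e ≠ σ.a .lB e → σ.a .kap e ≤ τ.v .k)) σ := by
  simp only [findMax, wp_seq, wp_set, Ex.ok_ofNat, Ex.eval_ofNat]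
  refine ⟨by norm_num, by norm_num, ?_⟩
  refine wp_for_time m 5 (fun i τ =>
      (τ.v .go = 0 → τ.v .k = 0 ∧ ∀ e < i, σ.a .lA e = σ.a .lB e) ∧
      (τ.v .go ≠ 0 → (∃ e < i, σ.a .lA e ≠ σ.a .lB e ∧ σ.a .kap e = τ.v .k ∧
          σ.a .lA e = τ.v .r) ∧
        ∀ e < i, σ.a .lA e ≠ σ.a .lB e → σ.a .kap e ≤ τ.v .k)) rfl hmW ?_ ?_ ?_ ?_
  · intro τ hf
    simp [hf.v .m rfl, hm]
  · simp
  · intro i hi τ hf hv hI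
    have h1 := hf.a .lA rfl
    have h2 := hf.a .lB rfl
    have h3 := hf.a .kap rfl
    simp at h1 h2 h3
    have hiM : i < M := by omega
    simp [hv, hiM, h1, h2, h3]
    grind
  · intro τ hf hI ht
    simp at ht
    exact ⟨by simp; omega, fun h => (hI.1 h).2, hI.2⟩

theorem scan_spec (hm : σ.v .m = m) (hmM : m ≤ M) (hmW : m < W) :
    wp W M O scan (fun τ => τ.time ≤ σ.time + (8 * m + 3) ∧
      (τ.v .fnd = 0 → ∀ e < m, σ.a .lA e ≠ σ.a .lB e → σ.a .kap e = σ.v .k →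
        σ.a .lA e ≠ σ.v .r ∧ σ.a .lB e ≠ σ.v .r) ∧
      (τ.v .fnd ≠ 0 → ∃ e < m, σ.a .lA e ≠ σ.a .lB e ∧ σ.a .kap e = σ.v .k ∧
        (σ.a .lA e = σ.v .r ∧ τ.v .x = σ.a .lB e ∨ σ.a .lB e = σ.v .r ∧ τ.v .x = σ.a .lA e))) σ := by
  simp only [scan, wp_seq, wp_set, Ex.ok_ofNat, Ex.eval_ofNat]
  refine ⟨by norm_num, ?_⟩
  refine wp_for_time m 6 (fun i τ =>
      (τ.v .fnd = 0 → ∀ e < i, σ.a .lA e ≠ σ.a .lB e → σ.a .kap e = σ.v .k →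
        σ.a .lA e ≠ σ.v .r ∧ σ.a .lB e ≠ σ.v .r) ∧
      (τ.v .fnd ≠ 0 → ∃ e < i, σ.a .lA e ≠ σ.a .lB e ∧ σ.a .kap e = σ.v .k ∧
        (σ.a .lA e = σ.v .r ∧ τ.v .x = σ.a .lB e ∨ σ.a .lB e = σ.v .r ∧ τ.v .x = σ.a .lA e)))
    rfl hmW ?_ ?_ ?_ ?_
  · intro τ hf
    simp [hf.v .m rfl, hm]
  · simp
  · intro i hi τ hf hv hI
    have h1 := hf.a .lA rfl
    have h2 := hf.a .lB rfl
    have h3 := hf.a .kap rfl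
    have h4 := hf.v .k rfl
    have h5 := hf.v .r rfl
    simp at h1 h2 h3 h4 h5
    have hiM : i < M := by omega
    simp [hv, hiM, h1, h2, h3, h4, h5]
    refine ⟨fun c1 => ?_, fun c1 => ⟨fun c2 => ⟨fun c3 => ?_, fun c3 => ⟨fun c4 => ?_,
      fun c4 => ?_⟩⟩, fun c2 => ?_⟩⟩ <;> grind
  · intro τ hf hI ht
    simp at ht
    exact ⟨by simp; omega, hI.1, hI.2⟩

theorem contract_spec (hm : σ.v .m = m) (hmM : 2 * m ≤ M) (hmW : m < W)
    (hc : ∀ e < m, σ.a .cA e < 2 * m ∧ σ.a .cB e < 2 * m) :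
    wp W M O contract (fun τ => τ.time ≤ σ.time + (7 * m + 2) ∧ ∀ e < m,
      τ.a .cA e = (if σ.a .reach (σ.a .cA e) = 0 then σ.a .cA e else σ.v .v) ∧
      τ.a .cB e = (if σ.a .reach (σ.a .cB e) = 0 then σ.a .cB e else σ.v .v)) σ := by
  refine wp_for_time m 5 (fun i τ => ∀ e < m,
      (τ.a .cA e = if e < i then (if σ.a .reach (σ.a .cA e) = 0 then σ.a .cA e else σ.v .v)
        else σ.a .cA e) ∧
      (τ.a .cB e = if e < i then (if σ.a .reach (σ.a .cB e) = 0 then σ.a .cB e else σ.v .v)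
        else σ.a .cB e)) rfl hmW ?_ ?_ ?_ ?_
  · intro τ hf
    simp [hf.v .m rfl, hm]
  · simp
  · intro i hi τ hf hv hI
    have hx := hf.v .v rfl
    have hr := hf.a .reach rfl
    have h1 := (hI i hi).1
    have h2 := (hI i hi).2
    simp only [lt_irrefl, if_false] at h1 h2
    have hiM : i < M := by omega
    have hc1 : σ.a .cA i < M := by have := hc i hi; omega
    have hc2 : σ.a .cB i < M := by have := hc i hi; omega
    simp [hv, hiM, hx, hr, h1, h2, hc1, hc2]
    grind
  · intro τ hf hI ht
    refine ⟨by simp; omega, fun e he => ?_⟩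
    have := hI e he
    simpa [he] using this

theorem lowerLevels_spec (hm : σ.v .m = m) (hmM : m ≤ M) (hmW : m < W) :
    wp W M O lowerLevels (fun τ => τ.time ≤ σ.time + (4 * m + 2) ∧ ∀ e < m,
      τ.a .kap e = (if σ.a .cA e = σ.a .cB e then σ.a .kap e else σ.v .k)) σ := by
  refine wp_for_time m 2 (fun i τ => ∀ e < m,
      τ.a .kap e = (if σ.a .cA e = σ.a .cB e ∨ i ≤ e then σ.a .kap e else σ.v .k))
    rfl hmW ?_ ?_ ?_ ?_
  · intro τ hf
    simp [hf.v .m rfl, hm]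
  · simp
  · intro i hi τ hf hv hI
    have h1 := hf.a .cA rfl
    have h2 := hf.a .cB rfl
    have h3 := hf.v .k rfl
    have hiM : i < M := by omega
    simp [hv, hiM, h1, h2, h3]
    grind
  · intro τ hf hI ht
    refine ⟨by simp; omega, fun e he => ?_⟩
    have := hI e he
    have h3 : ¬ m ≤ e := by omega
    simpa [h3] using this

/-- The labels that occur on edges between different labels. -/
def labelSet (m : ℕ) (a b : ℕ → ℕ) : Finset ℕ :=
  ((Finset.range m).filter fun e => a e ≠ b e).image a ∪
    ((Finset.range m).filter fun e => a e ≠ b e).image b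

theorem mem_labelSet {a b : ℕ → ℕ} {c : ℕ} :
    c ∈ labelSet m a b ↔ ∃ e < m, a e ≠ b e ∧ (a e = c ∨ b e = c) := by
  simp only [labelSet, Finset.mem_union, Finset.mem_image, Finset.mem_filter, Finset.mem_range]
  grind

theorem markTouched_spec (hm : σ.v .m = m) (hmM : 2 * m ≤ M) (hmW : 2 * m < W)
    (hc : ∀ e < m, σ.a .cA e < 2 * m ∧ σ.a .cB e < 2 * m) (hk : σ.v .k + σ.v .step < W) :
    wp W M O markTouched (fun τ => τ.time ≤ σ.time + (12 * m + 4) ∧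
      (∀ u < 2 * m, τ.a .touch u ≠ 0 ↔ u ∈ labelSet m (σ.a .cA) (σ.a .cB)) ∧
      ∀ e < m, τ.a .kap e =
        (if σ.a .cA e = σ.a .cB e then σ.a .kap e else σ.v .k + σ.v .step)) σ := by
  simp only [markTouched, wp_seq]
  refine wp_for_time (2 * m) 1 (fun i τ => ∀ u < i, τ.a .touch u = 0) rfl hmW ?_ ?_ ?_ ?_
  · intro τ hf
    simp [hf.v .m rfl, hm]
    omega
  · simp
  · intro i hi τ hf hv hI
    have hiM : i < M := by omega
    simp [hv, hiM]
    grind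
  intro τ hf hI ht
  have f1 := hf.a .cA rfl
  have f2 := hf.a .cB rfl
  have f3 := hf.a .kap rfl
  have f4 := hf.v .k rfl
  have f5 := hf.v .step rfl
  have f6 := hf.v .m rfl
  refine wp_for_time m 4 (fun i υ => (∀ u < 2 * m, υ.a .touch u ≠ 0 ↔
      ∃ e < i, σ.a .cA e ≠ σ.a .cB e ∧ (σ.a .cA e = u ∨ σ.a .cB e = u)) ∧
      ∀ e < m, υ.a .kap e = (if σ.a .cA e = σ.a .cB e ∨ i ≤ e then σ.a .kap e
        else σ.v .k + σ.v .step)) rfl (by omega) ?_ ?_ ?_ ?_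
  · intro υ hf
    simp [hf.v .m rfl, f6, hm]
  · simp [f3]
    exact hI
  · intro i hi υ hf' hv hI'
    have h1 := hf'.a .cA rfl
    have h2 := hf'.a .cB rfl
    have h4 := hf'.v .k rfl
    have h5 := hf'.v .step rfl
    simp at h1 h2 h4 h5
    have hiM : i < M := by omega
    have hc1 : σ.a .cA i < M := by have := hc i hi; omega
    have hc2 : σ.a .cB i < M := by have := hc i hi; omega
    simp [hv, hiM, h1, h2, h4, h5, f1, f2, f4, f5, hc1, hc2, hk]
    obtain ⟨hI1, hI2⟩ := hI'
    refine ⟨fun heq => ⟨fun u hu => ?_, fun e he => ?_⟩, fun hne => ⟨fun u hu => ?_, fun e he => ?_⟩⟩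
    · have := hI1 u hu
      constructor
      · intro h
        obtain ⟨e, h1, h2⟩ := this.1 h
        exact ⟨e, by omega, h2⟩
      · rintro ⟨e, h1, h2, h3⟩
        refine this.2 ⟨e, ?_, h2, h3⟩
        have : e ≠ i := by rintro rfl; exact h2 heq
        omega
    · have := hI2 e he
      grind
    · have := hI1 u hu
      by_cases hub : u = σ.a .cB i
      · simp [hub]
        exact ⟨i, by omega, hne, .inr rfl⟩
      by_cases hua : u = σ.a .cA i
      · simp [hua]
        exact ⟨i, by omega, hne, .inl rfl⟩
      simp only [hub, hua, if_false]
      constructor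
      · intro h
        obtain ⟨e, h1, h2⟩ := this.1 h
        exact ⟨e, by omega, h2⟩
      · rintro ⟨e, h1, h2, h3⟩
        refine this.2 ⟨e, ?_, h2, h3⟩
        have : e ≠ i := by rintro rfl; rcases h3 with h | h <;> simp_all
        omega
    · have := hI2 e he
      grind
  · intro υ hf' hI' ht'
    simp only [St.tick_time] at ht' ⊢
    refine ⟨by omega, fun u hu => ?_, fun e he => ?_⟩
    · rw [mem_labelSet]; exact hI'.1 u hu
    · have := hI'.2 e he
      have h3 : ¬ m ≤ e := by omega
      simpa [h3] using this

end Specs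

end StructRAM

/-! ### The flow instance and the residual search -/

namespace StructRAM

section Specs

variable {W M m : ℕ} {O : FlowSubroutine} {σ : St}

/-- The capacity of the arcs that represent an edge with end labels `a` and `b` and scaled weight
`w`, for the label `v`. -/
def arcWeight (v a b w : ℕ) : ℕ := if a ≠ b ∧ a ≤ v ∧ b ≤ v then w else 0

/-- The first `m` arcs lead from `v` to the first ends of the edges, the next `m` arcs from the
first to the second ends, and the last `2 * m` arcs from the labels to the sink. -/
theorem build_spec (hm : σ.v .m = m) (hM : 4 + 12 * m ≤ M) (hMW : 16 * M ≤ W)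
    (hw : ∀ e < m, σ.v .dd * σ.a .inp (4 + 3 * e) < W) :
    wp W M O build (fun τ => τ.time ≤ σ.time + (26 * m + 16) ∧
      τ.a .inst 0 = 2 * m + 1 ∧ τ.a .inst 1 = 4 * m ∧ τ.a .inst 2 = σ.v .v ∧
      τ.a .inst 3 = 2 * m ∧
      (∀ e < m, τ.a .inst (4 + 3 * e) = σ.v .v ∧ τ.a .inst (5 + 3 * e) = σ.a .cA e ∧
        τ.a .inst (6 + 3 * e) = arcWeight (σ.v .v) (σ.a .cA e) (σ.a .cB e)
          (σ.v .dd * σ.a .inp (4 + 3 * e)) ∧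
        τ.a .inst (4 + 3 * (m + e)) = σ.a .cA e ∧ τ.a .inst (5 + 3 * (m + e)) = σ.a .cB e ∧
        τ.a .inst (6 + 3 * (m + e)) = arcWeight (σ.v .v) (σ.a .cA e) (σ.a .cB e)
          (σ.v .dd * σ.a .inp (4 + 3 * e))) ∧
      ∀ u < 2 * m, τ.a .inst (4 + 3 * (2 * m + u)) = u ∧
        τ.a .inst (5 + 3 * (2 * m + u)) = 2 * m ∧
        τ.a .inst (6 + 3 * (2 * m + u)) = σ.v .lam) σ := by
  simp only [build, wp_seq, wp_put, St.put_a, St.put_v, St.tick_a, St.tick_v, Ex.eval_add,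
    Ex.eval_mul, Ex.eval_ofNat, Ex.eval_var, Ex.ok_ofNat, Ex.ok_var, Ex.ok_add, Ex.ok_mul, hm,
    true_and, and_true]
  refine ⟨by norm_num, ?_, by omega, by norm_num, ?_, by omega, by norm_num, by omega, by norm_num,
    ?_, by omega, ?_⟩
  · refine ⟨⟨by norm_num, ?_⟩, by norm_num, ?_⟩ <;> omega
  · refine ⟨by norm_num, ?_⟩; omega
  · refine ⟨by norm_num, ?_⟩; omega
  refine wp_for_time m 14 (fun i τ => τ.a .inst 0 = 2 * m + 1 ∧ τ.a .inst 1 = 4 * m ∧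
      τ.a .inst 2 = σ.v .v ∧ τ.a .inst 3 = 2 * m ∧
      (∀ e < i, τ.a .inst (4 + 3 * e) = σ.v .v ∧ τ.a .inst (5 + 3 * e) = σ.a .cA e ∧
        τ.a .inst (6 + 3 * e) = arcWeight (σ.v .v) (σ.a .cA e) (σ.a .cB e)
          (σ.v .dd * σ.a .inp (4 + 3 * e)) ∧
        τ.a .inst (4 + 3 * (m + e)) = σ.a .cA e ∧ τ.a .inst (5 + 3 * (m + e)) = σ.a .cB e ∧
        τ.a .inst (6 + 3 * (m + e)) = arcWeight (σ.v .v) (σ.a .cA e) (σ.a .cB e)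
          (σ.v .dd * σ.a .inp (4 + 3 * e)))) rfl (by omega) ?_ ?_ ?_ ?_
  · intro τ hf
    simp [hf.v .m rfl, hm]
  · simp
  · intro i hi τ hf hv hI
    have f1 := hf.a .cA rfl
    have f2 := hf.a .cB rfl
    have f3 := hf.a .inp rfl
    have f4 := hf.v .v rfl
    have f5 := hf.v .dd rfl
    have f6 := hf.v .m rfl
    simp at f4 f5 f6
    have f1 : τ.a .cA = σ.a .cA := by rw [f1]; ext; simp
    have f2 : τ.a .cB = σ.a .cB := by rw [f2]; ext; simp
    have f3 : τ.a .inp = σ.a .inp := by rw [f3]; ext; simp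
    have hiM : i < M := by omega
    have hwi := hw i hi
    rw [wp_seq, wp_set]
    refine ⟨by simp [hv, hiM], ?_⟩
    rw [wp_seq, wp_set]
    refine ⟨by simp [hv, hiM], ?_⟩
    rw [wp_seq, wp_set]
    refine ⟨by simp, ?_⟩
    rw [wp_seq]
    refine wp_mono (Q := fun υ => υ.time ≤ τ.time + 1 + 7 ∧
      υ.v .cap = arcWeight (σ.v .v) (σ.a .cA i) (σ.a .cB i)
        (σ.v .dd * σ.a .inp (4 + 3 * i))) ?_ ?_
    · have e1 : 3 * i < W := by omega
      have e2 : 4 + 3 * i < W := by omega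
      have e3 : 4 + 3 * i < M := by omega
      simp [hv, f1, f2, f3, f4, f5, e1, e2, e3, hwi, arcWeight]
      grind
    · rintro υ fυ ⟨ht, hc⟩
      have g1 := fυ.v .e rfl
      have g2 := fυ.v .m rfl
      have g3 := fυ.v .v rfl
      have g4 := fυ.v .a rfl
      have g5 := fυ.v .b rfl
      have g6 := fυ.a .inst rfl
      simp [f1, f2, f3, f4, f5, f6, hv, hm] at g1 g2 g3 g4 g5 g6
      have e1 : 3 * i < W := by omega
      have e2 : m + i < W := by omega
      have e3 : 3 * (m + i) < W := by omega
      have e4 : 4 + 3 * i < W := by omega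
      have e5 : 5 + 3 * i < W := by omega
      have e6 : 6 + 3 * i < W := by omega
      have e7 : 4 + 3 * (m + i) < W := by omega
      have e8 : 5 + 3 * (m + i) < W := by omega
      have e9 : 6 + 3 * (m + i) < W := by omega
      have d4 : 4 + 3 * i < M := by omega
      have d5 : 5 + 3 * i < M := by omega
      have d6 : 6 + 3 * i < M := by omega
      have d7 : 4 + 3 * (m + i) < M := by omega
      have d8 : 5 + 3 * (m + i) < M := by omega
      have d9 : 6 + 3 * (m + i) < M := by omega
      obtain ⟨i1, i2, i3, i4, i5⟩ := hI
      simp only [wp_put, wp_seq, St.put_a, St.put_v, St.tick_a, St.tick_v, Ex.eval_add,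
        Ex.eval_mul, Ex.eval_ofNat, Ex.eval_var, Ex.ok_ofNat, Ex.ok_var, Ex.ok_add, Ex.ok_mul,
        true_and, and_true, g1, g2, g3, g4, g5, g6, hc, e1, e2, e3, e4, e5, e6, e7, e8, e9, d4, d5,
        d6, d7, d8, d9, if_true, St.tick_time, St.put_time, St.set_a]
      refine ⟨by norm_num, by norm_num, by norm_num, by norm_num, by norm_num, by norm_num,
        by omega, ?_, ?_, ?_, ?_, ?_⟩
      · rw [if_neg, if_neg, if_neg, if_neg, if_neg, if_neg, i1] <;> omega
      · rw [if_neg, if_neg, if_neg, if_neg, if_neg, if_neg, i2] <;> omega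
      · rw [if_neg, if_neg, if_neg, if_neg, if_neg, if_neg, i3] <;> omega
      · rw [if_neg, if_neg, if_neg, if_neg, if_neg, if_neg, i4] <;> omega
      · intro e he
        rcases Nat.lt_succ_iff_lt_or_eq.1 he with he | rfl
        · obtain ⟨j1, j2, j3, j4, j5, j6⟩ := i5 e he
          refine ⟨?_, ?_, ?_, ?_, ?_, ?_⟩
          · rw [if_neg, if_neg, if_neg, if_neg, if_neg, if_neg, j1] <;> omega
          · rw [if_neg, if_neg, if_neg, if_neg, if_neg, if_neg, j2] <;> omega
          · rw [if_neg, if_neg, if_neg, if_neg, if_neg, if_neg, j3] <;> omega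
          · rw [if_neg, if_neg, if_neg, if_neg, if_neg, if_neg, j4] <;> omega
          · rw [if_neg, if_neg, if_neg, if_neg, if_neg, if_neg, j5] <;> omega
          · rw [if_neg, if_neg, if_neg, if_neg, if_neg, if_neg, j6] <;> omega
        · refine ⟨?_, ?_, ?_, ?_, ?_, ?_⟩
          · rw [if_neg, if_neg, if_neg, if_neg, if_neg, if_pos rfl] <;> omega
          · rw [if_neg, if_neg, if_neg, if_neg, if_pos rfl] <;> omega
          · rw [if_neg, if_neg, if_neg, if_pos rfl] <;> omega
          · rw [if_neg, if_neg, if_pos rfl] <;> omega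
          · rw [if_neg, if_pos rfl]; omega
          · rw [if_pos rfl]
  intro τ hf hI ht
  have f4 := hf.v .v rfl
  have f5 := hf.v .lam rfl
  have f6 := hf.v .m rfl
  simp only [St.tick_v, St.put_v, St.tick_time, St.put_time] at f4 f5 f6 ht
  obtain ⟨i1, i2, i3, i4, i5⟩ := hI
  refine wp_for_time (2 * m) 3 (fun i υ => (∀ q < 4 + 3 * (2 * m), υ.a .inst q = τ.a .inst q) ∧
      ∀ u < i, υ.a .inst (4 + 3 * (2 * m + u)) = u ∧
        υ.a .inst (5 + 3 * (2 * m + u)) = 2 * m ∧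
        υ.a .inst (6 + 3 * (2 * m + u)) = σ.v .lam) rfl (by omega) ?_ ?_ ?_ ?_
  · intro υ hf'
    simp [hf'.v .m rfl, f6, hm]
    omega
  · simp
  · intro i hi υ hf' hv hI'
    have h1 := hf'.v .m rfl
    have h2 := hf'.v .lam rfl
    simp [f6, f5, hm] at h1 h2
    have c1 : 2 * m < W := by omega
    have c2 : 2 * m + i < W := by omega
    have c3 : 3 * (2 * m + i) < W := by omega
    have c4 : 4 + 3 * (2 * m + i) < W := by omega
    have c5 : 5 + 3 * (2 * m + i) < W := by omega
    have c6 : 6 + 3 * (2 * m + i) < W := by omega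
    have d4 : 4 + 3 * (2 * m + i) < M := by omega
    have d5 : 5 + 3 * (2 * m + i) < M := by omega
    have d6 : 6 + 3 * (2 * m + i) < M := by omega
    simp [hv, h1, h2, c1, c2, c3, c4, c5, c6, d4, d5, d6]
    obtain ⟨j1, j2⟩ := hI'
    refine ⟨fun q hq => ?_, fun u hu => ?_⟩
    · rw [if_neg, if_neg, if_neg, j1 q hq] <;> omega
    · rcases hu.lt_or_eq with hu | rfl
      · obtain ⟨k1, k2, k3⟩ := j2 u hu
        refine ⟨?_, ?_, ?_⟩
        · rw [if_neg, if_neg, if_neg, k1] <;> omega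
        · rw [if_neg, if_neg, if_neg, k2] <;> omega
        · rw [if_neg, if_neg, k3] <;> omega
      · refine ⟨?_, ?_, ?_⟩
        · rw [if_neg, if_neg, if_pos rfl] <;> omega
        · rw [if_neg, if_pos rfl]; omega
        · exact fun h => absurd rfl h
  · intro υ hf' hI' ht'
    obtain ⟨j1, j2⟩ := hI'
    simp only [St.tick_time, St.tick_a] at ht' ⊢
    refine ⟨by omega, ?_, ?_, ?_, ?_, fun e he => ?_, j2⟩
    · rw [j1 _ (by omega), i1]
    · rw [j1 _ (by omega), i2]
    · rw [j1 _ (by omega), i3]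
    · rw [j1 _ (by omega), i4]
    · rw [j1 _ (by omega), j1 _ (by omega), j1 _ (by omega), j1 _ (by omega), j1 _ (by omega),
        j1 _ (by omega)]
      exact i5 e he

/-- The nodes below `N` that are marked by `f`. -/
def marked (N : ℕ) (f : ℕ → ℕ) : Finset ℕ := (Finset.range N).filter fun u => f u ≠ 0

/-- Closedness of a set of nodes under residual arcs, for the first `N` arcs of an instance stored
in an array. -/
def ArcClosed (N : ℕ) (inst flo : ℕ → ℕ) (p : ℕ → Prop) : Prop :=
  ∀ j < N, (p (inst (4 + 3 * j)) → flo j < inst (6 + 3 * j) → p (inst (5 + 3 * j))) ∧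
    (p (inst (5 + 3 * j)) → 0 < flo j → p (inst (4 + 3 * j)))

theorem relax_spec (hm : σ.v .m = m) (hM : 7 + 12 * m ≤ M) (hMW : 16 * M ≤ W)
    (hin : ∀ j < 4 * m, σ.a .inst (4 + 3 * j) < 2 * m + 1 ∧ σ.a .inst (5 + 3 * j) < 2 * m + 1)
    (hchg : σ.v .chg = 0) (p : ℕ → Prop) (hp : ArcClosed (4 * m) (σ.a .inst) (σ.a .flo) p)
    (hpr : ∀ u, σ.a .reach u ≠ 0 → p u) :
    wp W M O relax (fun τ => τ.time ≤ σ.time + (28 * m + 2) ∧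
      (∀ u, σ.a .reach u ≠ 0 → τ.a .reach u ≠ 0) ∧ (∀ u, τ.a .reach u ≠ 0 → p u) ∧
      (τ.v .chg = 0 → τ.a .reach = σ.a .reach ∧
        ArcClosed (4 * m) (σ.a .inst) (σ.a .flo) fun u => σ.a .reach u ≠ 0) ∧
      (τ.v .chg ≠ 0 → τ.v .chg = 1 ∧ ∃ u < 2 * m + 1, σ.a .reach u = 0 ∧ τ.a .reach u ≠ 0)) σ := by
  refine wp_for_time (4 * m) 5 (fun i τ =>
      (∀ u, σ.a .reach u ≠ 0 → τ.a .reach u ≠ 0) ∧ (∀ u, τ.a .reach u ≠ 0 → p u) ∧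
      (τ.v .chg = 0 → (∀ u, τ.a .reach u = σ.a .reach u) ∧
        ArcClosed i (σ.a .inst) (σ.a .flo) fun u => σ.a .reach u ≠ 0) ∧
      (τ.v .chg ≠ 0 → τ.v .chg = 1 ∧ ∃ u < 2 * m + 1, σ.a .reach u = 0 ∧ τ.a .reach u ≠ 0))
    rfl (by omega) ?_ ?_ ?_ ?_
  · intro τ hf
    simp [hf.v .m rfl, hm]
    omega
  · simp only [St.tick_a, St.tick_v, St.set_a, St.set_v]
    refine ⟨fun _ h => h, hpr, fun _ => ⟨by simp, fun j hj => absurd hj (by omega)⟩, ?_⟩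
    simp [hchg]
  · intro i hi τ hf hv hI
    have h1 := hf.a .inst rfl
    have h2 := hf.a .flo rfl
    have c1 : 3 * i < W := by omega
    have c4 : 4 + 3 * i < W := by omega
    have c5 : 5 + 3 * i < W := by omega
    have c6 : 6 + 3 * i < W := by omega
    have d0 : i < M := by omega
    have d4 : 4 + 3 * i < M := by omega
    have d5 : 5 + 3 * i < M := by omega
    have d6 : 6 + 3 * i < M := by omega
    obtain ⟨b1, b2⟩ := hin i hi
    have b3 : σ.a .inst (4 + 3 * i) < M := by omega
    have b4 : σ.a .inst (5 + 3 * i) < M := by omega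
    obtain ⟨i1, i2, i3, i4⟩ := hI
    obtain ⟨p1, p2⟩ := hp i hi
    have hcl : ∀ {q : ℕ → Prop}, ArcClosed i (σ.a .inst) (σ.a .flo) q →
        ((q (σ.a .inst (4 + 3 * i)) → σ.a .flo i < σ.a .inst (6 + 3 * i) →
          q (σ.a .inst (5 + 3 * i))) ∧
        (q (σ.a .inst (5 + 3 * i)) → 0 < σ.a .flo i → q (σ.a .inst (4 + 3 * i)))) →
        ArcClosed (i + 1) (σ.a .inst) (σ.a .flo) q := by
      intro q h1 h2 j hj
      rcases Nat.lt_succ_iff_lt_or_eq.1 hj with hj | rfl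
      · exact h1 j hj
      · exact h2
    simp only [wp_ite, wp_skip, wp_seq, wp_put, wp_set, Ex.ok_rd, Ex.ok_add, Ex.ok_mul, Ex.ok_ofNat,
      Ex.ok_var, Ex.eval_rd, Ex.eval_add, Ex.eval_mul, Ex.eval_ofNat, Ex.eval_var, Ex.ok_lt,
      Ex.eval_lt, St.tick_a, St.tick_v, St.set_a, St.set_v, St.put_a, St.put_v, hv, h1, h2, c1, c4,
      c5, c6, d0, d4, d5, d6, b3, b4, true_and, and_true, St.tick_time, St.set_time, St.put_time,
      if_true, reduceCtorEq, if_false]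
    refine ⟨by norm_num, fun hr => ⟨by norm_num, fun hr2 => ⟨by omega, i1, i2, fun h => ?_, i4⟩,
      fun hr2 => ⟨by norm_num, fun hf => ⟨by norm_num, by norm_num, by norm_num, by omega, ?_, ?_, ?_, ?_⟩,
        fun hf => ⟨by omega, i1, i2, fun h => ?_, i4⟩⟩⟩,
      fun hr => ⟨by norm_num, fun hr2 => ⟨by norm_num, fun hf => ⟨by norm_num, by norm_num, by norm_num, by omega,
        ?_, ?_, ?_, ?_⟩, fun hf => ⟨by omega, i1, i2, fun h => ?_, i4⟩⟩,
        fun hr2 => ⟨by omega, i1, i2, fun h => ?_, i4⟩⟩⟩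
    · obtain ⟨e1, e2⟩ := i3 h
      rw [e1] at hr hr2
      exact ⟨e1, hcl e2 ⟨fun _ _ => hr2, fun _ _ => hr⟩⟩
    · intro u hu
      split_ifs
      · norm_num
      · exact i1 u hu
    · intro u hu
      split_ifs at hu with h
      · subst h
        refine p1 (i2 _ hr) ?_
        by_contra hcon
        simp [hcon] at hf
      · exact i2 u hu
    · intro h; simp at h
    · refine fun _ => ⟨σ.a .inst (5 + 3 * i), b2, ?_, by simp⟩
      by_contra hcon
      exact i1 _ hcon hr2
    · obtain ⟨e1, e2⟩ := i3 h
      rw [e1] at hr hr2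
      refine ⟨e1, hcl e2 ⟨fun _ h' => ?_, fun h' => absurd hr2 h'⟩⟩
      simp [h'] at hf
    · intro u hu
      split_ifs
      · norm_num
      · exact i1 u hu
    · intro u hu
      split_ifs at hu with h
      · subst h
        refine p2 (i2 _ hr2) ?_
        by_contra hcon
        simp [hcon] at hf
      · exact i2 u hu
    · intro h; simp at h
    · refine fun _ => ⟨σ.a .inst (4 + 3 * i), b1, ?_, by simp⟩
      by_contra hcon
      exact i1 _ hcon hr
    · obtain ⟨e1, e2⟩ := i3 h
      rw [e1] at hr hr2
      refine ⟨e1, hcl e2 ⟨fun h' => absurd hr h', fun _ h' => ?_⟩⟩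
      simp [h'] at hf
    · obtain ⟨e1, e2⟩ := i3 h
      rw [e1] at hr hr2
      exact ⟨e1, hcl e2 ⟨fun h' => absurd hr h', fun h' => absurd hr2 h'⟩⟩
  · intro τ hf hI ht
    obtain ⟨i1, i2, i3, i4⟩ := hI
    exact ⟨by simp only [St.tick_time]; omega, i1, i2, fun h => ⟨funext (i3 h).1, (i3 h).2⟩, i4⟩

/-- Afterwards the marked nodes form the least set that contains `v` and is closed under residual
arcs. Every round but the last marks a new node, which pays for its time. -/
theorem search_spec (hm : σ.v .m = m) (hM : 7 + 12 * m ≤ M) (hMW : 16 * M ≤ W)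
    (hv : σ.v .v < 2 * m + 1)
    (hin : ∀ j < 4 * m, σ.a .inst (4 + 3 * j) < 2 * m + 1 ∧ σ.a .inst (5 + 3 * j) < 2 * m + 1) :
    wp W M O search (fun τ =>
      τ.time ≤ σ.time + 50 * (m + 1) * ((marked (2 * m + 1) (τ.a .reach)).card + 1) ∧
      τ.a .reach (σ.v .v) ≠ 0 ∧
      ArcClosed (4 * m) (σ.a .inst) (σ.a .flo) (fun u => u < 2 * m + 1 ∧ τ.a .reach u ≠ 0) ∧
      ∀ p : ℕ → Prop, p (σ.v .v) → ArcClosed (4 * m) (σ.a .inst) (σ.a .flo) p →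
        ∀ u < 2 * m + 1, τ.a .reach u ≠ 0 → p u) σ := by
  simp only [search, wp_seq]
  refine wp_for_time (2 * m + 1) 1 (fun i τ => ∀ u < i, τ.a .reach u = 0) rfl (by omega) ?_ ?_ ?_ ?_
  · intro τ hf
    simp [hf.v .m rfl, hm]
    omega
  · simp
  · intro i hi τ hf hv hI
    have hiM : i < M := by omega
    simp [hv, hiM]
    grind
  intro τ hf hI ht
  have f1 := hf.v .v rfl
  have f2 := hf.v .m rfl
  have f3 := hf.a .inst rfl
  have f4 := hf.a .flo rfl
  simp only [wp_seq, wp_put, wp_set, Ex.ok_var, Ex.ok_ofNat, Ex.eval_var, Ex.eval_ofNat, St.tick_v, f1]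
  refine ⟨trivial, by norm_num, by omega, by norm_num, ?_⟩
  -- only nodes below `2 * m + 1` matter; outside, the array may hold marks of other searches
  refine wp_loop (fun υ => υ.v .chg ≤ 1 ∧ υ.a .reach (σ.v .v) ≠ 0 ∧
      (∀ p : ℕ → Prop, p (σ.v .v) → ArcClosed (4 * m) (σ.a .inst) (σ.a .flo) p →
        ∀ u < 2 * m + 1, υ.a .reach u ≠ 0 → p u) ∧
      (υ.v .chg = 0 → ArcClosed (4 * m) (σ.a .inst) (σ.a .flo)
        (fun u => u < 2 * m + 1 ∧ υ.a .reach u ≠ 0)) ∧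
      υ.time + 50 * (m + 1) * υ.v .chg ≤ σ.time +
        50 * (m + 1) * ((marked (2 * m + 1) (υ.a .reach)).card + 1) - 1)
    (fun υ => 2 * m + 2 - (marked (2 * m + 1) (υ.a .reach)).card + υ.v .chg) ?_ ?_
  · simp only [St.tick_v, St.set_v, if_true, St.tick_a, St.set_a, St.put_a, if_true, St.tick_time,
      St.set_time, St.put_time]
    have hcard : (marked (2 * m + 1) ((((τ.tick.put .reach (σ.v .v) 1).tick.set .chg 1).tick).a
        .reach)).card = 1 := by
      rw [Finset.card_eq_one]
      refine ⟨σ.v .v, ?_⟩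
      ext u
      simp only [marked, Finset.mem_filter, Finset.mem_range, Finset.mem_singleton, St.tick_a,
        St.set_a, St.put_a, if_true]
      constructor
      · rintro ⟨h1, h2⟩
        by_contra hne
        rw [if_neg hne] at h2
        exact h2 (hI u h1)
      · rintro rfl
        exact ⟨hv, by simp⟩
    refine ⟨le_rfl, by norm_num, ?_, by norm_num, ?_⟩
    · intro p hp _ u hu h
      split_ifs at h with h1
      · exact h1 ▸ hp
      · exact absurd (hI u hu) h
    · simp only [St.tick_a, St.set_a] at hcard
      rw [hcard]
      omega
  · rintro υ hf' ⟨i1, i2, i3, i4, i5⟩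
    have g1 := hf'.v .m rfl
    have g2 := hf'.a .inst rfl
    have g3 := hf'.a .flo rfl
    simp [f2, hm] at g1
    have g2 : υ.a .inst = σ.a .inst := by rw [g2]; ext; simp [f3]
    have g3 : υ.a .flo = σ.a .flo := by rw [g3]; ext; simp [f4]
    have hpos : 0 < 50 * (m + 1) * ((marked (2 * m + 1) (υ.a .reach)).card + 1) := by positivity
    refine ⟨trivial, fun hc => ?_, fun hc => ?_⟩
    · simp only [Ex.eval_var] at hc
      have hc1 : υ.v .chg = 1 := by omega
      simp only [wp_seq, wp_set, Ex.ok_ofNat, Ex.eval_ofNat]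
      refine ⟨by norm_num, ?_⟩
      set υ' := (υ.tick.set .chg 0).tick with hυ'
      have r1 : υ'.a .reach = υ.a .reach := by simp [hυ']
      -- every set that is closed under residual arcs may be used for minimality
      let p₀ : ℕ → Prop := fun u => u < 2 * m + 1 → ∀ p : ℕ → Prop, p (σ.v .v) →
        ArcClosed (4 * m) (σ.a .inst) (σ.a .flo) p → p u
      refine wp_mono (relax_spec (m := m) (by simp [hυ', g1]) hM hMW (by simpa [hυ', g2] using hin)
        (by simp [hυ']) p₀ ?_ ?_) ?_
      · intro j hj
        simp only [hυ', St.tick_a, St.set_a, g2, g3]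
        obtain ⟨b1, b2⟩ := hin j hj
        exact ⟨fun h hfl _ p hp hcl => (hcl j hj).1 (h b1 p hp hcl) hfl,
          fun h hfl _ p hp hcl => (hcl j hj).2 (h b2 p hp hcl) hfl⟩
      · intro u hu hlt p hp hcl
        rw [r1] at hu
        exact i3 p hp hcl u hlt hu
      · rintro φ - ⟨j1, j2, j3, j4, j5⟩
        rw [r1] at j2 j4 j5
        have hsub : marked (2 * m + 1) (υ.a .reach) ⊆ marked (2 * m + 1) (φ.a .reach) := by
          intro u hu
          simp only [marked, Finset.mem_filter] at hu ⊢
          exact ⟨hu.1, j2 u hu.2⟩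
        have hcle := Finset.card_le_card hsub
        have hcub : (marked (2 * m + 1) (φ.a .reach)).card ≤ 2 * m + 1 := by
          refine (Finset.card_filter_le _ _).trans ?_
          simp
        have htime : φ.time ≤ υ.time + 28 * m + 4 := by
          simp only [hυ', St.tick_time, St.set_time] at j1; omega
        have r2 : υ'.a .inst = σ.a .inst := by simp [hυ', g2]
        have r3 : υ'.a .flo = σ.a .flo := by simp [hυ', g3]
        rw [r2, r3] at j4
        by_cases hφ : φ.v .chg = 0
        · obtain ⟨k1, k2⟩ := j4 hφ
          refine ⟨⟨by omega, j2 _ i2, fun p hp hcl u hu h => j3 u h hu p hp hcl, fun _ => ?_, ?_⟩, ?_⟩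
          · rw [k1]
            intro j hj
            obtain ⟨b1, b2⟩ := hin j hj
            obtain ⟨l1, l2⟩ := k2 j hj
            exact ⟨fun h hfl => ⟨b2, l1 h.2 hfl⟩, fun h hfl => ⟨b1, l2 h.2 hfl⟩⟩
          · rw [k1, hφ]
            rw [hc1] at i5
            omega
          · simp only [hφ, hc1, k1]; omega
        · obtain ⟨k1, u, k2, k3, k4⟩ := j5 hφ
          have hlt : (marked (2 * m + 1) (υ.a .reach)).card <
              (marked (2 * m + 1) (φ.a .reach)).card := by
            refine Finset.card_lt_card ⟨hsub, fun h => ?_⟩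
            have : u ∈ marked (2 * m + 1) (υ.a .reach) :=
              h (by simp only [marked, Finset.mem_filter, Finset.mem_range]; exact ⟨k2, k4⟩)
            simp only [marked, Finset.mem_filter] at this
            exact this.2 k3
          refine ⟨⟨by omega, j2 _ i2, fun p hp hcl u hu h => j3 u h hu p hp hcl,
            fun h => absurd h hφ, ?_⟩, ?_⟩
          · rw [k1]
            rw [hc1] at i5
            have := Nat.mul_le_mul_left (50 * (m + 1)) hlt
            simp only [Nat.mul_add, Nat.succ_eq_add_one] at this i5 ⊢
            omega
          · simp only [k1, hc1]
            omega
    · simp only [Ex.eval_var] at hc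
      refine ⟨?_, i2, i4 hc, i3⟩
      simp only [St.tick_time, St.tick_a]
      rw [hc] at i5
      omega

end Specs

end StructRAM

/-! ### The best set of labels as a minimum cut -/

namespace StructRAM

variable {n m : ℕ}

/-- The flow instance with `2 * m + 1` nodes and `4 * m` arcs that is stored in an array. -/
def storedInstance (m : ℕ) (f : ℕ → ℕ) (v : ℕ) (hv : v < 2 * m) : FlowInstance where
  nodes := 2 * m + 1
  arcs := 4 * m
  source := ⟨v, by omega⟩
  sink := ⟨2 * m, by omega⟩
  source_ne_sink := by simp only [ne_eq, Fin.mk.injEq]; omega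
  tail j := Fin.ofNat (2 * m + 1) (f (4 + 3 * j))
  head j := Fin.ofNat (2 * m + 1) (f (5 + 3 * j))
  cap j := f (6 + 3 * j)

/-- The array `f` describes the instance for label `v`: the arcs from `v` to the first end and from
the first to the second end of every edge carry the scaled weight of the edge, and the arcs from all
labels to the sink have capacity `L`. -/
structure LabelInstance (m : ℕ) (f a b w : ℕ → ℕ) (v L : ℕ) : Prop where
  first : ∀ e < m, f (4 + 3 * e) = v ∧ f (5 + 3 * e) = a e ∧
    f (6 + 3 * e) = arcWeight v (a e) (b e) (w e)
  second : ∀ e < m, f (4 + 3 * (m + e)) = a e ∧ f (5 + 3 * (m + e)) = b e ∧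
    f (6 + 3 * (m + e)) = arcWeight v (a e) (b e) (w e)
  third : ∀ u < 2 * m, f (4 + 3 * (2 * m + u)) = u ∧ f (5 + 3 * (2 * m + u)) = 2 * m ∧
    f (6 + 3 * (2 * m + u)) = L

namespace LabelInstance

variable {f a b w : ℕ → ℕ} {v L : ℕ} (h : LabelInstance m f a b w v L) (hv : v < 2 * m)
  (hab : ∀ e < m, a e < 2 * m ∧ b e < 2 * m)
include h

theorem forall_arc {P : ℕ → ℕ → ℕ → Prop}
    (h1 : ∀ e < m, P v (a e) (arcWeight v (a e) (b e) (w e)))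
    (h2 : ∀ e < m, P (a e) (b e) (arcWeight v (a e) (b e) (w e)))
    (h3 : ∀ u < 2 * m, P u (2 * m) L) :
    ∀ j < 4 * m, P (f (4 + 3 * j)) (f (5 + 3 * j)) (f (6 + 3 * j)) := by
  intro j hj
  by_cases hj1 : j < m
  · obtain ⟨e1, e2, e3⟩ := h.first j hj1
    rw [e1, e2, e3]; exact h1 j hj1
  · by_cases hj2 : j < 2 * m
    · obtain ⟨i, rfl⟩ := Nat.exists_eq_add_of_le (not_lt.1 hj1)
      obtain ⟨e1, e2, e3⟩ := h.second i (by omega)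
      rw [e1, e2, e3]; exact h2 i (by omega)
    · obtain ⟨i, rfl⟩ := Nat.exists_eq_add_of_le (not_lt.1 hj2)
      obtain ⟨e1, e2, e3⟩ := h.third i (by omega)
      rw [e1, e2, e3]; exact h3 i (by omega)

include hv hab in
theorem ends_lt : ∀ j < 4 * m, f (4 + 3 * j) < 2 * m + 1 ∧ f (5 + 3 * j) < 2 * m + 1 :=
  h.forall_arc (P := fun x y _ => x < 2 * m + 1 ∧ y < 2 * m + 1)
    (fun e he => by have := hab e he; omega) (fun e he => by have := hab e he; omega)
    (fun u hu => by omega)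

include hab in
theorem tail_val (j : Fin (4 * m)) :
    ((storedInstance m f v hv).tail j : ℕ) = f (4 + 3 * j) :=
  Nat.mod_eq_of_lt (h.ends_lt hv hab j j.2).1

include hab in
theorem head_val (j : Fin (4 * m)) :
    ((storedInstance m f v hv).head j : ℕ) = f (5 + 3 * j) :=
  Nat.mod_eq_of_lt (h.ends_lt hv hab j j.2).2

include hab in
theorem storedIn (h0 : f 0 = 2 * m + 1) (h1 : f 1 = 4 * m) (h2 : f 2 = v) (h3 : f 3 = 2 * m) :
    StoredIn (storedInstance m f v hv) f :=
  ⟨h0, h1, h2, h3, fun j => ⟨(h.tail_val hv hab j).symm, (h.head_val hv hab j).symm, rfl⟩⟩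

include hab in
open Classical in
/-- The capacity of a cut, up to a constant. -/
theorem cutCap_add (G : WGraph n m) {D : ℕ} (hw : ∀ e : Fin m, w e = D * G.weight e)
    {T : Finset ℕ} (hT : T ⊆ Finset.range (2 * m)) (hvT : v ∈ T) :
    (storedInstance m f v hv).cutCap (fun u => (u : ℕ) ∈ T) +
      D * G.cw (fun e => a e) (fun e => b e) (T.filter (· ≤ v)) =
      (∑ e ∈ Finset.range m, arcWeight v (a e) (b e) (w e)) + L * T.card := by
  have h0 : (storedInstance m f v hv).cutCap (fun u => (u : ℕ) ∈ T) =
      ∑ j ∈ Finset.range (4 * m), if f (4 + 3 * j) ∈ T ∧ f (5 + 3 * j) ∉ T then f (6 + 3 * j)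
        else 0 := by
    rw [Finset.sum_range]
    refine Finset.sum_congr rfl fun j _ => ?_
    rw [show (storedInstance m f v hv).cap j = f (6 + 3 * j) from rfl]
    have e1 := h.tail_val hv hab j
    have e2 := h.head_val hv hab j
    simp only [e1, e2]
  have hsplit : 4 * m = m + m + 2 * m := by ring
  have hsT : 2 * m ∉ T := fun h => by simpa using Finset.mem_range.1 (hT h)
  have h1 : G.cw (fun e => a e) (fun e => b e) (T.filter (· ≤ v)) * D =
      ∑ e ∈ Finset.range m, if a e ∈ T ∧ b e ∈ T then arcWeight v (a e) (b e) (w e) else 0 := by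
    rw [WGraph.cw, Finset.sum_mul, Finset.sum_filter, Finset.sum_range]
    refine Finset.sum_congr rfl fun e _ => ?_
    rw [hw e, arcWeight]
    simp only [Finset.mem_filter, mul_comm D]
    split_ifs <;> first | rfl | grind
  have h3 : ∑ u ∈ Finset.range (2 * m), (if u ∈ T then L else 0) = L * T.card := by
    rw [← Finset.sum_filter, Finset.sum_const, smul_eq_mul, mul_comm]
    congr 2
    ext u
    simp only [Finset.mem_filter, and_iff_right_iff_imp]
    exact fun hu => hT hu
  rw [h0, mul_comm D, h1, hsplit, Finset.sum_range_add, Finset.sum_range_add]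
  have h4 : ∑ u ∈ Finset.range (2 * m), (if f (4 + 3 * (m + m + u)) ∈ T ∧
      f (5 + 3 * (m + m + u)) ∉ T then f (6 + 3 * (m + m + u)) else 0) = L * T.card := by
    rw [← h3]
    refine Finset.sum_congr rfl fun u hu => ?_
    obtain ⟨e1, e2, e3⟩ := h.third u (Finset.mem_range.1 hu)
    rw [← two_mul, e1, e2, e3]
    simp [hsT]
  rw [h4, ← Finset.sum_add_distrib, add_right_comm, ← Finset.sum_add_distrib]
  congr 1
  refine Finset.sum_congr rfl fun e he => ?_
  obtain ⟨e1, e2, e3⟩ := h.first e (Finset.mem_range.1 he)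
  obtain ⟨e4, e5, e6⟩ := h.second e (Finset.mem_range.1 he)
  rw [e1, e2, e3, e4, e5, e6]
  by_cases h5 : a e ∈ T <;> by_cases h6 : b e ∈ T <;> simp [h5, h6, hvT]

include hab in
/-- The nodes reached in the residual graph of a maximum flow are the best set of labels. -/
theorem best (G : WGraph n m) {D : ℕ} (hw : ∀ e : Fin m, w e = D * G.weight e)
    {φ : Fin (4 * m) → ℕ} (hφ : (storedInstance m f v hv).IsMaxFlow φ) {flo : ℕ → ℕ}
    (hflo : ∀ j : Fin (4 * m), flo j = φ j) {S : Finset ℕ} (hS : S ⊆ Finset.range (2 * m + 1))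
    (hvS : v ∈ S) (hcl : ArcClosed (4 * m) f flo (· ∈ S))
    (hmin : ∀ p : ℕ → Prop, p v → ArcClosed (4 * m) f flo p → ∀ u ∈ S, p u) :
    G.Best D L (fun e => a e) (fun e => b e) v S := by
  have hres : (storedInstance m f v hv).ResClosed φ fun u => (u : ℕ) ∈ S := by
    intro j
    have e1 := h.tail_val hv hab j
    have e2 := h.head_val hv hab j
    have e3 := hflo j
    have e4 := hcl j j.2
    simp only [← e1, ← e2, e3] at e4
    exact e4
  have hleast : ∀ q, q (storedInstance m f v hv).source →
      (storedInstance m f v hv).ResClosed φ q → ∀ u : Fin (2 * m + 1), (u : ℕ) ∈ S → q u := by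
    intro q hq hqc u hu
    have := hmin (fun x => ∃ hx : x < 2 * m + 1, q ⟨x, hx⟩) ⟨_, hq⟩ ?_ u hu
    · exact this.2
    · intro j hj
      obtain ⟨b1, b2⟩ := h.ends_lt hv hab j hj
      have e1 : (storedInstance m f v hv).tail ⟨j, hj⟩ = ⟨f (4 + 3 * j), b1⟩ :=
        Fin.ext (h.tail_val hv hab ⟨j, hj⟩)
      have e2 : (storedInstance m f v hv).head ⟨j, hj⟩ = ⟨f (5 + 3 * j), b2⟩ :=
        Fin.ext (h.head_val hv hab ⟨j, hj⟩)
      have h3 := hqc ⟨j, hj⟩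
      rw [e1, e2] at h3
      have h4 := hflo ⟨j, hj⟩
      simp only at h4
      rw [h4]
      exact ⟨fun ⟨_, hx⟩ hl => ⟨b2, h3.1 hx hl⟩, fun ⟨_, hx⟩ hl => ⟨b1, h3.2 hx hl⟩⟩
  obtain ⟨h1, h2⟩ := hφ.cutCap_le (p := fun u => (u : ℕ) ∈ S) hvS hres hleast
  have hS' : S ⊆ Finset.range (2 * m) := fun u hu => by
    have := Finset.mem_range.1 (hS hu)
    have : u ≠ 2 * m := by rintro rfl; exact h1 hu
    exact Finset.mem_range.2 (by omega)
  have key : ∀ T ⊆ Finset.range (2 * m), v ∈ T →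
      (storedInstance m f v hv).cutCap (fun u => (u : ℕ) ∈ S) ≤
        (storedInstance m f v hv).cutCap (fun u => (u : ℕ) ∈ T) ∧
      ((storedInstance m f v hv).cutCap (fun u => (u : ℕ) ∈ S) =
        (storedInstance m f v hv).cutCap (fun u => (u : ℕ) ∈ T) → S ⊆ T) := by
    intro T hT hvT
    obtain ⟨h3, h4⟩ := h2 (fun u => (u : ℕ) ∈ T) hvT
      (fun hs => lt_irrefl _ (Finset.mem_range.1 (hT hs)))
    refine ⟨h3, fun h5 u hu => ?_⟩
    exact h4 h5 ⟨u, Finset.mem_range.1 (hS hu)⟩ hu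
  have hcS := h.cutCap_add hv hab G hw hS' hvS
  have hle : S ⊆ Finset.range (v + 1) := by
    have hT : S.filter (· ≤ v) ⊆ Finset.range (2 * m) := (Finset.filter_subset _ _).trans hS'
    have hvT : v ∈ S.filter (· ≤ v) := by simp [hvS]
    have hcT := h.cutCap_add hv hab G hw hT hvT
    rw [Finset.filter_filter] at hcT
    simp only [and_self] at hcT
    obtain ⟨h3, h4⟩ := key _ hT hvT
    have h5 : L * (S.filter (· ≤ v)).card ≤ L * S.card :=
      Nat.mul_le_mul_left _ (Finset.card_filter_le _ _)
    intro u hu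
    have := h4 (by omega) hu
    simp only [Finset.mem_filter] at this
    exact Finset.mem_range.2 (by omega)
  have hfilter : ∀ T ⊆ Finset.range (v + 1), T.filter (· ≤ v) = T := fun T hT =>
    Finset.filter_true_of_mem fun u hu => by have := Finset.mem_range.1 (hT hu); omega
  have hsub : ∀ T ⊆ Finset.range (v + 1), T ⊆ Finset.range (2 * m) := fun T hT =>
    hT.trans fun u hu => by simp only [Finset.mem_range] at hu ⊢; omega
  rw [hfilter S hle] at hcS
  refine ⟨hvS, hle, fun T hT hvT => ?_, fun T hT hvT he => ?_⟩
  · have hcT := h.cutCap_add hv hab G hw (hsub T hT) hvT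
    rw [hfilter T hT] at hcT
    have := (key T (hsub T hT) hvT).1
    omega
  · have hcT := h.cutCap_add hv hab G hw (hsub T hT) hvT
    rw [hfilter T hT] at hcT
    exact (key T (hsub T hT) hvT).2 (by omega)

end LabelInstance

/-- A call of the flow subroutine is of the admissible size. -/
def SmallCall (m B : ℕ) (I : FlowInstance) : Prop :=
  I.nodes = 2 * m + 1 ∧ I.arcs = 4 * m ∧ ∀ a, I.cap a ≤ B

theorem arcWeight_le (v a b w : ℕ) : arcWeight v a b w ≤ w := by
  unfold arcWeight; split_ifs <;> omega

/-- One flow call finds the best set of labels around the new label and contracts it. The time is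
paid for by the labels that disappear. -/
theorem insertLabel_spec {W M B D : ℕ} {O : FlowSubroutine} {σ : St} (G : WGraph n m)
    (hO : O.Correct) (hm : σ.v .m = m) (hM : 7 + 12 * m ≤ M) (hMW : 16 * M ≤ W) (hBW : B < W)
    (hdd : σ.v .dd = D) (hinp : ∀ e : Fin m, σ.a .inp (4 + 3 * e) = G.weight e)
    (hDB : ∀ e : Fin m, D * G.weight e ≤ B) (hlam : σ.v .lam ≤ B) (hv : σ.v .v < 2 * m)
    (hc : ∀ e < m, σ.a .cA e < 2 * m ∧ σ.a .cB e < 2 * m) :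
    wp W M O insertLabel (fun τ => ∃ S : Finset ℕ,
      G.Best D (σ.v .lam) (fun e => σ.a .cA e) (fun e => σ.a .cB e) (σ.v .v) S ∧
      τ.time ≤ σ.time + 100 * (m + 1) * (S.card + 1) ∧
      (∀ e < m, τ.a .cA e = WGraph.collapse S (σ.v .v) (σ.a .cA e) ∧
        τ.a .cB e = WGraph.collapse S (σ.v .v) (σ.a .cB e)) ∧
      ∃ I, τ.calls = I :: σ.calls ∧ SmallCall m B I) σ := by
  simp only [insertLabel, wp_seq]
  have hwt : ∀ e (he : e < m), σ.v .dd * σ.a .inp (4 + 3 * e) ≤ B := fun e he => by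
    rw [hdd, hinp ⟨e, he⟩]; exact hDB ⟨e, he⟩
  refine wp_mono (build_spec hm (by omega) hMW fun e he => (hwt e he).trans_lt hBW) ?_
  rintro τ fτ ⟨t1, i0, i1, i2, i3, i4, i5⟩
  have hLI : LabelInstance m (τ.a .inst) (σ.a .cA) (σ.a .cB)
      (fun e => σ.v .dd * σ.a .inp (4 + 3 * e)) (σ.v .v) (σ.v .lam) :=
    ⟨fun e he => ⟨(i4 e he).1, (i4 e he).2.1, (i4 e he).2.2.1⟩,
      fun e he => (i4 e he).2.2.2, i5⟩
  set I := storedInstance m (τ.a .inst) (σ.v .v) hv with hI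
  have hcap : ∀ j, I.cap j ≤ B := fun j =>
    hLI.forall_arc (P := fun _ _ c => c ≤ B) (fun e he => (arcWeight_le ..).trans (hwt e he))
      (fun e he => (arcWeight_le ..).trans (hwt e he)) (fun _ _ => hlam) j j.2
  rw [wp_seq]
  refine ⟨_, Run.flow τ I (hLI.storedIn hv hc i0 i1 i2 i3)
    (by change 4 + 3 * (4 * m) ≤ M; omega)
    fun j => (((hO I).1.1 j).trans (hcap j)).trans_lt hBW, ?_⟩
  set υ : St := ⟨τ.v, Function.update τ.a .flo
    (fun i => if h : i < I.arcs then O I ⟨i, h⟩ else τ.a .flo i), τ.time + 1, I :: τ.calls⟩ with hυ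
  have a1 : υ.a .inst = τ.a .inst := by simp [hυ]
  have a2 : υ.a .cA = σ.a .cA := by simp [hυ, fτ.a .cA rfl]
  have a3 : υ.a .cB = σ.a .cB := by simp [hυ, fτ.a .cB rfl]
  have a4 : υ.v .m = m := by simp [hυ, fτ.v .m rfl, hm]
  have a5 : υ.v .v = σ.v .v := by simp [hυ, fτ.v .v rfl]
  have a6 : ∀ j : Fin (4 * m), υ.a .flo j = O I j := fun j => by
    simp only [hυ, Function.update_self]
    exact dif_pos j.2
  have hends := hLI.ends_lt hv hc
  rw [wp_seq]
  refine wp_mono (search_spec a4 hM hMW (by rw [a5]; omega) (by rwa [a1])) ?_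
  rintro φ fφ ⟨t2, s1, s2, s3⟩
  rw [a1] at s2 s3
  rw [a5] at s1 s3
  refine wp_mono (contract_spec (m := m) (by rw [fφ.v .m rfl, a4]) (by omega) (by omega)
    (by rw [fφ.a .cA rfl, fφ.a .cB rfl, a2, a3]; exact hc)) ?_
  rintro ψ fψ ⟨t3, c1⟩
  have b1 : φ.v .v = σ.v .v := by rw [fφ.v .v rfl, a5]
  rw [fφ.a .cA rfl, fφ.a .cB rfl, a2, a3, b1] at c1
  have hmk : ∀ u, u ∈ marked (2 * m + 1) (φ.a .reach) ↔ u < 2 * m + 1 ∧ φ.a .reach u ≠ 0 :=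
    fun u => by simp [marked]
  refine ⟨marked (2 * m + 1) (φ.a .reach), hLI.best hv hc G (fun e => by rw [hdd, hinp]) (hO I) a6
    (Finset.filter_subset _ _) ((hmk _).2 ⟨by omega, s1⟩) (by simpa only [hmk] using s2)
    (fun p hp hcl u hu => s3 p hp hcl u ((hmk u).1 hu).1 ((hmk u).1 hu).2), ?_, ?_, I, ?_,
    rfl, rfl, hcap⟩
  · have : υ.time = τ.time + 1 := rfl
    have h1 : 0 < (marked (2 * m + 1) (φ.a .reach)).card :=
      Finset.card_pos.2 ⟨σ.v .v, (hmk _).2 ⟨by omega, s1⟩⟩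
    nlinarith [Nat.mul_le_mul_left (50 * (m + 1)) h1]
  · intro e he
    obtain ⟨h1, h2⟩ := c1 e he
    obtain ⟨h3, h4⟩ := hc e he
    rw [h1, h2, WGraph.collapse, WGraph.collapse]
    simp only [hmk]
    constructor <;> split_ifs <;> first | rfl | omega
  · rw [fψ.calls rfl, fφ.calls rfl]
    change I :: τ.calls = _
    rw [fτ.calls rfl]

end StructRAM

/-! ### The greedy contraction of strong sets -/

namespace StructRAM

variable {n m : ℕ} {G : WGraph n m}

theorem best_subset_labelSet {D L v : ℕ} {S : Finset ℕ} {a b : ℕ → ℕ} (hL : 0 < L)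
    (h : G.Best D L (fun e => a e) (fun e => b e) v S) : S.erase v ⊆ labelSet m a b := by
  intro s hs
  obtain ⟨hsv, hs⟩ := Finset.mem_erase.1 hs
  by_contra hcon
  have h1 := h.le (S.erase s) ((Finset.erase_subset _ _).trans h.sub)
    (Finset.mem_erase.2 ⟨Ne.symm hsv, h.mem⟩)
  have h2 : G.cw (fun e => a e) (fun e => b e) (S.erase s) =
      G.cw (fun e => a e) (fun e => b e) S := by
    unfold WGraph.cw
    refine Finset.sum_congr (Finset.filter_congr fun e _ => ?_) fun _ _ => rfl
    simp only [Finset.mem_erase]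
    refine ⟨fun h => ⟨h.1, h.2.1.2, h.2.2.2⟩, fun h => ⟨h.1, ⟨?_, h.2.1⟩, ?_, h.2.2⟩⟩
    · exact fun he => hcon (mem_labelSet.2 ⟨e, e.2, h.1, .inl he⟩)
    · exact fun he => hcon (mem_labelSet.2 ⟨e, e.2, h.1, .inr he⟩)
  have h3 := Finset.card_erase_add_one hs
  rw [h2, ← h3, Nat.mul_add] at h1
  omega

section Collapse

variable {D L v : ℕ} {S : Finset ℕ} {a b a' b' : ℕ → ℕ}
  (h' : ∀ e < m, a' e = WGraph.collapse S v (a e) ∧ b' e = WGraph.collapse S v (b e))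
include h'

theorem labelSet_collapse : labelSet m a' b' ⊆ insert v (labelSet m a b \ S) := by
  intro c hc
  obtain ⟨e, he, hne, hc⟩ := mem_labelSet.1 hc
  obtain ⟨e1, e2⟩ := h' e he
  have hab : a e ≠ b e := fun h => hne (by rw [e1, e2, h])
  rw [Finset.mem_insert, Finset.mem_sdiff, mem_labelSet]
  rw [e1, e2] at hc
  unfold WGraph.collapse at hc
  rcases hc with hc | hc
  · split_ifs at hc with h
    · exact .inl hc.symm
    · exact .inr ⟨⟨e, he, hab, .inl hc⟩, hc ▸ h⟩
  · split_ifs at hc with h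
    · exact .inl hc.symm
    · exact .inr ⟨⟨e, he, hab, .inr hc⟩, hc ▸ h⟩

/-- The size of a contracted set is paid for by the labels that disappear. -/
theorem card_add_labelSet_le (hL : 0 < L) (h : G.Best D L (fun e => a e) (fun e => b e) v S) :
    S.card + (labelSet m a' b').card ≤ (labelSet m a b).card + 2 := by
  have h1 := (Finset.card_le_card (labelSet_collapse h')).trans (Finset.card_insert_le _ _)
  have h2 : S.erase v ⊆ labelSet m a b ∩ S :=
    Finset.subset_inter (best_subset_labelSet hL h) (Finset.erase_subset _ _)
  have h3 := Finset.card_le_card h2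
  have h4 := Finset.card_erase_add_one h.mem
  have h5 := Finset.card_sdiff_add_card_inter (labelSet m a b) S
  omega

end Collapse

/-- A label that occurs on no edge may be inserted for free. -/
theorem sparse_succ {D L v : ℕ} {a b : ℕ → ℕ} (hv : v ∉ labelSet m a b)
    (h : G.Sparse D L (fun e => a e) (fun e => b e) v) :
    G.Sparse D L (fun e => a e) (fun e => b e) (v + 1) := by
  intro T hT hne
  have h2 : G.cw (fun e => a e) (fun e => b e) (T.erase v) =
      G.cw (fun e => a e) (fun e => b e) T := by
    unfold WGraph.cw
    refine Finset.sum_congr (Finset.filter_congr fun e _ => ?_) fun _ _ => rfl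
    simp only [Finset.mem_erase]
    refine ⟨fun h => ⟨h.1, h.2.1.2, h.2.2.2⟩, fun h => ⟨h.1, ⟨?_, h.2.1⟩, ?_, h.2.2⟩⟩
    · exact fun he => hv (mem_labelSet.2 ⟨e, e.2, h.1, .inl he⟩)
    · exact fun he => hv (mem_labelSet.2 ⟨e, e.2, h.1, .inr he⟩)
  have hsub : T.erase v ⊆ Finset.range v := fun c hc => by
    obtain ⟨h1, h2⟩ := Finset.mem_erase.1 hc
    have := Finset.mem_range.1 (hT h2)
    exact Finset.mem_range.2 (by omega)
  rw [← h2]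
  rcases (T.erase v).eq_empty_or_nonempty with h0 | h0
  · rw [h0]
    have := Nat.mul_le_mul_left L (Finset.card_pos.2 hne)
    simp [WGraph.cw]
    omega
  · have := Nat.mul_le_mul_left L (Finset.card_le_card (Finset.erase_subset v T))
    have := h _ hsub h0
    omega

/-- The state of the contraction of the component `U`, whose edges between different labels `lab`
are active: the labels `ℓ` are coarser than `lab`, the arrays `a` and `b` hold them at the ends of
active edges, their classes are strong at level `L`, and the labels below `v` are sparse. -/
structure Contracted (G : WGraph n m) (D L : ℕ) (U : Finset (Fin n)) (lab ℓ : Fin n → ℕ)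
    (a b : ℕ → ℕ) (v : ℕ) : Prop where
  coarse : ∀ u w, lab u = lab w → ℓ u = ℓ w
  ends : ∀ e, G.src e ∈ U → G.dst e ∈ U → lab (G.src e) ≠ lab (G.dst e) →
    a e = ℓ (G.src e) ∧ b e = ℓ (G.dst e)
  inactive : ∀ e : Fin m, a e ≠ b e →
    G.src e ∈ U ∧ G.dst e ∈ U ∧ lab (G.src e) ≠ lab (G.dst e)
  lt : ∀ e < m, a e < 2 * m ∧ b e < 2 * m
  label_lt : ∀ u ∈ U, ℓ u < 2 * m
  strong : ∀ u ∈ U, G.Strong ((L : ℚ) / D) (U.filter fun w => ℓ w = ℓ u)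
  sparse : G.Sparse D L (fun e => a e) (fun e => b e) v

theorem Contracted.insert {D L v : ℕ} {U : Finset (Fin n)} {lab ℓ : Fin n → ℕ}
    {a b a' b' : ℕ → ℕ} {S : Finset ℕ} (hD : 0 < D) (h : Contracted G D L U lab ℓ a b v)
    (hv : v < 2 * m) (hS : G.Best D L (fun e => a e) (fun e => b e) v S)
    (h' : ∀ e < m, a' e = WGraph.collapse S v (a e) ∧ b' e = WGraph.collapse S v (b e)) :
    Contracted G D L U lab (fun u => WGraph.collapse S v (ℓ u)) a' b' (v + 1) where
  coarse u w huw := by rw [h.coarse u w huw]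
  ends e h1 h2 h3 := by
    obtain ⟨e1, e2⟩ := h.ends e h1 h2 h3
    rw [(h' e e.2).1, (h' e e.2).2, e1, e2]
    exact ⟨rfl, rfl⟩
  inactive e hne := h.inactive e fun he => hne (by rw [(h' e e.2).1, (h' e e.2).2, he])
  lt e he := by
    rw [(h' e he).1, (h' e he).2]
    have := h.lt e he
    unfold WGraph.collapse
    constructor <;> split_ifs <;> omega
  label_lt u hu := by
    have := h.label_lt u hu
    unfold WGraph.collapse
    split_ifs <;> omega
  strong u hu := by
    by_cases hus : ℓ u ∈ S
    · convert hS.strong hD h.sparse (U := U) (ℓ := ℓ) ?_ h.strong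
        ⟨u, Finset.mem_filter.2 ⟨hu, hus⟩⟩ using 1
      · ext w
        simp only [Finset.mem_filter, WGraph.collapse, hus, if_true, and_congr_right_iff]
        intro hw
        refine ⟨fun h2 => ?_, fun h2 => by rw [if_pos h2]⟩
        by_contra h3
        rw [if_neg h3] at h2
        exact h3 (h2 ▸ hS.mem)
      · intro e hne
        obtain ⟨h1, h2, h3⟩ := h.inactive e hne
        exact ⟨h1, h2, h.ends e h1 h2 h3⟩
    · convert h.strong u hu using 1
      ext w
      simp only [Finset.mem_filter, WGraph.collapse, hus, if_false, and_congr_right_iff]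
      intro hw
      split_ifs with h2
      · exact ⟨fun h3 => absurd (h3 ▸ hS.mem) hus, fun h3 => absurd (h3 ▸ h2) hus⟩
      · rfl
  sparse := by
    have := hS.sparse h.sparse
    intro T hT hne
    have h1 := this T hT hne
    convert h1 using 4
    · exact funext fun e => (h' e e.2).1
    · exact funext fun e => (h' e e.2).2

/-- After all labels have been inserted, the contracted classes are exactly the maximal strong sets
at level `k + h` inside the component, so that the contracted edges are those whose level rises. The
number of flow calls is at most the number of classes in the component. -/
theorem greedy_spec {W M B D h k : ℕ} {O : FlowSubroutine} {σ : St} (hO : O.Correct)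
    (hm : σ.v .m = m) (hM : 7 + 12 * m ≤ M) (hMW : 16 * M ≤ W) (hBW : B < W) (hD : 0 < D)
    (hdd : σ.v .dd = D) (hinp : ∀ e : Fin m, σ.a .inp (4 + 3 * e) = G.weight e)
    (hDB : ∀ e : Fin m, D * G.weight e ≤ B) (hkB : k + h ≤ B) (hh : 0 < h)
    (hk : σ.v .k = k) (hs : σ.v .step = h) {κ : Fin m → ℕ} {U : Finset (Fin n)}
    {lab : Fin n → ℕ} (hκ : ∀ e, G.EdgeApprox D (2 * h) (κ e) e)
    (hdvd : 2 * h ∣ k) (hcl : G.Closed (fun e => k ≤ κ e) U)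
    (hact : ∀ e, G.src e ∈ U → G.dst e ∈ U → lab (G.src e) ≠ lab (G.dst e) → κ e = k)
    (hC : Contracted G D (k + h) U lab lab (σ.a .cA) (σ.a .cB) 0)
    (hcalls : ∀ I ∈ σ.calls, SmallCall m B I) :
    wp W M O greedy (fun τ =>
      τ.time ≤ σ.time + 500 * (m + 1) * ((labelSet m (σ.a .cA) (σ.a .cB)).card + 1) ∧
      (∀ I ∈ τ.calls, SmallCall m B I) ∧
      τ.calls.length ≤ σ.calls.length + (labelSet m (σ.a .cA) (σ.a .cB)).card ∧
      ∀ e : Fin m, (σ.a .cA e = σ.a .cB e → τ.a .kap e = σ.a .kap e) ∧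
        (σ.a .cA e ≠ σ.a .cB e → G.EdgeApprox D h (τ.a .kap e) e)) σ := by
  set Z := labelSet m (σ.a .cA) (σ.a .cB) with hZ
  have hactive : ∀ e : Fin m, σ.a .cA e ≠ σ.a .cB e ↔
      G.src e ∈ U ∧ G.dst e ∈ U ∧ lab (G.src e) ≠ lab (G.dst e) := fun e =>
    ⟨hC.inactive e, fun ⟨h1, h2, h3⟩ => by rwa [(hC.ends e h1 h2 h3).1, (hC.ends e h1 h2 h3).2]⟩
  simp only [greedy, wp_seq]
  refine wp_mono (markTouched_spec hm (by omega) (by omega) hC.lt (by rw [hk, hs]; omega)) ?_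
  rintro σ₁ f₁ ⟨t₁, htouch, hkap⟩
  rw [wp_seq, wp_set]
  have k1 : σ₁.v .k = k := by rw [f₁.v .k rfl, hk]
  have s1 : σ₁.v .step = h := by rw [f₁.v .step rfl, hs]
  refine ⟨by simp [k1, s1]; omega, ?_⟩
  rw [wp_seq]
  set σ₂ := (σ₁.set .lam ((Ex.var Var.k + Ex.var Var.step : Ex).eval σ₁)).tick with hσ₂
  have hlam : σ₂.v .lam = k + h := by simp [hσ₂, k1, s1]
  have hA : σ₂.a = σ₁.a := by simp [hσ₂]
  have hZcard : Z.card = (Z.filter (· < 2 * m)).card := by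
    congr 1
    refine (Finset.filter_true_of_mem fun u hu => ?_).symm
    obtain ⟨e, he, -, hu⟩ := mem_labelSet.1 hu
    have := hC.lt e he
    omega
  refine wp_for (2 * m) (fun i τ => labelSet m (τ.a .cA) (τ.a .cB) ⊆ Z ∧
      (∃ ℓ, Contracted G D (k + h) U lab ℓ (τ.a .cA) (τ.a .cB) i) ∧
      (∀ I ∈ τ.calls, SmallCall m B I) ∧
      τ.calls.length ≤ σ.calls.length + (Z.filter (· < i)).card ∧
      τ.time + 100 * (m + 1) * (labelSet m (τ.a .cA) (τ.a .cB)).card ≤ σ₂.time + 1 + 5 * i +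
        100 * (m + 1) * (Z.card + 3 * (Z.filter (· < i)).card)) rfl (by omega) ?_ ?_ ?_ ?_
  · intro τ hf
    simp [hf.v .m rfl, hσ₂, f₁.v .m rfl, hm]
    omega
  · have c1 : σ₁.calls = σ.calls := f₁.calls rfl
    simp only [hσ₂, St.tick_a, St.set_a, f₁.a .cA rfl, f₁.a .cB rfl, St.tick_calls, St.set_calls,
      c1, St.tick_time, St.set_time]
    rw [← hZ]
    exact ⟨subset_rfl, ⟨lab, hC⟩, hcalls, by omega, by simp⟩
  · rintro i hi τ hf hv ⟨i1, ⟨ℓ, i2⟩, i3, i4, i5⟩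
    have b1 : τ.a .touch = σ₁.a .touch := by rw [hf.a .touch rfl, hA]
    have b2 : τ.v .lam = k + h := by rw [hf.v .lam rfl, hlam]
    have b3 : τ.v .m = m := by rw [hf.v .m rfl]; simp [hσ₂, f₁.v .m rfl, hm]
    have b4 : τ.v .dd = D := by rw [hf.v .dd rfl]; simp [hσ₂, f₁.v .dd rfl, hdd]
    have b5 : τ.a .inp = σ.a .inp := by rw [hf.a .inp rfl, hA, f₁.a .inp rfl]
    have hiM : i < M := by omega
    have hfil : Z.filter (· < i + 1) = if i ∈ Z then insert i (Z.filter (· < i))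
        else Z.filter (· < i) := by
      ext u
      split_ifs <;> simp only [Finset.mem_filter, Finset.mem_insert, Order.lt_add_one_iff,
        le_iff_lt_or_eq] <;> grind
    have hni : i ∉ Z.filter (· < i) := by simp
    simp only [wp_ite, Ex.ok_rd, Ex.ok_var, Ex.eval_rd, Ex.eval_var, St.tick_a,
      St.tick_v, hv, b1, true_and, wp_skip]
    refine ⟨hiM, fun ht => ?_, fun ht => ?_⟩
    · have hiZ := (htouch i hi).1 ht
      rw [if_pos hiZ] at hfil
      refine wp_mono (insertLabel_spec (σ := τ.tick.tick) (m := m) (B := B) (D := D) G hO b3 hM hMW hBW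
        b4 (by simpa [b5] using hinp) hDB (by simpa [b2] using hkB) (by simpa [hv] using hi)
        i2.lt) ?_
      rintro υ fυ ⟨S, hS, ht', hcol, I, hI, hsm⟩
      simp only [St.tick_a, St.tick_v, St.tick_time, St.tick_calls, hv, b2] at hS ht' hcol hI
      simp only [St.tick_a, St.set_a, St.tick_calls, St.set_calls, St.tick_time, St.set_time]
      have hsub := labelSet_collapse hcol
      have hcard := card_add_labelSet_le hcol (by omega) hS
      refine ⟨hsub.trans (Finset.insert_subset hiZ (Finset.sdiff_subset.trans i1)),
        ⟨_, i2.insert hD hi hS hcol⟩, ?_, ?_, ?_⟩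
      · intro J hJ
        rw [hI, List.mem_cons] at hJ
        rcases hJ with rfl | hJ
        · exact hsm
        · exact i3 J hJ
      · rw [hI, List.length_cons, hfil, Finset.card_insert_of_notMem hni]
        omega
      · rw [hfil, Finset.card_insert_of_notMem hni]
        have := Nat.mul_le_mul_left (100 * (m + 1)) hcard
        simp only [Nat.mul_add] at this ht' i5 ⊢
        omega
    · have hiZ : i ∉ Z := fun h => (htouch i hi).2 h ht
      rw [if_neg hiZ] at hfil
      simp only [St.tick_a, St.set_a, St.tick_calls, St.set_calls, St.tick_time, St.set_time, hfil]
      refine ⟨i1, ⟨ℓ, { i2 with sparse := sparse_succ (fun h => hiZ (i1 h)) i2.sparse }⟩, i3, i4,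
        by omega⟩
  rintro τ hf ⟨i1, ⟨ℓ, i2⟩, i3, i4, i5⟩
  have b3 : τ.tick.v .m = m := by
    rw [St.tick_v, hf.v .m rfl]; simp [hσ₂, f₁.v .m rfl, hm]
  refine wp_mono (lowerLevels_spec b3 (by omega) (by omega)) ?_
  rintro φ fφ ⟨t2, c2⟩
  rw [← hZcard] at i4 i5
  refine ⟨?_, ?_, ?_, fun e => ?_⟩
  · have : σ₂.time = σ₁.time + 1 := rfl
    simp only [St.tick_time] at t2
    simp only [Nat.mul_add, Nat.add_mul, Nat.mul_one, Nat.one_mul] at i5 ⊢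
    nlinarith [Nat.zero_le (m * Z.card), Nat.zero_le (m * (labelSet m (τ.a .cA) (τ.a .cB)).card)]
  · rw [fφ.calls rfl]; exact i3
  · rw [fφ.calls rfl]; exact i4
  · have hk2 := hkap e e.2
    have hk3 := c2 e e.2
    have d1 : τ.a .kap = σ₁.a .kap := by rw [hf.a .kap rfl, hA]
    have d2 : τ.v .k = k := by rw [hf.v .k rfl]; simp [hσ₂, k1]
    simp only [St.tick_a, St.tick_v, d1, d2, hk2] at hk3
    rw [hk3]
    refine ⟨fun heq => ?_, fun hne => ?_⟩
    · have : τ.a .cA e = τ.a .cB e := by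
        by_contra hcon
        exact (hactive e).2 (i2.inactive e hcon) heq
      rw [if_pos this, if_pos heq]
    · obtain ⟨h1, h2, h3⟩ := (hactive e).1 hne
      rw [if_neg hne, hk, hs]
      exact WGraph.edgeApprox_refine hD hκ hdvd hcl i2.coarse hact
        (fun e h1 h2 h3 => i2.ends e h1 h2 h3) i2.strong i2.label_lt i2.sparse h1 h2 h3

end StructRAM

/-! ### Merging along edges of decreasing level -/

namespace WGraph

variable {n m : ℕ} {G : WGraph n m} {κ : Fin m → ℕ} {g : Fin n → ℕ}

/-- The labels `g` arise by merging along edges in the order of decreasing levels `κ`: their classes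
are connected, and the edges inside a class have higher levels than those that leave it. -/
structure Merged (G : WGraph n m) (κ : Fin m → ℕ) (g : Fin n → ℕ) : Prop where
  linked : ∀ u, G.Linked (fun _ => True) (Finset.univ.filter fun w => g w = g u)
  lt : ∀ e f, g (G.src e) = g (G.dst e) → g (G.src f) ≠ g (G.dst f) →
    (g (G.src f) = g (G.src e) ∨ g (G.dst f) = g (G.src e)) → κ f < κ e

theorem Merged.of_injective (hg : Function.Injective g) : Merged G κ g where
  linked u γ _ v hv w hw := by
    simp only [Finset.mem_filter, Finset.mem_univ, true_and] at hv hw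
    rw [hg (hv.trans hw.symm)]
  lt e _ he := absurd (hg he) (G.loopless e)

/-- `S` is the set of labels of the component of the label `r` in the graph of the edges between
different labels that have the maximal level `k`. -/
structure TopComponent (G : WGraph n m) (κ : Fin m → ℕ) (g : Fin n → ℕ) (k r : ℕ)
    (S : Finset ℕ) : Prop where
  mem : r ∈ S
  le : ∀ e, g (G.src e) ≠ g (G.dst e) → κ e ≤ k
  touch : ∀ s ∈ S, ∃ e, g (G.src e) ≠ g (G.dst e) ∧ κ e = k ∧ (g (G.src e) = s ∨ g (G.dst e) = s)
  conn : ∀ γ : ℕ → ℕ, (∀ e, g (G.src e) ≠ g (G.dst e) → κ e = k → g (G.src e) ∈ S →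
    g (G.dst e) ∈ S → γ (g (G.src e)) = γ (g (G.dst e))) → ∀ s ∈ S, γ s = γ r
  closed : ∀ e, g (G.src e) ≠ g (G.dst e) → κ e = k → (g (G.src e) ∈ S ↔ g (G.dst e) ∈ S)

/-- The vertices with labels in `S`. -/
def fiber (g : Fin n → ℕ) (S : Finset ℕ) : Finset (Fin n) := Finset.univ.filter fun u => g u ∈ S

@[simp] theorem mem_fiber {S : Finset ℕ} {u : Fin n} : u ∈ fiber g S ↔ g u ∈ S := by simp [fiber]

namespace TopComponent

variable {k r : ℕ} {S : Finset ℕ} (h : TopComponent G κ g k r S) (hg : Merged G κ g)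
include h

include hg in
theorem lt_of_merged {e : Fin m} (he : g (G.src e) = g (G.dst e)) (hs : g (G.src e) ∈ S) :
    k < κ e := by
  obtain ⟨f, h1, h2, h3⟩ := h.touch _ hs
  rw [← h2]
  exact hg.lt e f he h1 h3

theorem closed_fiber : G.Closed (fun e => k ≤ κ e) (fiber g S) := by
  intro e he
  rw [mem_fiber, mem_fiber]
  by_cases h1 : g (G.src e) = g (G.dst e)
  · rw [h1]
  · exact h.closed e h1 (le_antisymm (h.le e h1) he)

theorem closed_class (u : Fin n) :
    G.Closed (fun e => k < κ e) ((fiber g S).filter fun w => g w = g u) := by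
  intro e he
  have : g (G.src e) = g (G.dst e) := by
    by_contra h1
    exact absurd (h.le e h1) (not_le.2 he)
  simp [this]

include hg in
theorem linked_class {u : Fin n} (hu : u ∈ fiber g S) :
    G.Linked (fun e => k < κ e) ((fiber g S).filter fun w => g w = g u) := by
  have : ((fiber g S).filter fun w => g w = g u) = Finset.univ.filter fun w => g w = g u := by
    ext w
    simp only [Finset.mem_filter, mem_fiber, Finset.mem_univ, true_and, and_iff_right_iff_imp]
    exact fun hw => hw ▸ mem_fiber.1 hu
  rw [this]
  refine (hg.linked u).mono fun e _ hs hd => ?_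
  simp only [Finset.mem_filter, Finset.mem_univ, true_and] at hs hd
  exact h.lt_of_merged hg (hs.trans hd.symm) (hs ▸ mem_fiber.1 hu)

include hg in
theorem linked_fiber : G.Linked (fun e => k ≤ κ e) (fiber g S) := by
  intro γ hγ
  -- the colouring is constant on the classes, so it is a colouring of the labels
  have h1 : ∀ u ∈ fiber g S, ∀ v ∈ fiber g S, g u = g v → γ u = γ v := by
    intro u hu v hv huv
    refine h.linked_class hg hu γ (fun e he hs hd => ?_) u (by simpa using hu) v
      (by simp only [Finset.mem_filter]; exact ⟨hv, huv.symm⟩)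
    exact hγ e he.le (Finset.mem_filter.1 hs).1 (Finset.mem_filter.1 hd).1
  classical
  let γ' : ℕ → ℕ := fun s => if hs : ∃ u, g u = s then γ hs.choose else 0
  have h2 : ∀ u ∈ fiber g S, γ' (g u) = γ u := by
    intro u hu
    have hs : ∃ w, g w = g u := ⟨u, rfl⟩
    simp only [γ', dif_pos hs]
    exact h1 _ (by rw [mem_fiber, hs.choose_spec]; exact mem_fiber.1 hu) u hu hs.choose_spec
  have h3 := h.conn γ' fun e he hk hs hd => by
    rw [h2 _ (mem_fiber.2 hs), h2 _ (mem_fiber.2 hd)]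
    exact hγ e hk.ge (mem_fiber.2 hs) (mem_fiber.2 hd)
  intro u hu v hv
  rw [← h2 u hu, ← h2 v hv, h3 _ (mem_fiber.1 hu), h3 _ (mem_fiber.1 hv)]

/-- The edges between different labels in `S` have level `k`. -/
theorem eq_of_active {D s : ℕ} (hg : Merged G κ g) (hκ : ∀ e, G.EdgeApprox D s (κ e) e)
    (hk : s ∣ k) {e : Fin m} (hs : G.src e ∈ fiber g S) (hd : G.dst e ∈ fiber g S)
    (he : g (G.src e) ≠ g (G.dst e)) : κ e = k :=
  le_antisymm (h.le e he) (le_of_linked hκ hk (h.linked_fiber hg) h.closed_fiber hs hd)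

/-- The classes in the component are strong at the next level. -/
theorem strong_class {D s : ℕ} (hg : Merged G κ g) (hκ : ∀ e, G.EdgeApprox D s (κ e) e)
    (hk : s ∣ k) {u : Fin n} (hu : u ∈ fiber g S) :
    G.Strong (((k + s : ℕ) : ℚ) / D) ((fiber g S).filter fun w => g w = g u) := by
  have hlt : ∀ e, k < κ e ↔ k + s ≤ κ e := fun e => by
    obtain ⟨a, ha⟩ := hk
    obtain ⟨b, hb⟩ := (hκ e).1
    have hs0 : 0 < s := by
      rcases Nat.eq_zero_or_pos s with rfl | h0
      · obtain ⟨U, h1, h2, h3⟩ := (hκ e).2.1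
        exact absurd h3 ((hκ e).2.2 U h1 h2)
      · exact h0
    constructor
    · intro hlt
      rw [ha, hb] at hlt ⊢
      have := Nat.lt_of_mul_lt_mul_left hlt
      calc s * a + s = s * (a + 1) := by ring
        _ ≤ s * b := Nat.mul_le_mul_left s this
    · intro hle; omega
  have h1 := h.linked_class hg hu
  have h2 := h.closed_class u
  simp only [hlt] at h1 h2
  exact strong_of_linked hκ ((Nat.dvd_add_right hk).2 dvd_rfl) ⟨u, by simpa using hu⟩ h1 h2

theorem collapse_eq_iff {u v : Fin n} : collapse S r (g u) = collapse S r (g v) ↔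
    g u = g v ∨ g u ∈ S ∧ g v ∈ S := by
  have hr := h.mem
  unfold collapse
  split_ifs <;> grind

theorem merged {D s : ℕ} (hg : Merged G κ g) (hκ : ∀ e, G.EdgeApprox D s (κ e) e) (hk : s ∣ k) :
    Merged G κ (fun u => collapse S r (g u)) where
  linked u := by
    by_cases hu : g u ∈ S
    · have : (Finset.univ.filter fun w => collapse S r (g w) = collapse S r (g u)) =
          fiber g S := by
        ext w
        simp only [Finset.mem_filter, Finset.mem_univ, true_and, h.collapse_eq_iff, mem_fiber]
        grind
      rw [this]
      exact (h.linked_fiber hg).mono fun _ _ _ _ => trivial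
    · have : (Finset.univ.filter fun w => collapse S r (g w) = collapse S r (g u)) =
          Finset.univ.filter fun w => g w = g u := by
        ext w
        simp only [Finset.mem_filter, Finset.mem_univ, true_and, h.collapse_eq_iff]
        grind
      rw [this]
      exact hg.linked u
  lt e f he hf htouch := by
    simp only [h.collapse_eq_iff, ne_eq, not_or, not_and] at he hf htouch
    by_cases hs : g (G.src e) ∈ S
    · have h1 : k ≤ κ e := by
        by_cases h2 : g (G.src e) = g (G.dst e)
        · exact (h.lt_of_merged hg h2 hs).le
        · have h3 : g (G.dst e) ∈ S := (he.resolve_left h2).2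
          exact (h.eq_of_active hg hκ hk (mem_fiber.2 hs) (mem_fiber.2 h3) h2).ge
      refine lt_of_lt_of_le ?_ h1
      by_contra hcon
      have := h.closed f hf.1 (le_antisymm (h.le f hf.1) (not_lt.1 hcon))
      grind
    · exact hg.lt e f (by grind) hf.1 (by grind)

theorem card_image : (Finset.univ.image fun u => collapse S r (g u)).card + S.card =
    (Finset.univ.image g).card + 1 := by
  have hsub : S ⊆ Finset.univ.image g := fun s hs => by
    obtain ⟨e, -, -, h3⟩ := h.touch s hs
    rcases h3 with h3 | h3
    · exact Finset.mem_image.2 ⟨_, Finset.mem_univ _, h3⟩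
    · exact Finset.mem_image.2 ⟨_, Finset.mem_univ _, h3⟩
  have : (Finset.univ.image fun u => collapse S r (g u)) =
      insert r (Finset.univ.image g \ S) := by
    ext c
    obtain ⟨w, -, hw⟩ := Finset.mem_image.1 (hsub h.mem)
    simp only [Finset.mem_image, Finset.mem_univ, true_and, Finset.mem_insert, Finset.mem_sdiff]
    constructor
    · rintro ⟨u, rfl⟩
      by_cases hu : g u ∈ S
      · exact .inl (if_pos hu)
      · rw [collapse, if_neg hu]
        exact .inr ⟨⟨u, rfl⟩, hu⟩
    · rintro (rfl | ⟨⟨u, rfl⟩, hu⟩)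
      · exact ⟨w, if_pos (hw ▸ h.mem)⟩
      · exact ⟨u, if_neg hu⟩
  rw [this, Finset.card_insert_of_notMem (by simp [h.mem])]
  have := Finset.card_sdiff_add_card_eq_card hsub
  omega

theorem two_le_card : 2 ≤ S.card := by
  obtain ⟨e, h1, h2, h3⟩ := h.touch r h.mem
  have h4 := h.closed e h1 h2
  have hr := h.mem
  refine Finset.one_lt_card.2 ⟨g (G.src e), ?_, g (G.dst e), ?_, h1⟩ <;> grind

end TopComponent

end WGraph

/-! ### Merging a component -/

namespace StructRAM

open WGraph

variable {n m : ℕ} {G : WGraph n m} {κ : Fin m → ℕ} {g : Fin n → ℕ}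

/-- The arrays of labels hold the labels `g` at the ends of the edges. -/
def HasLabels (G : WGraph n m) (g : Fin n → ℕ) (a b : ℕ → ℕ) : Prop :=
  ∀ e : Fin m, a e = g (G.src e) ∧ b e = g (G.dst e)

/-- The array of levels is correct on the edges between different labels. -/
def HasLevels (G : WGraph n m) (κ : Fin m → ℕ) (g : Fin n → ℕ) (f : ℕ → ℕ) : Prop :=
  ∀ e : Fin m, g (G.src e) ≠ g (G.dst e) → f e = κ e

/-- A set of labels that is connected to `r` by edges of level `k`. -/
structure PartialComponent (G : WGraph n m) (κ : Fin m → ℕ) (g : Fin n → ℕ) (k r : ℕ)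
    (S : Finset ℕ) : Prop where
  mem : r ∈ S
  touch : ∀ s ∈ S, ∃ e, g (G.src e) ≠ g (G.dst e) ∧ κ e = k ∧ (g (G.src e) = s ∨ g (G.dst e) = s)
  conn : ∀ γ : ℕ → ℕ, (∀ e, g (G.src e) ≠ g (G.dst e) → κ e = k → g (G.src e) ∈ S →
    g (G.dst e) ∈ S → γ (g (G.src e)) = γ (g (G.dst e))) → ∀ s ∈ S, γ s = γ r

theorem PartialComponent.card_le {k r : ℕ} {S : Finset ℕ} (h : PartialComponent G κ g k r S) :
    S.card ≤ n := by
  have hsub : S ⊆ Finset.univ.image g := fun s hs => by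
    obtain ⟨e, -, -, h3⟩ := h.touch s hs
    rcases h3 with h3 | h3
    · exact Finset.mem_image.2 ⟨_, Finset.mem_univ _, h3⟩
    · exact Finset.mem_image.2 ⟨_, Finset.mem_univ _, h3⟩
  exact (Finset.card_le_card hsub).trans (Finset.card_image_le.trans (by simp))

theorem PartialComponent.insert {k r x : ℕ} {S : Finset ℕ} (h : PartialComponent G κ g k r S)
    {e : Fin m} (hk : κ e = k) (hx : x ∉ S) (he : g (G.src e) ∈ S ∧ g (G.dst e) = x ∨
      g (G.dst e) ∈ S ∧ g (G.src e) = x) : PartialComponent G κ g k r (insert x S) where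
  mem := Finset.mem_insert_of_mem h.mem
  touch s hs := by
    rcases Finset.mem_insert.1 hs with rfl | hs
    · exact ⟨e, by grind, hk, by grind⟩
    · exact h.touch s hs
  conn γ hγ s hs := by
    have h1 : ∀ s ∈ S, γ s = γ r := h.conn γ fun e h1 h2 h3 h4 =>
      hγ e h1 h2 (Finset.mem_insert_of_mem h3) (Finset.mem_insert_of_mem h4)
    rcases Finset.mem_insert.1 hs with rfl | hs
    · have h2 := hγ e (by grind) hk (by grind) (by grind)
      rcases he with ⟨h3, h4⟩ | ⟨h3, h4⟩
      · rw [← h1 _ h3, h2, h4]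
      · rw [← h1 _ h3, ← h2, h4]
    · exact h1 s hs

section Specs

variable {W M : ℕ} {O : FlowSubroutine} {σ : St}

/-- The state while the component of `r` grows: the labels in `S` have been merged. -/
structure Growing (G : WGraph n m) (κ : Fin m → ℕ) (g : Fin n → ℕ) (k r : ℕ) (S : Finset ℕ)
    (τ : St) : Prop where
  comp : PartialComponent G κ g k r S
  labels : HasLabels G (fun u => collapse S r (g u)) (τ.a .lA) (τ.a .lB)
  levels : HasLevels G κ g (τ.a .kap)
  cnt : τ.v .cnt + 1 = S.card
  m_eq : τ.v .m = m
  k_eq : τ.v .k = k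
  r_eq : τ.v .r = r

theorem scan_growing {k r : ℕ} {S : Finset ℕ} (h : Growing G κ g k r S σ) (hmM : m ≤ M)
    (hmW : m < W) :
    wp W M O scan (fun τ => Growing G κ g k r S τ ∧ τ.time ≤ σ.time + (8 * m + 3) ∧
      (τ.v .fnd = 0 → ∀ e, g (G.src e) ≠ g (G.dst e) → κ e = k →
        (g (G.src e) ∈ S ↔ g (G.dst e) ∈ S)) ∧
      (τ.v .fnd ≠ 0 → τ.v .x ∉ S ∧ ∃ e, κ e = k ∧
        (g (G.src e) ∈ S ∧ g (G.dst e) = τ.v .x ∨ g (G.dst e) ∈ S ∧ g (G.src e) = τ.v .x))) σ := by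
  have hmem : ∀ u, collapse S r (g u) = r ↔ g u ∈ S := fun u => by
    have := h.comp.mem
    unfold collapse
    split_ifs <;> grind
  refine wp_mono (scan_spec h.m_eq hmM hmW) ?_
  rintro τ fτ ⟨t1, h1, h2⟩
  refine ⟨⟨h.comp, by rw [fτ.a .lA rfl, fτ.a .lB rfl]; exact h.labels,
    by rw [fτ.a .kap rfl]; exact h.levels, by rw [fτ.v .cnt rfl]; exact h.cnt,
    by rw [fτ.v .m rfl]; exact h.m_eq, by rw [fτ.v .k rfl]; exact h.k_eq,
    by rw [fτ.v .r rfl]; exact h.r_eq⟩, t1, fun h0 e hne hk => ?_, fun h0 => ?_⟩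
  · obtain ⟨l1, l2⟩ := h.labels e
    have l3 := h1 h0 e e.2
    rw [l1, l2, h.levels e hne, h.k_eq, h.r_eq] at l3
    by_cases heq : collapse S r (g (G.src e)) = collapse S r (g (G.dst e))
    · have := hmem (G.src e)
      rw [heq, hmem] at this
      exact this.symm
    · have := l3 heq hk
      simp only [ne_eq, hmem] at this
      grind
  · obtain ⟨e, he, l1, l2, l3⟩ := h2 h0
    obtain ⟨k1, k2⟩ := h.labels ⟨e, he⟩
    simp only at k1 k2
    rw [k1, k2] at l1
    have hne : g (G.src ⟨e, he⟩) ≠ g (G.dst ⟨e, he⟩) := fun h => l1 (by rw [h])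
    have := h.levels ⟨e, he⟩ hne
    simp only at this
    rw [this, h.k_eq] at l2
    rw [k1, k2, h.r_eq, hmem, hmem] at l3
    rcases l3 with ⟨l3, l4⟩ | ⟨l3, l4⟩
    · have hS : g (G.dst ⟨e, he⟩) ∉ S := fun hS => l1 (by rw [(hmem _).2 l3, (hmem _).2 hS])
      rw [collapse, if_neg hS] at l4
      exact ⟨l4 ▸ hS, _, l2, .inl ⟨l3, l4.symm⟩⟩
    · have hS : g (G.src ⟨e, he⟩) ∉ S := fun hS => l1 (by rw [(hmem _).2 l3, (hmem _).2 hS])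
      rw [collapse, if_neg hS] at l4
      exact ⟨l4 ▸ hS, _, l2, .inr ⟨l3, l4.symm⟩⟩

theorem grow_spec {k r : ℕ} (hmM : m ≤ M) (hnM : n ≤ M) (hMW : M < W) (hm : σ.v .m = m)
    (hk : σ.v .k = k) (hr : σ.v .r = r) (hl : HasLabels G g (σ.a .lA) (σ.a .lB))
    (hκ : HasLevels G κ g (σ.a .kap)) (hmax : ∀ e, g (G.src e) ≠ g (G.dst e) → κ e ≤ k)
    (htouch : ∃ e, g (G.src e) ≠ g (G.dst e) ∧ κ e = k ∧ g (G.src e) = r) :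
    wp W M O grow (fun τ => ∃ S, TopComponent G κ g k r S ∧ τ.v .cnt + 1 = S.card ∧
      HasLabels G (fun u => collapse S r (g u)) (τ.a .lA) (τ.a .lB) ∧
      τ.time ≤ σ.time + 30 * (m + 1) * S.card) σ := by
  simp only [grow, wp_seq, wp_set, Ex.ok_ofNat, Ex.eval_ofNat]
  refine ⟨by norm_num, ?_⟩
  have hcol : ∀ c, collapse {r} r c = c := fun c => by
    unfold collapse
    split_ifs with h
    · exact (Finset.mem_singleton.1 h).symm
    · rfl
  have h0 : Growing G κ g k r {r} (σ.set .cnt 0).tick := by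
    refine ⟨⟨by simp, fun s hs => ?_, fun γ _ s hs => by rw [Finset.mem_singleton.1 hs]⟩,
      by simpa [hcol] using hl, by simpa using hκ, by simp, by simpa, by simpa, by simpa⟩
    obtain ⟨e, h1, h2, h3⟩ := htouch
    exact ⟨e, h1, h2, .inl (h3.trans (Finset.mem_singleton.1 hs).symm)⟩
  refine wp_mono (scan_growing h0 hmM (by omega)) ?_
  rintro σ₁ f₁ ⟨g1, t1, c1, d1⟩
  refine wp_loop (fun τ => ∃ S, Growing G κ g k r S τ ∧
      (τ.v .fnd = 0 → ∀ e, g (G.src e) ≠ g (G.dst e) → κ e = k →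
        (g (G.src e) ∈ S ↔ g (G.dst e) ∈ S)) ∧
      (τ.v .fnd ≠ 0 → τ.v .x ∉ S ∧ ∃ e, κ e = k ∧
        (g (G.src e) ∈ S ∧ g (G.dst e) = τ.v .x ∨ g (G.dst e) ∈ S ∧ g (G.src e) = τ.v .x)) ∧
      τ.time + 1 ≤ σ.time + 30 * (m + 1) * S.card) (fun τ => n - τ.v .cnt) ?_ ?_
  · refine ⟨{r}, g1, c1, d1, ?_⟩
    simp only [St.tick_time, St.set_time] at t1
    simp
    omega
  · rintro τ fτ ⟨S, g2, c2, d2, t2⟩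
    refine ⟨trivial, fun hf => ?_, fun hf => ?_⟩
    · simp only [Ex.eval_var] at hf
      obtain ⟨hx, e, he, hex⟩ := d2 hf
      have hcomp := g2.comp.insert he hx hex
      have hcard := hcomp.card_le
      rw [Finset.card_insert_of_notMem hx, ← g2.cnt] at hcard
      simp only [wp_seq]
      refine wp_mono (mergeLabel_spec (σ := τ.tick) (m := m) g2.m_eq hmM (by omega)) ?_
      rintro υ fυ ⟨t3, l3⟩
      have hc : υ.v .cnt = τ.v .cnt := fυ.v .cnt rfl
      rw [wp_seq, wp_set]
      refine ⟨by simp [hc]; omega, ?_⟩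
      have g3 : Growing G κ g k r (insert (τ.v .x) S)
          (υ.set .cnt ((Ex.var Var.cnt + 1 : Ex).eval υ)).tick := by
        refine ⟨hcomp, fun e => ?_, ?_, ?_, ?_, ?_, ?_⟩
        · obtain ⟨l4, l5⟩ := l3 e e.2
          obtain ⟨l6, l7⟩ := g2.labels e
          have l8 : τ.tick.v .r = r := g2.r_eq
          have l9 : τ.tick.v .x = τ.v .x := rfl
          rw [St.tick_a, l6, l8, l9] at l4
          rw [St.tick_a, l7, l8, l9] at l5
          rw [St.tick_a, St.set_a, l4, l5]
          have hrx : r ≠ τ.v .x := fun h => hx (h ▸ g2.comp.mem)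
          constructor <;> · unfold collapse; split_ifs <;> grind
        · simp only [St.tick_a, St.set_a]
          rw [fυ.a .kap rfl]; exact g2.levels
        · simp [hc, g2.cnt, Finset.card_insert_of_notMem hx]
        · simp [fυ.v .m rfl, g2.m_eq]
        · simp [fυ.v .k rfl, g2.k_eq]
        · simp [fυ.v .r rfl, g2.r_eq]
      refine wp_mono (scan_growing g3 hmM (by omega)) ?_
      rintro φ fφ ⟨g4, t4, c4, d4⟩
      refine ⟨⟨_, g4, c4, d4, ?_⟩, ?_⟩
      · simp only [St.tick_time, St.set_time] at t4 t3
        rw [Finset.card_insert_of_notMem hx, Nat.mul_add]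
        omega
      · have : φ.v .cnt = τ.v .cnt + 1 := by rw [fφ.v .cnt rfl]; simp [hc]
        rw [this]
        omega
    · simp only [Ex.eval_var] at hf
      exact ⟨S, ⟨g2.comp.mem, hmax, g2.comp.touch, g2.comp.conn, c2 hf⟩, g2.cnt, g2.labels, t2⟩

/-- The arrays `cA` and `cB` keep the old labels on edges inside the merged component and on edges
that were merged before, and are equal on all other edges. -/
theorem pick_spec {k r : ℕ} (hmM : m ≤ M) (hnM : n ≤ M) (hMW : M < W) (hm : σ.v .m = m)
    (hk : σ.v .k = k) (hr : σ.v .r = r) (hl : HasLabels G g (σ.a .lA) (σ.a .lB))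
    (hκ : HasLevels G κ g (σ.a .kap)) (hmax : ∀ e, g (G.src e) ≠ g (G.dst e) → κ e ≤ k)
    (htouch : ∃ e, g (G.src e) ≠ g (G.dst e) ∧ κ e = k ∧ g (G.src e) = r) :
    wp W M O pick (fun τ => ∃ S, TopComponent G κ g k r S ∧ τ.v .cnt + 1 = S.card ∧
      HasLabels G (fun u => collapse S r (g u)) (τ.a .lA) (τ.a .lB) ∧
      (∀ e : Fin m, (g (G.src e) = g (G.dst e) ∨ g (G.src e) ∈ S ∧ g (G.dst e) ∈ S →
          τ.a .cA e = g (G.src e) ∧ τ.a .cB e = g (G.dst e)) ∧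
        (¬ (g (G.src e) = g (G.dst e) ∨ g (G.src e) ∈ S ∧ g (G.dst e) ∈ S) →
          τ.a .cA e = 0 ∧ τ.a .cB e = 0)) ∧
      τ.time ≤ σ.time + 50 * (m + 1) * S.card) σ := by
  simp only [pick, wp_seq]
  refine wp_mono (copyLabels_spec hm hmM (by omega)) ?_
  rintro σ₁ f₁ ⟨t1, c1⟩
  rw [wp_seq]
  refine wp_mono (grow_spec (G := G) (κ := κ) (g := g) (k := k) (r := r) hmM hnM hMW
    (by rw [f₁.v .m rfl, hm]) (by rw [f₁.v .k rfl, hk]) (by rw [f₁.v .r rfl, hr])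
    (by rw [f₁.a .lA rfl, f₁.a .lB rfl]; exact hl) (by rw [f₁.a .kap rfl]; exact hκ) hmax htouch) ?_
  rintro σ₂ f₂ ⟨S, hS, hcnt, hlab, t2⟩
  refine wp_mono (mask_spec (m := m) (by rw [f₂.v .m rfl, f₁.v .m rfl, hm]) hmM (by omega)) ?_
  rintro σ₃ f₃ ⟨t3, c3⟩
  refine ⟨S, hS, by rw [f₃.v .cnt rfl]; exact hcnt,
    by rw [f₃.a .lA rfl, f₃.a .lB rfl]; exact hlab, fun e => ?_, ?_⟩
  · obtain ⟨l1, l2⟩ := c3 e e.2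
    obtain ⟨l3, l4⟩ := hlab e
    obtain ⟨l5, l6⟩ := c1 e e.2
    obtain ⟨l7, l8⟩ := hl e
    simp only [l3, l4, hS.collapse_eq_iff] at l1 l2
    rw [f₂.a .cA rfl, l5, l7] at l1
    rw [f₂.a .cB rfl, l6, l8] at l2
    exact ⟨fun h => by rw [l1, l2, if_pos h, if_pos h]; exact ⟨rfl, rfl⟩,
      fun h => by rw [l1, l2, if_neg h, if_neg h]; exact ⟨rfl, rfl⟩⟩
  · have := hS.two_le_card
    have h3 := Nat.mul_le_mul_left (m + 1) this
    nlinarith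

end Specs

end StructRAM

/-! ### One sweep of refinement -/

namespace StructRAM

open WGraph

variable {n m : ℕ} {G : WGraph n m}

/-- The state after reading the input, with the labels `lab` of the vertices. -/
structure Input (G : WGraph n m) (lab : Fin n → ℕ) (τ : St) : Prop where
  n_eq : τ.v .n = n
  m_eq : τ.v .m = m
  dd_eq : τ.v .dd = n * n
  src : ∀ e : Fin m, τ.a .inp (2 + 3 * e) = G.src e
  dst : ∀ e : Fin m, τ.a .inp (3 + 3 * e) = G.dst e
  weight : ∀ e : Fin m, τ.a .inp (4 + 3 * e) = G.weight e
  fst : ∀ e : Fin m, τ.a .fst (G.src e) = lab (G.src e) ∧ τ.a .fst (G.dst e) = lab (G.dst e)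

theorem Input.congr {lab : Fin n → ℕ} {σ τ : St} (h : Input G lab σ) (h1 : τ.v .n = σ.v .n)
    (h2 : τ.v .m = σ.v .m) (h3 : τ.v .dd = σ.v .dd) (h4 : τ.a .inp = σ.a .inp)
    (h5 : τ.a .fst = σ.a .fst) : Input G lab τ :=
  ⟨h1.trans h.n_eq, h2.trans h.m_eq, h3.trans h.dd_eq, by rw [h4]; exact h.src,
    by rw [h4]; exact h.dst, by rw [h4]; exact h.weight, by rw [h5]; exact h.fst⟩

theorem Input.of_frame {lab : Fin n → ℕ} {σ τ : St} {c : Stm} (h : Input G lab σ)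
    (hf : Frame c σ τ) (h1 : c.modV .n = false := by rfl) (h2 : c.modV .m = false := by rfl)
    (h3 : c.modV .dd = false := by rfl) (h4 : c.modA .inp = false := by rfl)
    (h5 : c.modA .fst = false := by rfl) : Input G lab τ :=
  h.congr (hf.v _ h1) (hf.v _ h2) (hf.v _ h3) (hf.a _ h4) (hf.a _ h5)

section Specs

variable {W M : ℕ} {O : FlowSubroutine} {σ : St}

/-- Loops with an invariant that depends on a decreasing natural number. -/
theorem wp_loop_exists {e : Ex} {c : Stm} {Q : St → Prop} (I : ℕ → St → Prop) {p₀ : ℕ}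
    (h0 : I p₀ σ)
    (hs : ∀ p τ, Frame (.loop e c) σ τ → I p τ → e.ok W M τ ∧
      (e.eval τ ≠ 0 → wp W M O c (fun υ => ∃ p' < p, I p' υ) τ.tick) ∧
      (e.eval τ = 0 → Q τ.tick)) : wp W M O (.loop e c) Q σ := by
  refine wp_loop (fun τ => ∃ p, I p τ) (fun τ => sInf {p | I p τ}) ⟨p₀, h0⟩ ?_
  rintro τ hf h
  obtain ⟨h1, h2, h3⟩ := hs _ τ hf (Nat.sInf_mem (s := {p | I p τ}) h)
  refine ⟨h1, fun he => wp_mono (h2 he) ?_, h3⟩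
  rintro υ - ⟨p', hp', hI⟩
  exact ⟨⟨p', hI⟩, (Nat.sInf_le (s := {p | I p υ}) hI).trans_lt hp'⟩

theorem setLabels_spec {lab : Fin n → ℕ} (hin : Input G lab σ) (hM : 4 + 3 * m ≤ M) (hnM : n ≤ M)
    (hMW : M < W) :
    wp W M O setLabels (fun τ => τ.time ≤ σ.time + (4 * m + 2) ∧
      HasLabels G lab (τ.a .lA) (τ.a .lB)) σ := by
  refine wp_for_time m 2 (fun i τ => ∀ e : Fin m, (e : ℕ) < i →
      τ.a .lA e = lab (G.src e) ∧ τ.a .lB e = lab (G.dst e)) rfl (by omega) ?_ ?_ ?_ ?_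
  · intro τ hf
    simp [hf.v .m rfl, hin.m_eq]
  · simp
  · intro i hi τ hf hv hI
    have h1 := hf.a .inp rfl
    have h2 := hf.a .fst rfl
    have s1 := hin.src ⟨i, hi⟩
    have s2 := hin.dst ⟨i, hi⟩
    obtain ⟨s3, s4⟩ := hin.fst ⟨i, hi⟩
    simp only at s1 s2
    have b1 := (G.src ⟨i, hi⟩).2
    have b2 := (G.dst ⟨i, hi⟩).2
    have c1 : 3 * i < W := by omega
    have c2 : 2 + 3 * i < W := by omega
    have c3 : 3 + 3 * i < W := by omega
    have d1 : i < M := by omega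
    have d2 : 2 + 3 * i < M := by omega
    have d3 : 3 + 3 * i < M := by omega
    have d4 : (G.src ⟨i, hi⟩ : ℕ) < M := by omega
    have d5 : (G.dst ⟨i, hi⟩ : ℕ) < M := by omega
    simp [hv, h1, h2, s1, s2, s3, s4, c1, c2, c3, d1, d2, d3, d4, d5]
    intro e he
    rcases he.lt_or_eq with he | he
    · have h3 : (e : ℕ) ≠ i := he.ne
      simpa [h3] using hI e he
    · have : e = ⟨i, hi⟩ := Fin.ext he
      subst this
      simp
  · intro τ hf hI ht
    exact ⟨by simp; omega, fun e => hI e e.2⟩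

/-- A top component may be handed to the greedy contraction. -/
theorem _root_.WGraph.TopComponent.contracted {D h k r : ℕ} {S : Finset ℕ} {κ : Fin m → ℕ}
    {g : Fin n → ℕ} {a b : ℕ → ℕ} (hS : TopComponent G κ g k r S) (hg : Merged G κ g)
    (hκ : ∀ e, G.EdgeApprox D (2 * h) (κ e) e) (hk : 2 * h ∣ k)
    (hlt : ∀ e, g (G.src e) < 2 * m ∧ g (G.dst e) < 2 * m)
    (hab : ∀ e : Fin m, (g (G.src e) = g (G.dst e) ∨ g (G.src e) ∈ S ∧ g (G.dst e) ∈ S →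
          a e = g (G.src e) ∧ b e = g (G.dst e)) ∧
        (¬ (g (G.src e) = g (G.dst e) ∨ g (G.src e) ∈ S ∧ g (G.dst e) ∈ S) →
          a e = 0 ∧ b e = 0)) :
    Contracted G D (k + h) (fiber g S) g g a b 0 where
  coarse _ _ h := h
  ends e h1 h2 _ := (hab e).1 (.inr ⟨mem_fiber.1 h1, mem_fiber.1 h2⟩)
  inactive e hne := by
    rw [mem_fiber, mem_fiber]
    obtain ⟨h1, h2⟩ := hab e
    grind
  lt e he := by
    obtain ⟨h1, h2⟩ := hab ⟨e, he⟩
    obtain ⟨h3, h4⟩ := hlt ⟨e, he⟩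
    by_cases hc : g (G.src ⟨e, he⟩) = g (G.dst ⟨e, he⟩) ∨
        g (G.src ⟨e, he⟩) ∈ S ∧ g (G.dst ⟨e, he⟩) ∈ S
    · have := h1 hc; simp only at this; omega
    · have := h2 hc; simp only at this; omega
  label_lt u hu := by
    obtain ⟨e, -, -, h3⟩ := hS.touch _ (mem_fiber.1 hu)
    have := hlt e
    omega
  strong u hu := (hS.strong_class hg hκ hk hu).mono_div (by omega)
  sparse T hT hne := by
    obtain ⟨c, hc⟩ := hne
    simpa using hT hc

theorem labelSet_card_le {S : Finset ℕ} {g : Fin n → ℕ} {a b : ℕ → ℕ}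
    (hab : ∀ e : Fin m, (g (G.src e) = g (G.dst e) ∨ g (G.src e) ∈ S ∧ g (G.dst e) ∈ S →
          a e = g (G.src e) ∧ b e = g (G.dst e)) ∧
        (¬ (g (G.src e) = g (G.dst e) ∨ g (G.src e) ∈ S ∧ g (G.dst e) ∈ S) →
          a e = 0 ∧ b e = 0)) : (labelSet m a b).card ≤ S.card := by
  refine Finset.card_le_card fun c hc => ?_
  obtain ⟨e, he, hne, hc⟩ := mem_labelSet.1 hc
  obtain ⟨h1, h2⟩ := hab ⟨e, he⟩
  grind

/-- The specification of `findMax` in terms of the labels of the vertices. -/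
theorem findMax_labels {κ : Fin m → ℕ} {g : Fin n → ℕ} (hm : σ.v .m = m) (hmM : m ≤ M)
    (hmW : m < W) (hl : HasLabels G g (σ.a .lA) (σ.a .lB)) (hκ : HasLevels G κ g (σ.a .kap)) :
    wp W M O findMax (fun τ => τ.time ≤ σ.time + (7 * m + 4) ∧
      (τ.v .go = 0 → ∀ e, g (G.src e) = g (G.dst e)) ∧
      (τ.v .go ≠ 0 → (∃ e, g (G.src e) ≠ g (G.dst e) ∧ κ e = τ.v .k ∧ g (G.src e) = τ.v .r) ∧
        ∀ e, g (G.src e) ≠ g (G.dst e) → κ e ≤ τ.v .k)) σ := by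
  refine wp_mono (findMax_spec hm hmM hmW) ?_
  rintro τ - ⟨t1, h1, h2⟩
  refine ⟨t1, fun h0 e => ?_, fun h0 => ?_⟩
  · have := h1 h0 e e.2
    rwa [(hl e).1, (hl e).2] at this
  · obtain ⟨⟨e, he, h3, h4, h5⟩, h6⟩ := h2 h0
    have e1 := (hl ⟨e, he⟩).1
    have e2 := (hl ⟨e, he⟩).2
    simp only at e1 e2
    rw [e1, e2] at h3
    have e3 := hκ ⟨e, he⟩ h3
    simp only at e3
    refine ⟨⟨⟨e, he⟩, h3, by rw [← e3, h4], by rw [← e1, h5]⟩, fun f hf => ?_⟩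
    rw [← hκ f hf]
    refine h6 f f.2 ?_
    rwa [(hl f).1, (hl f).2]

/-- The invariant of a sweep of refinement. -/
structure Sweeping (G : WGraph n m) (lab : Fin n → ℕ) (B h : ℕ) (κ : Fin m → ℕ) (g : Fin n → ℕ)
    (τ : St) : Prop where
  input : Input G lab τ
  step_eq : τ.v .step = h
  merged : Merged G κ g
  labels : HasLabels G g (τ.a .lA) (τ.a .lB)
  levels : HasLevels G κ g (τ.a .kap)
  lt : ∀ e, g (G.src e) < 2 * m ∧ g (G.dst e) < 2 * m
  done : ∀ e, g (G.src e) = g (G.dst e) → G.EdgeApprox (n * n) h (τ.a .kap e) e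
  small : ∀ I ∈ τ.calls, SmallCall m B I

/-- One sweep doubles the precision of all levels. A component with `s` classes costs at most `s`
flow calls and reduces the number of classes by `s - 1 ≥ s / 2`, so that a sweep makes at most `2 *
n` calls. -/
theorem refineSweep_spec {lab : Fin n → ℕ} {B h : ℕ} {κ : Fin m → ℕ} (hO : O.Correct)
    (hin : Input G lab σ) (hlab : Function.Injective lab)
    (hlt : ∀ e, lab (G.src e) < 2 * m ∧ lab (G.dst e) < 2 * m)
    (hM : 7 + 12 * m ≤ M) (hnM : n ≤ M) (hMW : 16 * M ≤ W) (hBW : B < W)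
    (hDB : ∀ e, n * n * G.weight e ≤ B) (hκB : ∀ e, κ e + h ≤ B) (hh : 0 < h)
    (hs : σ.v .step = h) (hκ : ∀ e, G.EdgeApprox (n * n) (2 * h) (κ e) e)
    (hkap : ∀ e : Fin m, σ.a .kap e = κ e) (hcalls : ∀ I ∈ σ.calls, SmallCall m B I) :
    wp W M O refineSweep (fun τ => Input G lab τ ∧ τ.v .step = h ∧
      (∀ e : Fin m, G.EdgeApprox (n * n) h (τ.a .kap e) e) ∧
      (∀ I ∈ τ.calls, SmallCall m B I) ∧ τ.calls.length ≤ σ.calls.length + 2 * n ∧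
      τ.time ≤ σ.time + 2000 * (m + 1) * (n + 1)) σ := by
  simp only [refineSweep, wp_seq]
  refine wp_mono (setLabels_spec hin (by omega) hnM (by omega)) ?_
  rintro σ₁ f₁ ⟨t1, l1⟩
  rw [wp_seq]
  have in1 := hin.of_frame f₁
  have kap1 : HasLevels G κ lab (σ₁.a .kap) := fun e _ => by rw [f₁.a .kap rfl]; exact hkap e
  refine wp_mono (findMax_labels in1.m_eq (by omega) (by omega) l1 kap1) ?_
  rintro σ₂ f₂ ⟨t2, c2, d2⟩
  have key : ∀ g : Fin n → ℕ, (Finset.univ.image g).card ≤ n := fun g =>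
    Finset.card_image_le.trans (by simp)
  refine wp_loop_exists (fun p τ => ∃ g, Sweeping G lab B h κ g τ ∧
      p = (Finset.univ.image g).card ∧
      (τ.v .go = 0 → ∀ e, g (G.src e) = g (G.dst e)) ∧
      (τ.v .go ≠ 0 → (∃ e, g (G.src e) ≠ g (G.dst e) ∧ κ e = τ.v .k ∧ g (G.src e) = τ.v .r) ∧
        ∀ e, g (G.src e) ≠ g (G.dst e) → κ e ≤ τ.v .k) ∧
      τ.calls.length + 2 * p ≤ σ.calls.length + 2 * n ∧
      τ.time + 2000 * (m + 1) * p + 1 ≤ σ.time + 2000 * (m + 1) * (n + 1))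
    (p₀ := (Finset.univ.image lab).card) ?_ ?_
  · refine ⟨lab, ⟨in1.of_frame f₂, by rw [f₂.v .step rfl, f₁.v .step rfl, hs],
      .of_injective hlab, by rw [f₂.a .lA rfl, f₂.a .lB rfl]; exact l1,
      by rw [f₂.a .kap rfl]; exact kap1, hlt, fun e he => absurd (hlab he) (G.loopless e), ?_⟩,
      rfl, c2, d2, ?_, ?_⟩
    · rw [f₂.calls rfl, f₁.calls rfl]; exact hcalls
    · rw [f₂.calls rfl, f₁.calls rfl]
      have := key lab
      omega
    · have := Nat.mul_le_mul_left (2000 * (m + 1)) (key lab)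
      have e1 : 2000 * (m + 1) * (n + 1) = 2000 * (m + 1) * n + 2000 * (m + 1) := by ring
      omega
  rintro p τ - ⟨g, hI, hp, hc, hd, hcl, ht⟩
  refine ⟨trivial, fun hgo => ?_, fun hgo => ?_⟩
  · simp only [Ex.eval_var] at hgo
    obtain ⟨htouch, hmax⟩ := hd hgo
    have hk : 2 * h ∣ τ.v .k := by
      obtain ⟨e, -, h2, -⟩ := htouch
      exact h2 ▸ (hκ e).1
    have hkB : τ.v .k + h ≤ B := by
      obtain ⟨e, -, h2, -⟩ := htouch
      exact h2 ▸ hκB e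
    simp only [wp_seq]
    refine wp_mono (pick_spec (σ := τ.tick) (k := τ.v .k) (r := τ.v .r) (by omega) hnM (by omega)
      hI.input.m_eq rfl rfl hI.labels hI.levels hmax htouch) ?_
    rintro υ fυ ⟨S, hS, hcnt, hl, hab, tυ⟩
    have inυ : Input G lab υ := (hI.input.congr rfl rfl rfl rfl rfl : Input G lab τ.tick).of_frame fυ
    rw [wp_seq]
    have hC := hS.contracted hI.merged hκ hk hI.lt hab
    have hact : ∀ e, G.src e ∈ fiber g S → G.dst e ∈ fiber g S → g (G.src e) ≠ g (G.dst e) →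
        κ e = τ.v .k := fun e h1 h2 h3 => hS.eq_of_active hI.merged hκ hk h1 h2 h3
    have hnn : 0 < n * n := by
      obtain ⟨e, -⟩ := htouch
      exact Nat.mul_pos (G.src e).pos (G.src e).pos
    refine wp_mono (greedy_spec (D := n * n) (k := τ.v .k) (h := h) (κ := κ) hO inυ.m_eq hM hMW hBW
      hnn inυ.dd_eq inυ.weight hDB hkB hh (by rw [fυ.v .k rfl]; rfl)
      (by rw [fυ.v .step rfl]; exact hI.step_eq) hκ hk hS.closed_fiber hact hC
      (by rw [fυ.calls rfl]; exact hI.small)) ?_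
    rintro φ fφ ⟨tφ, sφ, lφ, kφ⟩
    have hZ := labelSet_card_le hab
    have inφ := inυ.of_frame fφ
    set g' : Fin n → ℕ := fun u => collapse S (τ.v .r) (g u) with hg'
    have hiff : ∀ e, g' (G.src e) = g' (G.dst e) ↔
        g (G.src e) = g (G.dst e) ∨ g (G.src e) ∈ S ∧ g (G.dst e) ∈ S := fun e =>
      hS.collapse_eq_iff
    have hkapυ : υ.a .kap = τ.a .kap := fυ.a .kap rfl
    have hlev : HasLevels G κ g' (φ.a .kap) := by
      intro e he
      rw [ne_eq, hiff] at he
      obtain ⟨h1, h2⟩ := (hab e).2 he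
      rw [(kφ e).1 (h1.trans h2.symm), hkapυ]
      exact hI.levels e fun h => he (.inl h)
    have hlabφ : HasLabels G g' (φ.a .lA) (φ.a .lB) := by
      rw [fφ.a .lA rfl, fφ.a .lB rfl]; exact hl
    refine wp_mono (findMax_labels inφ.m_eq (by omega) (by omega) hlabφ hlev) ?_
    rintro ψ fψ ⟨tψ, cψ, dψ⟩
    have hcard : (Finset.univ.image g').card + S.card = (Finset.univ.image g).card + 1 :=
      hS.card_image
    have h2S := hS.two_le_card
    refine ⟨(Finset.univ.image g').card, by omega, g',
      ⟨inφ.of_frame fψ, ?_, hS.merged hI.merged hκ hk, ?_, ?_, fun e => ?_, fun e he => ?_, ?_⟩,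
      rfl, cψ, dψ, ?_, ?_⟩
    · rw [fψ.v .step rfl, fφ.v .step rfl, fυ.v .step rfl]; exact hI.step_eq
    · rw [fψ.a .lA rfl, fψ.a .lB rfl]; exact hlabφ
    · rw [fψ.a .kap rfl]; exact hlev
    · have hr : τ.v .r < 2 * m := by
        obtain ⟨f, -, -, h3⟩ := htouch
        exact h3 ▸ (hI.lt f).1
      have := hI.lt e
      simp only [hg', collapse]
      constructor <;> split_ifs <;> omega
    · rw [fψ.a .kap rfl]
      rw [hiff] at he
      obtain ⟨h1, h2⟩ := (hab e).1 he
      by_cases hold : g (G.src e) = g (G.dst e)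
      · rw [(kφ e).1 (by rw [h1, h2, hold]), hkapυ]
        exact hI.done e hold
      · exact (kφ e).2 (by rw [h1, h2]; exact hold)
    · rw [fψ.calls rfl]; exact sφ
    · have e1 : υ.calls = τ.calls := fυ.calls rfl
      rw [fψ.calls rfl]
      rw [e1] at lφ
      omega
    · simp only [St.tick_time] at tυ
      have e1 : S.card ≤ 2 * (S.card - 1) := by omega
      have e2 : p = (Finset.univ.image g').card + (S.card - 1) := by omega
      have e3 := Nat.mul_le_mul_left (m + 1) e1
      have e4 := Nat.mul_le_mul_left (m + 1) hZ
      have e5 : 1 ≤ S.card - 1 := by omega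
      have e6 := Nat.mul_le_mul_left (m + 1) e5
      rw [e2, Nat.mul_add] at ht
      simp only [mul_assoc, Nat.mul_add (m + 1), Nat.mul_one] at tυ tφ tψ ht e3 e4 e6 ⊢
      set x1 := (m + 1) * S.card
      set x2 := (m + 1) * (labelSet m (υ.a .cA) (υ.a .cB)).card
      set x3 := (m + 1) * (S.card - 1)
      have e7 : (m + 1) * (2 * (S.card - 1)) = 2 * x3 := by simp only [x3]; ring
      omega
  · simp only [Ex.eval_var] at hgo
    refine ⟨hI.input.congr rfl rfl rfl rfl rfl, hI.step_eq, fun e => hI.done e (hc hgo e),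
      hI.small, ?_, ?_⟩
    · simp only [St.tick_calls]; omega
    · simp only [St.tick_time]
      omega

end Specs

end StructRAM

/-! ### The tree of the hierarchy -/

namespace WGraph

variable {n m : ℕ} {G : WGraph n m} {g : Fin n → ℕ}

/-- The class of the vertex `u` in the set `U`, for the labels `g`. -/
def cls (g : Fin n → ℕ) (U : Finset (Fin n)) (u : Fin n) : Finset (Fin n) :=
  U.filter fun w => g w = g u

@[simp] theorem mem_cls {U : Finset (Fin n)} {u w : Fin n} : w ∈ cls g U u ↔ w ∈ U ∧ g w = g u := by
  simp [cls]

/-- A part of the tree of the hierarchy that has been built from the leaves, with nodes below `N`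
and parent pointers `par`, where `0` stands for a missing parent; the leaf `0` is no parent, since
the parents are at least `n ≥ 1`. The vertex set of node `i` is `Ls i`; the sets of the roots are
the classes of the labels `g`, and `nd u` is the root above the vertex `u`. -/
structure Forest (G : WGraph n m) (g nd : Fin n → ℕ) (N : ℕ) (par : ℕ → ℕ)
    (Ls : ℕ → Finset (Fin n)) : Prop where
  le : n ≤ N
  leaf : ∀ v : Fin n, Ls v = {v}
  up : ∀ i < N, par i ≠ 0 → n ≤ par i ∧ i < par i ∧ par i < N
  cut : ∀ i, n ≤ i → i < N → ∃ col : Fin n → ℕ, 2 ≤ ncol (Ls i) col ∧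
    (∀ Q : Finpartition (Ls i), G.IsMaximalMinRatioCut Q → IsCol Q col) ∧
    ∀ X, (∃ u ∈ Ls i, X = cls col (Ls i) u) ↔ ∃ j < N, par j = i ∧ Ls j = X
  inj : ∀ i < N, ∀ j < N, Ls i = Ls j → i = j
  root : ∀ i < N, par i = 0 ↔ ∃ u, nd u = i
  nd_lt : ∀ u, nd u < N
  nd_set : ∀ u, Ls (nd u) = cls g Finset.univ u
  sub : ∀ i < N, ∃ u, Ls i ⊆ cls g Finset.univ u

theorem Forest.of_injective (hg : Function.Injective g) {par : ℕ → ℕ} (hpar : ∀ i < n, par i = 0) :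
    Forest G g (fun u => u) n par (fun i => if h : i < n then {⟨i, h⟩} else ∅) where
  le := le_rfl
  leaf v := by simp
  up i hi h := absurd (hpar i hi) h
  cut i h1 h2 := absurd h2 (by omega)
  inj i hi j hj h := by
    simp only [hi, hj, dif_pos, Finset.singleton_inj, Fin.mk.injEq] at h
    exact h
  root i hi := ⟨fun _ => ⟨⟨i, hi⟩, rfl⟩, fun _ => hpar i hi⟩
  nd_lt u := u.2
  nd_set u := by
    ext w
    simp only [u.2, dif_pos, Finset.mem_singleton, mem_cls, Finset.mem_univ, true_and]
    exact ⟨fun h => by rw [h], fun h => hg h⟩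
  sub i hi := ⟨⟨i, hi⟩, by simp [hi]⟩

namespace Forest

variable {nd : Fin n → ℕ} {N : ℕ} {par : ℕ → ℕ} {Ls : ℕ → Finset (Fin n)}
  (h : Forest G g nd N par Ls)
include h

theorem nd_eq_iff {u w : Fin n} : nd u = nd w ↔ g u = g w := by
  constructor
  · intro he
    have h1 := h.nd_set u
    rw [he, h.nd_set w] at h1
    have : w ∈ cls g Finset.univ u := h1 ▸ (by simp)
    exact (mem_cls.1 this).2.symm
  · intro he
    refine h.inj _ (h.nd_lt u) _ (h.nd_lt w) ?_
    rw [h.nd_set, h.nd_set]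
    simp [cls, he]

/-- A new root is put over the roots of the vertices in `U`. -/
theorem join {U : Finset (Fin n)} {g' : Fin n → ℕ} {par' : ℕ → ℕ}
    (hU : ∀ u ∈ U, ∀ w, g w = g u → w ∈ U) (h2 : 2 ≤ ncol U g)
    (hcut : ∀ Q : Finpartition U, G.IsMaximalMinRatioCut Q → IsCol Q g)
    (hg' : ∀ u w, g' u = g' w ↔ g u = g w ∨ u ∈ U ∧ w ∈ U)
    (hpar : ∀ i < N, ((∃ u ∈ U, nd u = i) → par' i = N) ∧ ((¬ ∃ u ∈ U, nd u = i) → par' i = par i))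
    (hparN : par' N = 0) :
    Forest G g' (fun u => if u ∈ U then N else nd u) (N + 1) par' (Function.update Ls N U) := by
  obtain ⟨u₀, hu₀, u₁, hu₁, hne⟩ := exists_of_two_le_ncol h2
  have hn : 0 < n := u₀.pos
  have hN : 0 < N := hn.trans_le h.le
  have hLs : ∀ i < N, Function.update Ls N U i = Ls i := fun i hi =>
    Function.update_of_ne hi.ne _ _
  have hclsU : ∀ u ∈ U, cls g U u = cls g Finset.univ u := fun u hu => by
    ext w
    simp only [mem_cls, Finset.mem_univ, true_and, and_iff_right_iff_imp]
    exact hU u hu w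
  have hclsg : ∀ u ∈ U, cls g' Finset.univ u = U := fun u hu => by
    ext w
    simp only [mem_cls, Finset.mem_univ, true_and, hg']
    exact ⟨fun h => h.elim (hU u hu w) fun h => h.1, fun hw => .inr ⟨hw, hu⟩⟩
  have hclsg' : ∀ u ∉ U, cls g' Finset.univ u = cls g Finset.univ u := fun u hu => by
    ext w
    simp only [mem_cls, Finset.mem_univ, true_and, hg']
    exact ⟨fun h => h.elim id fun h => absurd h.2 hu, .inl⟩
  have hnew : ∀ i < N, Ls i ≠ U := fun i hi he => by
    obtain ⟨u, hu⟩ := h.sub i hi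
    rw [he] at hu
    exact hne ((mem_cls.1 (hu hu₀)).2.trans (mem_cls.1 (hu hu₁)).2.symm)
  have hchild : ∀ i < N, par' i = N ↔ ∃ u ∈ U, nd u = i := fun i hi => by
    refine ⟨fun hp => ?_, (hpar i hi).1⟩
    by_contra hcon
    rw [(hpar i hi).2 hcon] at hp
    have := h.up i hi (by omega)
    omega
  refine ⟨h.le.trans (Nat.le_succ N), fun v => ?_, fun i hi hp => ?_, fun i h1 hi => ?_,
    fun i hi j hj he => ?_, fun i hi => ?_, fun u => ?_, fun u => ?_, fun i hi => ?_⟩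
  · rw [hLs _ (v.2.trans_le h.le), h.leaf]
  · rcases Nat.lt_succ_iff_lt_or_eq.1 hi with hi | rfl
    · by_cases hc : ∃ u ∈ U, nd u = i
      · rw [(hpar i hi).1 hc]
        exact ⟨h.le, hi, Nat.lt_succ_self N⟩
      · rw [(hpar i hi).2 hc] at hp ⊢
        have := h.up i hi hp
        omega
    · exact absurd hparN hp
  · rcases Nat.lt_succ_iff_lt_or_eq.1 hi with hi | rfl
    · obtain ⟨col, c1, c2, c3⟩ := h.cut i h1 hi
      rw [hLs i hi]
      refine ⟨col, c1, c2, fun X => (c3 X).trans ?_⟩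
      constructor
      · rintro ⟨j, hj, hp, rfl⟩
        refine ⟨j, by omega, ?_, hLs j hj⟩
        rw [(hpar j hj).2, hp]
        rintro hu
        have := (h.root j hj).2 (hu.imp fun _ h => h.2)
        omega
      · rintro ⟨j, hj, hp, rfl⟩
        have hjN : j < N := by
          rcases Nat.lt_succ_iff_lt_or_eq.1 hj with hj | rfl
          · exact hj
          · omega
        refine ⟨j, hjN, ?_, (hLs j hjN).symm⟩
        rw [← (hpar j hjN).2, hp]
        intro hu
        have := (hpar j hjN).1 hu
        omega
    · rw [Function.update_self]
      refine ⟨g, h2, hcut, fun X => ?_⟩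
      constructor
      · rintro ⟨u, hu, rfl⟩
        refine ⟨nd u, (h.nd_lt u).trans (Nat.lt_succ_self _),
          (hpar _ (h.nd_lt u)).1 ⟨u, hu, rfl⟩, ?_⟩
        rw [hLs _ (h.nd_lt u), h.nd_set, hclsU u hu]
      · rintro ⟨j, hj, hp, rfl⟩
        rcases Nat.lt_succ_iff_lt_or_eq.1 hj with hj | rfl
        · obtain ⟨u, hu, rfl⟩ := (hchild j hj).1 hp
          refine ⟨u, hu, ?_⟩
          rw [hLs _ hj, h.nd_set, hclsU u hu]
        · omega
  · rcases Nat.lt_succ_iff_lt_or_eq.1 hi with hi | rfl <;>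
      rcases Nat.lt_succ_iff_lt_or_eq.1 hj with hj | rfl
    · rw [hLs i hi, hLs j hj] at he
      exact h.inj i hi j hj he
    · rw [hLs i hi, Function.update_self] at he
      exact absurd he (hnew i hi)
    · rw [hLs j hj, Function.update_self] at he
      exact absurd he.symm (hnew j hj)
    · rfl
  · rcases Nat.lt_succ_iff_lt_or_eq.1 hi with hi | rfl
    · by_cases hc : ∃ u ∈ U, nd u = i
      · rw [(hpar i hi).1 hc]
        refine ⟨fun h0 => by omega, ?_⟩
        rintro ⟨w, hw⟩
        split_ifs at hw with hwU
        · omega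
        · obtain ⟨u, hu, hui⟩ := hc
          exact absurd (hU u hu w (h.nd_eq_iff.1 (hw.trans hui.symm))) hwU
      · rw [(hpar i hi).2 hc, h.root i hi]
        constructor
        · rintro ⟨u, hu⟩
          refine ⟨u, ?_⟩
          rw [if_neg fun huU => hc ⟨u, huU, hu⟩, hu]
        · rintro ⟨u, hu⟩
          split_ifs at hu with huU
          · omega
          · exact ⟨u, hu⟩
    · exact ⟨fun _ => ⟨u₀, if_pos hu₀⟩, fun _ => hparN⟩
  · split_ifs
    · exact Nat.lt_succ_self N
    · exact (h.nd_lt u).trans (Nat.lt_succ_self N)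
  · split_ifs with hu
    · rw [Function.update_self, hclsg u hu]
    · rw [hLs _ (h.nd_lt u), h.nd_set, hclsg' u hu]
  · rcases Nat.lt_succ_iff_lt_or_eq.1 hi with hi | rfl
    · obtain ⟨u, hu⟩ := h.sub i hi
      rw [hLs i hi]
      refine ⟨u, hu.trans ?_⟩
      by_cases huU : u ∈ U
      · rw [hclsg u huU]
        exact fun w hw => hU u huU w (mem_cls.1 hw).2
      · rw [hclsg' u huU]
    · exact ⟨u₀, by rw [Function.update_self, hclsg u₀ hu₀]⟩

theorem two_le_card {i : ℕ} (h1 : n ≤ i) (hi : i < N) : 2 ≤ (Ls i).card := by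
  obtain ⟨col, h2, -⟩ := h.cut i h1 hi
  exact h2.trans Finset.card_image_le

theorem child_subset {j : ℕ} (hj : j < N) (hp : par j ≠ 0) : Ls j ⊆ Ls (par j) := by
  obtain ⟨h1, -, h3⟩ := h.up j hj hp
  obtain ⟨col, -, -, c3⟩ := h.cut _ h1 h3
  obtain ⟨u, hu, he⟩ := (c3 (Ls j)).2 ⟨j, hj, rfl, rfl⟩
  rw [he]
  exact Finset.filter_subset _ _

theorem exists_child {i : ℕ} (h1 : n ≤ i) (hi : i < N) {u : Fin n} (hu : u ∈ Ls i) :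
    ∃ j < i, par j = i ∧ u ∈ Ls j := by
  obtain ⟨col, -, -, c3⟩ := h.cut _ h1 hi
  obtain ⟨j, hj, hp, he⟩ := (c3 _).1 ⟨u, hu, rfl⟩
  have hi0 : par j ≠ 0 := by have := u.pos; omega
  exact ⟨j, hp ▸ (h.up j hj hi0).2.1, hp, by rw [he]; simp [hu]⟩

variable (hone : ∀ u w, g u = g w) (u₀ : Fin n)
include hone

theorem root_iff {i : ℕ} (hi : i < N) : par i = 0 ↔ i = nd u₀ := by
  rw [h.root i hi]
  constructor
  · rintro ⟨u, rfl⟩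
    exact h.nd_eq_iff.2 (hone _ _)
  · rintro rfl
    exact ⟨u₀, rfl⟩

theorem root_set : Ls (nd u₀) = Finset.univ := by
  rw [h.nd_set]
  ext w
  simp [hone w u₀]

include u₀ in
theorem inHierarchy : ∀ i < N, G.InHierarchy (Ls i) := by
  -- induction from the root downwards
  suffices H : ∀ d, ∀ i < N, N - i ≤ d → G.InHierarchy (Ls i) from
    fun i hi => H _ i hi le_rfl
  intro d
  induction d with
  | zero => intro i hi h0; omega
  | succ d ih =>
    intro i hi hd
    by_cases hp : par i = 0
    · rw [(h.root_iff hone u₀ hi).1 hp, h.root_set hone u₀]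
      exact .root
    · obtain ⟨h1, h2, h3⟩ := h.up i hi hp
      obtain ⟨Q, hQ⟩ := exists_maximal (G := G) (h.two_le_card h1 h3)
      obtain ⟨col, -, c2, c3⟩ := h.cut _ h1 h3
      obtain ⟨u, hu, he⟩ := (c3 (Ls i)).2 ⟨i, hi, rfl, rfl⟩
      refine .side Q _ (ih _ h3 (by omega)) hQ ?_
      rw [(c2 Q hQ).parts, he]
      exact Finset.mem_image.2 ⟨u, hu, rfl⟩

include u₀ in
theorem exists_of_inHierarchy {S : Finset (Fin n)} (hS : G.InHierarchy S) : ∃ i < N, Ls i = S := by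
  induction hS with
  | root => exact ⟨nd u₀, h.nd_lt _, h.root_set hone u₀⟩
  | side P S hU hP hS ih =>
    obtain ⟨i, hi, rfl⟩ := ih
    have h1 : n ≤ i := by
      by_contra hcon
      have h2 : P.parts.card ≤ (Ls i).card := P.card_parts_le_card
      have h3 := h.leaf ⟨i, not_le.1 hcon⟩
      simp only at h3
      have h4 : (Ls i).card = 1 := by rw [h3, Finset.card_singleton]
      have := hP.1.1
      omega
    obtain ⟨col, -, c2, c3⟩ := h.cut i h1 hi
    rw [(c2 P hP).parts] at hS
    obtain ⟨u, hu, rfl⟩ := Finset.mem_image.1 hS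
    obtain ⟨j, hj, -, he⟩ := (c3 _).1 ⟨u, hu, rfl⟩
    exact ⟨j, hj, he⟩

theorem leavesBelow_eq {parent : ℕ → ℕ} (hpar : ∀ i < N, parent i = if i = nd u₀ then i else par i)
    {i : ℕ} (hi : i < N) : leavesBelow n parent i = Ls i := by
  have hlt : ∀ j < N, parent j < N := fun j hj => by
    rw [hpar j hj]
    split_ifs with h1
    · exact hj
    · exact (h.up j hj fun h2 => h1 ((h.root_iff hone u₀ hj).1 h2)).2.2
  ext w
  simp only [leavesBelow, Finset.mem_filter, Finset.mem_univ, true_and]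
  constructor
  · rintro ⟨k, rfl⟩
    have hw : (w : ℕ) < N := w.2.trans_le h.le
    suffices H : parent^[k] w < N ∧ w ∈ Ls (parent^[k] w) from H.2
    induction k with
    | zero => exact ⟨hw, by simp [h.leaf]⟩
    | succ k ih =>
      rw [Function.iterate_succ_apply'] at hi ⊢
      have ih' := ih (by
        by_contra hcon
        have : ∀ k, parent^[k] w < N := fun k => by
          induction k with
          | zero => exact hw
          | succ k ih => rw [Function.iterate_succ_apply']; exact hlt _ ih
        exact hcon (this k))
      refine ⟨hi, ?_⟩
      rw [hpar _ ih'.1]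
      split_ifs with h1
      · exact ih'.2
      · exact h.child_subset ih'.1 (fun h2 => h1 ((h.root_iff hone u₀ ih'.1).1 h2)) ih'.2
  · induction i using Nat.strong_induction_on with
    | _ i ih =>
      intro hw
      by_cases h1 : n ≤ i
      · obtain ⟨j, hj, hp, hwj⟩ := h.exists_child h1 hi hw
        obtain ⟨k, hk⟩ := ih j hj (hj.trans hi) hwj
        refine ⟨k + 1, ?_⟩
        rw [Function.iterate_succ_apply', hk, hpar j (hj.trans hi), if_neg, hp]
        intro h2
        have := (h.root_iff hone u₀ (hj.trans hi)).2 h2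
        have := w.pos
        omega
      · have h3 := h.leaf ⟨i, not_le.1 h1⟩
        simp only at h3
        rw [h3, Finset.mem_singleton] at hw
        exact ⟨0, by simp [hw]⟩

/-- Once there is a single root, pointing the root to itself turns the forest into the tree of the
hierarchy. -/
theorem representsHierarchy {parent : ℕ → ℕ}
    (hpar : ∀ i < N, parent i = if i = nd u₀ then i else par i) :
    RepresentsHierarchy G N parent := by
  have hL : ∀ i < N, leavesBelow n parent i = Ls i := fun i hi => h.leavesBelow_eq hone u₀ hpar hi
  refine ⟨h.le, fun i hi => ?_, fun v => ?_, fun i hi => ?_, fun i hi j hj he => ?_, ?_⟩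
  · rw [hpar i hi]
    split_ifs with h1
    · exact hi
    · exact (h.up i hi fun h2 => h1 ((h.root_iff hone u₀ hi).1 h2)).2.2
  · rw [hL _ (v.2.trans_le h.le), h.leaf]
  · rw [Set.mem_ofPred_eq, hL i hi]
    exact h.inHierarchy hone u₀ i hi
  · rw [hL i hi, hL j hj] at he
    exact h.inj i hi j hj he
  · intro S hS
    obtain ⟨i, hi, rfl⟩ := h.exists_of_inHierarchy hone u₀ hS
    exact ⟨i, hi, hL i hi⟩

end Forest

/-- The numerator `c` and the denominator `w` describe the ideal load of the edge `e`, which is cut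
at some node of the forest. -/
def Loaded (G : WGraph n m) (N : ℕ) (Ls : ℕ → Finset (Fin n)) (e : Fin m) (c w : ℕ) : Prop :=
  ∃ i < N, n ≤ i ∧ ∃ col : Fin n → ℕ, G.src e ∈ Ls i ∧ G.dst e ∈ Ls i ∧
    col (G.src e) ≠ col (G.dst e) ∧
    (∀ Q : Finpartition (Ls i), G.IsMaximalMinRatioCut Q → IsCol Q col) ∧
    c + 1 = ncol (Ls i) col ∧ w = G.dcut (Ls i) col

theorem Loaded.mono {N : ℕ} {Ls : ℕ → Finset (Fin n)} {e : Fin m} {c w : ℕ}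
    (h : Loaded G N Ls e c w) (U : Finset (Fin n)) :
    Loaded G (N + 1) (Function.update Ls N U) e c w := by
  obtain ⟨i, hi, h1, h2⟩ := h
  refine ⟨i, hi.trans (Nat.lt_succ_self N), h1, ?_⟩
  rw [Function.update_of_ne hi.ne]
  exact h2

theorem Loaded.isIdealLoad {nd : Fin n → ℕ} {N : ℕ} {par : ℕ → ℕ} {Ls : ℕ → Finset (Fin n)}
    (h : Forest G g nd N par Ls) (hone : ∀ u w, g u = g w) (hw : ∀ e, 1 ≤ G.weight e) {e : Fin m}
    {c w : ℕ} (hl : Loaded G N Ls e c w) : G.IsIdealLoad e ((c : ℚ) / w) ∧ w ≠ 0 := by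
  obtain ⟨i, hi, h1, col, hs, hd, hne, hQ, hc, rfl⟩ := hl
  obtain ⟨Q, hQ'⟩ := exists_maximal (G := G) (h.two_le_card h1 hi)
  have hcol := hQ Q hQ'
  refine ⟨⟨Ls i, Q, h.inHierarchy hone (G.src e) i hi, hQ', ?_, ?_⟩, ?_⟩
  · rw [hcol.cutEdges]
    exact Finset.mem_filter.2 ⟨Finset.mem_univ _, hs, hd, hne⟩
  · rw [hcol.card, hcol.cutValue, ← hc]
    push_cast
    ring
  · have : G.weight e ≤ G.dcut (Ls i) col := by
      unfold dcut
      exact Finset.single_le_sum (f := G.weight) (fun _ _ => Nat.zero_le _)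
        (Finset.mem_filter.2 ⟨Finset.mem_univ _, hs, hd, hne⟩)
    have := hw e
    omega

namespace TopComponent

variable {κ : Fin m → ℕ} {k r : ℕ} {S : Finset ℕ} (h : TopComponent G κ g k r S)
include h

theorem image_fiber : (fiber g S).image g = S := by
  ext s
  simp only [Finset.mem_image, mem_fiber]
  constructor
  · rintro ⟨u, hu, rfl⟩; exact hu
  · intro hs
    obtain ⟨e, -, -, h3⟩ := h.touch s hs
    rcases h3 with h3 | h3
    · exact ⟨_, h3 ▸ hs, h3⟩
    · exact ⟨_, h3 ▸ hs, h3⟩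

/-- A top component is split by its maximal minimum ratio cut into the current classes. -/
theorem isCol (hg : Merged G κ g) (hκ : ∀ e, G.EdgeApprox (n * n) 1 (κ e) e)
    {Q : Finpartition (fiber g S)} (hQ : G.IsMaximalMinRatioCut Q) : IsCol Q g :=
  isCol_of_level rfl hκ (h.linked_fiber hg) h.closed_fiber (fun _ hu => h.linked_class hg hu)
    (fun u _ => h.closed_class u) (by rw [ncol, h.image_fiber]; exact h.two_le_card) hQ

/-- Every class in the component is an end of an edge between different classes in it. -/
theorem exists_active {u : Fin n} (hu : u ∈ fiber g S) : ∃ e, g (G.src e) ∈ S ∧ g (G.dst e) ∈ S ∧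
    g (G.src e) ≠ g (G.dst e) ∧ (g (G.src e) = g u ∨ g (G.dst e) = g u) := by
  obtain ⟨e, h1, h2, h3⟩ := h.touch _ (mem_fiber.1 hu)
  have h4 := h.closed e h1 h2
  have h5 := mem_fiber.1 hu
  refine ⟨e, ?_, ?_, h1, h3⟩ <;> grind

end TopComponent

end WGraph

/-! ### Building the tree -/

namespace StructRAM

open WGraph

variable {n m : ℕ} {G : WGraph n m}

section Specs

variable {W M : ℕ} {O : FlowSubroutine} {σ : St}

theorem initNodes_spec {lab : Fin n → ℕ} (hin : Input G lab σ) (hlab : Function.Injective lab)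
    (hlt : ∀ e, lab (G.src e) < 2 * m ∧ lab (G.dst e) < 2 * m)
    (hl : HasLabels G lab (σ.a .lA) (σ.a .lB)) (hM : 4 + 3 * m ≤ M) (hMW : M < W) :
    wp W M O initNodes (fun τ => τ.time ≤ σ.time + (4 * m + 4) ∧ τ.v .num = n ∧
      ∀ e, τ.a .node (lab (G.src e)) = G.src e ∧ τ.a .node (lab (G.dst e)) = G.dst e) σ := by
  simp only [initNodes, wp_seq, wp_set, Ex.ok_var, Ex.eval_var]
  refine ⟨trivial, ?_⟩
  refine wp_for_time m 2 (fun i τ => ∀ e : Fin m, (e : ℕ) < i →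
      τ.a .node (lab (G.src e)) = G.src e ∧ τ.a .node (lab (G.dst e)) = G.dst e)
      rfl (by omega) ?_ ?_ ?_ ?_
  · intro τ hf
    simp [hf.v .m rfl, hin.m_eq]
  · simp
  · intro i hi τ hf hv hI
    have h1 := hf.a .inp rfl
    have h2 := hf.a .lA rfl
    have h3 := hf.a .lB rfl
    simp only [St.tick_a, St.set_a] at h1 h2 h3
    have s1 := hin.src ⟨i, hi⟩
    have s2 := hin.dst ⟨i, hi⟩
    obtain ⟨s3, s4⟩ := hl ⟨i, hi⟩
    obtain ⟨s5, s6⟩ := hlt ⟨i, hi⟩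
    simp only at s1 s2 s3 s4
    have c1 : 3 * i < W := by omega
    have c2 : 2 + 3 * i < W := by omega
    have c3 : 3 + 3 * i < W := by omega
    have d1 : i < M := by omega
    have d2 : 2 + 3 * i < M := by omega
    have d3 : 3 + 3 * i < M := by omega
    have d4 : lab (G.src ⟨i, hi⟩) < M := by omega
    have d5 : lab (G.dst ⟨i, hi⟩) < M := by omega
    simp [hv, h1, h2, h3, s1, s2, s3, s4, c1, c2, c3, d1, d2, d3, d4, d5, hlab.eq_iff]
    have key : ∀ u, (τ.a .node (lab u) = u ∨ u = G.src ⟨i, hi⟩ ∨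
        u = G.dst ⟨i, hi⟩) → (if u = G.dst ⟨i, hi⟩ then (G.dst ⟨i, hi⟩ : ℕ)
        else if u = G.src ⟨i, hi⟩ then (G.src ⟨i, hi⟩ : ℕ) else τ.a .node (lab u)) = u := by
      intro u hu
      split_ifs with h1 h2
      · rw [h1]
      · rw [h2]
      · exact hu.resolve_right (by simp [h1, h2])
    intro e he
    rcases he.lt_or_eq with he | he
    · exact ⟨key _ (.inl (hI e he).1), key _ (.inl (hI e he).2)⟩
    · have : e = ⟨i, hi⟩ := Fin.ext he
      subst this
      exact ⟨key _ (.inr (.inl rfl)), key _ (.inr (.inr rfl))⟩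
  · intro τ hf hI ht
    simp only [St.tick_time, St.set_time] at ht ⊢
    refine ⟨by omega, ?_, fun e => hI e e.2⟩
    rw [St.tick_v, hf.v .num rfl]
    simp [hin.n_eq]

theorem emit_spec {N : ℕ} (hm : σ.v .m = m) (hM : 4 + 3 * m ≤ M) (hNM : N + 2 ≤ M)
    (hMW : M < W) (hnum : σ.v .num = N)
    (hc : ∀ e < m, σ.a .cA e < M ∧ σ.a .cB e < M)
    (hnode : ∀ e < m, σ.a .cA e ≠ σ.a .cB e →
      σ.a .node (σ.a .cA e) < N ∧ σ.a .node (σ.a .cB e) < N)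
    (hr : σ.v .r < M) (hsum : ∑ e ∈ Finset.range m, σ.a .inp (4 + 3 * e) < W) :
    wp W M O emit (fun τ => τ.time ≤ σ.time + (20 * m + 20) ∧
      (∀ i, ((∃ e < m, σ.a .cA e ≠ σ.a .cB e ∧
          (σ.a .node (σ.a .cA e) = i ∨ σ.a .node (σ.a .cB e) = i)) → τ.a .out (1 + i) = N) ∧
        ((¬ ∃ e < m, σ.a .cA e ≠ σ.a .cB e ∧
          (σ.a .node (σ.a .cA e) = i ∨ σ.a .node (σ.a .cB e) = i)) →
            τ.a .out (1 + i) = σ.a .out (1 + i))) ∧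
      (∀ e < m, (σ.a .cA e ≠ σ.a .cB e → τ.a .oc e = σ.v .cnt ∧ τ.a .ow e =
          ∑ f ∈ Finset.range m with σ.a .cA f ≠ σ.a .cB f, σ.a .inp (4 + 3 * f)) ∧
        (σ.a .cA e = σ.a .cB e → τ.a .oc e = σ.a .oc e ∧ τ.a .ow e = σ.a .ow e)) ∧
      (∀ i, τ.a .node i = if i = σ.v .r then N else σ.a .node i) ∧ τ.v .num = N + 1) σ := by
  simp only [emit, wp_seq, wp_set, Ex.ok_ofNat, Ex.eval_ofNat]
  refine ⟨by norm_num, ?_⟩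
  refine wp_for_time m 6 (fun i τ =>
      (∀ j, ((∃ e < i, σ.a .cA e ≠ σ.a .cB e ∧
          (σ.a .node (σ.a .cA e) = j ∨ σ.a .node (σ.a .cB e) = j)) → τ.a .out (1 + j) = N) ∧
        ((¬ ∃ e < i, σ.a .cA e ≠ σ.a .cB e ∧
          (σ.a .node (σ.a .cA e) = j ∨ σ.a .node (σ.a .cB e) = j)) →
            τ.a .out (1 + j) = σ.a .out (1 + j))) ∧
      τ.v .wt = ∑ f ∈ Finset.range i with σ.a .cA f ≠ σ.a .cB f, σ.a .inp (4 + 3 * f))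
      rfl (by omega) ?_ ?_ ?_ ?_
  · intro τ hf
    simp [hf.v .m rfl, hm]
  · simp
  · intro i hi τ hf hv hI
    have h1 := hf.a .inp rfl
    have h2 := hf.a .cA rfl
    have h3 := hf.a .cB rfl
    have h4 := hf.a .node rfl
    have h5 := hf.v .num rfl
    simp at h1 h2 h3 h4 h5
    obtain ⟨b1, b2⟩ := hc i hi
    have c1 : 3 * i < W := by omega
    have c2 : 4 + 3 * i < W := by omega
    have d1 : i < M := by omega
    have d2 : 4 + 3 * i < M := by omega
    obtain ⟨hI1, hI2⟩ := hI
    have hsumle : ∀ f : ℕ → Prop, [DecidablePred f] → ∑ e ∈ Finset.range (i + 1) with f e,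
        σ.a .inp (4 + 3 * e) < W := fun f _ => by
      refine (Finset.sum_le_sum_of_subset fun e he => ?_).trans_lt hsum
      have := Finset.mem_range.1 (Finset.mem_filter.1 he).1
      exact Finset.mem_range.2 (by omega)
    have hstep : ∑ f ∈ Finset.range (i + 1) with σ.a .cA f ≠ σ.a .cB f, σ.a .inp (4 + 3 * f) =
        (∑ f ∈ Finset.range i with σ.a .cA f ≠ σ.a .cB f, σ.a .inp (4 + 3 * f)) +
          if σ.a .cA i ≠ σ.a .cB i then σ.a .inp (4 + 3 * i) else 0 := by
      rw [Finset.sum_filter, Finset.sum_filter, Finset.sum_range_succ]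
    have hlt := hsumle (fun f => σ.a .cA f ≠ σ.a .cB f)
    rw [hstep] at hlt
    by_cases heq : σ.a .cA i = σ.a .cB i
    · simp only [wp_ite, wp_skip, Ex.ok_eq, Ex.ok_rd, Ex.ok_var, Ex.eval_eq, Ex.eval_rd,
        Ex.eval_var, St.tick_a, St.tick_v, St.set_a, hv, h2, h3, heq, if_true]
      refine ⟨⟨⟨trivial, d1⟩, trivial, d1⟩, fun _ => ⟨by simp, ?_, ?_⟩, fun h => by simp at h⟩
      · intro j
        have := hI1 j
        refine ⟨fun ⟨e, he, hne, hj⟩ => this.1 ⟨e, ?_, hne, hj⟩,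
          fun hcon => this.2 fun ⟨e, he, hne, hj⟩ => hcon ⟨e, by omega, hne, hj⟩⟩
        have : e ≠ i := by rintro rfl; exact hne heq
        omega
      · simp [hstep, heq, hI2]
    · obtain ⟨n1, n2⟩ := hnode i hi heq
      have e1 : 1 + σ.a .node (σ.a .cA i) < M := by omega
      have e2 : 1 + σ.a .node (σ.a .cB i) < M := by omega
      have e3 : 1 + σ.a .node (σ.a .cA i) < W := by omega
      have e4 : 1 + σ.a .node (σ.a .cB i) < W := by omega
      rw [if_pos heq] at hlt
      simp only [wp_ite, wp_skip, wp_seq, wp_put, wp_set, Ex.ok_eq, Ex.ok_rd, Ex.ok_var, Ex.ok_add,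
        Ex.ok_mul, Ex.ok_ofNat, Ex.eval_ofNat, Ex.eval_eq, Ex.eval_rd, Ex.eval_add, Ex.eval_mul,
        Ex.eval_var, St.tick_a, St.tick_v, St.set_a, St.set_v, St.put_a, St.put_v, hv, h1, h2, h3,
        h4, h5, heq, if_false, hnum, hI2, e1, e2, e3, e4, b1, b2, c1, c2, d1, d2, hlt, true_and,
        and_true, reduceCtorEq]
      refine ⟨fun h => absurd rfl h, fun _ => ⟨by norm_num, by norm_num, by norm_num, ?_, ?_, ?_⟩⟩
      · simp
      · intro j
        have := hI1 j
        refine ⟨fun hj => ?_, fun hj => ?_⟩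
        · split_ifs with k1 k2
          · rfl
          · rfl
          · obtain ⟨e, he, hne, hj⟩ := hj
            refine this.1 ⟨e, ?_, hne, hj⟩
            have : e ≠ i := by rintro rfl; rcases hj with rfl | rfl <;> simp_all
            omega
        · split_ifs with k1 k2
          · exact absurd ⟨i, by omega, heq, .inr (by omega)⟩ hj
          · exact absurd ⟨i, by omega, heq, .inl (by omega)⟩ hj
          · exact this.2 fun ⟨e, he, hne, hj'⟩ => hj ⟨e, by omega, hne, hj'⟩
      · simp [hstep, heq]
  intro τ hf ⟨hI1, hI2⟩ ht
  have f1 := hf.a .cA rfl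
  have f2 := hf.a .cB rfl
  have f3 := hf.a .oc rfl
  have f4 := hf.a .ow rfl
  have f5 := hf.a .node rfl
  have f6 := hf.v .m rfl
  have f7 := hf.v .num rfl
  have f8 := hf.v .cnt rfl
  have f9 := hf.v .r rfl
  simp at f1 f2 f3 f4 f5 f6 f7 f8 f9
  rw [wp_seq]
  refine wp_for_time m 3 (fun i υ => ∀ e < m, (σ.a .cA e ≠ σ.a .cB e → e < i →
      υ.a .oc e = σ.v .cnt ∧ υ.a .ow e = τ.v .wt) ∧
      ((σ.a .cA e = σ.a .cB e ∨ i ≤ e) → υ.a .oc e = σ.a .oc e ∧ υ.a .ow e = σ.a .ow e))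
      rfl (by omega) ?_ ?_ ?_ ?_
  · intro υ hf'
    simp [hf'.v .m rfl, f6, hm]
  · simp [f3, f4]
  · intro i hi υ hf' hv hI
    have h1 := hf'.a .cA rfl
    have h2 := hf'.a .cB rfl
    have h3 := hf'.v .cnt rfl
    have h4 := hf'.v .wt rfl
    simp [f1, f2, f8] at h1 h2 h3 h4
    have d1 : i < M := by omega
    by_cases heq : σ.a .cA i = σ.a .cB i
    · simp [hv, h1, h2, heq, d1]
      intro e he
      have := hI e he
      grind
    · simp [hv, h1, h2, h3, h4, heq, d1]
      intro e he
      have := hI e he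
      grind
  intro υ hf' hI' ht'
  have g1 := hf'.v .r rfl
  have g2 := hf'.v .num rfl
  have g3 := hf'.a .node rfl
  have g4 := hf'.a .out rfl
  simp [f9, f7, f5] at g1 g2 g3 g4
  have k1 : N + 1 < W := by omega
  simp only [wp_seq, wp_put, wp_set, Ex.ok_var, Ex.ok_add, Ex.ok_ofNat, Ex.eval_var, Ex.eval_add,
    Ex.eval_ofNat, St.tick_v, St.tick_a, St.put_v, St.put_a, St.set_a, St.set_v, g1, g2, hnum, hr,
    k1, true_and, and_true, reduceCtorEq, if_false, if_true, g4, g3, St.tick_time, St.set_time,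
    St.put_time]
  simp only [St.tick_time, St.set_time] at ht ht'
  refine ⟨by norm_num, by omega, hI1, fun e he => ⟨fun hne => ?_, fun heq => ?_⟩, fun i => trivial⟩
  · obtain ⟨h1, h2⟩ := (hI' e he).1 hne he
    exact ⟨h1, h2.trans hI2⟩
  · exact (hI' e he).2 (.inl heq)

end Specs

end StructRAM

namespace StructRAM

open WGraph

variable {n m : ℕ} {G : WGraph n m}

section Specs

variable {W M : ℕ} {O : FlowSubroutine} {σ : St}

/-- The arrays describe the forest over the classes of `g`, and the ideal loads of the edges inside
these classes. -/
structure HasForest (G : WGraph n m) (g nd : Fin n → ℕ) (N : ℕ) (Ls : ℕ → Finset (Fin n))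
    (τ : St) : Prop where
  forest : Forest G g nd N (fun i => τ.a .out (1 + i)) Ls
  num_eq : τ.v .num = N
  zero : ∀ i, N ≤ i → τ.a .out (1 + i) = 0
  loaded : ∀ e : Fin m, g (G.src e) = g (G.dst e) → Loaded G N Ls e (τ.a .oc e) (τ.a .ow e)
  card : N + (Finset.univ.image g).card ≤ 2 * n

theorem HasForest.congr {g nd : Fin n → ℕ} {N : ℕ} {Ls : ℕ → Finset (Fin n)} {σ τ : St}
    (h : HasForest G g nd N Ls σ) (h1 : τ.a .out = σ.a .out) (h2 : τ.v .num = σ.v .num)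
    (h3 : τ.a .oc = σ.a .oc) (h4 : τ.a .ow = σ.a .ow) : HasForest G g nd N Ls τ :=
  ⟨by rw [h1]; exact h.forest, h2.trans h.num_eq, by rw [h1]; exact h.zero,
    by rw [h3, h4]; exact h.loaded, h.card⟩

/-- The invariant of the sweep that builds the tree. -/
structure Building (G : WGraph n m) (lab : Fin n → ℕ) (κ : Fin m → ℕ) (g nd : Fin n → ℕ) (N : ℕ)
    (Ls : ℕ → Finset (Fin n)) (τ : St) : Prop where
  input : Input G lab τ
  merged : Merged G κ g
  labels : HasLabels G g (τ.a .lA) (τ.a .lB)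
  levels : HasLevels G κ g (τ.a .kap)
  lt : ∀ e, g (G.src e) < 2 * m ∧ g (G.dst e) < 2 * m
  node : ∀ e, τ.a .node (g (G.src e)) = nd (G.src e) ∧ τ.a .node (g (G.dst e)) = nd (G.dst e)
  tree : HasForest G g nd N Ls τ

/-- With levels of precision `1`, merging components in the order of decreasing levels meets the
members of the hierarchy inside the connected components of the graph; every merged component
becomes a node of the tree. -/
theorem treeSweep_spec {lab : Fin n → ℕ} {κ : Fin m → ℕ} (hin : Input G lab σ)
    (hlab : Function.Injective lab)
    (hlt : ∀ e, lab (G.src e) < 2 * m ∧ lab (G.dst e) < 2 * m)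
    (hM : 7 + 12 * m ≤ M) (hnM : 2 * n + 2 ≤ M) (hMW : M < W) (hsumW : ∑ e, G.weight e < W)
    (hκ : ∀ e, G.EdgeApprox (n * n) 1 (κ e) e) (hkap : ∀ e : Fin m, σ.a .kap e = κ e)
    (hout : ∀ i, σ.a .out (1 + i) = 0) :
    wp W M O treeSweep (fun τ => ∃ g nd N Ls, Input G lab τ ∧ HasForest G g nd N Ls τ ∧
      (∀ u, G.Linked (fun _ => True) (Finset.univ.filter fun w => g w = g u)) ∧
      (∀ e, g (G.src e) = g (G.dst e)) ∧ τ.calls = σ.calls ∧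
      τ.time ≤ σ.time + 500 * (m + 1) * (n + 1)) σ := by
  simp only [treeSweep, wp_seq]
  refine wp_mono (setLabels_spec hin (by omega) (by omega) (by omega)) ?_
  rintro σ₁ f₁ ⟨t1, l1⟩
  have in1 := hin.of_frame f₁
  rw [wp_seq]
  refine wp_mono (initNodes_spec in1 hlab hlt l1 (by omega) (by omega)) ?_
  rintro σ₂ f₂ ⟨t2, n2, d2⟩
  have in2 := in1.of_frame f₂
  have l2 : HasLabels G lab (σ₂.a .lA) (σ₂.a .lB) := by
    rw [f₂.a .lA rfl, f₂.a .lB rfl]; exact l1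
  have kap2 : HasLevels G κ lab (σ₂.a .kap) := fun e _ => by
    rw [f₂.a .kap rfl, f₁.a .kap rfl]; exact hkap e
  have out2 : ∀ i, σ₂.a .out (1 + i) = 0 := fun i => by
    rw [f₂.a .out rfl, f₁.a .out rfl]; exact hout i
  rw [wp_seq]
  refine wp_mono (findMax_labels in2.m_eq (by omega) (by omega) l2 kap2) ?_
  rintro σ₃ f₃ ⟨t3, c3, d3⟩
  have key : ∀ g : Fin n → ℕ, (Finset.univ.image g).card ≤ n := fun g =>
    Finset.card_image_le.trans (by simp)
  refine wp_loop_exists (fun p τ => ∃ g nd N Ls, Building G lab κ g nd N Ls τ ∧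
      p = (Finset.univ.image g).card ∧
      (τ.v .go = 0 → ∀ e, g (G.src e) = g (G.dst e)) ∧
      (τ.v .go ≠ 0 → (∃ e, g (G.src e) ≠ g (G.dst e) ∧ κ e = τ.v .k ∧ g (G.src e) = τ.v .r) ∧
        ∀ e, g (G.src e) ≠ g (G.dst e) → κ e ≤ τ.v .k) ∧ τ.calls = σ.calls ∧
      τ.time + 500 * (m + 1) * p + 1 ≤ σ.time + 500 * (m + 1) * (n + 1))
    (p₀ := (Finset.univ.image lab).card) ?_ ?_
  · refine ⟨lab, fun u => u, n, _, ⟨in2.of_frame f₃, .of_injective hlab,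
      by rw [f₃.a .lA rfl, f₃.a .lB rfl]; exact l2, by rw [f₃.a .kap rfl]; exact kap2, hlt,
      by rw [f₃.a .node rfl]; exact d2, ⟨.of_injective hlab fun i _ => ?_, ?_, fun i _ => ?_,
        fun e he => absurd (hlab he) (G.loopless e), ?_⟩⟩, rfl, c3, d3, ?_, ?_⟩
    · rw [f₃.a .out rfl]; exact out2 i
    · rw [f₃.v .num rfl, n2]
    · rw [f₃.a .out rfl]; exact out2 i
    · have := key lab; omega
    · rw [f₃.calls rfl, f₂.calls rfl, f₁.calls rfl]
    · have := Nat.mul_le_mul_left (500 * (m + 1)) (key lab)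
      have e1 : 500 * (m + 1) * (n + 1) = 500 * (m + 1) * n + 500 * (m + 1) := by ring
      omega
  rintro p τ - ⟨g, nd, N, Ls, hI, hp, hc, hd, hcl, ht⟩
  refine ⟨trivial, fun hgo => ?_, fun hgo => ?_⟩
  · simp only [Ex.eval_var] at hgo
    obtain ⟨htouch, hmax⟩ := hd hgo
    have hr : τ.v .r < 2 * m := by
      obtain ⟨f, -, -, h3⟩ := htouch
      exact h3 ▸ (hI.lt f).1
    have hT := hI.tree
    simp only [wp_seq]
    refine wp_mono (pick_spec (σ := τ.tick) (k := τ.v .k) (r := τ.v .r) (by omega) (by omega)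
      (by omega) hI.input.m_eq rfl rfl hI.labels hI.levels hmax htouch) ?_
    rintro υ fυ ⟨S, hS, hcnt, hl, hab, tυ⟩
    have inυ : Input G lab υ := (hI.input.congr rfl rfl rfl rfl rfl : Input G lab τ.tick).of_frame fυ
    have nodeυ : υ.a .node = τ.a .node := fυ.a .node rfl
    have outυ : υ.a .out = τ.a .out := fυ.a .out rfl
    have hcard : (Finset.univ.image fun u => collapse S (τ.v .r) (g u)).card + S.card =
      (Finset.univ.image g).card + 1 := hS.card_image
    have h2S := hS.two_le_card
    have hNn := hT.card
    have hactive : ∀ e : Fin m, υ.a .cA e ≠ υ.a .cB e ↔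
        g (G.src e) ∈ S ∧ g (G.dst e) ∈ S ∧ g (G.src e) ≠ g (G.dst e) := fun e => by
      obtain ⟨h1, h2⟩ := hab e
      grind
    have hnd : ∀ e : Fin m, υ.a .cA e ≠ υ.a .cB e →
        υ.a .node (υ.a .cA e) = nd (G.src e) ∧ υ.a .node (υ.a .cB e) = nd (G.dst e) := fun e he => by
      obtain ⟨h1, h2, -⟩ := (hactive e).1 he
      obtain ⟨h3, h4⟩ := (hab e).1 (.inr ⟨h1, h2⟩)
      rw [h3, h4, nodeυ]
      exact hI.node e
    have hweight : ∀ f : ℕ → Prop, [DecidablePred f] →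
        ∑ e ∈ Finset.range m with f e, υ.a .inp (4 + 3 * e) =
        ∑ e ∈ Finset.univ.filter (fun e : Fin m => f e), G.weight e := fun f _ => by
      rw [Finset.sum_filter, Finset.sum_filter, Finset.sum_range]
      exact Finset.sum_congr rfl fun e _ => by rw [inυ.weight e]
    rw [wp_seq]
    refine wp_mono (emit_spec (N := N) inυ.m_eq (by omega) (by omega) hMW
      (by rw [fυ.v .num rfl]; exact hT.num_eq) (fun e he => ?_) (fun e he hne => ?_)
      (by rw [fυ.v .r rfl]; change τ.v .r < M; omega) ?_) ?_
    · have h1 := hab ⟨e, he⟩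
      have h2 := hI.lt ⟨e, he⟩
      simp only at h1
      by_cases h3 : g (G.src ⟨e, he⟩) = g (G.dst ⟨e, he⟩) ∨
          g (G.src ⟨e, he⟩) ∈ S ∧ g (G.dst ⟨e, he⟩) ∈ S
      · have := h1.1 h3; omega
      · have := h1.2 h3; omega
    · obtain ⟨h1, h2⟩ := hnd ⟨e, he⟩ hne
      simp only at h1 h2
      rw [h1, h2]
      exact ⟨hT.forest.nd_lt _, hT.forest.nd_lt _⟩
    · have := hweight (fun _ => True)
      simp only [Finset.filter_true] at this
      rw [this]; exact hsumW
    rintro φ fφ ⟨tφ, oφ, lφ, nφ, mφ⟩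
    have inφ := inυ.of_frame fφ
    set g' : Fin n → ℕ := fun u => collapse S (τ.v .r) (g u) with hg'
    have hiff : ∀ u w, g' u = g' w ↔ g u = g w ∨ u ∈ fiber g S ∧ w ∈ fiber g S := fun u w => by
      rw [mem_fiber, mem_fiber]; exact hS.collapse_eq_iff
    have hncol : ncol (fiber g S) g = S.card := by rw [ncol, hS.image_fiber]
    have hchild : ∀ i, (∃ u ∈ fiber g S, nd u = i) ↔ ∃ e < m, υ.a .cA e ≠ υ.a .cB e ∧
        (υ.a .node (υ.a .cA e) = i ∨ υ.a .node (υ.a .cB e) = i) := fun i => by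
      constructor
      · rintro ⟨u, hu, rfl⟩
        obtain ⟨e, h1, h2, h3, h4⟩ := hS.exists_active hu
        have hne := (hactive e).2 ⟨h1, h2, h3⟩
        obtain ⟨h5, h6⟩ := hnd e hne
        refine ⟨e, e.2, hne, ?_⟩
        rw [h5, h6]
        exact h4.imp hT.forest.nd_eq_iff.2 hT.forest.nd_eq_iff.2
      · rintro ⟨e, he, hne, h4⟩
        obtain ⟨h1, h2, -⟩ := (hactive ⟨e, he⟩).1 hne
        obtain ⟨h5, h6⟩ := hnd ⟨e, he⟩ hne
        simp only at h5 h6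
        rw [h5, h6] at h4
        rcases h4 with h4 | h4
        · exact ⟨_, mem_fiber.2 h1, h4⟩
        · exact ⟨_, mem_fiber.2 h2, h4⟩
    have hcut : ∀ Q : Finpartition (fiber g S), G.IsMaximalMinRatioCut Q → IsCol Q g :=
      fun Q hQ => hS.isCol hI.merged hκ hQ
    have hlev : HasLevels G κ g' (φ.a .kap) := by
      intro e he
      rw [fφ.a .kap rfl, fυ.a .kap rfl]
      exact hI.levels e fun h => he ((hiff _ _).2 (.inl h))
    have hlabφ : HasLabels G g' (φ.a .lA) (φ.a .lB) := by
      rw [fφ.a .lA rfl, fφ.a .lB rfl]; exact hl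
    have hzero : ∀ i, N ≤ i → φ.a .out (1 + i) = 0 := fun i hi => by
      rw [(oφ i).2, outυ]
      · exact hT.zero i hi
      · rw [← hchild]
        rintro ⟨u, -, rfl⟩
        exact absurd (hT.forest.nd_lt u) (not_lt.2 hi)
    have hF : Forest G g' (fun u => if u ∈ fiber g S then N else nd u) (N + 1)
        (fun i => φ.a .out (1 + i)) (Function.update Ls N (fiber g S)) := by
      refine hT.forest.join (fun u hu w hw => ?_) (by rw [hncol]; exact h2S) hcut hiff
        (fun i hi => ⟨fun h => (oφ i).1 ((hchild i).1 h), fun h => ?_⟩) (hzero N le_rfl)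
      · rw [mem_fiber] at hu ⊢
        rwa [hw]
      · rw [(oφ i).2 (fun h' => h ((hchild i).2 h')), outυ]
    refine wp_mono (findMax_labels inφ.m_eq (by omega) (by omega) hlabφ hlev) ?_
    rintro ψ fψ ⟨tψ, cψ, dψ⟩
    refine ⟨(Finset.univ.image g').card, by omega, g', fun u => if u ∈ fiber g S then N else nd u,
      N + 1, Function.update Ls N (fiber g S),
      ⟨inφ.of_frame fψ, hS.merged hI.merged hκ (one_dvd _), ?_, ?_, fun e => ?_, fun e => ?_,
        HasForest.congr (σ := φ) ⟨hF, mφ, fun i hi => hzero i (by omega), fun e he => ?_,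
          by omega⟩ (fψ.a .out rfl) (fψ.v .num rfl) (fψ.a .oc rfl) (fψ.a .ow rfl)⟩,
      rfl, cψ, dψ, ?_, ?_⟩
    · rw [fψ.a .lA rfl, fψ.a .lB rfl]; exact hlabφ
    · rw [fψ.a .kap rfl]; exact hlev
    · have := hI.lt e
      simp only [hg', collapse]
      constructor <;> split_ifs <;> omega
    · have hrυ : υ.v .r = τ.v .r := fυ.v .r rfl
      have key : ∀ u, υ.a .node (g u) = nd u →
          ψ.a .node (g' u) = if u ∈ fiber g S then N else nd u := fun u hu => by
        rw [fψ.a .node rfl, nφ, hrυ]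
        simp only [mem_fiber, hg', collapse]
        by_cases h1 : g u ∈ S
        · rw [if_pos h1, if_pos h1, if_pos rfl]
        · rw [if_neg h1, if_neg h1, if_neg fun h2 : g u = τ.v .r => h1 (h2 ▸ hS.mem), hu]
      rw [nodeυ] at key
      exact ⟨key _ (hI.node e).1, key _ (hI.node e).2⟩
    · by_cases hold : g (G.src e) = g (G.dst e)
      · have heq : υ.a .cA e = υ.a .cB e := by
          by_contra hne
          exact ((hactive e).1 hne).2.2 hold
        obtain ⟨h1, h2⟩ := (lφ e e.2).2 heq
        rw [h1, h2, fυ.a .oc rfl, fυ.a .ow rfl]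
        exact (hT.loaded e hold).mono _
      · obtain ⟨h1, h2⟩ := ((hiff _ _).1 he).resolve_left hold
        have hne := (hactive e).2 ⟨mem_fiber.1 h1, mem_fiber.1 h2, hold⟩
        obtain ⟨h3, h4⟩ := (lφ e e.2).1 hne
        rw [h3, h4]
        refine ⟨N, Nat.lt_succ_self N, hT.forest.le, g, ?_⟩
        rw [Function.update_self]
        refine ⟨h1, h2, hold, hcut, by rw [hncol, hcnt], ?_⟩
        rw [hweight]
        unfold dcut
        refine Finset.sum_congr (Finset.filter_congr fun f _ => ?_) fun _ _ => rfl
        rw [hactive, mem_fiber, mem_fiber]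
    · rw [fψ.calls rfl, fφ.calls rfl, fυ.calls rfl]; exact hcl
    · simp only [St.tick_time] at tυ
      have e1 : S.card ≤ 2 * (S.card - 1) := by omega
      have e2 : p = (Finset.univ.image g').card + (S.card - 1) := by omega
      have e3 := Nat.mul_le_mul_left (m + 1) e1
      have e5 : 1 ≤ S.card - 1 := by omega
      have e6 := Nat.mul_le_mul_left (m + 1) e5
      rw [e2, Nat.mul_add] at ht
      simp only [mul_assoc, Nat.mul_add (m + 1), Nat.mul_one] at tυ tφ tψ ht e3 e6 ⊢
      set x1 := (m + 1) * S.card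
      set x3 := (m + 1) * (S.card - 1)
      have e7 : (m + 1) * (2 * (S.card - 1)) = 2 * x3 := by simp only [x3]; ring
      omega
  · simp only [Ex.eval_var] at hgo
    refine ⟨g, nd, N, Ls, hI.input.congr rfl rfl rfl rfl rfl, hI.tree.congr rfl rfl rfl rfl,
      hI.merged.linked, hc hgo, hcl, ?_⟩
    simp only [St.tick_time]
    omega

end Specs

end StructRAM

/-! ### Writing the output -/

namespace StructRAM

open WGraph

variable {n m : ℕ} {G : WGraph n m}

/-- The output that is stored in an array describes the hierarchy and the ideal loads. -/
structure Finished (G : WGraph n m) (g nd : Fin n → ℕ) (N : ℕ) (par : ℕ → ℕ)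
    (Ls : ℕ → Finset (Fin n)) (u₀ : Fin n) (f : ℕ → ℕ) : Prop where
  forest : Forest G g nd N par Ls
  connected : ∀ u w, g u = g w
  le : N ≤ 2 * n
  zero : f 0 = N
  parent : ∀ i < N, f (1 + i) = if i = nd u₀ then i else par i
  load : ∀ e : Fin m, ∃ c w, Loaded G N Ls e c w ∧ f (1 + N + 3 * e) = c ∧
    f (1 + N + 3 * e + 1) = c * G.weight e ∧ f (1 + N + 3 * e + 2) = w

theorem Finished.correctOutput {g nd : Fin n → ℕ} {N : ℕ} {par : ℕ → ℕ} {Ls : ℕ → Finset (Fin n)}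
    {u₀ : Fin n} {f : ℕ → ℕ} (h : Finished G g nd N par Ls u₀ f) (hw : ∀ e, 1 ≤ G.weight e)
    {M w : ℕ} (hM : 1 + 2 * n + 3 * m ≤ M) {t : WordRAM.Config} (hpw : t.reg 0 + M ≤ 2 ^ w)
    (hmem : ∀ q < M, t.mem (t.reg 0 + q) = f q) : CorrectOutput G w t := by
  have hn : 0 < n := u₀.pos
  have hN := h.le
  refine ⟨t.reg 0, N, rfl, ?_, by omega, ?_, fun e => ?_⟩
  · have := hmem 0 (by omega)
    rw [← h.zero, ← this]; rfl
  · refine h.forest.representsHierarchy h.connected u₀ fun i hi => ?_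
    rw [add_assoc, hmem _ (by omega), h.parent i hi]
  · obtain ⟨c, w', hl, h1, h2, h3⟩ := h.load e
    obtain ⟨h4, h5⟩ := hl.isIdealLoad h.forest h.connected hw
    have he := e.2
    have e1 : t.mem (t.reg 0 + 1 + N + 3 * e) = c := by
      rw [← h1, ← hmem _ (by omega)]; congr 1; ring
    have e2 : t.mem (t.reg 0 + 1 + N + 3 * e + 1) = c * G.weight e := by
      rw [← h2, ← hmem _ (by omega)]; congr 1; ring
    have e3 : t.mem (t.reg 0 + 1 + N + 3 * e + 2) = w' := by
      rw [← h3, ← hmem _ (by omega)]; congr 1; ring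
    refine ⟨_, h4, by rwa [e3], by rw [e1, e3], ?_⟩
    rw [e2, e3]
    push_cast
    ring

section Specs

variable {W M : ℕ} {O : FlowSubroutine} {σ : St}

theorem countRoots_spec {N : ℕ} (hN : σ.v .num = N) (hNM : N + 2 ≤ M) (hMW : M < W) :
    wp W M O countRoots (fun τ => τ.time ≤ σ.time + (5 * N + 3) ∧
      τ.v .cnt = ((Finset.range N).filter fun i => σ.a .out (1 + i) = 0).card ∧
      (τ.v .cnt ≠ 0 → τ.v .root < N ∧ σ.a .out (1 + τ.v .root) = 0)) σ := by
  simp only [countRoots, wp_seq, wp_set, Ex.ok_ofNat, Ex.eval_ofNat]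
  refine ⟨by norm_num, ?_⟩
  refine wp_for_time N 3 (fun i τ =>
      τ.v .cnt = ((Finset.range i).filter fun i => σ.a .out (1 + i) = 0).card ∧
      (τ.v .cnt ≠ 0 → τ.v .root < i ∧ σ.a .out (1 + τ.v .root) = 0)) rfl (by omega) ?_ ?_ ?_ ?_
  · intro τ hf
    simp [hf.v .num rfl, hN]
  · simp
  · intro i hi τ hf hv ⟨hI1, hI2⟩
    have h1 := hf.a .out rfl
    simp at h1
    have c1 : 1 + i < W := by omega
    have d1 : 1 + i < M := by omega
    have hcnt : τ.v .cnt ≤ i := by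
      rw [hI1]; exact (Finset.card_filter_le _ _).trans (by simp)
    have c2 : τ.v .cnt + 1 < W := by omega
    have hsucc : ((Finset.range (i + 1)).filter fun i => σ.a .out (1 + i) = 0).card =
        ((Finset.range i).filter fun i => σ.a .out (1 + i) = 0).card +
          if σ.a .out (1 + i) = 0 then 1 else 0 := by
      rw [Finset.range_add_one, Finset.filter_insert]
      split_ifs
      · rw [Finset.card_insert_of_notMem (by simp)]
      · rfl
    by_cases h0 : σ.a .out (1 + i) = 0
    · simp [hv, h1, h0, c1, c2, d1, hsucc, hI1]
      rw [← hI1]; exact c2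
    · simp [hv, h1, h0, c1, d1, hsucc, ← hI1]
      intro h
      have := hI2 h
      omega
  · intro τ hf ⟨hI1, hI2⟩ ht
    simp only [St.tick_time, St.set_time] at ht ⊢
    exact ⟨by omega, hI1, hI2⟩

theorem fillRoots_spec {N : ℕ} (hN : σ.v .num = N) (hNM : N + 2 ≤ M) (hMW : M < W) :
    wp W M O (.for .e (.var .num)
      (.ite (.rd .out (1 + .var .e)) .skip (.put .out (1 + .var .e) (.var .num))))
      (fun τ => τ.time ≤ σ.time + (4 * N + 2) ∧
        (∀ i < N, τ.a .out (1 + i) = if σ.a .out (1 + i) = 0 then N else σ.a .out (1 + i)) ∧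
        τ.a .out (1 + N) = σ.a .out (1 + N)) σ := by
  refine wp_for_time N 2 (fun i τ => (∀ j < N, τ.a .out (1 + j) =
      if σ.a .out (1 + j) = 0 ∧ j < i then N else σ.a .out (1 + j)) ∧
      τ.a .out (1 + N) = σ.a .out (1 + N)) rfl (by omega) ?_ ?_ ?_ ?_
  · intro τ hf
    simp [hf.v .num rfl, hN]
  · simp
  · intro i hi τ hf hv ⟨hI1, hI2⟩
    have h1 := hf.v .num rfl
    have h2 := hI1 i hi
    simp only [lt_irrefl, and_false, if_false] at h2
    have c1 : 1 + i < W := by omega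
    have d1 : 1 + i < M := by omega
    have hne : N ≠ i := by omega
    by_cases h0 : σ.a .out (1 + i) = 0
    · simp [hv, h1, h2, h0, c1, d1, hN, hne, hI2]
      intro j hj
      have := hI1 j hj
      grind
    · simp [hv, h1, h2, h0, c1, d1, hN, hI2]
      intro j hj
      have := hI1 j hj
      grind
  · intro τ hf ⟨hI1, hI2⟩ ht
    simp only [St.tick_time] at ht ⊢
    refine ⟨by omega, fun i hi => ?_, hI2⟩
    rw [St.tick_a, hI1 i hi]
    simp [hi]

/-- The loads of the edges are copied behind the parent pointers. -/
theorem copyLoads_spec {lab : Fin n → ℕ} {N B : ℕ} (hin : Input G lab σ) (hN : σ.v .num = N)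
    (hM : 4 + N + 3 * m ≤ M) (hMW : M < W) (hoc : ∀ e : Fin m, σ.a .oc e ≤ B)
    (hB : ∀ e, B * G.weight e < W) :
    wp W M O (.for .e (.var .m)
      (.put .out (1 + (.var .num + 3 * .var .e)) (Arr.oc.at .e) ;;
       .put .out (2 + (.var .num + 3 * .var .e)) (Arr.oc.at .e * inWeight) ;;
       .put .out (3 + (.var .num + 3 * .var .e)) (Arr.ow.at .e)))
      (fun τ => τ.time ≤ σ.time + (5 * m + 2) ∧ (∀ q ≤ N, τ.a .out q = σ.a .out q) ∧
        ∀ e : Fin m, τ.a .out (1 + N + 3 * e) = σ.a .oc e ∧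
          τ.a .out (1 + N + 3 * e + 1) = σ.a .oc e * G.weight e ∧
          τ.a .out (1 + N + 3 * e + 2) = σ.a .ow e) σ := by
  refine wp_for_time m 3 (fun i τ => (∀ q ≤ N, τ.a .out q = σ.a .out q) ∧
      ∀ e : Fin m, (e : ℕ) < i → τ.a .out (1 + N + 3 * e) = σ.a .oc e ∧
          τ.a .out (1 + N + 3 * e + 1) = σ.a .oc e * G.weight e ∧
          τ.a .out (1 + N + 3 * e + 2) = σ.a .ow e) rfl (by omega) ?_ ?_ ?_ ?_
  · intro τ hf
    simp [hf.v .m rfl, hin.m_eq]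
  · simp
  · intro i hi τ hf hv ⟨hI1, hI2⟩
    have h1 := hf.v .num rfl
    have h2 := hf.a .oc rfl
    have h3 := hf.a .ow rfl
    have h4 := hf.a .inp rfl
    have s1 := hin.weight ⟨i, hi⟩
    simp only at s1
    have c0 : i < M := by omega
    have c1 : 3 * i < W := by omega
    have c2 : N + 3 * i < W := by omega
    have c3 : 1 + (N + 3 * i) < W := by omega
    have c4 : 2 + (N + 3 * i) < W := by omega
    have c5 : 3 + (N + 3 * i) < W := by omega
    have c6 : 4 + 3 * i < W := by omega
    have d3 : 1 + (N + 3 * i) < M := by omega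
    have d4 : 2 + (N + 3 * i) < M := by omega
    have d5 : 3 + (N + 3 * i) < M := by omega
    have d6 : 4 + 3 * i < M := by omega
    have hmul : σ.a .oc i * G.weight ⟨i, hi⟩ < W :=
      (Nat.mul_le_mul_right _ (hoc ⟨i, hi⟩)).trans_lt (hB _)
    simp [hv, h1, h2, h3, h4, hN, s1, c0, c1, c2, c3, c4, c5, c6, d3, d4, d5, d6, hmul]
    refine ⟨fun q hq => ?_, fun e he => ?_⟩
    · rw [if_neg (by omega), if_neg (by omega), if_neg (by omega)]
      exact hI1 q hq
    · rcases he.lt_or_eq with he | he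
      · obtain ⟨j1, j2, j3⟩ := hI2 e he
        refine ⟨?_, ?_, ?_⟩
        · rw [if_neg (by omega), if_neg (by omega), if_neg (by omega), j1]
        · rw [if_neg (by omega), if_neg (by omega), if_neg (by omega), j2]
        · rw [if_neg (by omega), if_neg (by omega), if_neg (by omega), j3]
      · have : e = ⟨i, hi⟩ := Fin.ext he
        subst this
        simp only
        refine ⟨?_, ?_, ?_⟩
        · rw [if_neg (by omega), if_neg (by omega), if_pos (by omega)]
        · rw [if_neg (by omega), if_pos (by omega)]
        · rw [if_pos (by omega)]
  · intro τ hf ⟨hI1, hI2⟩ ht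
    simp only [St.tick_time] at ht ⊢
    exact ⟨by omega, hI1, fun e => hI2 e e.2⟩

theorem _root_.WGraph.Loaded.le {N c w : ℕ} {Ls : ℕ → Finset (Fin n)} {e : Fin m}
    (h : Loaded G N Ls e c w) : c ≤ n := by
  obtain ⟨i, -, -, col, -, -, -, -, hc, -⟩ := h
  have : ncol (Ls i) col ≤ n :=
    Finset.card_image_le.trans ((Finset.card_le_univ _).trans (by simp))
  omega

/-- The end of the program, once there is a single root. -/
theorem finish_connected {lab g nd : Fin n → ℕ} {N : ℕ} {par : ℕ → ℕ} {Ls : ℕ → Finset (Fin n)}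
    (hin : Input G lab σ) (hF : Forest G g nd N par Ls) (hone : ∀ u w, g u = g w) (u₀ : Fin n)
    (hN2 : N ≤ 2 * n) (hpar : ∀ i < N, σ.a .out (1 + i) = par i) (hnum : σ.v .num = N)
    (hroot : σ.v .root = nd u₀)
    (hload : ∀ e : Fin m, Loaded G N Ls e (σ.a .oc e) (σ.a .ow e))
    (hM : 4 + 2 * n + 3 * m ≤ M) (hMW : M < W) (hB : ∀ e, n * G.weight e < W) :
    wp W M O (.put .out (1 + .var .root) (.var .root) ;; .put .out 0 (.var .num) ;;
      .for .e (.var .m)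
        (.put .out (1 + (.var .num + 3 * .var .e)) (Arr.oc.at .e) ;;
         .put .out (2 + (.var .num + 3 * .var .e)) (Arr.oc.at .e * inWeight) ;;
         .put .out (3 + (.var .num + 3 * .var .e)) (Arr.ow.at .e)))
      (fun τ => τ.time ≤ σ.time + (5 * m + 4) ∧ Finished G g nd N par Ls u₀ (τ.a .out)) σ := by
  have hr := hF.nd_lt u₀
  simp only [wp_seq, wp_put, Ex.ok_ofNat, Ex.ok_var, Ex.ok_add, Ex.eval_ofNat, Ex.eval_var,
    Ex.eval_add, St.tick_v, St.put_v, hroot, hnum]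
  refine ⟨⟨by norm_num, trivial, by omega⟩, trivial, by omega, by norm_num, trivial, by omega, ?_⟩
  refine wp_mono (copyLoads_spec (lab := lab) (N := N) (B := n)
    (hin.congr rfl rfl rfl (by ext; simp) (by ext; simp)) (by simpa) (by omega) hMW ?_ hB) ?_
  · intro e
    simpa using (hload e).le
  · rintro τ - ⟨t1, q1, l1⟩
    refine ⟨by simp only [St.tick_time, St.put_time] at t1; omega, hF, hone, hN2, ?_, ?_, ?_⟩
    · rw [q1 0 (by omega)]; simp
    · intro i hi
      rw [q1 _ (by omega)]
      simp only [St.tick_a, St.put_a, true_and, Nat.add_left_cancel_iff, if_true]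
      rw [if_neg (by omega)]
      split_ifs with h1
      · exact h1.symm
      · exact hpar i hi
    · intro e
      obtain ⟨h1, h2, h3⟩ := l1 e
      refine ⟨σ.a .oc e, σ.a .ow e, hload e, ?_, ?_, ?_⟩
      · rw [h1]; simp
      · rw [h2]; simp
      · rw [h3]; simp

/-- The roots of a disconnected graph are joined, as its maximal minimum ratio cut is the partition
into connected components. -/
theorem finish_spec {lab g nd : Fin n → ℕ} {κ : Fin m → ℕ} {N : ℕ} {Ls : ℕ → Finset (Fin n)}
    (hn : 0 < n) (hin : Input G lab σ) (hF : HasForest G g nd N Ls σ)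
    (hκ : ∀ e, G.EdgeApprox (n * n) 1 (κ e) e)
    (hlink : ∀ u, G.Linked (fun _ => True) (Finset.univ.filter fun w => g w = g u))
    (hmono : ∀ e, g (G.src e) = g (G.dst e))
    (hM : 4 + 2 * n + 3 * m ≤ M) (hMW : M < W) (hB : ∀ e, n * G.weight e < W) :
    wp W M O finish (fun τ => τ.time ≤ σ.time + 50 * (m + n + 1) ∧
      ∃ g nd N par Ls u₀, Finished G g nd N par Ls u₀ (τ.a .out)) σ := by
  simp only [finish]
  rw [wp_seq]
  have u₀ : Fin n := ⟨0, hn⟩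
  have hcard : 1 ≤ (Finset.univ.image g).card :=
    Finset.card_pos.2 ⟨g u₀, Finset.mem_image_of_mem g (Finset.mem_univ _)⟩
  have hN2 := hF.card
  refine wp_mono (countRoots_spec hF.num_eq (by omega) hMW) ?_
  rintro σ₁ f₁ ⟨t1, c1, r1⟩
  have in1 := hin.of_frame f₁
  have out1 : σ₁.a .out = σ.a .out := f₁.a .out rfl
  have num1 : σ₁.v .num = N := by rw [f₁.v .num rfl]; exact hF.num_eq
  have hroots : ∀ i, i ∈ (Finset.range N).filter (fun i => σ.a .out (1 + i) = 0) ↔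
      ∃ u, nd u = i := fun i => by
    rw [Finset.mem_filter, Finset.mem_range]
    constructor
    · rintro ⟨h1, h2⟩; exact (hF.forest.root i h1).1 h2
    · rintro ⟨u, rfl⟩; exact ⟨hF.forest.nd_lt u, (hF.forest.root _ (hF.forest.nd_lt u)).2 ⟨u, rfl⟩⟩
  rw [wp_seq, wp_ite]
  refine ⟨by simp, fun hc => ?_, fun hc => ?_⟩
  · replace hc : 1 < σ₁.v .cnt := by
      by_contra h
      exact hc (by simp [h])
    rw [c1, Finset.one_lt_card] at hc
    obtain ⟨i, hi, j, hj, hij⟩ := hc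
    obtain ⟨u, rfl⟩ := (hroots i).1 hi
    obtain ⟨w, rfl⟩ := (hroots j).1 hj
    have hgne : g u ≠ g w := fun h => hij (hF.forest.nd_eq_iff.2 h)
    have h2 : 2 ≤ ncol Finset.univ g := two_le_ncol (Finset.mem_univ u) (Finset.mem_univ w) hgne
    have h2' : 2 ≤ (Finset.univ.image g).card := h2
    rw [wp_seq]
    refine wp_mono (fillRoots_spec (σ := σ₁.tick) (N := N) num1 (by omega) hMW) ?_
    rintro σ₂ f₂ ⟨t2, o2, z2⟩
    have num2 : σ₂.v .num = N := by rw [f₂.v .num rfl]; exact num1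
    simp only [wp_seq, wp_set, Ex.ok_var, Ex.ok_add, Ex.ok_ofNat, Ex.eval_var, Ex.eval_add,
      Ex.eval_ofNat, St.tick_v, St.set_v, reduceCtorEq, if_false, num2]
    refine ⟨trivial, ⟨trivial, by norm_num, by omega⟩, ?_⟩
    rw [← wp_seq]
    have hL : ∀ i < N, σ₂.a .out (1 + i) = if σ.a .out (1 + i) = 0 then N else σ.a .out (1 + i) :=
      fun i hi => by rw [o2 i hi, St.tick_a, out1]
    have hJ : Forest G (fun _ => 0) (fun u => if u ∈ Finset.univ then N else nd u) (N + 1)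
        (fun i => σ₂.a .out (1 + i)) (Function.update Ls N Finset.univ) := by
      refine hF.forest.join (fun _ _ _ _ => Finset.mem_univ _) h2
        (fun Q hQ => isCol_of_disconnected hκ hlink hmono h2 hQ)
        (fun _ _ => by simp) (fun i hi => ?_) ?_
      · rw [hL i hi]
        have := hF.forest.root i hi
        simp only [Finset.mem_univ, true_and, this]
        exact ⟨fun h => if_pos h, fun h => if_neg h⟩
      · rw [z2, St.tick_a, out1]; exact hF.zero N le_rfl
    refine wp_mono (finish_connected (lab := lab) (((in1.congr rfl rfl rfl rfl rfl :
        Input G lab σ₁.tick).of_frame f₂).congr rfl rfl rfl rfl rfl :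
        Input G lab ((σ₂.set .root N).tick.set .num (N + 1)).tick) hJ (fun _ _ => rfl) u₀
      (by omega) (fun i hi => rfl) (by simp) (by simp) (fun e => ?_) hM hMW hB) ?_
    · simp only [St.tick_a, St.set_a]
      rw [f₂.a .oc rfl, f₂.a .ow rfl, St.tick_a, f₁.a .oc rfl, f₁.a .ow rfl]
      exact (hF.loaded e (hmono e)).mono _
    · rintro τ - ⟨t3, h3⟩
      simp only [St.tick_time, St.set_time] at t2 t3
      exact ⟨by omega, _, _, _, _, _, _, h3⟩
  · replace hc : σ₁.v .cnt ≤ 1 := by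
      by_contra h
      simp [not_le.1 h] at hc
    rw [wp_skip]
    have hone : ∀ u w, g u = g w := fun u w => by
      rw [c1, Finset.card_le_one] at hc
      exact hF.forest.nd_eq_iff.1 (hc _ ((hroots _).2 ⟨u, rfl⟩) _ ((hroots _).2 ⟨w, rfl⟩))
    have hc0 : σ₁.v .cnt ≠ 0 := by
      rw [c1]
      exact (Finset.card_pos.2 ⟨_, (hroots _).2 ⟨u₀, rfl⟩⟩).ne'
    obtain ⟨r2, r3⟩ := r1 hc0
    refine wp_mono (finish_connected (lab := lab)
      (in1.congr rfl rfl rfl rfl rfl : Input G lab σ₁.tick.tick) hF.forest hone u₀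
      (by omega) (fun i hi => by simp [out1]) (by simpa using num1) ?_ (fun e => ?_) hM hMW hB) ?_
    · exact (hF.forest.root_iff hone u₀ r2).1 r3
    · simp only [St.tick_a]
      rw [f₁.a .oc rfl, f₁.a .ow rfl]
      exact hF.loaded e (hmono e)
    · rintro τ - ⟨t3, h3⟩
      simp only [St.tick_time] at t3
      exact ⟨by omega, _, _, _, _, _, _, h3⟩

end Specs

end StructRAM

/-! ### Reading the input, and the whole program -/

namespace WGraph

variable {n m : ℕ} {G : WGraph n m} {U : Finset (Fin n)}

theorem dcut_le_sum (U : Finset (Fin n)) (g : Fin n → ℕ) : G.dcut U g ≤ ∑ e, G.weight e :=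
  Finset.sum_le_sum_of_subset (Finset.filter_subset _ _)

/-- A strong set with an edge has less strength than the graph has weight, as the edge can be cut by
a partition into two sides. -/
theorem Strong.lt_sum {D k : ℕ} (hD : 0 < D) {e : Fin m} (hs : G.src e ∈ U) (hd : G.dst e ∈ U)
    (h : G.Strong ((k : ℚ) / D) U) : k < D * ∑ e, G.weight e := by
  set g : Fin n → ℕ := fun v => if v = G.src e then 1 else 0 with hg
  have h2 : 2 ≤ ncol U g := two_le_ncol hs hd (by simp [hg, (G.loopless e).symm])
  have h3 := h.2 g h2
  have h4 : (G.dcut U g : ℚ) ≤ ((∑ e, G.weight e : ℕ) : ℚ) := by exact_mod_cast dcut_le_sum U g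
  have h5 : (2 : ℚ) ≤ ncol U g := by exact_mod_cast h2
  have h6 : (0 : ℚ) < D := by exact_mod_cast hD
  have h7 : (k : ℚ) / D ≤ (k : ℚ) / D * ((ncol U g : ℚ) - 1) :=
    le_mul_of_one_le_right (by positivity) (by linarith)
  have h8 : (k : ℚ) / D < ((∑ e, G.weight e : ℕ) : ℚ) := by
    unfold excess at h3
    linarith
  rw [div_lt_iff₀ h6, mul_comm] at h8
  exact_mod_cast h8

theorem EdgeApprox.lt_sum {D s k : ℕ} (hD : 0 < D) {e : Fin m} (h : G.EdgeApprox D s k e) :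
    k < D * ∑ e, G.weight e := by
  obtain ⟨-, ⟨U, h1, h2, h3⟩, -⟩ := h
  exact h3.lt_sum hD h1 h2

theorem edgeApprox_zero {D s : ℕ} (hD : 0 < D) (hw : ∀ e, 1 ≤ G.weight e)
    (hs : D * ∑ e, G.weight e ≤ s) (e : Fin m) : G.EdgeApprox D s 0 e := by
  refine ⟨dvd_zero s, ⟨{G.src e, G.dst e}, by simp, by simp, ⟨_, Finset.mem_insert_self _ _⟩, ?_⟩,
    fun U h1 h2 h3 => ?_⟩
  · intro g hg
    have hne : g (G.src e) ≠ g (G.dst e) := by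
      intro h
      simp [ncol, h] at hg
    have h1 : G.weight e ≤ G.dcut {G.src e, G.dst e} g :=
      Finset.single_le_sum (f := G.weight) (fun _ _ => Nat.zero_le _) (by simp [hne])
    have h2 : (1 : ℚ) ≤ G.dcut {G.src e, G.dst e} g := by exact_mod_cast (hw e).trans h1
    simp only [excess, Nat.cast_zero, zero_div, zero_mul, sub_zero]
    linarith
  · have := h3.lt_sum hD h1 h2
    omega

end WGraph

namespace StructRAM

open WGraph

variable {n m : ℕ} {G : WGraph n m} {W M : ℕ} {O : FlowSubroutine} {σ : St}

/-- The label of a vertex is the number of the last edge end at the vertex. The initial precision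
exceeds all scaled strengths, so that the levels may start at `0`. -/
theorem readInput_spec (hn : σ.a .inp 0 = n) (hm : σ.a .inp 1 = m)
    (hsrc : ∀ e : Fin m, σ.a .inp (2 + 3 * e) = G.src e)
    (hdst : ∀ e : Fin m, σ.a .inp (3 + 3 * e) = G.dst e)
    (hwt : ∀ e : Fin m, σ.a .inp (4 + 3 * e) = G.weight e)
    (hM : 4 + 3 * m ≤ M) (hnM : n ≤ M) (hMW : M < W) (hnW : n * n < W)
    (htW : ∑ e, G.weight e < W) (hS : 2 * (n * n * ∑ e, G.weight e) < W) :
    wp W M O readInput (fun τ => ∃ lab L, Input G lab τ ∧ Function.Injective lab ∧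
      (∀ e, lab (G.src e) < 2 * m ∧ lab (G.dst e) < 2 * m) ∧
      τ.v .step = 2 ^ L ∧ n * n * ∑ e, G.weight e ≤ 2 ^ L ∧
      2 ^ L ≤ max 1 (2 * (n * n * ∑ e, G.weight e)) ∧
      τ.time ≤ σ.time + (5 * m + 10 + 2 * L)) σ := by
  set wt : ℕ → ℕ := fun k => if h : k < m then G.weight ⟨k, h⟩ else 0 with hwtdef
  have hsum : ∑ k ∈ Finset.range m, wt k = ∑ e, G.weight e := by
    rw [Finset.sum_range]
    exact Finset.sum_congr rfl fun e _ => by simp [hwtdef]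
  simp only [readInput, wp_seq, wp_set, Ex.ok_rd, Ex.ok_ofNat, Ex.eval_rd, Ex.eval_ofNat,
    St.tick_a, St.set_a, hn, hm]
  refine ⟨⟨by norm_num, by omega⟩, ⟨by norm_num, by omega⟩, by norm_num, ?_⟩
  refine wp_for_time m 3 (fun i τ => τ.v .tot = ∑ k ∈ Finset.range i, wt k ∧
      ∀ e : Fin m, (e : ℕ) < i → ∀ v, (G.src e = v ∨ G.dst e = v) → ∃ f : Fin m,
        τ.a .fst v = 2 * f ∧ G.src f = v ∨ τ.a .fst v = 2 * f + 1 ∧ G.dst f = v)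
    rfl (by omega) ?_ ?_ ?_ ?_
  · intro τ hf
    simp [hf.v .m rfl]
  · simp
  · rintro i hi τ hf hv ⟨htot, hI⟩
    have h1 := hf.a .inp rfl
    have s1 := hsrc ⟨i, hi⟩
    have s2 := hdst ⟨i, hi⟩
    have s3 := hwt ⟨i, hi⟩
    have b1 := (G.src ⟨i, hi⟩).2
    have b2 := (G.dst ⟨i, hi⟩).2
    have hle : ∑ k ∈ Finset.range (i + 1), wt k ≤ ∑ e, G.weight e :=
      hsum ▸ Finset.sum_le_sum_of_subset (Finset.range_subset_range.2 hi)
    have hwi : wt i = G.weight ⟨i, hi⟩ := by simp [hwtdef, hi]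
    rw [Finset.sum_range_succ, hwi] at hle
    simp only [St.tick_a, St.set_a] at h1
    simp only at s1 s2 s3
    have c1 : 3 * i < W := by omega
    have c2 : 2 + 3 * i < W := by omega
    have c3 : 3 + 3 * i < W := by omega
    have c4 : 4 + 3 * i < W := by omega
    have c5 : 2 * i < W := by omega
    have c6 : 2 * i + 1 < W := by omega
    have d2 : 2 + 3 * i < M := by omega
    have d3 : 3 + 3 * i < M := by omega
    have d4 : 4 + 3 * i < M := by omega
    have d5 : (G.src ⟨i, hi⟩ : ℕ) < M := by omega
    have d6 : (G.dst ⟨i, hi⟩ : ℕ) < M := by omega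
    have d7 : ∑ k ∈ Finset.range i, wt k + G.weight ⟨i, hi⟩ < W := by omega
    simp [hv, h1, s1, s2, s3, htot, c1, c2, c3, c4, c5, c6, d2, d3, d4, d5, d6, d7]
    refine ⟨by rw [Finset.sum_range_succ, hwi], fun e he v hev => ?_⟩
    by_cases hv2 : G.dst ⟨i, hi⟩ = v
    · exact ⟨⟨i, hi⟩, .inr ⟨by simp [hv2], hv2⟩⟩
    by_cases hv1 : G.src ⟨i, hi⟩ = v
    · refine ⟨⟨i, hi⟩, .inl ⟨?_, hv1⟩⟩
      rw [if_neg (fun h => hv2 (Fin.ext h).symm), if_pos (by rw [hv1])]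
    rw [if_neg (fun h => hv2 (Fin.ext h).symm), if_neg (fun h => hv1 (Fin.ext h).symm)]
    refine hI e (lt_of_le_of_ne he fun h => ?_) v hev
    have : e = ⟨i, hi⟩ := Fin.ext h
    subst this
    exact hev.elim hv1 hv2
  · rintro τ hf ⟨htot, hI⟩ ht
    rw [hsum] at htot
    have hn' : τ.v .n = n := by rw [hf.v .n rfl]; simp
    have hm' : τ.v .m = m := by rw [hf.v .m rfl]; simp
    have hinp : τ.a .inp = σ.a .inp := hf.a .inp rfl
    simp only [St.tick_v, St.set_v, wp_set, wp_seq, Ex.ok_mul, Ex.ok_var, Ex.ok_ofNat,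
      Ex.eval_mul, Ex.eval_var, Ex.eval_ofNat, hn']
    refine ⟨⟨trivial, trivial, hnW⟩, by norm_num, ?_⟩
    refine wp_loop_exists (fun p υ => ∃ L, υ.v .step = 2 ^ L ∧
        2 ^ L ≤ max 1 (2 * (n * n * ∑ e, G.weight e)) ∧ p = n * n * ∑ e, G.weight e - 2 ^ L ∧
        υ.time + 1 ≤ σ.time + (5 * m + 10 + 2 * L))
      (p₀ := n * n * ∑ e, G.weight e - 1) ⟨0, by simp, by simp, by simp, ?_⟩ ?_
    · simp only [St.tick_time, St.set_time] at ht ⊢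
      omega
    rintro p υ fυ ⟨L, e1, e2, e3, e4⟩
    have edd : υ.v .dd = n * n := by rw [fυ.v .dd rfl]; simp
    have etot : υ.v .tot = ∑ e, G.weight e := by rw [fυ.v .tot rfl]; simp [htot]
    refine ⟨?_, fun hc => ?_, fun hc => ?_⟩
    · simp only [Ex.ok_lt, Ex.ok_mul, Ex.ok_var, Ex.eval_var, edd, etot]
      exact ⟨trivial, trivial, trivial, by omega⟩
    · have hlt : 2 ^ L < n * n * ∑ e, G.weight e := by
        by_contra h
        exact hc (by simp [e1, edd, etot, h])
      simp only [wp_set, Ex.ok_mul, Ex.ok_var, Ex.ok_ofNat, Ex.eval_mul, Ex.eval_var, Ex.eval_ofNat,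
        St.tick_v, e1]
      refine ⟨⟨by norm_num, trivial, by omega⟩, _, ?_, L + 1, by simp [pow_succ, mul_comm], ?_, rfl,
        ?_⟩
      · have : 0 < 2 ^ L := by positivity
        rw [pow_succ]
        omega
      · rw [pow_succ]
        exact le_max_of_le_right (by omega)
      · simp only [St.tick_time, St.set_time]
        omega
    · have hle : n * n * ∑ e, G.weight e ≤ 2 ^ L := by
        by_contra h
        have : 2 ^ L < n * n * ∑ e, G.weight e := by omega
        simp [e1, edd, etot, this] at hc
      have hfst : υ.a .fst = τ.a .fst := fυ.a .fst rfl
      have hkey : ∀ v : Fin n, (∃ e, G.src e = v ∨ G.dst e = v) → ∃ f : Fin m,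
          υ.a .fst v = 2 * f ∧ G.src f = v ∨ υ.a .fst v = 2 * f + 1 ∧ G.dst f = v := by
        rintro v ⟨e, he⟩
        rw [hfst]
        exact hI e e.2 v he
      classical
      -- Vertices without edges have no entry in `fst`; they get labels above all edge ends.
      let lab : Fin n → ℕ := fun v =>
        if ∃ e, G.src e = v ∨ G.dst e = v then υ.a .fst v else 2 * m + v
      have lab_of : ∀ v, (∃ e, G.src e = v ∨ G.dst e = v) → lab v = υ.a .fst v :=
        fun v h => if_pos h
      have lab_lt : ∀ v, (∃ e, G.src e = v ∨ G.dst e = v) → lab v < 2 * m := by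
        intro v h
        rw [lab_of v h]
        obtain ⟨f, ⟨h1, -⟩ | ⟨h1, -⟩⟩ := hkey v h <;> have := f.2 <;> omega
      refine ⟨lab, L, ⟨?_, ?_, ?_, ?_, ?_, ?_, ?_⟩, ?_, ?_, e1, hle, e2, e4⟩
      · rw [St.tick_v, fυ.v .n rfl]; simp [hn']
      · rw [St.tick_v, fυ.v .m rfl]; simp [hm']
      · exact edd
      · intro e; rw [St.tick_a, fυ.a .inp rfl]; simp [hinp, hsrc]
      · intro e; rw [St.tick_a, fυ.a .inp rfl]; simp [hinp, hdst]
      · intro e; rw [St.tick_a, fυ.a .inp rfl]; simp [hinp, hwt]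
      · exact fun e => ⟨(lab_of _ ⟨e, .inl rfl⟩).symm, (lab_of _ ⟨e, .inr rfl⟩).symm⟩
      · intro u v huv
        by_cases hu : ∃ e, G.src e = u ∨ G.dst e = u
        · by_cases hv : ∃ e, G.src e = v ∨ G.dst e = v
          · rw [lab_of u hu, lab_of v hv] at huv
            obtain ⟨f, hf⟩ := hkey u hu
            obtain ⟨f', hf'⟩ := hkey v hv
            have hff : f = f' := Fin.ext (by omega)
            subst hff
            rcases hf with ⟨h1, h2⟩ | ⟨h1, h2⟩ <;> rcases hf' with ⟨h3, h4⟩ | ⟨h3, h4⟩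
            · exact h2.symm.trans h4
            · omega
            · omega
            · exact h2.symm.trans h4
          · have h1 := lab_lt u hu
            have h2 : lab v = 2 * m + v := if_neg hv
            omega
        · have h2 : lab u = 2 * m + u := if_neg hu
          by_cases hv : ∃ e, G.src e = v ∨ G.dst e = v
          · have h1 := lab_lt v hv
            omega
          · have h3 : lab v = 2 * m + v := if_neg hv
            exact Fin.ext (by omega)
      · exact fun e => ⟨lab_lt _ ⟨e, .inl rfl⟩, lab_lt _ ⟨e, .inr rfl⟩⟩

end StructRAM

namespace StructRAM

open WGraph

variable {n m : ℕ} {G : WGraph n m} {W M : ℕ} {O : FlowSubroutine} {σ : St}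

/-- Halving the precision until it is `1`. -/
theorem refineLoop_spec {lab : Fin n → ℕ} {L : ℕ} (hO : O.Correct) (hin : Input G lab σ)
    (hlab : Function.Injective lab) (hlt : ∀ e, lab (G.src e) < 2 * m ∧ lab (G.dst e) < 2 * m)
    (hn : 0 < n) (hw : ∀ e, 1 ≤ G.weight e) (hM : 7 + 12 * m ≤ M) (hnM : n ≤ M)
    (hMW : 16 * M ≤ W) (hS : 2 * (n * n * ∑ e, G.weight e) < W) (hs : σ.v .step = 2 ^ L)
    (hL : n * n * ∑ e, G.weight e ≤ 2 ^ L) (hL' : 2 ^ L ≤ max 1 (2 * (n * n * ∑ e, G.weight e)))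
    (hkap : ∀ e : Fin m, σ.a .kap e = 0) (hcalls : σ.calls = []) :
    wp W M O (.loop (.bin .lt 1 (.var .step)) (.step ≔ .var .step / 2 ;; refineSweep))
      (fun τ => Input G lab τ ∧ (∀ e : Fin m, G.EdgeApprox (n * n) 1 (τ.a .kap e) e) ∧
        (∀ I ∈ τ.calls, SmallCall m (2 * (n * n * ∑ e, G.weight e)) I) ∧
        τ.calls.length ≤ 2 * n * L ∧
        τ.time ≤ σ.time + (2000 * (m + 1) * (n + 1) + 2) * L + 1) σ := by
  have hD : 0 < n * n := Nat.mul_pos hn hn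
  refine wp_loop_exists (fun p τ => Input G lab τ ∧ τ.v .step = 2 ^ p ∧
      2 ^ p ≤ max 1 (2 * (n * n * ∑ e, G.weight e)) ∧
      (∀ e : Fin m, G.EdgeApprox (n * n) (2 ^ p) (τ.a .kap e) e) ∧
      (∀ I ∈ τ.calls, SmallCall m (2 * (n * n * ∑ e, G.weight e)) I) ∧
      τ.calls.length + 2 * n * p ≤ 2 * n * L ∧
      τ.time + (2000 * (m + 1) * (n + 1) + 2) * p ≤
        σ.time + (2000 * (m + 1) * (n + 1) + 2) * L) (p₀ := L) ?_ ?_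
  · refine ⟨hin, hs, hL', fun e => ?_, by simp [hcalls], by simp [hcalls], le_rfl⟩
    rw [hkap]
    exact edgeApprox_zero hD hw hL e
  rintro p τ - ⟨hI, e1, e2, e3, e4, e5, e6⟩
  refine ⟨by simp, fun hc => ?_, fun hc => ?_⟩
  · obtain _ | p := p
    · exact absurd (by simp [e1]) hc
    have hstep : τ.v .step / 2 = 2 ^ p := by rw [e1, pow_succ]; simp
    have hpos : 0 < 2 ^ p := by positivity
    have hpS : 2 ^ p ≤ n * n * ∑ e, G.weight e := by
      rw [pow_succ] at e2
      omega
    simp only [wp_seq, wp_set, Ex.ok_div, Ex.ok_var, Ex.ok_ofNat, Ex.eval_div, Ex.eval_var,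
      Ex.eval_ofNat, St.tick_v, hstep]
    refine ⟨⟨trivial, by norm_num⟩, ?_⟩
    refine wp_mono (refineSweep_spec (B := 2 * (n * n * ∑ e, G.weight e)) (h := 2 ^ p)
      (κ := fun e => τ.a .kap e) hO (hI.congr ?_ ?_ ?_ rfl rfl) hlab hlt hM hnM hMW hS
      (fun e => ?_) (fun e => ?_) hpos (by simp) (fun e => ?_) (fun e => rfl) e4) ?_
    · simp
    · simp
    · simp
    · have := Nat.mul_le_mul_left (n * n) (Finset.single_le_sum (f := G.weight)
        (fun _ _ => Nat.zero_le _) (Finset.mem_univ e))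
      omega
    · have := (e3 e).lt_sum hD
      omega
    · rw [← pow_succ']
      exact e3 e
    · rintro υ - ⟨h1, h2, h3, h4, h5, h6⟩
      simp only [St.tick_calls, St.set_calls, St.tick_time, St.set_time] at h5 h6
      refine ⟨p, by omega, h1, h2, ?_, h3, h4, ?_, ?_⟩
      · exact le_max_of_le_right (by omega)
      · rw [Nat.mul_succ] at e5
        omega
      · rw [Nat.mul_succ] at e6
        omega
  · obtain _ | p := p
    · refine ⟨hI.congr rfl rfl rfl rfl rfl, by simpa using e3, e4, by simpa using e5, ?_⟩
      simp only [St.tick_time]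
      omega
    · have : 1 < 2 ^ (p + 1) := Nat.one_lt_two_pow (by omega)
      simp [e1, this] at hc

/-- The whole program is correct, for words and arrays that are large enough; `L` is the number of
halvings of the precision. -/
theorem mainProg_spec (hO : O.Correct) (hn : 0 < n) (hw : ∀ e, 1 ≤ G.weight e)
    (hinp0 : σ.a .inp 0 = n) (hinp1 : σ.a .inp 1 = m)
    (hsrc : ∀ e : Fin m, σ.a .inp (2 + 3 * e) = G.src e)
    (hdst : ∀ e : Fin m, σ.a .inp (3 + 3 * e) = G.dst e)
    (hwt : ∀ e : Fin m, σ.a .inp (4 + 3 * e) = G.weight e)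
    (hkap : ∀ i, σ.a .kap i = 0) (hout : ∀ i, σ.a .out i = 0) (hcalls : σ.calls = [])
    (hM : 7 + 2 * n + 12 * m ≤ M) (hMW : 16 * M ≤ W)
    (hnW : n * n < W) (htW : ∑ e, G.weight e < W) (hlW : ∀ e, n * G.weight e < W)
    (hS : 2 * (n * n * ∑ e, G.weight e) < W) :
    wp W M O mainProg (fun τ => ∃ L, 2 ^ L ≤ max 1 (2 * (n * n * ∑ e, G.weight e)) ∧
      (∀ I ∈ τ.calls, SmallCall m (2 * (n * n * ∑ e, G.weight e)) I) ∧
      τ.calls.length ≤ 2 * n * L ∧ τ.time ≤ σ.time + 3000 * (m + 1) * (n + 1) * (L + 1) ∧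
      ∃ g nd N par Ls u₀, Finished G g nd N par Ls u₀ (τ.a .out)) σ := by
  simp only [mainProg]
  rw [wp_seq]
  refine wp_mono (readInput_spec hinp0 hinp1 hsrc hdst hwt (by omega) (by omega) (by omega) hnW htW
    hS) ?_
  rintro σ₁ f₁ ⟨lab, L, in1, hlab, hlt, s1, l1, l2, t1⟩
  rw [wp_seq]
  refine wp_mono (refineLoop_spec hO in1 hlab hlt hn hw (by omega) (by omega) hMW hS s1 l1 l2
    (fun e => by rw [f₁.a .kap rfl]; exact hkap e) (by rw [f₁.calls rfl]; exact hcalls)) ?_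
  rintro σ₂ f₂ ⟨in2, k2, c2, n2, t2⟩
  rw [wp_seq]
  refine wp_mono (treeSweep_spec in2 hlab hlt (by omega) (by omega) (by omega) htW k2
    (fun e => rfl) (fun i => by rw [f₂.a .out rfl, f₁.a .out rfl]; exact hout _)) ?_
  rintro σ₃ f₃ ⟨g, nd, N, Ls, in3, hF, hlink, hmono, c3, t3⟩
  refine wp_mono (finish_spec hn in3 hF k2 hlink hmono (by omega) (by omega) hlW) ?_
  rintro σ₄ f₄ ⟨t4, h4⟩
  have c4 : σ₄.calls = σ₂.calls := (f₄.calls rfl).trans c3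
  refine ⟨L, l2, by rw [c4]; exact c2, by rw [c4]; exact n2, ?_, h4⟩
  have key : m + n + 1 ≤ (m + 1) * (n + 1) := by nlinarith [Nat.zero_le (m * n)]
  have e1 : 3000 * (m + 1) * (n + 1) * (L + 1) =
    2000 * (m + 1) * (n + 1) * L + 1000 * ((m + 1) * (n + 1) * L)
      + 3000 * ((m + 1) * (n + 1)) := by ring
  have e2 : L ≤ (m + 1) * (n + 1) * L := Nat.le_mul_of_pos_left _ (by positivity)
  have e3 : (2000 * (m + 1) * (n + 1) + 2) * L = 2000 * (m + 1) * (n + 1) * L + 2 * L := by ring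
  have e4 : 500 * (m + 1) * (n + 1) = 500 * ((m + 1) * (n + 1)) := by ring
  omega

end StructRAM

/-! ### The word RAM program -/

namespace StructRAM

open WordRAM

variable {n m : ℕ} {G : WGraph n m}

/-- Compute the length `16 * (n + m + 1)` of the arrays in register `0`. -/
def setup : Cmd :=
  .seq (.const 2 0) (.seq (.load 2 2) (.seq (.const 4 1) (.seq (.load 6 4)
    (.seq (.op .add 2 2 6) (.seq (.op .add 2 2 4) (.seq (.const 4 16) (.op .mul 0 2 4)))))))

theorem setup_exec {w : ℕ} {O : FlowSubroutine} {ρ : ℕ → ℕ} (hw : 16 * (n + m + 1) < 2 ^ w) :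
    ∃ t, Exec w O ρ setup (initial G) t ∧ t.reg 0 = 16 * (n + m + 1) ∧
      (∀ r, r % 2 = 1 → t.reg r = 0) ∧ t.mem = (initial G).mem ∧ t.calls = [] ∧ t.time = 8 := by
  refine ⟨_, .seq (.const ..) (.seq (.load ..) (.seq (.const ..) (.seq (.load ..) (.seq (.op ..)
    (.seq (.op ..) (.seq (.const ..) (.op ..))))))), ?_, ?_, rfl, rfl, rfl⟩
  · have h1 : 1 % 2 ^ w = 1 := Nat.mod_eq_of_lt (by omega)
    have h2 : 16 % 2 ^ w = 16 := Nat.mod_eq_of_lt (by omega)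
    have h3 : (n + m + 1) * 16 % 2 ^ w = (n + m + 1) * 16 := Nat.mod_eq_of_lt (by omega)
    simp [Config.setReg, Config.tick, Op.eval, initial, h1, h2]
    rw [h3, mul_comm]
  · intro r hr
    have h0 : r ≠ 0 := by omega
    have h2 : r ≠ 2 := by omega
    have h4 : r ≠ 4 := by omega
    have h6 : r ≠ 6 := by omega
    simp [Config.setReg, Config.tick, initial, h0, h2, h4, h6]

/-- The machine program: the output starts at the beginning of the array `out`. -/
def program : Cmd :=
  .seq setup (.seq mainProg.code (.seq (.const 2 Arr.out.ctorIdx) (.op .mul 0 0 2)))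

/-- The state that the initial configuration stands for. -/
def start (G : WGraph n m) : St where
  v _ := 0
  a j i := if j = .inp then (initial G).mem i else 0
  time := 0
  calls := []

theorem initial_src (e : Fin m) : (initial G).mem (2 + 3 * e) = G.src e := by
  have h1 : (2 + 3 * (e : ℕ) - 2) / 3 = e := by omega
  have h2 : (2 + 3 * (e : ℕ) - 2) % 3 = 0 := by omega
  have h3 : 2 + 3 * (e : ℕ) ≠ 1 := by omega
  simp [initial, h1, h2, h3]

theorem initial_dst (e : Fin m) : (initial G).mem (3 + 3 * e) = G.dst e := by
  have h1 : (3 + 3 * (e : ℕ) - 2) / 3 = e := by omega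
  have h2 : (3 + 3 * (e : ℕ) - 2) % 3 = 1 := by omega
  have h3 : 3 + 3 * (e : ℕ) ≠ 1 := by omega
  simp [initial, h1, h2, h3]

theorem initial_weight (e : Fin m) : (initial G).mem (4 + 3 * e) = G.weight e := by
  have h1 : (4 + 3 * (e : ℕ) - 2) / 3 = e := by omega
  have h2 : (4 + 3 * (e : ℕ) - 2) % 3 = 2 := by omega
  have h3 : 4 + 3 * (e : ℕ) ≠ 1 := by omega
  simp [initial, h1, h2, h3]

theorem initial_mem_lt {W : ℕ} (hn : n < W) (hm : m < W) (hw : ∀ e, G.weight e < W) (i : ℕ) :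
    (initial G).mem i < W := by
  simp only [initial]
  split_ifs
  · exact hn
  · exact hm
  · exact (Fin.is_lt _).trans hn
  · exact (Fin.is_lt _).trans hn
  · exact hw _
  · omega

theorem initial_mem_of_le {i : ℕ} (hi : 2 + 3 * m ≤ i) : (initial G).mem i = 0 := by
  have h1 : ¬ (i - 2) / 3 < m := by omega
  simp only [initial, h1, dite_false]
  rw [if_neg (by omega), if_neg (by omega)]

theorem sim_start {w : ℕ} {s : Config} (hM : 2 + 3 * m ≤ s.reg 0)
    (hr : ∀ r, r % 2 = 1 → s.reg r = 0) (hm : s.mem = (initial G).mem) (hc : s.calls = [])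
    (hlt : ∀ i, (initial G).mem i < 2 ^ w) : Sim w (s.reg 0) (start G) s where
  len := rfl
  reg x := hr _ (by omega)
  vlt _ := by simp [start]
  mem j i hi := by
    rw [hm]
    by_cases hj : j = .inp
    · subst hj
      have : Arr.inp.ctorIdx = 0 := rfl
      simp [start, this]
    · have h1 : j.ctorIdx ≠ 0 := fun h => hj (Arr.ctorIdx_inj h)
      have h2 : s.reg 0 ≤ j.ctorIdx * s.reg 0 := Nat.le_mul_of_pos_left _ (by omega)
      rw [initial_mem_of_le (by omega)]
      simp [start, hj]
  alt j i _ := by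
    simp only [start]
    split_ifs
    · exact hlt i
    · positivity
  calls := hc

theorem _root_.WGraph.card_edges_le (G : WGraph n m) : m ≤ n * n := by
  have : Function.Injective fun e => (G.src e, G.dst e) := fun e f h => by
    simp only [Prod.mk.injEq] at h
    exact G.simple (by simp [h.1, h.2])
  simpa using Fintype.card_le_of_injective _ this

/-- What a run of the program achieves. -/
theorem program_exec {w : ℕ} {O : FlowSubroutine} (hO : O.Correct) (hn : 0 < n)
    (hw : ∀ e, 1 ≤ G.weight e) (hMW : 16 * (16 * (n + m + 1)) ≤ 2 ^ w)
    (hnW : n * n < 2 ^ w) (htW : ∑ e, G.weight e < 2 ^ w) (hlW : ∀ e, n * G.weight e < 2 ^ w)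
    (hS : 2 * (n * n * ∑ e, G.weight e) < 2 ^ w) (ρ : ℕ → ℕ) :
    ∃ t, Exec w O ρ program (initial G) t ∧ CorrectOutput G w t ∧
      ∃ L, 2 ^ L ≤ max 1 (2 * (n * n * ∑ e, G.weight e)) ∧
        t.time ≤ 10 + mainProg.unit * (3000 * (m + 1) * (n + 1) * (L + 1)) ∧
        t.calls.length ≤ 2 * n * L ∧
        ∀ I ∈ t.calls, SmallCall m (2 * (n * n * ∑ e, G.weight e)) I := by
  obtain ⟨s, hs, s0, sr, sm, sc, st⟩ := setup_exec (G := G) (O := O) (ρ := ρ) (w := w) (by omega)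
  have hwW : ∀ e, G.weight e < 2 ^ w := fun e =>
    (Nat.le_mul_of_pos_left _ hn).trans_lt (hlW e)
  have hsim := sim_start (w := w) (by omega) sr sm sc
    (initial_mem_lt (by omega) (by omega) hwW)
  obtain ⟨τ, hrun, L, l1, l2, l3, l4, g, nd, N, par, Ls, u₀, hF⟩ :=
    mainProg_spec (σ := start G) (W := 2 ^ w) (M := s.reg 0) hO hn hw rfl rfl initial_src
      initial_dst initial_weight (fun _ => rfl) (fun _ => rfl) rfl (by omega) (by omega) hnW htW hlW
      hS
  obtain ⟨t, ht, hts, htt⟩ := mainProg.code_exec (by omega) (by omega) hrun le_rfl s hsim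
  have hout : Arr.out.ctorIdx = 3 := rfl
  have h3 : 3 % 2 ^ w = 3 := Nat.mod_eq_of_lt (by omega)
  have hreg : ((t.setReg 2 (3 % 2 ^ w)).tick.setReg 0 (Op.mul.eval w
      ((t.setReg 2 (3 % 2 ^ w)).tick.reg 0) ((t.setReg 2 (3 % 2 ^ w)).tick.reg 2))).tick.reg 0 =
      3 * s.reg 0 := by
    simp only [Config.setReg, Config.tick, Op.eval, Function.update_self, ne_eq,
      OfNat.ofNat_ne_zero, OfNat.zero_ne_ofNat, not_false_eq_true, Function.update_of_ne, h3,
      hts.len]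
    rw [Nat.mod_eq_of_lt (by omega), mul_comm]
  refine ⟨_, .seq hs (.seq ht (.seq (.const ..) (.op ..))), ?_, L, l1, ?_, ?_, ?_⟩
  · rw [hout]
    refine hF.correctOutput hw (M := s.reg 0) (by omega) (by rw [hreg]; omega) fun q hq => ?_
    rw [hreg]
    exact hts.mem .out q hq
  · have h4 : mainProg.unit * τ.time ≤ mainProg.unit * (3000 * (m + 1) * (n + 1) * (L + 1)) :=
      Nat.mul_le_mul_left _ (by simpa [start] using l4)
    have h5 : t.time + mainProg.unit * 0 ≤ s.time + mainProg.unit * τ.time := htt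
    simp only [Config.setReg, Config.tick]
    omega
  · change t.calls.length ≤ _
    rw [hts.calls]; exact l3
  · change ∀ I ∈ t.calls, _
    rw [hts.calls]; exact l2

/-- The number of halvings is logarithmic in the weights. -/
theorem scale_le {L t n C : ℕ} (hn : 1 ≤ n) (hC : 1 ≤ C) (hL : 2 ^ L ≤ max 1 (2 * (n * n * t)))
    (ht : t ≤ n * n * C) : L + 1 ≤ 10 * ((Nat.log 2 n + 1) * (Nat.log 2 C + 1)) := by
  have h1 : n < 2 ^ (Nat.log 2 n + 1) := Nat.lt_pow_succ_log_self (by norm_num) n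
  have h2 : C < 2 ^ (Nat.log 2 C + 1) := Nat.lt_pow_succ_log_self (by norm_num) C
  have h3 : 2 ^ L ≤ 2 * (n ^ 4 * C) := by
    refine hL.trans (max_le ?_ ?_)
    · have : 0 < n ^ 4 * C := by positivity
      omega
    · have := Nat.mul_le_mul_left (n * n) ht
      calc 2 * (n * n * t) ≤ 2 * (n * n * (n * n * C)) := by omega
        _ = 2 * (n ^ 4 * C) := by ring
  have h4 : n ^ 4 * C ≤ 2 ^ (4 * (Nat.log 2 n + 1)) * 2 ^ (Nat.log 2 C + 1) := by
    refine Nat.mul_le_mul ?_ h2.le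
    rw [mul_comm, pow_mul]
    exact Nat.pow_le_pow_left h1.le 4
  have h5 : 2 ^ L ≤ 2 ^ (1 + (4 * (Nat.log 2 n + 1) + (Nat.log 2 C + 1))) := by
    rw [pow_add, pow_add, pow_one]
    omega
  have h6 := (Nat.pow_le_pow_iff_right (by norm_num)).1 h5
  have h7 : (Nat.log 2 n + 1) * (Nat.log 2 C + 1) =
    Nat.log 2 n * Nat.log 2 C + Nat.log 2 n + Nat.log 2 C + 1 := by ring
  rw [h7]
  omega

/-- All numbers that occur fit into a word. -/
theorem word_bounds {n m C t X : ℕ} (hX : n + C < X) (hn : 1 ≤ n) (hC : 1 ≤ C) (hX4 : 4 ≤ X)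
    (hm : m ≤ n * n) (ht : t ≤ n * n * C) :
    16 * (16 * (n + m + 1)) ≤ X ^ 10 ∧ n * n < X ^ 10 ∧ t < X ^ 10 ∧ n * C < X ^ 10 ∧
      2 * (n * n * t) < X ^ 10 := by
  have p2 : n * n ≤ X ^ 2 := by rw [pow_two]; exact Nat.mul_le_mul (by omega) (by omega)
  have lt10 : ∀ {a k : ℕ}, a ≤ X ^ k → k < 10 → a < X ^ 10 := fun ha hk =>
    ha.trans_lt (Nat.pow_lt_pow_right (by omega) hk)
  have p3 : t ≤ X ^ 3 := ht.trans (by rw [pow_succ]; exact Nat.mul_le_mul p2 (by omega))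
  refine ⟨?_, lt10 p2 (by norm_num), lt10 p3 (by norm_num), lt10 (k := 2) ?_ (by norm_num),
    lt10 (k := 6) ?_ (by norm_num)⟩
  · have h1 : n + m + 1 ≤ X ^ 3 := by
      have : X ^ 3 = X ^ 2 * X := pow_succ X 2
      have h2 : X ^ 2 * 4 ≤ X ^ 2 * X := Nat.mul_le_mul_left _ hX4
      have h3 : X * 4 ≤ X ^ 2 := by rw [pow_two]; exact Nat.mul_le_mul_left _ hX4
      omega
    have h4 : 4 ^ 4 ≤ X ^ 4 := Nat.pow_le_pow_left hX4 4
    calc 16 * (16 * (n + m + 1)) = 4 ^ 4 * (n + m + 1) := by ring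
      _ ≤ X ^ 4 * X ^ 3 := Nat.mul_le_mul h4 h1
      _ = X ^ 7 := by ring
      _ ≤ X ^ 10 := Nat.pow_le_pow_right (by omega) (by norm_num)
  · rw [pow_two]; exact Nat.mul_le_mul (by omega) (by omega)
  · calc 2 * (n * n * t) ≤ X * (X ^ 2 * X ^ 3) :=
          Nat.mul_le_mul (by omega) (Nat.mul_le_mul p2 p3)
      _ = X ^ 6 := by ring

/-- The guarantees of the program, with explicit constants. -/
theorem program_correct {C w K : ℕ} {O : FlowSubroutine} (hO : O.Correct) (hn : 1 ≤ n) (hC : 1 ≤ C)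
    (hG : ∀ e, 1 ≤ G.weight e ∧ G.weight e ≤ C) (hw : w = 10 * (Nat.log 2 (n + C) + 1))
    (hK : K = 60000 * mainProg.unit + 100) (ρ : ℕ → ℕ) :
    ∃ t, Exec w O ρ program (initial G) t ∧ CorrectOutput G w t ∧
      t.time ≤ K * (Nat.log 2 n + 1) ^ K * (n * (m + 1) * (Nat.log 2 C + 1)) ∧
      t.calls.length ≤ K * (Nat.log 2 n + 1) ^ K * (n * (Nat.log 2 C + 1)) ∧
      ∀ I ∈ t.calls, I.nodes ≤ K * (m + 1) ∧ I.arcs ≤ K * (m + 1) ∧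
        ∀ a, I.cap a ≤ K * (n * C) ^ K := by
  have ht : ∑ e, G.weight e ≤ n * n * C :=
    calc ∑ e, G.weight e ≤ ∑ _ : Fin m, C := Finset.sum_le_sum fun e _ => (hG e).2
      _ = m * C := by simp
      _ ≤ n * n * C := Nat.mul_le_mul_right C G.card_edges_le
  have hX : n + C < 2 ^ (Nat.log 2 (n + C) + 1) := Nat.lt_pow_succ_log_self (by norm_num) _
  have hX4 : 4 ≤ 2 ^ (Nat.log 2 (n + C) + 1) := by
    have : 1 ≤ Nat.log 2 (n + C) := Nat.le_log_of_pow_le (by norm_num) (by omega)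
    calc 4 = 2 ^ 2 := by norm_num
      _ ≤ _ := Nat.pow_le_pow_right (by norm_num) (by omega)
  have hW : 2 ^ w = (2 ^ (Nat.log 2 (n + C) + 1)) ^ 10 := by rw [hw, mul_comm, pow_mul]
  obtain ⟨b1, b2, b3, b4, b5⟩ := word_bounds hX hn hC hX4 G.card_edges_le ht
  rw [← hW] at b1 b2 b3 b4 b5
  obtain ⟨t, h1, h2, L, h3, h4, h5, h6⟩ := program_exec hO hn (fun e => (hG e).1) b1 b2 b3
    (fun e => (Nat.mul_le_mul_left n (hG e).2).trans_lt b4) b5 ρ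
  have hL := scale_le hn hC h3 ht
  generalize mainProg.unit = u at hK h4
  have hKu : 60000 * u + 10 ≤ K := hK ▸ Nat.add_le_add_left (by norm_num) _
  have hlog : Nat.log 2 n + 1 ≤ (Nat.log 2 n + 1) ^ K := Nat.le_self_pow (by omega) _
  set l := Nat.log 2 n + 1 with hl
  set c := Nat.log 2 C + 1 with hc
  refine ⟨t, h1, h2, ?_, ?_, fun I hI => ?_⟩
  · have e1 : 3000 * (m + 1) * (n + 1) * (L + 1) ≤ 3000 * (m + 1) * (2 * n) * (10 * (l * c)) :=
      Nat.mul_le_mul (Nat.mul_le_mul_left _ (by omega)) hL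
    have e2 : 1 ≤ l * (n * (m + 1) * c) := by
      have : 0 < l * (n * (m + 1) * c) := by positivity
      omega
    calc t.time ≤ 10 + u * (3000 * (m + 1) * (n + 1) * (L + 1)) := h4
      _ ≤ 10 * (l * (n * (m + 1) * c)) +
          u * (3000 * (m + 1) * (2 * n) * (10 * (l * c))) :=
        Nat.add_le_add (by omega) (Nat.mul_le_mul_left _ e1)
      _ = (60000 * u + 10) * (l * (n * (m + 1) * c)) := by ring
      _ ≤ K * (l ^ K * (n * (m + 1) * c)) :=
        Nat.mul_le_mul hKu (Nat.mul_le_mul_right _ hlog)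
      _ = _ := by ring
  · calc t.calls.length ≤ 2 * n * L := h5
      _ ≤ 2 * n * (10 * (l * c)) := Nat.mul_le_mul_left _ (by omega)
      _ = 20 * (l * (n * c)) := by ring
      _ ≤ K * (l ^ K * (n * c)) := Nat.mul_le_mul (by omega) (Nat.mul_le_mul_right _ hlog)
      _ = _ := by ring
  · obtain ⟨i1, i2, i3⟩ := h6 I hI
    have hKm : 100 * (m + 1) ≤ K * (m + 1) := Nat.mul_le_mul_right _ (by omega)
    refine ⟨by omega, by omega, fun a => (i3 a).trans ?_⟩
    have h7 : 1 ≤ n * C := Nat.mul_pos hn hC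
    calc 2 * (n * n * ∑ e, G.weight e) ≤ 2 * (n * n * (n * n * C)) := by gcongr
      _ = 2 * (n ^ 4 * C) := by ring
      _ ≤ 2 * (n ^ 4 * C ^ 4) := by
        gcongr
        exact Nat.le_self_pow (by norm_num) C
      _ = 2 * (n * C) ^ 4 := by ring
      _ ≤ K * (n * C) ^ K :=
        Nat.mul_le_mul (by omega) (Nat.pow_le_pow_right h7 (by omega))

end StructRAM

open Classical in
theorem theorem1 (c : ℕ) :
    -- a program, its word size parameter and its constants, for the error exponent `c`
    ∃ (prog : WordRAM.Cmd) (β K : ℕ), 3 ≤ β ∧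
      ∀ (n m C : ℕ) (G : WGraph n m), 1 ≤ n → 1 ≤ C →
        (∀ e, 1 ≤ G.weight e ∧ G.weight e ≤ C) →
      ∀ (O : FlowSubroutine), O.Correct →
        -- word size, time bound, and bound on the number of maximum flow calls
        ∀ w T Q : ℕ,
          w = β * (Nat.log 2 (n + C) + 1) →
          T = K * (Nat.log 2 n + 1) ^ K * (n * (m + 1) * (Nat.log 2 C + 1)) →
          Q = K * (Nat.log 2 n + 1) ^ K * (n * (Nat.log 2 C + 1)) →
          -- every run halts within the bounds
          (∀ ρ : Fin T → Fin (2 ^ w), ∃ t : WordRAM.Config,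
            WordRAM.Exec w O (WordRAM.tape ρ) prog (WordRAM.initial G) t ∧
              t.time ≤ T ∧ t.calls.length ≤ Q ∧
              ∀ I ∈ t.calls, I.nodes ≤ K * (m + 1) ∧ I.arcs ≤ K * (m + 1) ∧
                ∀ a, I.cap a ≤ K * (n * C) ^ K) ∧
          -- the output is correct with probability at least `1 - n ^ (-c)`
          (1 - 1 / (n : ℝ) ^ c) * (Fintype.card (Fin T → Fin (2 ^ w)) : ℝ) ≤
            ((Finset.univ.filter fun ρ : Fin T → Fin (2 ^ w) =>
              ∃ t : WordRAM.Config,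
                WordRAM.Exec w O (WordRAM.tape ρ) prog (WordRAM.initial G) t ∧
                  CorrectOutput G w t).card : ℝ) := by
  refine ⟨StructRAM.program, 10, 60000 * StructRAM.mainProg.unit + 100, by norm_num, ?_⟩
  intro n m C G hn hC hG O hO w T Q hw hT hQ
  have key := fun ρ => StructRAM.program_correct (ρ := ρ) hO hn hC hG hw rfl
  rw [← hT, ← hQ] at key
  refine ⟨fun ρ => ?_, ?_⟩
  · obtain ⟨t, h1, -, h2⟩ := key (WordRAM.tape ρ)
    exact ⟨t, h1, h2⟩
  -- The program draws no random words, so that every tape leads to a correct output.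
  · rw [Finset.filter_true_of_mem fun ρ _ => ?_, Finset.card_univ]
    · exact mul_le_of_le_one_left (Nat.cast_nonneg _) (sub_le_self _ (by positivity))
    · obtain ⟨t, h1, h2, -⟩ := key (WordRAM.tape ρ)
      exact ⟨t, h1, h2⟩
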